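/- Let $F$ be a totally real number field of degree $n$ and narrow class number one, with ring of integers $R$, and let $\delta$ be a totally positive generator of its different. For $z\in\mathbb H^n$ put $\mathrm{tr}(z)=\sum_j z_j$, $e(z)=e^{2\pi i\,\mathrm{tr}(z)}$, $\theta(z)=\sum_{x\in R}e(x^2z/2)$ and $h(\gamma,z)=\theta(\gamma z)/\theta(z)$ (extended holomorphically across the zeros of $\theta$); here $\xi\in F$ acts on $z$ through the $n$ real embeddings, so that $e(\xi z)=\exp(2\pi i\sum_j\xi^{(j)}z_j)$. Let $\mathfrak c$ be an ideal of $R$ which is divisible by $4$ and is the square of an ideal, let $c$ be a totally positive generator of $\mathfrak c$, and let $\psi$ be a finite-order Hecke character of $F$ whose conductor divides $\mathfrak c$ and with $\psi_\infty$ trivial. Write $\psi_{\mathfrak c}=\prod_{v\mid\mathfrak c}\psi_v$, and let $\Gamma_{\mathfrak c}$ be the group of $\gamma=\begin{pmatrix}a_\gamma&b_\gamma\\c_\gamma&d_\gamma\end{pmatrix}\in SL_2(F)$ with $a_\gamma,d_\gamma\in R$, $b_\gamma\in2\delta^{-1}R$, $c_\gamma\in2^{-1}\delta\mathfrak c$.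 Let $M(\mathfrak c,\psi)$ be the space of holomorphic functions $f$ on $\mathbb H^n$ with $f(\gamma z)=\psi_{\mathfrak c}(a_\gamma)h(\gamma,z)f(z)$ for all $\gamma\in\Gamma_{\mathfrak c}$ (which, if $F=\mathbb Q$, are moreover required to be regular at the cusps). Let $f\in M(\mathfrak c,\psi)$ and put $$g(z)=(f|W(c))(z)=\prod_j(-iz_j)^{-1/2}\,N(2^{-2}\delta^2c)^{-1/4}f\!\left(\frac{-4}{c\delta^2z}\right).$$ Then $f$ and $g$ have Fourier expansions $f(z)=\sum_{\xi\in R}a(\xi)e(\xi z/2)$ and $g(z)=\sum_{\xi\in R}b(\xi)e(\xi z/2)$, and for a nonzero ideal $I$ the values $a(I)=a(\xi)$, $b(I)=b(\xi)$, where $\xi$ is a totally positive generator of $I$, do not depend on $\xi$. The series $$L(s,f)=\sum_{I\neq0}\frac{a(I)}{N(I)^s},\qquad L(s,g)=\sum_{I\ne0}\frac{b(I)}{N(I)^s}$$ converge absolutely in some right half-plane and continue analytically to $\mathbb C\setminus\{1/2\}$, with at most a simple pole at $s=1/2$. The function $L(s,f)$ is entire if $f$ is a cusp form; more precisely, it has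 a simple pole at $s=1/2$ if $b(0)\neq0$, and is entire if $b(0)=0$. Moreover $$\Lambda(s,f)=(2\pi)^{-ns}\Gamma(s)^nN(\delta)^sN(\mathfrak c)^{s/2}L(s,f)$$ (and $\Lambda(s,g)$, defined in the same way) satisfy, as meromorphic functions, $$\Lambda(s,f)=\Lambda(1/2-s,\,g).$$ -/

import Mathlib

open scoped NumberField nonZeroDivisors
open NumberField IsDedekindDomain

noncomputable section

namespace HilbertHalf

variable {F : Type*} [Field F]

/-- `x ≫ 0`: every real embedding of `x` is positive. -/
def TotallyPositive (x : F) : Prop := ∀ σ : F →+* ℝ, 0 < σ x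

variable (F) in
/-- Narrow class number one: every invertible fractional ideal has a totally positive generator. -/
def NarrowClassNumberOne [NumberField F] : Prop :=
  ∀ I : (FractionalIdeal (𝓞 F)⁰ F)ˣ, ∃ x : F, TotallyPositive x ∧
    (I : FractionalIdeal (𝓞 F)⁰ F) = FractionalIdeal.spanSingleton (𝓞 F)⁰ x

/-! ### Hecke characters -/

variable (F) in
/-- A Hecke character of finite order: a continuous character of the idele group with values in the
unit circle, trivial on the principal ideles, and of finite order. -/
structure HeckeCharacter [NumberField F] where
  toHom : (AdeleRing (𝓞 F) F)ˣ →* Circle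
  continuous_toHom : Continuous toHom
  map_principal : ∀ a : Fˣ, toHom (Units.map (algebraMap F (AdeleRing (𝓞 F) F)) a) = 1
  finite_order : ∃ m : ℕ, 0 < m ∧ ∀ x, toHom x ^ m = 1

/-- The finite adele with component `a` at the primes dividing `𝔠` and `1` at all others. -/
def partFiniteAdele [NumberField F] (𝔠 : Ideal (𝓞 F)) (a : F) : FiniteAdeleRing (𝓞 F) F :=
  ⟨fun v => open Classical in if v.asIdeal ∣ 𝔠 then (a : v.adicCompletion F) else 1, by
    filter_upwards [(algebraMap F (FiniteAdeleRing (𝓞 F) F) a).2] with v hv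
    split_ifs
    · exact hv
    · exact one_mem _⟩

lemma partFiniteAdele_apply [NumberField F] (𝔠 : Ideal (𝓞 F)) (a : F)
    (v : HeightOneSpectrum (𝓞 F)) :
    partFiniteAdele 𝔠 a v =
      open Classical in if v.asIdeal ∣ 𝔠 then (a : v.adicCompletion F) else 1 := rfl

lemma partFiniteAdele_mul [NumberField F] (𝔠 : Ideal (𝓞 F)) (a b : F) :
    partFiniteAdele 𝔠 a * partFiniteAdele 𝔠 b = partFiniteAdele 𝔠 (a * b) := by
  refine FiniteAdeleRing.ext F fun v => ?_
  change partFiniteAdele 𝔠 a v * partFiniteAdele 𝔠 b v = _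
  simp only [partFiniteAdele_apply]
  split_ifs
  · exact (HeightOneSpectrum.adicCompletion.coe_mul ..).symm
  · simp

lemma partFiniteAdele_one [NumberField F] (𝔠 : Ideal (𝓞 F)) :
    partFiniteAdele 𝔠 (1 : F) = 1 := by
  refine FiniteAdeleRing.ext F fun v => ?_
  change _ = (1 : v.adicCompletion F)
  simp only [partFiniteAdele_apply]
  split_ifs
  · exact HeightOneSpectrum.adicCompletion.coe_one ..
  · rfl

/-- The idele `a_𝔠`, with component `a` at the primes dividing `𝔠` and `1` at all other places,
the infinite ones included. -/
def partIdele [NumberField F] (𝔠 : Ideal (𝓞 F)) (a : Fˣ) : (AdeleRing (𝓞 F) F)ˣ where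
  val := ((1 : InfiniteAdeleRing F), partFiniteAdele 𝔠 (a : F))
  inv := ((1 : InfiniteAdeleRing F), partFiniteAdele 𝔠 ((a⁻¹ : Fˣ) : F))
  val_inv := Prod.ext (one_mul (1 : InfiniteAdeleRing F))
    ((partFiniteAdele_mul 𝔠 _ _).trans (by rw [Units.mul_inv, partFiniteAdele_one]; rfl))
  inv_val := Prod.ext (one_mul (1 : InfiniteAdeleRing F))
    ((partFiniteAdele_mul 𝔠 _ _).trans (by rw [Units.inv_mul, partFiniteAdele_one]; rfl))

namespace HeckeCharacter

variable [NumberField F]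

/-- `ψ_∞` is trivial: `ψ` is trivial on the ideles whose finite part is `1`. -/
def TrivialAtInfinity (ψ : HeckeCharacter F) : Prop :=
  ∀ u : (AdeleRing (𝓞 F) F)ˣ, (u : AdeleRing (𝓞 F) F).2 = 1 → ψ.toHom u = 1

/-- The (finite) conductor of `ψ` divides `𝔠`: `ψ` is trivial on the finite ideles that are units
at every finite place and congruent to `1` modulo `𝔠 R_v` at every `v`. -/
def ConductorDvd (ψ : HeckeCharacter F) (𝔠 : Ideal (𝓞 F)) : Prop :=
  ∀ u : (AdeleRing (𝓞 F) F)ˣ, (u : AdeleRing (𝓞 F) F).1 = 1 →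
    (∀ v : HeightOneSpectrum (𝓞 F), Valued.v ((u : AdeleRing (𝓞 F) F).2 v) = 1 ∧
      ∃ a ∈ 𝔠, Valued.v ((u : AdeleRing (𝓞 F) F).2 v - 1) ≤
        v.valuation F (algebraMap (𝓞 F) F a)) →
    ψ.toHom u = 1

/-- `ψ_𝔠(a) = ∏_{v ∣ 𝔠} ψ_v(a)` for `a ∈ F^×` (extended by `0` to `a = 0`). -/
def finitePart (ψ : HeckeCharacter F) (𝔠 : Ideal (𝓞 F)) (a : F) : ℂ :=
  open Classical in
  if h : a ≠ 0 then (ψ.toHom (partIdele 𝔠 (Units.mk0 a h)) : ℂ) else 0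

end HeckeCharacter

/-! ### The upper half plane, the group, the theta series -/

variable (F) in
/-- `ℍⁿ`, with the factors indexed by the real embeddings of `F`. -/
def upperHalf : Set ((F →+* ℝ) → ℂ) := {z | ∀ σ, 0 < (z σ).im}

/-- The action of `SL₂(F)` on `ℍⁿ` by fractional linear transformations in each coordinate. -/
def moebius (γ : Matrix.SpecialLinearGroup (Fin 2) F) (z : (F →+* ℝ) → ℂ) : (F →+* ℝ) → ℂ :=
  fun σ => ((σ (γ 0 0) : ℂ) * z σ + (σ (γ 0 1) : ℂ)) / ((σ (γ 1 0) : ℂ) * z σ + (σ (γ 1 1) : ℂ))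

variable [NumberField F]

/-- `Γ[𝔣, 𝔤]`. -/
def Gam (𝔣 𝔤 : FractionalIdeal (𝓞 F)⁰ F) : Set (Matrix.SpecialLinearGroup (Fin 2) F) :=
  {γ | γ 0 0 ∈ (1 : FractionalIdeal (𝓞 F)⁰ F) ∧ γ 1 1 ∈ (1 : FractionalIdeal (𝓞 F)⁰ F) ∧
    γ 0 1 ∈ 𝔣 ∧ γ 1 0 ∈ 𝔤}

variable (F) in
/-- The different of `F / ℚ`, as a fractional ideal. -/
def diff : FractionalIdeal (𝓞 F)⁰ F := ((differentIdeal ℤ (𝓞 F) : Ideal (𝓞 F)) : _)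

/-- `Γ_𝔠 = Γ[2 δ⁻¹, 2⁻¹ δ 𝔠]`. -/
def GamLevel (𝔠 : Ideal (𝓞 F)) : Set (Matrix.SpecialLinearGroup (Fin 2) F) :=
  Gam (FractionalIdeal.spanSingleton (𝓞 F)⁰ (2 : F) * (diff F)⁻¹)
    (FractionalIdeal.spanSingleton (𝓞 F)⁰ ((2 : F)⁻¹) * diff F *
      (𝔠 : FractionalIdeal (𝓞 F)⁰ F))

/-- `e(w) = ∏_σ exp(2 π i w_σ)`. -/
def e (w : (F →+* ℝ) → ℂ) : ℂ := Complex.exp (2 * Real.pi * Complex.I * ∑ σ, w σ)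

/-- `e(ξ z / 2)` for `ξ ∈ R`. -/
def eHalf (ξ : 𝓞 F) (z : (F →+* ℝ) → ℂ) : ℂ := e fun σ => (σ (ξ : F) : ℂ) * z σ / 2

/-- `θ(z) = ∑_{x ∈ R} e(x² z / 2)`. -/
def theta (z : (F →+* ℝ) → ℂ) : ℂ := ∑' x : 𝓞 F, eHalf (x ^ 2) z

/-- The automorphy factor `h(γ, z) = θ(γ z) / θ(z)`, meaningful where `θ(z) ≠ 0`. -/
def autFactor (γ : Matrix.SpecialLinearGroup (Fin 2) F) (z : (F →+* ℝ) → ℂ) : ℂ :=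
  theta (moebius γ z) / theta z

/-! ### Modular forms of parallel weight one half -/

/-- `|∏_σ (c_σ z_σ + d_σ)|^{1/2}`, the absolute value of any automorphy factor of parallel
weight `1/2`. -/
def absFactor (α : Matrix.SpecialLinearGroup (Fin 2) F) (z : (F →+* ℝ) → ℂ) : ℝ :=
  ‖∏ σ : F →+* ℝ, ((σ (α 1 0) : ℂ) * z σ + (σ (α 1 1) : ℂ))‖ ^ (1 / 2 : ℝ)

/-- `f` is regular at every cusp: for every `α ∈ SL₂(F)`, the weight one half translate of `f` by
`α` is bounded as all the imaginary parts grow. -/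
def RegularAtCusps (f : ((F →+* ℝ) → ℂ) → ℂ) : Prop :=
  ∀ α : Matrix.SpecialLinearGroup (Fin 2) F, ∃ B C : ℝ, ∀ z ∈ upperHalf F,
    (∀ σ, B ≤ (z σ).im) → ‖f (moebius α z)‖ ≤ C * absFactor α z

/-- `f` vanishes at every cusp: for every `α ∈ SL₂(F)`, the weight one half translate of `f` by
`α` tends to `0` as all the imaginary parts tend to infinity. -/
def VanishesAtCusps (f : ((F →+* ℝ) → ℂ) → ℂ) : Prop :=
  ∀ α : Matrix.SpecialLinearGroup (Fin 2) F, ∀ ε : ℝ, 0 < ε → ∃ B : ℝ, ∀ z ∈ upperHalf F,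
    (∀ σ, B ≤ (z σ).im) → ‖f (moebius α z)‖ ≤ ε * absFactor α z

/-- `f ∈ M(𝔠, ψ)`: `f` is holomorphic on `ℍⁿ` (its values elsewhere are irrelevant) and
`f(γ z) = ψ_𝔠(a_γ) h(γ, z) f(z)` for `γ ∈ Γ_𝔠`. The factor `h(γ, ·)` is a holomorphic function on
`ℍⁿ` given by `θ(γ z) / θ(z)` off the zeros of `θ`; by continuity it is enough, and equivalent, to
ask for the identity on the dense set where `θ(z) ≠ 0`. Regularity at the cusps is a condition only
when `F = ℚ`. -/
structure IsModularForm (𝔠 : Ideal (𝓞 F)) (ψ : HeckeCharacter F)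
    (f : ((F →+* ℝ) → ℂ) → ℂ) : Prop where
  holomorphic : DifferentiableOn ℂ f (upperHalf F)
  transform : ∀ γ ∈ GamLevel 𝔠, ∀ z ∈ upperHalf F, theta z ≠ 0 →
    f (moebius γ z) = ψ.finitePart 𝔠 (γ 0 0) * autFactor γ z * f z
  regular : Module.finrank ℚ F = 1 → RegularAtCusps f

/-- The symmetry operator:
`(f | W(c))(z) = (-i z)^{-1/2} N(2⁻² δ² c)^{-1/4} f(-4 / (c δ² z))`. -/
def symmetryW (δ c : 𝓞 F) (f : ((F →+* ℝ) → ℂ) → ℂ) : ((F →+* ℝ) → ℂ) → ℂ := fun z =>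
  (∏ σ : F →+* ℝ, (-Complex.I * z σ) ^ (-(1 / 2) : ℂ)) *
    ((((Algebra.norm ℚ ((2 : F)⁻¹ ^ 2 * (δ : F) ^ 2 * (c : F)) : ℚ) : ℝ) ^ (-(1 / 4) : ℝ) : ℝ) : ℂ) *
    f fun σ => -4 / ((σ (c : F) : ℂ) * (σ (δ : F) : ℂ) ^ 2 * z σ)

/-! ### Fourier coefficients and `L`-series -/

/-- `f(z) = ∑_{ξ ∈ R} a(ξ) e(ξ z / 2)` on `ℍⁿ`, with absolute convergence. -/
def HasFourierExpansion (f : ((F →+* ℝ) → ℂ) → ℂ) (a : 𝓞 F → ℂ) : Prop :=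
  ∀ z ∈ upperHalf F, HasSum (fun ξ : 𝓞 F => a ξ * eHalf ξ z) (f z)

/-- The Fourier coefficients `a(ξ)` of `f` (`0` if `f` has no Fourier expansion over `R`). -/
def fourierCoeff (f : ((F →+* ℝ) → ℂ) → ℂ) : 𝓞 F → ℂ :=
  open Classical in
  if h : ∃ a, HasFourierExpansion f a then h.choose else 0

/-- `a(I) = a(ξ)`, where `ξ` is a totally positive generator of the ideal `I`. -/
def idealCoeff (a : 𝓞 F → ℂ) (I : Ideal (𝓞 F)) : ℂ :=
  open Classical in
  if h : ∃ ξ : 𝓞 F, TotallyPositive (ξ : F) ∧ Ideal.span {ξ} = I then a h.choose else 0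

/-- The value `a(ξ)` is the same for all totally positive generators `ξ` of an ideal. -/
def IdealCoeffWellDefined (a : 𝓞 F → ℂ) : Prop :=
  ∀ ξ : 𝓞 F, TotallyPositive (ξ : F) → a ξ = idealCoeff a (Ideal.span {ξ})

/-- The general term `a(I) N(I)^{-s}` of the `L`-series. -/
def lTerm (a : 𝓞 F → ℂ) (s : ℂ) (I : {I : Ideal (𝓞 F) // I ≠ ⊥}) : ℂ :=
  idealCoeff a I * (Ideal.absNorm (I : Ideal (𝓞 F)) : ℂ) ^ (-s)

/-- `L` is the continuation of `∑_{I ≠ 0} a(I) N(I)^{-s}`: the series converges absolutely to `L(s)`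
in some right half-plane, and `L` is holomorphic on `ℂ` except for at most a simple pole at
`s = 1/2`. -/
structure IsLContinuation (a : 𝓞 F → ℂ) (L : ℂ → ℂ) : Prop where
  hasSum : ∃ x : ℝ, ∀ s : ℂ, x < s.re → HasSum (lTerm a s) (L s)
  holomorphic : DifferentiableOn ℂ L {(1 / 2 : ℂ)}ᶜ
  meromorphic : MeromorphicAt L (1 / 2)
  order : -1 ≤ meromorphicOrderAt L (1 / 2)

/-- `Λ(s) = (2π)^{-ns} Γ(s)ⁿ N(δ)^s N(𝔠)^{s/2} L(s)`. -/
def completedL (𝔠 : Ideal (𝓞 F)) (L : ℂ → ℂ) (s : ℂ) : ℂ :=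
  (2 * Real.pi : ℂ) ^ (-((Module.finrank ℚ F : ℂ) * s)) *
    Complex.Gamma s ^ Module.finrank ℚ F *
    (Ideal.absNorm (differentIdeal ℤ (𝓞 F)) : ℂ) ^ s *
    (Ideal.absNorm 𝔠 : ℂ) ^ (s / 2) * L s

end HilbertHalf

end

noncomputable section

set_option linter.unusedSectionVars false
set_option linter.unusedSimpArgs false

namespace HilbertHalf

/-! The method is Hecke's. Totally positive units are squares of units
(`exists_sq_of_totallyPositive_unit`, a count of signatures), and 𝔠 is the square of an ideal, so c
= t². With m = tδ/2 the operator W(c) is the weight 1/2 action of z ↦ -1/(m²z). On the imaginary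
axes z_σ = i exp(v_σ)/|σ(m)| this involution is v ↦ -v, and the restrictions φ of f and γ of g
satisfy φ(-v) = exp(Σv/2) γ(v). Squares of units translate v by a lattice in the hyperplane Σv = 0.
Averaging over the resulting torus leaves functions of t = exp(Σv) alone, exchanged by t ↦ 1/t with
weight 1/2: a `WeakFEPair` (`averagePair`).

On the other hand each totally positive integer is uniquely a chosen generator of an ideal times the
square of a product of fundamental units (`genEquiv`). Unfolding the average therefore turns its
Mellin transform into a constant times an exponential, Γ(s)ⁿ and L(s, f)
(`IsLogExpansion.mellin_eq`). Continuation and functional equation are those of the pair. Of its two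
possible poles, the one at s = 0 is absorbed by 1/Γ(s)ⁿ, and the one at s = 1/2 has a nonzero
multiple of b(0) as residue. If f vanishes at the cusps then b(0) = 0, because g at infinity is f at
the cusp 0.

This needs Fourier expansions of f and g supported on 0 and the totally positive integers, with
coefficients of polynomial growth. Both must be drawn from an automorphy factor known only as a
quotient of theta values. Poisson summation writes θ(αz) as J(z)ϑ(z) for α in SL₂(F) with nonzero
lower left entry, where J is holomorphic without zeros and ϑ is a theta series invariant under small
translations and squares of units near 1 (`exists_theta_moebius`). Since f transforms like θ, the
quotient f(αz)/J(z) inherits the invariance of ϑ (`IsModularForm.div_moebius_eq`). The Koecher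
principle then gives regular expansions, hence bounds, at every cusp. Identities involving h are
checked where θ ≠ 0 and extended by continuity, the zeros of θ having empty interior.

The growth of the coefficients follows from |f(z)| ≤ C(1 + N(y)^{-1/2}), with y = Im z
(`IsModularForm.exists_growth`). For γ in the theta group |h(γ, z)| = |N(cz + d)|^{1/2}
(`norm_theta_moebius`), so |f| has a known transformation under Γ_𝔠. Dirichlet approximation and
balancing by units move every low point z, by a matrix of Γ[2δ⁻¹, 2⁻¹δ], to one with imaginary parts
bounded below. The bottom rows of such matrices fall into finitely many classes modulo 𝔠, and each
class has a uniform cusp bound. -/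

lemma emb_ne_zero {F : Type*} [Field F] (σ : F →+* ℝ) {x : F} (hx : x ≠ 0) : σ x ≠ 0 := by
  simpa using hx

/-! ### Real embeddings, lattice coordinates, and duality with the inverse different. -/

section Embeddings

variable (F : Type*) [Field F] [NumberField F] [NumberField.IsTotallyReal F]

/-- The real embeddings of a totally real field are its complex embeddings. -/
def complexEmbEquiv : (F →+* ℝ) ≃ (F →+* ℂ) :=
  Equiv.ofBijective (fun σ => Complex.ofRealHom.comp σ) ⟨fun σ τ h => by
    ext x
    have := RingHom.congr_fun h x
    simpa using this, fun φ => by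
    refine ⟨(IsTotallyReal.complexEmbedding_isReal φ).embedding, ?_⟩
    ext x
    simp⟩

lemma complexEmbEquiv_apply (σ : F →+* ℝ) (x : F) : complexEmbEquiv F σ x = (σ x : ℂ) := rfl

lemma card_realEmb : Fintype.card (F →+* ℝ) = Module.finrank ℚ F := by
  rw [Fintype.card_congr (complexEmbEquiv F), Embeddings.card F ℂ]

variable {F}

lemma trace_eq_sum (x : F) : ((Algebra.trace ℚ F x : ℚ) : ℝ) = ∑ σ : F →+* ℝ, σ x := by
  have h := trace_eq_sum_embeddings (K := ℚ) (L := F) ℂ (x := x)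
  have h2 : ∑ σ : F →ₐ[ℚ] ℂ, σ x = ∑ σ : F →+* ℝ, (σ x : ℂ) := by
    rw [← Fintype.sum_equiv (RingHom.equivRatAlgHom (R := F) (S := ℂ)) (fun φ => φ x) _ (fun _ => rfl),
      ← Fintype.sum_equiv (complexEmbEquiv F) (fun σ => (σ x : ℂ)) _ (fun _ => rfl)]
  rw [h2] at h
  apply Complex.ofReal_injective
  push_cast
  simpa using h

lemma norm_eq_prod (x : F) : ((Algebra.norm ℚ x : ℚ) : ℝ) = ∏ σ : F →+* ℝ, σ x := by
  have h := Algebra.norm_eq_prod_embeddings ℚ (L := F) ℂ x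
  have h2 : ∏ σ : F →ₐ[ℚ] ℂ, σ x = ∏ σ : F →+* ℝ, (σ x : ℂ) := by
    rw [← Fintype.prod_equiv (RingHom.equivRatAlgHom (R := F) (S := ℂ)) (fun φ => φ x) _ (fun _ => rfl),
      ← Fintype.prod_equiv (complexEmbEquiv F) (fun σ => (σ x : ℂ)) _ (fun _ => rfl)]
  rw [h2] at h
  apply Complex.ofReal_injective
  push_cast
  simpa using h

lemma abs_prod_eq_absNorm (x : 𝓞 F) :
    |∏ σ : F →+* ℝ, σ (x : F)| = (Ideal.absNorm (Ideal.span {x}) : ℝ) := by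
  rw [← norm_eq_prod, Ideal.absNorm_span_singleton, ← Algebra.coe_norm_int]
  simp [Nat.cast_natAbs]

lemma one_le_abs_prod {x : 𝓞 F} (hx : x ≠ 0) : 1 ≤ ∏ σ : F →+* ℝ, |σ (x : F)| := by
  rw [← Finset.abs_prod, abs_prod_eq_absNorm]
  have : Ideal.absNorm (Ideal.span {x}) ≠ 0 := by
    rw [Ideal.absNorm_ne_zero_iff_mem_nonZeroDivisors]
    simpa using hx
  exact_mod_cast Nat.one_le_iff_ne_zero.mpr this

lemma unit_prod_abs (u : (𝓞 F)ˣ) : ∏ σ : F →+* ℝ, |σ ((u : 𝓞 F) : F)| = 1 := by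
  rw [← Finset.abs_prod, abs_prod_eq_absNorm]
  have : Ideal.span {(u : 𝓞 F)} = ⊤ := Ideal.span_singleton_eq_top.mpr u.isUnit
  simp [this]

instance nonempty_realEmb : Nonempty (F →+* ℝ) := by
  rw [← Fintype.card_pos_iff, card_realEmb]
  exact Module.finrank_pos

variable (F)

/-- The index of an integral basis. -/
abbrev BIdx : Type _ := Module.Free.ChooseBasisIndex ℤ (𝓞 F)

lemma card_BIdx : Fintype.card (BIdx F) = Fintype.card (F →+* ℝ) := by
  rw [card_realEmb, ← Module.finrank_eq_card_chooseBasisIndex, RingOfIntegers.rank]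

/-- The coordinates with respect to the integral basis. -/
def intCoord : 𝓞 F ≃ (BIdx F → ℤ) := (RingOfIntegers.basis F).equivFun.toEquiv

/-- The linear map sending the standard basis to the integral basis. -/
def latMap : (BIdx F → ℝ) →ₗ[ℝ] ((F →+* ℝ) → ℝ) where
  toFun s σ := ∑ i, s i * σ (RingOfIntegers.basis F i : F)
  map_add' s t := by ext σ; simp [add_mul, Finset.sum_add_distrib]
  map_smul' c s := by ext σ; simp [Finset.mul_sum, mul_assoc]

/-- The transpose of `latMap`. -/
def latMapT : ((F →+* ℝ) → ℝ) →ₗ[ℝ] (BIdx F → ℝ) where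
  toFun v i := ∑ σ, v σ * σ (RingOfIntegers.basis F i : F)
  map_add' s t := by ext i; simp [add_mul, Finset.sum_add_distrib]
  map_smul' c s := by ext i; simp [Finset.mul_sum, mul_assoc]

/-- Distinct embeddings are linearly independent characters. A real relation among them on the
integral basis extends to all of F by ℚ-linearity, hence is trivial. -/
lemma latMapT_injective : Function.Injective (latMapT F) := by
  rw [injective_iff_map_eq_zero]
  intro v hv
  have hli := linearIndependent_monoidHom F ℝ
  have hli2 : LinearIndependent ℝ (fun σ : F →+* ℝ => (σ : F → ℝ)) :=
    hli.comp (fun σ : F →+* ℝ => (σ : F →* ℝ)) (fun σ τ h => by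
      ext x; exact DFunLike.congr_fun h x)
  rw [Fintype.linearIndependent_iff] at hli2
  funext σ
  refine hli2 v ?_ σ
  funext x
  rw [Finset.sum_apply]
  simp only [Pi.smul_apply, smul_eq_mul, Pi.zero_apply]
  rw [← (integralBasis F).sum_repr x]
  simp only [map_sum, Finset.mul_sum]
  rw [Finset.sum_comm]
  refine Finset.sum_eq_zero fun i _ => ?_
  have := congr_fun hv i
  simp only [latMapT, LinearMap.coe_mk, AddHom.coe_mk, Pi.zero_apply] at this
  have h2 : ∀ σ : F →+* ℝ, σ ((integralBasis F).repr x i • integralBasis F i) =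
      ((integralBasis F).repr x i : ℝ) * σ (RingOfIntegers.basis F i : F) := by
    intro σ
    rw [integralBasis_apply, Rat.smul_def, map_mul, map_ratCast]
  simp only [h2]
  rw [← mul_zero (((integralBasis F).repr x i : ℚ) : ℝ), ← this, Finset.mul_sum]
  exact Finset.sum_congr rfl fun σ _ => by ring

/-- The transpose is injective between spaces of equal dimension, hence onto. Writing `s` as the
transpose of `v` gives |s|² = ⟨v, latMap s⟩ = 0. Thus R is a full lattice in ℝⁿ, with no appeal to
the discriminant. -/
lemma latMap_injective : Function.Injective (latMap F) := by
  have hsurj : Function.Surjective (latMapT F) :=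
    (LinearMap.injective_iff_surjective_of_finrank_eq_finrank
      (by simp [card_BIdx])).mp (latMapT_injective F)
  rw [injective_iff_map_eq_zero]
  intro s hs
  obtain ⟨v, hv⟩ := hsurj s
  have h1 : ∑ i, s i * s i = 0 := by
    calc ∑ i, s i * s i = ∑ i, s i * latMapT F v i := by rw [hv]
      _ = ∑ σ, v σ * latMap F s σ := by
        simp only [latMapT, latMap, LinearMap.coe_mk, AddHom.coe_mk, Finset.mul_sum]
        rw [Finset.sum_comm]
        exact Finset.sum_congr rfl fun σ _ => Finset.sum_congr rfl fun i _ => by ring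
      _ = 0 := by simp [hs]
  funext i
  have := (Finset.sum_eq_zero_iff_of_nonneg (fun i _ => mul_self_nonneg (s i))).mp h1 i
    (Finset.mem_univ i)
  simpa using this

/-- The linear equivalence sending the standard basis to the integral basis. -/
def latEquiv : (BIdx F → ℝ) ≃L[ℝ] ((F →+* ℝ) → ℝ) :=
  (LinearEquiv.ofInjectiveOfFinrankEq (latMap F) (latMap_injective F)
    (by simp [card_BIdx])).toContinuousLinearEquiv

variable {F}

lemma latEquiv_apply (s : BIdx F → ℝ) (σ : F →+* ℝ) :
    latEquiv F s σ = ∑ i, s i * σ (RingOfIntegers.basis F i : F) := rfl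

lemma coe_eq_sum_basis (r : 𝓞 F) :
    (r : F) = ∑ i, ((RingOfIntegers.basis F).repr r i : ℚ) • integralBasis F i := by
  have h := congr_arg (algebraMap (𝓞 F) F) ((RingOfIntegers.basis F).sum_repr r)
  rw [map_sum] at h
  refine h.symm.trans ?_
  refine Finset.sum_congr rfl fun i _ => ?_
  simp [integralBasis_apply, Rat.smul_def]

lemma latEquiv_intCoord (r : 𝓞 F) (σ : F →+* ℝ) :
    latEquiv F (fun i => (intCoord F r i : ℝ)) σ = σ (r : F) := by
  rw [latEquiv_apply]
  rw [coe_eq_sum_basis r, map_sum]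
  refine Finset.sum_congr rfl fun i _ => ?_
  rw [integralBasis_apply, Rat.smul_def, map_mul]
  simp [intCoord]

/-- An element of the inverse different is the quotient of an integer by the generator `δ`. -/
lemma mem_diff_inv_iff {δ : 𝓞 F} (hδ : Ideal.span {δ} = differentIdeal ℤ (𝓞 F)) (x : F) :
    x ∈ (diff F)⁻¹ ↔ ∃ ζ : 𝓞 F, x = (ζ : F) / (δ : F) := by
  have hδ0 : (δ : F) ≠ 0 := by
    intro h
    have h0 : δ = 0 := by exact_mod_cast h
    rw [h0] at hδ
    exact differentIdeal_ne_bot (A := ℤ) (B := 𝓞 F) (by rw [← hδ]; simp)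
  rw [diff, ← hδ, FractionalIdeal.coeIdeal_span_singleton, FractionalIdeal.spanSingleton_inv,
    FractionalIdeal.mem_spanSingleton]
  constructor
  · rintro ⟨z, hz⟩
    refine ⟨z, ?_⟩
    rw [← hz, Algebra.smul_def, div_eq_mul_inv]
  · rintro ⟨z, rfl⟩
    refine ⟨z, ?_⟩
    rw [Algebra.smul_def, div_eq_mul_inv]

lemma mem_diff_inv_iff_trace (x : F) :
    x ∈ (diff F)⁻¹ ↔ ∀ y : 𝓞 F, ∃ m : ℤ, Algebra.trace ℚ F (x * y) = m := by
  rw [diff, coeIdeal_differentIdeal ℤ ℚ, inv_inv,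
    FractionalIdeal.mem_dual (one_ne_zero' (FractionalIdeal (𝓞 F)⁰ F))]
  simp only [FractionalIdeal.mem_one_iff, Algebra.traceForm_apply, RingHom.mem_range]
  constructor
  · intro h y
    obtain ⟨m, hm⟩ := h y ⟨y, rfl⟩
    exact ⟨m, by rw [← hm]; simp⟩
  · rintro h _ ⟨y, rfl⟩
    obtain ⟨m, hm⟩ := h y
    exact ⟨m, by rw [hm]; simp⟩

lemma delta_ne_zero {δ : 𝓞 F} (hδ : Ideal.span {δ} = differentIdeal ℤ (𝓞 F)) : δ ≠ 0 := by
  rintro rfl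
  exact differentIdeal_ne_bot (A := ℤ) (B := 𝓞 F) (by rw [← hδ]; simp)

/-- ζ/δ lies in the inverse different, and the trace is tested against 1. This integrality makes
e(ζz/δ) periodic under R. -/
lemma exists_int_sum_div {δ : 𝓞 F} (hδ : Ideal.span {δ} = differentIdeal ℤ (𝓞 F)) (ζ : 𝓞 F) :
    ∃ m : ℤ, ∑ σ : F →+* ℝ, σ (ζ : F) / σ (δ : F) = m := by
  obtain ⟨m, hm⟩ := (mem_diff_inv_iff_trace ((ζ : F) / δ)).mp
    ((mem_diff_inv_iff hδ _).mpr ⟨ζ, rfl⟩) 1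
  refine ⟨m, ?_⟩
  have := trace_eq_sum ((ζ : F) / δ)
  simp only [map_one, mul_one] at hm
  rw [hm] at this
  simpa using this.symm

/-- The inverse different is dual to the ring of integers. -/
lemma exists_dualCoord {δ : 𝓞 F} (hδ : Ideal.span {δ} = differentIdeal ℤ (𝓞 F)) :
    ∃ D : 𝓞 F ≃ (BIdx F → ℤ), ∀ (ζ : 𝓞 F) (s : BIdx F → ℝ),
      ∑ i, (D ζ i : ℝ) * s i = ∑ σ : F →+* ℝ, σ (ζ : F) / σ (δ : F) * latEquiv F s σ := by
  have hδ0 : (δ : F) ≠ 0 := by exact_mod_cast delta_ne_zero hδ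
  choose D hD using fun (ζ : 𝓞 F) (i : BIdx F) =>
    exists_int_sum_div hδ (ζ * RingOfIntegers.basis F i)
  have hD2 : ∀ (ζ : 𝓞 F) i, ∑ σ : F →+* ℝ, σ (ζ : F) / σ (δ : F) * σ (RingOfIntegers.basis F i : F)
      = (D ζ i : ℝ) := by
    intro ζ i
    rw [← hD]
    refine Finset.sum_congr rfl fun σ _ => ?_
    simp only [map_mul]
    ring
  have hbij : Function.Bijective D := by
    constructor
    · intro ζ ζ' h
      have h1 : (fun σ : F →+* ℝ => σ (ζ : F) / σ (δ : F)) =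
          fun σ : F →+* ℝ => σ (ζ' : F) / σ (δ : F) := by
        apply latMapT_injective F
        funext i
        have := hD2 ζ i
        rw [h, ← hD2 ζ' i] at this
        simpa [latMapT] using this
      obtain ⟨σ⟩ := nonempty_realEmb (F := F)
      have h2 := congr_fun h1 σ
      rw [div_left_inj' (emb_ne_zero σ hδ0)] at h2
      have h3 := σ.injective h2
      exact_mod_cast h3
    · intro k
      have hnd : (Algebra.traceForm ℚ F).Nondegenerate := traceForm_nondegenerate ℚ F
      -- For surjectivity: the combination of the trace-dual basis with coefficients `k` has the
      -- prescribed traces against the integral basis, hence lies in the inverse different and is of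
      -- the form ζ/δ.
      let b' := (Algebra.traceForm ℚ F).dualBasis hnd (integralBasis F)
      let x : F := ∑ i, (k i : ℚ) • b' i
      have hx : ∀ j, Algebra.trace ℚ F (x * integralBasis F j) = k j := by
        intro j
        have h1 : Algebra.trace ℚ F (x * integralBasis F j) =
          Algebra.traceForm ℚ F x (integralBasis F j) := rfl
        rw [h1]
        simp only [x, map_sum, map_smul, LinearMap.sum_apply, LinearMap.smul_apply]
        simp only [b', LinearMap.BilinForm.apply_dualBasis_left]
        simp
      have hxd : x ∈ (diff F)⁻¹ := by
        rw [mem_diff_inv_iff_trace]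
        intro y
        refine ⟨∑ i, (RingOfIntegers.basis F).repr y i * k i, ?_⟩
        rw [coe_eq_sum_basis y, Finset.mul_sum, map_sum]
        push_cast
        refine Finset.sum_congr rfl fun i _ => ?_
        rw [mul_smul_comm, map_smul, hx, smul_eq_mul]
      obtain ⟨ζ, hζ⟩ := (mem_diff_inv_iff hδ x).mp hxd
      refine ⟨ζ, ?_⟩
      funext i
      have h1 := hD2 ζ i
      have h2 := trace_eq_sum (x * integralBasis F i)
      rw [hx, hζ, integralBasis_apply] at h2
      simp only [map_mul, map_div₀] at h2
      rw [h1] at h2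
      exact_mod_cast h2.symm
  refine ⟨Equiv.ofBijective D hbij, fun ζ s => ?_⟩
  simp only [Equiv.ofBijective_apply, latEquiv_apply, ← hD2, Finset.mul_sum, Finset.sum_mul]
  rw [Finset.sum_comm]
  exact Finset.sum_congr rfl fun σ _ => Finset.sum_congr rfl fun i _ => by ring

end Embeddings

/-! ### The action of SL₂(F) on the half space and its cocycle. -/

section HalfSpace

variable {F : Type*} [Field F]

/-- The factors `c z + d`. -/
def den (γ : Matrix.SpecialLinearGroup (Fin 2) F) (z : (F →+* ℝ) → ℂ) (σ : F →+* ℝ) : ℂ :=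
  (σ (γ 1 0) : ℂ) * z σ + (σ (γ 1 1) : ℂ)

lemma det_eq (γ : Matrix.SpecialLinearGroup (Fin 2) F) :
    γ 0 0 * γ 1 1 - γ 0 1 * γ 1 0 = 1 := by
  have := γ.det_coe
  rwa [Matrix.det_fin_two] at this

lemma emb_det (γ : Matrix.SpecialLinearGroup (Fin 2) F) (σ : F →+* ℝ) :
    σ (γ 0 0) * σ (γ 1 1) - σ (γ 0 1) * σ (γ 1 0) = 1 := by
  rw [← map_mul, ← map_mul, ← map_sub, det_eq, map_one]

lemma den_ne_zero (γ : Matrix.SpecialLinearGroup (Fin 2) F) {z : (F →+* ℝ) → ℂ}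
    (hz : z ∈ upperHalf F) (σ : F →+* ℝ) : den γ z σ ≠ 0 := by
  intro h
  have him := congr_arg Complex.im h
  have hre := congr_arg Complex.re h
  simp [den] at him hre
  have hdet := emb_det γ σ
  rcases him with hc | hy
  · rw [hc] at hre hdet
    simp at hre
    have : σ (γ 1 1) = 0 := by rw [hre]; simp
    rw [this] at hdet
    simp at hdet
  · exact (hz σ).ne' hy

lemma moebius_apply (γ : Matrix.SpecialLinearGroup (Fin 2) F) (z : (F →+* ℝ) → ℂ) (σ : F →+* ℝ) :
    moebius γ z σ = ((σ (γ 0 0) : ℂ) * z σ + (σ (γ 0 1) : ℂ)) / den γ z σ := rfl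

lemma moebius_im (γ : Matrix.SpecialLinearGroup (Fin 2) F) (z : (F →+* ℝ) → ℂ) (σ : F →+* ℝ) :
    (moebius γ z σ).im = (z σ).im / ‖den γ z σ‖ ^ 2 := by
  rw [moebius_apply, Complex.div_im, ← Complex.normSq_eq_norm_sq, ← sub_div]
  congr 1
  have hdet := emb_det γ σ
  simp [den]
  linear_combination (z σ).im * hdet

lemma moebius_mem (γ : Matrix.SpecialLinearGroup (Fin 2) F) {z : (F →+* ℝ) → ℂ}
    (hz : z ∈ upperHalf F) : moebius γ z ∈ upperHalf F := by
  intro σ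
  rw [moebius_im]
  have := norm_pos_iff.mpr (den_ne_zero γ hz σ)
  have := hz σ
  positivity

lemma mul_entry (γ γ' : Matrix.SpecialLinearGroup (Fin 2) F) (i j : Fin 2) :
    (γ * γ') i j = γ i 0 * γ' 0 j + γ i 1 * γ' 1 j := by
  rw [Matrix.SpecialLinearGroup.coe_mul, Matrix.mul_apply, Fin.sum_univ_two]

lemma den_mul (γ γ' : Matrix.SpecialLinearGroup (Fin 2) F) {z : (F →+* ℝ) → ℂ}
    (hz : z ∈ upperHalf F) (σ : F →+* ℝ) :
    den (γ * γ') z σ = den γ (moebius γ' z) σ * den γ' z σ := by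
  have h := den_ne_zero γ' hz σ
  rw [den, den, moebius_apply, mul_entry, mul_entry]
  field_simp
  rw [den]
  simp only [map_add, map_mul, Complex.ofReal_add, Complex.ofReal_mul]
  ring

lemma moebius_mul (γ γ' : Matrix.SpecialLinearGroup (Fin 2) F) {z : (F →+* ℝ) → ℂ}
    (hz : z ∈ upperHalf F) : moebius (γ * γ') z = moebius γ (moebius γ' z) := by
  funext σ
  have h1 := den_ne_zero γ' hz σ
  have h2 := den_ne_zero γ (moebius_mem γ' hz) σ
  rw [moebius_apply, den_mul γ γ' hz, moebius_apply γ, mul_entry, mul_entry]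
  rw [div_eq_div_iff (mul_ne_zero h2 h1) h2, moebius_apply γ']
  field_simp
  rw [den]
  simp only [map_add, map_mul, Complex.ofReal_add, Complex.ofReal_mul]
  ring

lemma moebius_one (z : (F →+* ℝ) → ℂ) : moebius (1 : Matrix.SpecialLinearGroup (Fin 2) F) z = z := by
  funext σ
  simp [moebius]

lemma moebius_inv_cancel (γ : Matrix.SpecialLinearGroup (Fin 2) F) {z : (F →+* ℝ) → ℂ}
    (hz : z ∈ upperHalf F) : moebius γ (moebius γ⁻¹ z) = z := by
  rw [← moebius_mul _ _ hz, mul_inv_cancel, moebius_one]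

lemma moebius_cancel_inv (γ : Matrix.SpecialLinearGroup (Fin 2) F) {z : (F →+* ℝ) → ℂ}
    (hz : z ∈ upperHalf F) : moebius γ⁻¹ (moebius γ z) = z := by
  rw [← moebius_mul _ _ hz, inv_mul_cancel, moebius_one]

lemma continuousOn_moebius (γ : Matrix.SpecialLinearGroup (Fin 2) F) :
    ContinuousOn (moebius γ) (upperHalf F) := by
  refine continuousOn_pi.mpr fun σ => ?_
  refine ContinuousOn.div (by fun_prop) (by fun_prop) fun z hz => den_ne_zero γ hz σ

lemma entry_inv (γ : Matrix.SpecialLinearGroup (Fin 2) F) :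
    γ⁻¹ 0 0 = γ 1 1 ∧ γ⁻¹ 0 1 = -γ 0 1 ∧ γ⁻¹ 1 0 = -γ 1 0 ∧ γ⁻¹ 1 1 = γ 0 0 := by
  simp [Matrix.SpecialLinearGroup.coe_inv, Matrix.adjugate_fin_two]

variable [NumberField F]

lemma absFactor_eq (γ : Matrix.SpecialLinearGroup (Fin 2) F) (z : (F →+* ℝ) → ℂ) :
    absFactor γ z = (∏ σ, ‖den γ z σ‖) ^ (1 / 2 : ℝ) := by
  rw [absFactor, norm_prod]
  rfl

lemma absFactor_pos (γ : Matrix.SpecialLinearGroup (Fin 2) F) {z : (F →+* ℝ) → ℂ}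
    (hz : z ∈ upperHalf F) : 0 < absFactor γ z := by
  rw [absFactor_eq]
  exact Real.rpow_pos_of_pos (Finset.prod_pos fun σ _ => norm_pos_iff.mpr (den_ne_zero γ hz σ)) _

lemma absFactor_mul (γ γ' : Matrix.SpecialLinearGroup (Fin 2) F) {z : (F →+* ℝ) → ℂ}
    (hz : z ∈ upperHalf F) :
    absFactor (γ * γ') z = absFactor γ (moebius γ' z) * absFactor γ' z := by
  simp only [absFactor_eq, den_mul γ γ' hz, norm_mul]
  rw [Finset.prod_mul_distrib, Real.mul_rpow (by positivity) (by positivity)]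

lemma absFactor_one (z : (F →+* ℝ) → ℂ) :
    absFactor (1 : Matrix.SpecialLinearGroup (Fin 2) F) z = 1 := by
  simp [absFactor]

end HalfSpace

/-! ### Fourier series on the torus, and holomorphic integrals over the cube. -/

section Torus

variable {d : Type*} [Fintype d]

variable (d) in
/-- The half-open unit cube. -/
def unitCube : Set (d → ℝ) := {s | ∀ i, s i ∈ Set.Ioc (0 : ℝ) 1}

/-- The character `s ↦ exp (2 π i k · s)`. -/
def torusChar (k : d → ℤ) (s : d → ℝ) : ℂ := 
  Complex.exp (2 * Real.pi * Complex.I * ((∑ i, (k i : ℝ) * s i : ℝ) : ℂ))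

/-- The Fourier coefficients of a periodic function. -/
def torusCoeff (φ : (d → ℝ) → ℂ) (k : d → ℤ) : ℂ := ∫ s in unitCube d, torusChar (-k) s * φ s

lemma unitCube_eq_pi : unitCube d = Set.univ.pi fun _ => Set.Ioc (0 : ℝ) 1 := by
  ext; simp [unitCube]

lemma measurableSet_unitCube : MeasurableSet (unitCube d) := by
  rw [unitCube_eq_pi]
  exact MeasurableSet.univ_pi fun _ => measurableSet_Ioc

lemma unitCube_subset : unitCube d ⊆ Set.Icc 0 1 := fun _ hs =>
  ⟨fun i => (hs i).1.le, fun i => (hs i).2⟩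

lemma volume_unitCube : MeasureTheory.volume (unitCube d) = 1 := by
  rw [unitCube_eq_pi, MeasureTheory.volume_pi_pi]
  simp

lemma integrableOn_unitCube {E : Type*} [NormedAddCommGroup E] {φ : (d → ℝ) → E}
    (h : ContinuousOn φ (Set.Icc 0 1)) :
    MeasureTheory.IntegrableOn φ (unitCube d) :=
  (h.integrableOn_compact isCompact_Icc).mono_set unitCube_subset

lemma norm_setIntegral_unitCube_le {E : Type*} [NormedAddCommGroup E] [NormedSpace ℝ E]
    {φ : (d → ℝ) → E} {C : ℝ} (h : ∀ s ∈ unitCube d, ‖φ s‖ ≤ C) :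
    ‖∫ s in unitCube d, φ s‖ ≤ C := by
  have := MeasureTheory.norm_setIntegral_le_of_norm_le_const (μ := MeasureTheory.volume)
    (s := unitCube d) (f := φ) (C := C) (by rw [volume_unitCube]; simp) h
  simpa [MeasureTheory.Measure.real, volume_unitCube] using this

lemma continuous_torusChar (k : d → ℤ) : Continuous (torusChar k) := by
  unfold torusChar; fun_prop

lemma norm_torusChar (k : d → ℤ) (s : d → ℝ) : ‖torusChar k s‖ = 1 := by
  have : (2 * Real.pi * Complex.I * ∑ i, k i * s i : ℂ) =
      ((2 * Real.pi * ∑ i, k i * s i : ℝ) : ℂ) * Complex.I := by push_cast; ring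
  rw [torusChar, this, Complex.norm_exp_ofReal_mul_I]

lemma mFourier_coe (k : d → ℤ) (s : d → ℝ) :
    UnitAddTorus.mFourier k (fun i => (s i : UnitAddCircle)) = torusChar k s := by
  simp only [UnitAddTorus.mFourier, ContinuousMap.coe_mk, fourier_coe_apply, torusChar]
  rw [← Complex.exp_sum]
  congr 1
  push_cast
  rw [Finset.mul_sum]
  exact Finset.sum_congr rfl fun i _ => by ring

/-- The projection from ℝᵈ to the torus is an open quotient map, so continuity passes to the induced
function, to which the Fourier theory of `UnitAddTorus` applies. -/
lemma exists_torus_lift {φ : (d → ℝ) → ℂ} (hc : Continuous φ)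
    (hp : ∀ (s : d → ℝ) (k : d → ℤ), φ (fun i => s i + k i) = φ s) :
    ∃ G : C(UnitAddTorus d, ℂ), ∀ s : d → ℝ, G (fun i => (s i : UnitAddCircle)) = φ s := by
  let q : (d → ℝ) → UnitAddTorus d := fun s i => (s i : UnitAddCircle)
  have hq : IsOpenQuotientMap q :=
    IsOpenQuotientMap.piMap (f := fun (_ : d) (x : ℝ) => (x : UnitAddCircle)) fun _ =>
      QuotientAddGroup.isOpenQuotientMap_mk
  have hfac : ∀ s t, q s = q t → φ s = φ t := by
    intro s t h
    have h1 : ∀ i, ∃ m : ℤ, s i = t i + m := by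
      intro i
      have := congr_fun h i
      simp only [q] at this
      rw [QuotientAddGroup.eq_iff_sub_mem, AddSubgroup.mem_zmultiples_iff] at this
      obtain ⟨m, hm⟩ := this
      exact ⟨m, by simp at hm; linarith⟩
    choose k hk using h1
    rw [← hp t k]
    congr 1
    funext i
    exact hk i
  let g : UnitAddTorus d → ℂ := fun t => φ (Function.surjInv hq.surjective t)
  have hg : ∀ s, g (q s) = φ s := fun s => hfac _ _ (Function.surjInv_eq hq.surjective (q s))
  refine ⟨⟨g, hq.isQuotientMap.continuous_iff.mpr ?_⟩, hg⟩
  have : g ∘ q = φ := funext hg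
  rwa [this]

/-- Both sides integrate the same function on the torus, read on two fundamental cubes. -/
lemma integral_unitCube_add {φ : (d → ℝ) → ℂ} (hc : Continuous φ)
    (hp : ∀ (s : d → ℝ) (k : d → ℤ), φ (fun i => s i + k i) = φ s) (t : d → ℝ) :
    ∫ s in unitCube d, φ (s + t) = ∫ s in unitCube d, φ s := by
  obtain ⟨G, hG⟩ := exists_torus_lift hc hp
  have h1 := (UnitAddTorus.integral_preimage G t).symm.trans (UnitAddTorus.integral_preimage G 0)
  simp only [hG] at h1
  have h2 : unitCube d = (fun s => s + t) ⁻¹' {x : d → ℝ | ∀ i, x i ∈ Set.Ioc (t i) (t i + 1)} := by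
    ext s
    simp only [unitCube, Set.mem_ofPred_eq, Set.mem_preimage, Pi.add_apply, Set.mem_Ioc]
    refine forall_congr' fun i => ?_
    constructor <;> rintro ⟨a, b⟩ <;> constructor <;> linarith
  have h3 := (MeasureTheory.measurePreserving_add_right MeasureTheory.volume t).setIntegral_preimage_emb
    (measurableEmbedding_addRight t) φ {x : d → ℝ | ∀ i, x i ∈ Set.Ioc (t i) (t i + 1)}
  rw [← h2] at h3
  rw [h3, h1]
  congr 2
  ext s
  simp [unitCube]

lemma hasSum_torusCoeff {φ : (d → ℝ) → ℂ} (hc : Continuous φ)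
    (hp : ∀ (s : d → ℝ) (k : d → ℤ), φ (fun i => s i + k i) = φ s)
    (hs : Summable (torusCoeff φ)) (s : d → ℝ) :
    HasSum (fun k => torusCoeff φ k * torusChar k s) (φ s) := by
  obtain ⟨G, hG⟩ := exists_torus_lift hc hp
  have hco : ∀ k, UnitAddTorus.mFourierCoeff G k = torusCoeff φ k := by
    intro k
    rw [UnitAddTorus.mFourierCoeff_eq_integral G k 0, torusCoeff]
    have : {x : d → ℝ | ∀ i, x i ∈ Set.Ioc ((0 : d → ℝ) i) ((0 : d → ℝ) i + 1)} = unitCube d := by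
      ext; simp [unitCube]
    rw [this]
    simp only [hG, mFourier_coe, smul_eq_mul]
  have hs' : Summable (UnitAddTorus.mFourierCoeff G) := by
    rw [show UnitAddTorus.mFourierCoeff (G : UnitAddTorus d → ℂ) = torusCoeff φ from funext hco]
    exact hs
  have := UnitAddTorus.hasSum_mFourier_series_apply_of_summable hs'
    (fun i => (s i : UnitAddCircle))
  simpa only [hco, hG, mFourier_coe, smul_eq_mul] using this

lemma integral_torusChar [DecidableEq d] (k : d → ℤ) :
    ∫ s in unitCube d, torusChar k s = if k = 0 then 1 else 0 := by
  have h1 : ∀ s : d → ℝ, torusChar k s = ∏ i, Complex.exp (2 * Real.pi * Complex.I * (k i * s i)) := by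
    intro s
    rw [torusChar]
    push_cast
    rw [Finset.mul_sum, Complex.exp_sum]
  simp only [h1]
  rw [unitCube_eq_pi, MeasureTheory.volume_pi, MeasureTheory.Measure.restrict_pi_pi,
    MeasureTheory.integral_fintype_prod_eq_prod
      (f := fun i x => Complex.exp (2 * Real.pi * Complex.I * (k i * (x : ℝ))))]
  have h2 : ∀ m : ℤ, ∫ x : ℝ in Set.Ioc 0 1, Complex.exp (2 * Real.pi * Complex.I * (m * x)) =
      if m = 0 then 1 else 0 := by
    intro m
    split_ifs with hm
    · simp [hm]
    · rw [← intervalIntegral.integral_of_le zero_le_one]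
      have hne : (2 * Real.pi * Complex.I * m : ℂ) ≠ 0 := by
        simp [hm, Real.pi_ne_zero]
      have := integral_exp_mul_complex (a := 0) (b := 1) hne
      simp only [mul_assoc] at this ⊢
      rw [this]
      have hexp : Complex.exp (2 * (Real.pi * (Complex.I * m))) = 1 := by
        rw [← Complex.exp_int_mul_two_pi_mul_I m]
        congr 1
        ring
      simp [hexp]
  simp only [h2]
  split_ifs with hk
  · simp [hk]
  · obtain ⟨i, hi⟩ : ∃ i, k i ≠ 0 := by
      by_contra! h
      exact hk (funext h)
    exact Finset.prod_eq_zero (Finset.mem_univ i) (by simp [hi])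

/-- Multiplying by a conjugate character and integrating term by term leaves a single term; absolute
summability licenses the exchange. Uniqueness of Fourier expansions rests on this. -/
lemma torusCoeff_eq_of_hasSum {φ : (d → ℝ) → ℂ} {a : (d → ℤ) → ℂ} (ha : Summable a)
    (h : ∀ s, HasSum (fun k => a k * torusChar k s) (φ s)) (k : d → ℤ) :
    torusCoeff φ k = a k := by
  classical
  have hn : ∀ (l : d → ℤ) s, ‖torusChar (-k) s * (a l * torusChar l s)‖ = ‖a l‖ := by
    intro l s
    rw [norm_mul, norm_mul, norm_torusChar, norm_torusChar]; ring
  have hsum := MeasureTheory.hasSum_integral_of_summable_integral_norm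
    (μ := MeasureTheory.volume.restrict (unitCube d))
    (F := fun l s => torusChar (-k) s * (a l * torusChar l s))
    (fun l => integrableOn_unitCube (((continuous_torusChar _).mul
      (continuous_const.mul (continuous_torusChar _))).continuousOn))
    (by
      simp only [hn]
      simp [MeasureTheory.Measure.real, volume_unitCube]
      exact ha.norm)
  have h1 : ∀ s, ∑' l, torusChar (-k) s * (a l * torusChar l s) = torusChar (-k) s * φ s :=
    fun s => ((h s).mul_left _).tsum_eq
  simp only [h1] at hsum
  have h2 : ∀ l, ∫ s in unitCube d, torusChar (-k) s * (a l * torusChar l s) =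
      if l = k then a k else 0 := by
    intro l
    have : ∀ s, torusChar (-k) s * (a l * torusChar l s) = a l * torusChar (l - k) s := by
      intro s
      rw [mul_left_comm]
      congr 1
      simp only [torusChar]
      rw [← Complex.exp_add, ← mul_add, ← Complex.ofReal_add, ← Finset.sum_add_distrib]
      congr 3
      refine Finset.sum_congr rfl fun i _ => ?_
      simp
      ring
    simp only [this, MeasureTheory.integral_const_mul, integral_torusChar, sub_eq_zero]
    split_ifs with hl
    · rw [hl, mul_one]
    · rw [mul_zero]
  simp only [h2] at hsum
  exact hsum.unique (hasSum_ite_eq k (a k))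

/-- Differentiation under the integral over the unit cube. -/
lemma differentiableOn_integral_unitCube {U : Set ℂ} (hU : IsOpen U) {H : ℂ → (d → ℝ) → ℂ}
    (hcont : ContinuousOn (Function.uncurry H) (U ×ˢ Set.univ))
    (hdiff : ∀ s, DifferentiableOn ℂ (fun w => H w s) U) :
    DifferentiableOn ℂ (fun w => ∫ s in unitCube d, H w s) U := by
  intro w₀ hw₀
  obtain ⟨R, hR, hball⟩ := Metric.isOpen_iff.mp hU w₀ hw₀
  have hsub : Metric.closedBall w₀ (R / 2) ⊆ U :=
    (Metric.closedBall_subset_ball (by linarith)).trans hball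
  obtain ⟨C, hC⟩ := ((isCompact_closedBall w₀ (R / 2)).prod
    (isCompact_Icc (a := (0 : d → ℝ)) (b := 1))).exists_bound_of_continuousOn
      (hcont.mono (Set.prod_mono hsub (Set.subset_univ _)))
  have hcs : ∀ w ∈ U, Continuous (H w) := by
    intro w hw
    have := hcont.comp_continuous (f := fun s : d → ℝ => (w, s)) (by fun_prop) (by simp [hw])
    exact this
  have hint : ∀ w ∈ U, MeasureTheory.IntegrableOn (H w) (unitCube d) := fun w hw =>
    integrableOn_unitCube (hcs w hw).continuousOn
  have hda : ∀ w ∈ U, ∀ s, HasDerivAt (fun w => H w s) (deriv (fun w => H w s) w) w :=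
    fun w hw s => ((hdiff s).differentiableAt (hU.mem_nhds hw)).hasDerivAt
  have key := hasDerivAt_integral_of_dominated_loc_of_deriv_le
    (μ := MeasureTheory.volume.restrict (unitCube d)) (F := H) (x₀ := w₀)
    (s := Metric.ball w₀ (R / 4)) (F' := fun w s => deriv (fun w => H w s) w)
    (bound := fun _ => C / (R / 4)) (Metric.ball_mem_nhds _ (by linarith))
    (by
      filter_upwards [hU.mem_nhds hw₀] with w hw
      exact (hint w hw).aestronglyMeasurable)
    (hint w₀ hw₀)
    (by
      -- Measurability of the derivative in `s`: it is the pointwise limit of difference quotients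
      -- with steps (R/4)/(n+1), each continuous in `s`.
      have hu0 : Filter.Tendsto (fun n : ℕ => ((R / 4 : ℝ) : ℂ) * (1 / ((n : ℂ) + 1))) Filter.atTop (nhds 0) := by
        have := (tendsto_one_div_add_atTop_nhds_zero_nat (𝕜 := ℂ)).const_mul ((R / 4 : ℝ) : ℂ)
        simpa using this
      have hne : ∀ n : ℕ, ((R / 4 : ℝ) : ℂ) * (1 / ((n : ℂ) + 1)) ≠ 0 := by
        intro n
        have : (n : ℂ) + 1 ≠ 0 := by exact_mod_cast Nat.succ_ne_zero n
        have hR' : ((R / 4 : ℝ) : ℂ) ≠ 0 := by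
          rw [Complex.ofReal_ne_zero]; positivity
        exact mul_ne_zero hR' (one_div_ne_zero this)
      have hmem : ∀ n : ℕ, w₀ + ((R / 4 : ℝ) : ℂ) * (1 / ((n : ℂ) + 1)) ∈ U := by
        intro n
        apply hball
        rw [Metric.mem_ball, dist_eq_norm, add_sub_cancel_left, norm_mul, Complex.norm_real,
          Real.norm_of_nonneg (by linarith), norm_div, norm_one]
        have h1 : ‖(n : ℂ) + 1‖ = (n : ℝ) + 1 := by
          exact_mod_cast Complex.norm_natCast (n + 1)
        rw [h1]
        have h2 : 1 / ((n : ℝ) + 1) ≤ 1 := by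
          rw [div_le_one (by positivity)]; linarith [(Nat.cast_nonneg n : (0 : ℝ) ≤ n)]
        nlinarith
      refine aestronglyMeasurable_of_tendsto_ae Filter.atTop
        (f := fun (n : ℕ) s => (((R / 4 : ℝ) : ℂ) * (1 / ((n : ℂ) + 1)))⁻¹ •
          (H (w₀ + ((R / 4 : ℝ) : ℂ) * (1 / ((n : ℂ) + 1))) s - H w₀ s)) ?_ ?_
      · intro n
        exact (((hcs _ (hmem n)).sub (hcs _ hw₀)).const_smul
          (((R / 4 : ℝ) : ℂ) * (1 / ((n : ℂ) + 1)))⁻¹).aestronglyMeasurable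
      · refine Filter.Eventually.of_forall fun s => ?_
        have := (hasDerivAt_iff_tendsto_slope_zero.mp (hda w₀ hw₀ s))
        exact this.comp (tendsto_nhdsWithin_iff.mpr ⟨hu0, Filter.Eventually.of_forall hne⟩))
    (by
      refine (MeasureTheory.ae_restrict_iff' measurableSet_unitCube).mpr
        (Filter.Eventually.of_forall fun s hs w hw => ?_)
      rw [Metric.mem_ball] at hw
      have hss : Metric.closedBall w (R / 4) ⊆ Metric.closedBall w₀ (R / 2) :=
        Metric.closedBall_subset_closedBall' (by linarith)
      -- Cauchy's estimate on a circle of radius R/4, which stays in the closed ball of radius R/2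
      -- where `C` bounds the integrand.
      refine Complex.norm_deriv_le_of_forall_mem_sphere_norm_le (by linarith) ?_ ?_
      · exact (((hdiff s).mono (hss.trans hsub)).diffContOnCl_ball subset_rfl)
      · intro w' hw'
        exact hC (w', s) ⟨hss (Metric.sphere_subset_closedBall hw'), unitCube_subset hs⟩)
    (integrableOn_unitCube (φ := fun _ : d → ℝ => C / (R / 4)) continuousOn_const)
    (by
      refine Filter.Eventually.of_forall fun s w hw => hda w ?_ s
      exact hball (Metric.ball_subset_ball (by linarith) hw))
  exact key.2.differentiableAt.differentiableWithinAt

end Torus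

/-! ### Convergence of sums over the ring of integers. -/

section LatticeSums

variable {F : Type*} [Field F] [NumberField F] [NumberField.IsTotallyReal F]

variable (F) in
lemma exists_norm_intCoord_le : ∃ C : ℝ, 0 < C ∧ ∀ ζ : 𝓞 F,
    ‖fun i => (intCoord F ζ i : ℝ)‖ ≤ C * ∑ σ : F →+* ℝ, |σ (ζ : F)| := by
  refine ⟨‖((latEquiv F).symm : ((F →+* ℝ) → ℝ) →L[ℝ] (BIdx F → ℝ))‖ + 1, by positivity, fun ζ => ?_⟩
  have h0 : 0 ≤ ∑ σ : F →+* ℝ, |σ (ζ : F)| := Finset.sum_nonneg fun _ _ => abs_nonneg _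
  have h1 := ((latEquiv F).symm : ((F →+* ℝ) → ℝ) →L[ℝ] (BIdx F → ℝ)).le_opNorm
    (fun σ => σ (ζ : F))
  have h2 : (latEquiv F).symm (fun σ => σ (ζ : F)) = fun i => (intCoord F ζ i : ℝ) := by
    rw [ContinuousLinearEquiv.symm_apply_eq]
    funext σ
    rw [latEquiv_intCoord]
  have h3 : ‖fun σ : F →+* ℝ => σ (ζ : F)‖ ≤ ∑ σ : F →+* ℝ, |σ (ζ : F)| := by
    rw [pi_norm_le_iff_of_nonneg h0]
    intro σ
    exact Finset.single_le_sum (f := fun σ : F →+* ℝ => |σ (ζ : F)|) (fun _ _ => abs_nonneg _)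
      (Finset.mem_univ σ)
  simp only [ContinuousLinearEquiv.coe_coe, h2] at h1
  calc _ ≤ _ := h1
    _ ≤ (‖((latEquiv F).symm : ((F →+* ℝ) → ℝ) →L[ℝ] (BIdx F → ℝ))‖ + 1) *
        ‖fun σ : F →+* ℝ => σ (ζ : F)‖ := by gcongr; linarith
    _ ≤ _ := by gcongr

variable (F) in
-- Comparison with ℤⁿ through the coordinates in the integral basis; any exponent above the rank
-- will do, and only its existence is used.
lemma exists_summable_inv_pow : ∃ N : ℕ,
    Summable fun ζ : 𝓞 F => (∑ σ : F →+* ℝ, |σ (ζ : F)|)⁻¹ ^ N := by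
  let L : Submodule ℤ (BIdx F → ℝ) := Submodule.span ℤ (Set.range (Pi.basisFun ℝ (BIdx F)))
  obtain ⟨C, hC, hle⟩ := exists_norm_intCoord_le F
  have hmem : ∀ ζ : 𝓞 F, (fun i => (intCoord F ζ i : ℝ)) ∈ L := by
    intro ζ
    rw [Module.Basis.mem_span_iff_repr_mem]
    intro i
    exact ⟨intCoord F ζ i, by simp⟩
  let j : 𝓞 F → L := fun ζ => ⟨_, hmem ζ⟩
  have hj : Function.Injective j := by
    intro ζ ζ' h
    have h1 := congr_arg Subtype.val h
    apply (intCoord F).injective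
    funext i
    have := congr_fun h1 i
    simp only [j] at this
    exact_mod_cast this
  refine ⟨Module.finrank ℤ L + 1, ?_⟩
  have hsum := (ZLattice.summable_norm_pow_inv L (Module.finrank ℤ L + 1) (Nat.lt_succ_self _)).comp_injective hj
  refine Summable.of_norm_bounded_eventually (hsum.mul_left (C ^ (Module.finrank ℤ L + 1))) ?_
  filter_upwards [(Set.finite_singleton (0 : 𝓞 F)).compl_mem_cofinite] with ζ hζ
  have hζ0 : ζ ≠ 0 := hζ
  have h0 : 0 ≤ ∑ σ : F →+* ℝ, |σ (ζ : F)| := Finset.sum_nonneg fun _ _ => abs_nonneg _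
  have hpos : 0 < ‖j ζ‖ := by
    rw [norm_pos_iff]
    intro h
    apply hζ0
    apply hj
    rw [h]
    ext i
    simp [j, intCoord]
  have h1 : ‖j ζ‖ ≤ C * ∑ σ : F →+* ℝ, |σ (ζ : F)| := hle ζ
  simp only [Function.comp_apply]
  rw [Real.norm_of_nonneg (by positivity), ← mul_pow]
  gcongr
  rw [inv_le_comm₀ (by nlinarith) (by positivity), mul_inv, inv_inv]
  rw [inv_mul_le_iff₀ hC]
  exact h1

lemma exp_neg_le_inv_pow {c x : ℝ} (hc : 0 < c) (hx : 0 < x) (N : ℕ) :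
    Real.exp (-(c * x)) ≤ (N.factorial / c ^ N) * x⁻¹ ^ N := by
  have h := Real.pow_div_factorial_le_exp (c * x) (by positivity) N
  rw [Real.exp_neg, inv_pow, ← div_eq_mul_inv, div_div, ← mul_pow]
  rw [inv_le_comm₀ (Real.exp_pos _) (by positivity), inv_div]
  exact h

/-- The exponential decays faster than the power in the convergent sum. This is the common majorant
for the theta series and Fourier expansions below. -/
lemma summable_exp_neg_absSum {c : ℝ} (hc : 0 < c) :
    Summable fun ζ : 𝓞 F => Real.exp (-(c * ∑ σ : F →+* ℝ, |σ (ζ : F)|)) := by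
  obtain ⟨N, hN⟩ := exists_summable_inv_pow F
  refine Summable.of_norm_bounded_eventually (hN.mul_left (N.factorial / c ^ N)) ?_
  filter_upwards [(Set.finite_singleton (0 : 𝓞 F)).compl_mem_cofinite] with ζ hζ
  have hζ0 : (ζ : F) ≠ 0 := by exact_mod_cast hζ
  obtain ⟨σ⟩ := nonempty_realEmb (F := F)
  rw [Real.norm_of_nonneg (Real.exp_pos _).le]
  refine exp_neg_le_inv_pow hc ?_ N
  exact Finset.sum_pos' (fun _ _ => abs_nonneg _)
    ⟨σ, Finset.mem_univ _, abs_pos.mpr (emb_ne_zero σ hζ0)⟩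

end LatticeSums

/-! ### Fourier expansions of periodic holomorphic functions. -/

section Expansion

variable {F : Type*} [Field F]

lemma norm_e [NumberField F] (w : (F →+* ℝ) → ℂ) : ‖e w‖ = Real.exp (-(2 * Real.pi * ∑ σ, (w σ).im)) := by
  rw [e, Complex.norm_exp]
  congr 1
  have : (2 * Real.pi * Complex.I * ∑ σ, w σ : ℂ) = Complex.I * ((2 * Real.pi : ℝ) * ∑ σ, w σ) := by
    push_cast; ring
  rw [this, Complex.I_mul_re, Complex.im_ofReal_mul, Complex.im_sum]

variable [NumberField F]

/-- The exponential `e(ζ z / δ)`. -/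
def eDual (δ ζ : 𝓞 F) (z : (F →+* ℝ) → ℂ) : ℂ :=
  e fun σ => ((σ (ζ : F) / σ (δ : F) : ℝ) : ℂ) * z σ

lemma e_add (w w' : (F →+* ℝ) → ℂ) : e (w + w') = e w * e w' := by
  rw [e, e, e, ← Complex.exp_add, ← mul_add, ← Finset.sum_add_distrib]
  rfl

lemma e_zero : e (0 : (F →+* ℝ) → ℂ) = 1 := by simp [e]

lemma differentiable_eDual (δ ζ : 𝓞 F) : Differentiable ℂ (eDual δ ζ) := by
  unfold eDual e; fun_prop

lemma e_ofReal_eq_one_of_int {v : (F →+* ℝ) → ℝ} {m : ℤ} (h : ∑ σ, v σ = m) :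
    e (fun σ => (v σ : ℂ)) = 1 := by
  rw [e, ← Complex.ofReal_sum, h, ← Complex.exp_int_mul_two_pi_mul_I m]
  congr 1
  push_cast; ring

variable [NumberField.IsTotallyReal F]

/-- The point of `ℂⁿ` with lattice coordinates `s` and imaginary part `y`. -/
def latPoint (s : BIdx F → ℝ) (y : (F →+* ℝ) → ℝ) : (F →+* ℝ) → ℂ :=
  fun σ => (latEquiv F s σ : ℂ) + Complex.I * y σ

lemma latPoint_im (s : BIdx F → ℝ) (y : (F →+* ℝ) → ℝ) (σ : F →+* ℝ) :
    (latPoint s y σ).im = y σ := by simp [latPoint]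

lemma latPoint_mem {y : (F →+* ℝ) → ℝ} (hy : ∀ σ, 0 < y σ) (s : BIdx F → ℝ) :
    latPoint s y ∈ upperHalf F := fun σ => by rw [latPoint_im]; exact hy σ

lemma latPoint_symm (z : (F →+* ℝ) → ℂ) :
    latPoint ((latEquiv F).symm fun σ => (z σ).re) (fun σ => (z σ).im) = z := by
  funext σ
  rw [latPoint, ContinuousLinearEquiv.apply_symm_apply, mul_comm, Complex.re_add_im]

lemma continuous_latPoint : Continuous fun p : (BIdx F → ℝ) × ((F →+* ℝ) → ℝ) => latPoint p.1 p.2 := by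
  unfold latPoint
  have := (latEquiv F).continuous
  refine continuous_pi fun σ => ?_
  have h1 : Continuous fun p : (BIdx F → ℝ) × ((F →+* ℝ) → ℝ) => latEquiv F p.1 σ :=
    (continuous_apply σ).comp (this.comp continuous_fst)
  fun_prop

lemma latPoint_add_int (s : BIdx F → ℝ) (y : (F →+* ℝ) → ℝ) (k : BIdx F → ℤ) :
    latPoint (fun i => s i + k i) y =
      fun σ => latPoint s y σ + (σ (((intCoord F).symm k : 𝓞 F) : F) : ℂ) := by
  funext σ
  have h1 : (fun i => s i + (k i : ℝ)) = s + fun i => (intCoord F ((intCoord F).symm k) i : ℝ) := by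
    funext i; simp
  rw [latPoint, h1, map_add, Pi.add_apply, latEquiv_intCoord, latPoint]
  push_cast; ring

/-- Invariance under translation by the integers. -/
def IntPeriodic (f : ((F →+* ℝ) → ℂ) → ℂ) : Prop :=
  ∀ z ∈ upperHalf F, ∀ r : 𝓞 F, f (fun σ => z σ + (σ (r : F) : ℂ)) = f z

variable {δ : 𝓞 F} (hδ : Ideal.span {δ} = differentIdeal ℤ (𝓞 F))
include hδ

lemma eDual_add_int (ζ : 𝓞 F) (z : (F →+* ℝ) → ℂ) (r : 𝓞 F) :
    eDual δ ζ (fun σ => z σ + (σ (r : F) : ℂ)) = eDual δ ζ z := by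
  obtain ⟨m, hm⟩ := exists_int_sum_div hδ (ζ * r)
  have h := e_ofReal_eq_one_of_int hm
  have h2 : (fun σ : F →+* ℝ => ((σ (ζ : F) / σ (δ : F) : ℝ) : ℂ) * (z σ + (σ (r : F) : ℂ))) =
      (fun σ => ((σ (ζ : F) / σ (δ : F) : ℝ) : ℂ) * z σ) +
      fun σ => ((σ ((ζ * r : 𝓞 F) : F) / σ (δ : F) : ℝ) : ℂ) := by
    funext σ
    simp only [Pi.add_apply, map_mul]
    push_cast; ring
  rw [eDual, h2, e_add, h, mul_one, eDual]

/-- The Fourier coefficient computed at height `y` does not depend on `y`. -/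
lemma integral_latPoint_eq {f : ((F →+* ℝ) → ℂ) → ℂ} (hf : DifferentiableOn ℂ f (upperHalf F))
    (hp : IntPeriodic f) {y₀ y₁ : (F →+* ℝ) → ℝ} (hy₀ : ∀ σ, 0 < y₀ σ) (hy₁ : ∀ σ, 0 < y₁ σ) :
    ∫ s in unitCube (BIdx F), f (latPoint s y₀) = ∫ s in unitCube (BIdx F), f (latPoint s y₁) := by
  -- A complex interpolation between the heights: w = 0 gives `y₀`, w = i gives `y₁`, and real w
  -- moves only the real part of the point.
  let pt : ℂ → (BIdx F → ℝ) → (F →+* ℝ) → ℂ := fun w s σ => latPoint s y₀ σ + w * ((y₁ σ - y₀ σ : ℝ) : ℂ)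
  let U : Set ℂ := {w | ∀ σ, 0 < y₀ σ + w.im * (y₁ σ - y₀ σ)}
  have hUeq : U = ⋂ σ, {w : ℂ | 0 < y₀ σ + w.im * (y₁ σ - y₀ σ)} := by ext; simp [U]
  have hU : IsOpen U := by
    rw [hUeq]
    exact isOpen_iInter_of_finite fun σ => isOpen_lt continuous_const (by fun_prop)
  have hconv : Convex ℝ U := by
    intro w hw w' hw' a b ha hb hab σ
    have h1 := hw σ
    have h2 := hw' σ
    have h3 : (a • w + b • w').im = a * w.im + b * w'.im := by simp
    rw [h3]
    have : y₀ σ + (a * w.im + b * w'.im) * (y₁ σ - y₀ σ) =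
      a * (y₀ σ + w.im * (y₁ σ - y₀ σ)) + b * (y₀ σ + w'.im * (y₁ σ - y₀ σ)) := by
      linear_combination (-y₀ σ) * hab
    rw [this]
    rcases eq_or_lt_of_le ha with rfl | ha'
    · have : b = 1 := by linarith
      subst this; simpa using h2
    · have := mul_pos ha' h1
      have := mul_nonneg hb h2.le
      linarith
  have hmem : ∀ w ∈ U, ∀ s, pt w s ∈ upperHalf F := by
    intro w hw s σ
    have : (pt w s σ).im = y₀ σ + w.im * (y₁ σ - y₀ σ) := by
      simp only [pt, Complex.add_im, latPoint_im, Complex.im_mul_ofReal]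
    rw [this]
    exact hw σ
  have hptc : Continuous (Function.uncurry pt) := by
    have hc := continuous_latPoint (F := F)
    refine continuous_pi fun σ => ?_
    have h1 : Continuous fun p : ℂ × (BIdx F → ℝ) => latPoint p.2 y₀ σ :=
      (continuous_apply σ).comp (hc.comp (continuous_snd.prodMk continuous_const))
    simp only [pt, Function.uncurry]
    fun_prop
  let G : ℂ → ℂ := fun w => ∫ s in unitCube (BIdx F), f (pt w s)
  have hG : DifferentiableOn ℂ G U := by
    refine differentiableOn_integral_unitCube hU (H := fun w s => f (pt w s)) ?_ ?_
    · exact hf.continuousOn.comp hptc.continuousOn fun p hp => hmem p.1 hp.1 p.2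
    · intro s
      have : Differentiable ℂ fun w => pt w s := by
        simp only [pt]; fun_prop
      exact hf.comp this.differentiableOn fun w hw => hmem w hw s
  have h0 : (0 : ℂ) ∈ U := fun σ => by simpa using hy₀ σ
  have hI : Complex.I ∈ U := fun σ => by simpa using hy₁ σ
  -- For real w the integrand is translated horizontally, which periodicity absorbs. So the
  -- holomorphic `G` is constant on ℝ, hence on the convex set `U`, which contains i.
  have hreal : ∀ t : ℝ, G t = G 0 := by
    intro t
    have hc : Continuous fun s => f (latPoint s y₀) :=
      hf.continuousOn.comp_continuous
        ((continuous_latPoint (F := F)).comp (continuous_id.prodMk continuous_const))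
        (latPoint_mem hy₀)
    have hper : ∀ (s : BIdx F → ℝ) (k : BIdx F → ℤ),
        f (latPoint (fun i => s i + k i) y₀) = f (latPoint s y₀) := by
      intro s k
      rw [latPoint_add_int]
      exact hp _ (latPoint_mem hy₀ s) _
    have := integral_unitCube_add hc hper ((latEquiv F).symm fun σ => t * (y₁ σ - y₀ σ))
    have hz : ∀ s, pt 0 s = latPoint s y₀ := by intro s; simp [pt]
    simp only [G, hz]
    rw [← this]
    congr 1
    funext s
    congr 1
    funext σ
    simp only [pt, latPoint, map_add, ContinuousLinearEquiv.apply_symm_apply, Pi.add_apply]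
    push_cast; ring
  have hfreq : ∃ᶠ w in nhdsWithin (0 : ℂ) {0}ᶜ, G w = G 0 := by
    have ht : Filter.Tendsto (fun t : ℝ => (t : ℂ)) (nhdsWithin 0 {0}ᶜ) (nhdsWithin 0 {0}ᶜ) := by
      refine tendsto_nhdsWithin_iff.mpr ⟨?_, ?_⟩
      · have : Filter.Tendsto (fun t : ℝ => (t : ℂ)) (nhds 0) (nhds ((0 : ℝ) : ℂ)) :=
          Complex.continuous_ofReal.tendsto 0
        simpa using this.mono_left nhdsWithin_le_nhds
      · filter_upwards [self_mem_nhdsWithin] with t ht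
        simpa using ht
    exact ht.frequently (Filter.Frequently.of_forall hreal)
  have hEq := (hG.analyticOnNhd hU).eqOn_of_preconnected_of_frequently_eq
    (g := fun _ => G 0) analyticOnNhd_const hconv.isPreconnected h0 hfreq
  have h1 := hEq hI
  have hz0 : ∀ s, pt 0 s = latPoint s y₀ := by intro s; simp [pt]
  have hz1 : ∀ s, pt Complex.I s = latPoint s y₁ := by
    intro s; funext σ; simp only [pt, latPoint]; push_cast; ring
  simp only [G, hz0, hz1] at h1
  exact h1.symm

lemma norm_eDual_latPoint (ζ : 𝓞 F) (s : BIdx F → ℝ) (y : (F →+* ℝ) → ℝ) :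
    ‖eDual δ ζ (latPoint s y)‖ =
      Real.exp (-(2 * Real.pi * ∑ σ : F →+* ℝ, σ (ζ : F) / σ (δ : F) * y σ)) := by
  rw [eDual, norm_e]
  simp only [Complex.im_ofReal_mul, latPoint_im]

lemma eDual_latPoint {D : 𝓞 F ≃ (BIdx F → ℤ)}
    (hD : ∀ (ζ : 𝓞 F) (s : BIdx F → ℝ),
      ∑ i, (D ζ i : ℝ) * s i = ∑ σ : F →+* ℝ, σ (ζ : F) / σ (δ : F) * latEquiv F s σ)
    (ζ : 𝓞 F) (s : BIdx F → ℝ) (y : (F →+* ℝ) → ℝ) :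
    eDual δ ζ (latPoint s y) = torusChar (D ζ) s *
      (Real.exp (-(2 * Real.pi * ∑ σ : F →+* ℝ, σ (ζ : F) / σ (δ : F) * y σ)) : ℂ) := by
  rw [torusChar, hD, eDual, e, Complex.ofReal_exp, ← Complex.exp_add]
  congr 1
  push_cast
  simp only [latPoint, mul_add, Finset.sum_add_distrib]
  congr 1
  simp only [Finset.mul_sum]
  rw [← Finset.sum_neg_distrib]
  refine Finset.sum_congr rfl fun σ _ => ?_
  linear_combination (2 * Real.pi * ((σ (ζ : F) : ℂ) / σ (δ : F)) * y σ) * Complex.I_mul_I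

omit hδ in
lemma dualCoord_neg {D : 𝓞 F ≃ (BIdx F → ℤ)}
    (hD : ∀ (ζ : 𝓞 F) (s : BIdx F → ℝ),
      ∑ i, (D ζ i : ℝ) * s i = ∑ σ : F →+* ℝ, σ (ζ : F) / σ (δ : F) * latEquiv F s σ) (ζ : 𝓞 F) :
    D (-ζ) = -D ζ := by
  funext i
  classical
  have h1 := hD ζ (Pi.single i 1)
  have h2 := hD (-ζ) (Pi.single i 1)
  simp only [map_neg, neg_div, neg_mul, Finset.sum_neg_distrib, ← h1] at h2
  simp [Pi.single_apply] at h2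
  simp only [Pi.neg_apply]
  exact_mod_cast h2

/-- A holomorphic function on the half space which is periodic under the integers has a Fourier
expansion. -/
lemma exists_expansion {f : ((F →+* ℝ) → ℂ) → ℂ} (hf : DifferentiableOn ℂ f (upperHalf F))
    (hp : IntPeriodic f) :
    ∃ a : 𝓞 F → ℂ, ∀ z ∈ upperHalf F, HasSum (fun ζ => a ζ * eDual δ ζ z) (f z) := by
  obtain ⟨D, hD⟩ := exists_dualCoord hδ
  have hδ0 : (δ : F) ≠ 0 := by exact_mod_cast delta_ne_zero hδ
  -- With the factor e(-ζz/δ) the integrand is holomorphic and periodic, so the integral does not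
  -- depend on the height.
  let c : 𝓞 F → ((F →+* ℝ) → ℝ) → ℂ := fun ζ y =>
    ∫ s in unitCube (BIdx F), f (latPoint s y) * eDual δ (-ζ) (latPoint s y)
  have hcc : ∀ ζ (y₀ y₁ : (F →+* ℝ) → ℝ), (∀ σ, 0 < y₀ σ) → (∀ σ, 0 < y₁ σ) → c ζ y₀ = c ζ y₁ := by
    intro ζ y₀ y₁ h0 h1
    refine integral_latPoint_eq hδ (f := fun z => f z * eDual δ (-ζ) z)
      (hf.mul (differentiable_eDual δ (-ζ)).differentiableOn) ?_ h0 h1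
    intro z hz r
    simp only
    rw [hp z hz, eDual_add_int hδ]
  refine ⟨fun ζ => c ζ 1, fun z hz => ?_⟩
  let y : (F →+* ℝ) → ℝ := fun σ => (z σ).im
  have hy : ∀ σ, 0 < y σ := hz
  let φ : (BIdx F → ℝ) → ℂ := fun s => f (latPoint s y)
  have hφc : Continuous φ :=
    hf.continuousOn.comp_continuous
      ((continuous_latPoint (F := F)).comp (continuous_id.prodMk continuous_const))
      (latPoint_mem hy)
  have hφp : ∀ (s : BIdx F → ℝ) (k : BIdx F → ℤ), φ (fun i => s i + k i) = φ s := by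
    intro s k
    simp only [φ]
    rw [latPoint_add_int]
    exact hp _ (latPoint_mem hy s) _
  have hneg := dualCoord_neg hD
  have hcoef : ∀ ζ, torusCoeff φ (D ζ) = c ζ 1 *
      (Real.exp (-(2 * Real.pi * ∑ σ : F →+* ℝ, σ (ζ : F) / σ (δ : F) * y σ)) : ℂ) := by
    intro ζ
    rw [hcc ζ 1 y (by simp) hy, torusCoeff, ← MeasureTheory.integral_mul_const]
    congr 1
    funext s
    rw [eDual_latPoint hδ hD, hneg, mul_assoc, mul_assoc]
    rw [← Complex.ofReal_mul, ← Real.exp_add]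
    simp [neg_div, φ, mul_comm]
  have hcomp : IsCompact ((fun p : (BIdx F → ℝ) × ((F →+* ℝ) → ℝ) => latPoint p.1 p.2) ''
      (Set.Icc 0 1 ×ˢ Set.Icc (fun σ => y σ / 2) (fun σ => 3 * y σ / 2))) :=
    (isCompact_Icc.prod isCompact_Icc).image continuous_latPoint
  obtain ⟨M, hM⟩ := hcomp.exists_bound_of_continuousOn (f := f) (hf.continuousOn.mono (by
    rintro _ ⟨⟨s, y'⟩, ⟨_, hy'⟩, rfl⟩
    exact latPoint_mem (fun σ => lt_of_lt_of_le (half_pos (hy σ)) (hy'.1 σ)) s))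
  have hbound : ∀ ζ, ‖torusCoeff φ (D ζ)‖ ≤
      M * Real.exp (-(Real.pi * ∑ σ : F →+* ℝ, |σ (ζ : F) / σ (δ : F)| * y σ)) := by
    intro ζ
    -- The height is lowered or raised by half according to the sign of σ(ζ)/σ(δ), so that every
    -- coordinate gains a factor exp(-π|σ(ζ/δ)|y_σ).
    let y' : (F →+* ℝ) → ℝ := fun σ => if 0 ≤ σ (ζ : F) / σ (δ : F) then y σ / 2 else 3 * y σ / 2
    have hy'1 : y' ∈ Set.Icc (fun σ => y σ / 2) (fun σ => 3 * y σ / 2) := by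
      constructor <;> intro σ <;> have := hy σ <;> simp only [y'] <;> split_ifs <;> linarith
    have hy'0 : ∀ σ, 0 < y' σ := fun σ => lt_of_lt_of_le (half_pos (hy σ)) (hy'1.1 σ)
    have h1 : ‖c ζ y'‖ ≤ M * Real.exp (2 * Real.pi * ∑ σ : F →+* ℝ, σ (ζ : F) / σ (δ : F) * y' σ) := by
      refine norm_setIntegral_unitCube_le fun s hs => ?_
      rw [norm_mul, norm_eDual_latPoint hδ]
      have : -(2 * Real.pi * ∑ σ : F →+* ℝ, σ ((-ζ : 𝓞 F) : F) / σ (δ : F) * y' σ) =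
          2 * Real.pi * ∑ σ : F →+* ℝ, σ (ζ : F) / σ (δ : F) * y' σ := by
        simp [neg_div]
      rw [this]
      gcongr
      exact hM _ ⟨(s, y'), ⟨unitCube_subset hs, hy'1⟩, rfl⟩
    rw [hcoef, norm_mul, hcc ζ 1 y' (by simp) hy'0, Complex.norm_real,
      Real.norm_of_nonneg (Real.exp_pos _).le]
    calc _ ≤ M * Real.exp (2 * Real.pi * ∑ σ : F →+* ℝ, σ (ζ : F) / σ (δ : F) * y' σ) *
          Real.exp (-(2 * Real.pi * ∑ σ : F →+* ℝ, σ (ζ : F) / σ (δ : F) * y σ)) := by gcongr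
      _ = _ := by
        rw [mul_assoc, ← Real.exp_add]
        congr 2
        rw [← sub_eq_add_neg, ← mul_sub, ← Finset.sum_sub_distrib, mul_assoc, mul_left_comm,
          ← mul_neg, Finset.mul_sum, ← Finset.sum_neg_distrib]
        congr 1
        refine Finset.sum_congr rfl fun σ _ => ?_
        simp only [y']
        split_ifs with h
        · rw [abs_of_nonneg h]; ring
        · rw [abs_of_neg (not_le.mp h)]; ring
  have hsum : Summable (torusCoeff φ) := by
    rw [← D.summable_iff]
    obtain ⟨κ, hκ, hκle⟩ : ∃ κ : ℝ, 0 < κ ∧ ∀ σ : F →+* ℝ, κ ≤ y σ / |σ (δ : F)| := by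
      have hpos : ∀ σ : F →+* ℝ, 0 < y σ / |σ (δ : F)| := fun σ =>
        div_pos (hy σ) (abs_pos.mpr (emb_ne_zero σ hδ0))
      obtain ⟨σ₁, h1⟩ := Finite.exists_min fun σ : F →+* ℝ => y σ / |σ (δ : F)|
      exact ⟨_, hpos σ₁, h1⟩
    refine Summable.of_norm_bounded ((summable_exp_neg_absSum (F := F)
      (c := Real.pi * κ) (by positivity)).mul_left M) fun ζ => ?_
    refine (hbound ζ).trans ?_
    have hM0 : 0 ≤ M := (norm_nonneg _).trans (hM _ ⟨(0, y), ⟨⟨le_rfl, zero_le_one⟩,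
      ⟨fun σ => by have := hy σ; simp only; linarith, fun σ => by have := hy σ; simp only; linarith⟩⟩, rfl⟩)
    refine mul_le_mul_of_nonneg_left (Real.exp_le_exp.mpr (neg_le_neg ?_)) hM0
    rw [mul_assoc]
    refine mul_le_mul_of_nonneg_left ?_ Real.pi_pos.le
    rw [Finset.mul_sum]
    refine Finset.sum_le_sum fun σ _ => ?_
    rw [abs_div, div_mul_eq_mul_div, mul_div_assoc, mul_comm κ]
    gcongr
    exact hκle σ
  have key := hasSum_torusCoeff hφc hφp hsum ((latEquiv F).symm fun σ => (z σ).re)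
  rw [← D.hasSum_iff] at key
  have hφz : φ ((latEquiv F).symm fun σ => (z σ).re) = f z := by
    simp only [φ, y, latPoint_symm]
  rw [hφz] at key
  convert! key using 1
  funext ζ
  simp only [Function.comp_apply]
  rw [hcoef]
  conv_lhs => rw [← latPoint_symm z, eDual_latPoint hδ hD]
  ring

/-- The Fourier coefficients are determined by the function. -/
lemma coeff_eq_integral {f : ((F →+* ℝ) → ℂ) → ℂ} {a : 𝓞 F → ℂ}
    (h : ∀ z ∈ upperHalf F, HasSum (fun ζ => a ζ * eDual δ ζ z) (f z))
    {y : (F →+* ℝ) → ℝ} (hy : ∀ σ, 0 < y σ) (ζ : 𝓞 F) :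
    a ζ = ∫ s in unitCube (BIdx F), f (latPoint s y) * eDual δ (-ζ) (latPoint s y) := by
  obtain ⟨D, hD⟩ := exists_dualCoord hδ
  have hneg := dualCoord_neg hD
  let w : 𝓞 F → ℝ := fun ζ => Real.exp (-(2 * Real.pi * ∑ σ : F →+* ℝ, σ (ζ : F) / σ (δ : F) * y σ))
  have hsum : Summable fun k => a (D.symm k) * (w (D.symm k) : ℂ) := by
    rw [← D.summable_iff]
    have := (h _ (latPoint_mem hy 0)).summable.norm
    refine Summable.of_norm ?_
    convert! this using 1
    funext ζ
    simp only [Function.comp_apply, Equiv.symm_apply_apply, norm_mul, norm_eDual_latPoint hδ, w,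
      Complex.norm_real, Real.norm_of_nonneg (Real.exp_pos _).le]
  have key := torusCoeff_eq_of_hasSum (φ := fun s => f (latPoint s y)) hsum (fun s => by
    have := h _ (latPoint_mem hy s)
    rw [← D.hasSum_iff]
    convert! this using 1
    funext ζ
    simp only [Function.comp_apply, Equiv.symm_apply_apply]
    rw [eDual_latPoint hδ hD]
    ring) (D ζ)
  rw [Equiv.symm_apply_apply, torusCoeff] at key
  have hw : (w ζ : ℂ) ≠ 0 := by
    rw [Complex.ofReal_ne_zero]; exact (Real.exp_pos _).ne'
  apply mul_right_cancel₀ hw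
  rw [← key, ← MeasureTheory.integral_mul_const]
  congr 1
  funext s
  rw [eDual_latPoint hδ hD, hneg, mul_assoc, mul_assoc]
  simp only [w]
  rw [← Complex.ofReal_mul, ← Real.exp_add]
  simp [neg_div, mul_comm]

lemma coeff_unique {f : ((F →+* ℝ) → ℂ) → ℂ} {a a' : 𝓞 F → ℂ}
    (h : ∀ z ∈ upperHalf F, HasSum (fun ζ => a ζ * eDual δ ζ z) (f z))
    (h' : ∀ z ∈ upperHalf F, HasSum (fun ζ => a' ζ * eDual δ ζ z) (f z)) : a = a' := by
  funext ζ
  rw [coeff_eq_integral hδ h (y := 1) (by simp), coeff_eq_integral hδ h' (y := 1) (by simp)]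

/-- Cauchy's estimate for Fourier coefficients. The height `y` is free; different choices give the
Koecher principle, the growth of the coefficients and the vanishing of the constant term. -/
lemma norm_coeff_le {f : ((F →+* ℝ) → ℂ) → ℂ} {a : 𝓞 F → ℂ}
    (h : ∀ z ∈ upperHalf F, HasSum (fun ζ => a ζ * eDual δ ζ z) (f z))
    {y : (F →+* ℝ) → ℝ} (hy : ∀ σ, 0 < y σ) {C : ℝ}
    (hC : ∀ s ∈ unitCube (BIdx F), ‖f (latPoint s y)‖ ≤ C) (ζ : 𝓞 F) :
    ‖a ζ‖ ≤ C * Real.exp (2 * Real.pi * ∑ σ : F →+* ℝ, σ (ζ : F) / σ (δ : F) * y σ) := by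
  rw [coeff_eq_integral hδ h hy]
  refine norm_setIntegral_unitCube_le fun s hs => ?_
  rw [norm_mul, norm_eDual_latPoint hδ]
  have : -(2 * Real.pi * ∑ σ : F →+* ℝ, σ ((-ζ : 𝓞 F) : F) / σ (δ : F) * y σ) =
      2 * Real.pi * ∑ σ : F →+* ℝ, σ (ζ : F) / σ (δ : F) * y σ := by
    simp [neg_div]
  rw [this]
  gcongr
  exact hC s hs

end Expansion

/-! ### Tiling by unit cubes, and linear changes of variable. -/

section Tiling

variable {d : Type*} [Fintype d]

lemma iUnion_cube_translates :
    (⋃ k : d → ℤ, (fun s : d → ℝ => s + fun i => -(k i : ℝ)) ⁻¹' unitCube d) = Set.univ := by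
  -- The cube (0, 1]ᵈ omits its lower faces, so the cell containing `s` has index ⌈s⌉ - 1.
  refine Set.eq_univ_of_forall fun s => Set.mem_iUnion.mpr ⟨fun i => ⌈s i⌉ - 1, fun i => ?_⟩
  have h1 := Int.le_ceil (s i)
  have h2 := Int.ceil_lt_add_one (s i)
  simp only [Pi.add_apply, Set.mem_Ioc]
  push_cast
  constructor <;> linarith

lemma pairwise_disjoint_cube_translates : Pairwise (Function.onFun Disjoint
    fun k : d → ℤ => (fun s : d → ℝ => s + fun i => -(k i : ℝ)) ⁻¹' unitCube d) := by
  intro k l hkl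
  refine Set.disjoint_left.mpr fun s hs ht => hkl ?_
  funext i
  have h1 := hs i
  have h2 := ht i
  simp only [Pi.add_apply, Set.mem_Ioc] at h1 h2
  have h3 : (k i : ℝ) < l i + 1 := by linarith [h1.1, h2.2]
  have h4 : (l i : ℝ) < k i + 1 := by linarith [h1.2, h2.1]
  have h3' : k i < l i + 1 := by exact_mod_cast h3
  have h4' : l i < k i + 1 := by exact_mod_cast h4
  omega

lemma measurableSet_cube_translate (k : d → ℤ) :
    MeasurableSet ((fun s : d → ℝ => s + fun i => -(k i : ℝ)) ⁻¹' unitCube d) :=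
  (measurable_add_const _) measurableSet_unitCube

lemma hasSum_integral_unitCube {g : (d → ℝ) → ℂ} (hg : MeasureTheory.Integrable g) :
    HasSum (fun k : d → ℤ => ∫ s in unitCube d, g (s + fun i => (k i : ℝ))) (∫ s, g s) := by
  have h := MeasureTheory.hasSum_integral_iUnion (μ := MeasureTheory.volume) (f := g)
    measurableSet_cube_translate pairwise_disjoint_cube_translates
    (by rw [iUnion_cube_translates]; exact hg.integrableOn)
  rw [iUnion_cube_translates, MeasureTheory.setIntegral_univ] at h
  convert! h using 1
  funext k
  have h3 := (MeasureTheory.measurePreserving_add_right MeasureTheory.volume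
    (fun i => -(k i : ℝ))).setIntegral_preimage_emb
    (measurableEmbedding_addRight _) (fun s => g (s + fun i => (k i : ℝ))) (unitCube d)
  rw [← h3]
  congr 1
  funext s
  congr 1
  funext i
  simp

/-- The push-forward of a Haar measure under a linear isomorphism is a Haar measure, hence a
positive multiple of Lebesgue measure. The multiple is never computed: a normalization removes it
from |h|, and a division removes it from the L-series. -/
lemma exists_integral_comp_equiv {E : Type*} [NormedAddCommGroup E] [NormedSpace ℝ E]
    [MeasureTheory.MeasureSpace E] [BorelSpace E]
    [(MeasureTheory.volume : MeasureTheory.Measure E).IsAddHaarMeasure]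
    {d' : Type*} [Fintype d'] (L : E ≃L[ℝ] (d' → ℝ)) :
    ∃ K : ℝ, 0 < K ∧ (∀ g : (d' → ℝ) → ℂ, ∫ s, g (L s) = K * ∫ v, g v) ∧
      (∀ g : (d' → ℝ) → ℂ, MeasureTheory.Integrable g →
        MeasureTheory.Integrable fun s => g (L s)) := by
  have : (MeasureTheory.Measure.map L (MeasureTheory.volume : MeasureTheory.Measure E)).IsAddHaarMeasure :=
    L.isAddHaarMeasure_map _
  obtain hμ := MeasureTheory.Measure.isAddLeftInvariant_eq_smul
    (MeasureTheory.Measure.map L (MeasureTheory.volume : MeasureTheory.Measure E))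
    (MeasureTheory.volume : MeasureTheory.Measure (d' → ℝ))
  set κ := MeasureTheory.Measure.addHaarScalarFactor
    (MeasureTheory.Measure.map L (MeasureTheory.volume : MeasureTheory.Measure E))
    (MeasureTheory.volume : MeasureTheory.Measure (d' → ℝ)) with hκ
  have hκpos : 0 < κ := MeasureTheory.Measure.addHaarScalarFactor_pos_of_isAddHaarMeasure _ _
  have hemb : MeasurableEmbedding L := L.toHomeomorph.measurableEmbedding
  refine ⟨κ, by exact_mod_cast hκpos, fun g => ?_, fun g hg => ?_⟩
  · rw [← hemb.integral_map, hμ, MeasureTheory.integral_smul_nnreal_measure]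
    rfl
  · have : MeasureTheory.Integrable g
        (MeasureTheory.Measure.map L (MeasureTheory.volume : MeasureTheory.Measure E)) := by
      rw [hμ]
      exact hg.smul_measure_nnreal
    exact (hemb.integrable_map_iff).mp this

end Tiling

/-! ### Gaussian integrals and Poisson summation. -/

section Gauss

variable {F : Type*} [Field F] [NumberField F]

/-- The Gaussian `e(v² w / 2)`. -/
def gauss (w : (F →+* ℝ) → ℂ) (v : (F →+* ℝ) → ℝ) : ℂ := e fun σ => (v σ : ℂ) ^ 2 * w σ / 2

/-- The factor `∏ (-i w)^{-1/2}`. -/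
def rootFactor (w : (F →+* ℝ) → ℂ) : ℂ := ∏ σ, (-Complex.I * w σ) ^ (-(1 / 2) : ℂ)

lemma norm_gauss (w : (F →+* ℝ) → ℂ) (v : (F →+* ℝ) → ℝ) :
    ‖gauss w v‖ = Real.exp (-(Real.pi * ∑ σ, (w σ).im * v σ ^ 2)) := by
  rw [gauss, norm_e]
  congr 2
  rw [Finset.mul_sum, Finset.mul_sum]
  refine Finset.sum_congr rfl fun σ _ => ?_
  rw [← Complex.ofReal_pow, show ((v σ ^ 2 : ℝ) : ℂ) * w σ / 2 = ((v σ ^ 2 / 2 : ℝ) : ℂ) * w σ by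
    push_cast; ring, Complex.im_ofReal_mul]
  ring

lemma neg_I_mul_re_pos {w : (F →+* ℝ) → ℂ} (hw : w ∈ upperHalf F) (σ : F →+* ℝ) :
    0 < (-Complex.I * w σ).re := by
  have := hw σ
  simpa using this

lemma neg_I_mul_ne_zero {w : (F →+* ℝ) → ℂ} (hw : w ∈ upperHalf F) (σ : F →+* ℝ) :
    -Complex.I * w σ ≠ 0 := by
  intro h
  have := neg_I_mul_re_pos hw σ
  rw [h] at this
  simp at this

lemma rootFactor_ne_zero {w : (F →+* ℝ) → ℂ} (hw : w ∈ upperHalf F) : rootFactor w ≠ 0 := by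
  refine Finset.prod_ne_zero_iff.mpr fun σ _ => ?_
  rw [Ne, Complex.cpow_eq_zero_iff]
  simp only [neg_I_mul_ne_zero hw σ, false_and, not_false_iff]

lemma norm_rootFactor (w : (F →+* ℝ) → ℂ) :
    ‖rootFactor w‖ = (∏ σ, ‖w σ‖) ^ (-(1 / 2) : ℝ) := by
  rw [rootFactor, norm_prod, ← Real.finsetProd_rpow _ _ (fun _ _ => norm_nonneg _)]
  refine Finset.prod_congr rfl fun σ _ => ?_
  have : (-(1 / 2) : ℂ) = ((-(1 / 2) : ℝ) : ℂ) := by push_cast; ring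
  rw [this, Complex.norm_cpow_real]
  simp

lemma differentiableOn_rootFactor : DifferentiableOn ℂ (rootFactor (F := F)) (upperHalf F) := by
  classical
  intro z hz
  have h1 : ∀ σ, DifferentiableWithinAt ℂ
      (fun w : (F →+* ℝ) → ℂ => (-Complex.I * w σ) ^ (-(1 / 2) : ℂ)) (upperHalf F) z := fun σ =>
    DifferentiableWithinAt.cpow (by fun_prop) (by fun_prop) (Or.inl (neg_I_mul_re_pos hz σ))
  have h2 : ∀ S : Finset (F →+* ℝ), DifferentiableWithinAt ℂ
      (fun w : (F →+* ℝ) → ℂ => ∏ σ ∈ S, (-Complex.I * w σ) ^ (-(1 / 2) : ℂ)) (upperHalf F) z := by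
    intro S
    induction S using Finset.induction_on with
    | empty => simp only [Finset.prod_empty]; exact differentiableWithinAt_const _
    | insert σ S hσ ih =>
      simp only [Finset.prod_insert hσ]
      exact (h1 σ).mul ih
  exact h2 Finset.univ

lemma neg_inv_mem {w : (F →+* ℝ) → ℂ} (hw : w ∈ upperHalf F) :
    (fun σ => -1 / w σ) ∈ upperHalf F := by
  intro σ
  have h := hw σ
  have h0 : w σ ≠ 0 := by intro h'; rw [h'] at h; simp at h
  change 0 < (-1 / w σ).im
  rw [neg_div, one_div, Complex.neg_im, Complex.inv_im]
  have := Complex.normSq_pos.mpr h0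
  rw [neg_div, neg_neg]
  positivity

lemma gauss_mul_char (w : (F →+* ℝ) → ℂ) (v η : (F →+* ℝ) → ℝ) :
    gauss w v * e (fun σ => -((η σ * v σ : ℝ) : ℂ)) =
      ∏ σ, Complex.exp (Real.pi * Complex.I * w σ * (v σ : ℂ) ^ 2 + -(2 * Real.pi * Complex.I * η σ) * v σ + 0) := by
  rw [gauss, ← e_add, e, ← Complex.exp_sum, Finset.mul_sum]
  congr 1
  refine Finset.sum_congr rfl fun σ _ => ?_
  simp only [Pi.add_apply]
  push_cast; ring

/-- A product of one-variable Gaussian integrals. As -iw has positive real part, its argument is not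
π, so inversion is compatible with the principal branch and the square root obtained is the right
one. -/
lemma integral_gauss {w : (F →+* ℝ) → ℂ} (hw : w ∈ upperHalf F) (η : (F →+* ℝ) → ℝ) :
    ∫ v, gauss w v * e (fun σ => -((η σ * v σ : ℝ) : ℂ)) =
      rootFactor w * gauss (fun σ => -1 / w σ) η := by
  have hb : ∀ σ, (Real.pi * Complex.I * w σ).re < 0 := by
    intro σ
    have h1 := neg_I_mul_re_pos hw σ
    have : (Real.pi * Complex.I * w σ : ℂ) = ((-Real.pi : ℝ) : ℂ) * (-Complex.I * w σ) := by
      push_cast; ring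
    rw [this, Complex.re_ofReal_mul]
    exact mul_neg_of_neg_of_pos (by linarith [Real.pi_pos]) h1
  simp only [gauss_mul_char]
  rw [MeasureTheory.integral_fintype_prod_volume_eq_prod
    (f := fun σ (x : ℝ) => Complex.exp (Real.pi * Complex.I * w σ * (x : ℂ) ^ 2 +
      -(2 * Real.pi * Complex.I * η σ) * x + 0))]
  rw [rootFactor, gauss, e, Finset.mul_sum, Complex.exp_sum, ← Finset.prod_mul_distrib]
  refine Finset.prod_congr rfl fun σ _ => ?_
  rw [integral_cexp_quadratic (hb σ)]
  have hw0 : w σ ≠ 0 := by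
    intro h'; have := hw σ; rw [h'] at this; simp at this
  have hpi : (Real.pi : ℂ) ≠ 0 := by exact_mod_cast Real.pi_ne_zero
  congr 1
  · have h1 : (Real.pi : ℂ) / -(Real.pi * Complex.I * w σ) = (-Complex.I * w σ)⁻¹ := by
      have := neg_I_mul_ne_zero hw σ
      rw [div_eq_iff (by simp [hpi, hw0])]
      field_simp
    rw [h1, Complex.inv_cpow, ← Complex.cpow_neg]
    intro harg
    have := neg_I_mul_re_pos hw σ
    rw [Complex.arg_eq_pi_iff] at harg
    linarith [harg.1]
  · congr 1
    have hI := Complex.I_ne_zero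
    field_simp
    linear_combination (0 : ℂ) * Complex.I_sq

lemma integrable_gauss {w : (F →+* ℝ) → ℂ} (hw : w ∈ upperHalf F) (η : (F →+* ℝ) → ℝ) :
    MeasureTheory.Integrable fun v => gauss w v * e (fun σ => -((η σ * v σ : ℝ) : ℂ)) := by
  have hb : ∀ σ, (Real.pi * Complex.I * w σ).re < 0 := by
    intro σ
    have h1 := neg_I_mul_re_pos hw σ
    have : (Real.pi * Complex.I * w σ : ℂ) = ((-Real.pi : ℝ) : ℂ) * (-Complex.I * w σ) := by
      push_cast; ring
    rw [this, Complex.re_ofReal_mul]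
    exact mul_neg_of_neg_of_pos (by linarith [Real.pi_pos]) h1
  simp only [gauss_mul_char]
  exact MeasureTheory.Integrable.fintype_prod
    (f := fun σ (x : ℝ) => Complex.exp (Real.pi * Complex.I * w σ * (x : ℂ) ^ 2 +
      -(2 * Real.pi * Complex.I * η σ) * x + 0)) fun σ => integrable_cexp_quadratic' (hb σ) _ _

lemma continuous_gauss (w : (F →+* ℝ) → ℂ) : Continuous (gauss w) := by
  unfold gauss e; fun_prop

variable [NumberField.IsTotallyReal F]

/-- A uniform bound for the translates of a Gaussian. -/
lemma norm_gauss_add_le {κ R : ℝ} (hκ : 0 < κ) {w : (F →+* ℝ) → ℂ} (hw : ∀ σ, κ ≤ (w σ).im)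
    {x : (F →+* ℝ) → ℝ} (hx : ∀ σ, |x σ| ≤ R) (r : 𝓞 F) :
    ‖gauss w fun σ => x σ + σ (r : F)‖ ≤
      Real.exp (Real.pi * κ * ∑ _σ : F →+* ℝ, (R + 1)) *
        Real.exp (-(Real.pi * κ * ∑ σ : F →+* ℝ, |σ (r : F)|)) := by
  rw [norm_gauss, ← Real.exp_add, Real.exp_le_exp, ← sub_eq_add_neg, ← mul_sub,
    ← Finset.sum_sub_distrib, mul_assoc, ← mul_neg]
  refine mul_le_mul_of_nonneg_left ?_ Real.pi_pos.le
  rw [← Finset.sum_neg_distrib, Finset.mul_sum]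
  refine Finset.sum_le_sum fun σ _ => ?_
  have h1 : |σ (r : F)| ≤ |x σ + σ (r : F)| + R := by
    have h := abs_sub (x σ + σ (r : F)) (x σ)
    rw [add_sub_cancel_left] at h
    linarith [hx σ]
  -- t ≤ t² + 1 trades the quadratic exponent for a linear one, uniformly for bounded `x`.
  have h2 : |x σ + σ (r : F)| ≤ (x σ + σ (r : F)) ^ 2 + 1 := by
    rw [← sq_abs (x σ + σ (r : F))]
    nlinarith [sq_nonneg (|x σ + σ (r : F)| - 1), abs_nonneg (x σ + σ (r : F))]
  have h3 := mul_le_mul_of_nonneg_right (hw σ) (sq_nonneg (x σ + σ (r : F)))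
  have h4 : κ * |σ (r : F)| ≤ κ * ((x σ + σ (r : F)) ^ 2 + 1 + R) := by gcongr; linarith
  linarith

lemma exists_im_lower_bound {w : (F →+* ℝ) → ℂ} (hw : w ∈ upperHalf F) :
    ∃ κ : ℝ, 0 < κ ∧ ∀ σ, κ ≤ (w σ).im := by
  obtain ⟨σ₁, h1⟩ := Finite.exists_min fun σ : F →+* ℝ => (w σ).im
  exact ⟨_, hw σ₁, h1⟩

lemma exists_abs_upper_bound (x : (F →+* ℝ) → ℝ) : ∃ R : ℝ, ∀ σ, |x σ| ≤ R := by
  obtain ⟨σ₁, h1⟩ := Finite.exists_max fun σ : F →+* ℝ => |x σ|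
  exact ⟨_, h1⟩

lemma summable_gauss_add {w : (F →+* ℝ) → ℂ} (hw : w ∈ upperHalf F) (x : (F →+* ℝ) → ℝ) :
    Summable fun r : 𝓞 F => gauss w fun σ => x σ + σ (r : F) := by
  obtain ⟨κ, hκ, hκw⟩ := exists_im_lower_bound hw
  obtain ⟨R, hR⟩ := exists_abs_upper_bound x
  exact Summable.of_norm_bounded ((summable_exp_neg_absSum (by positivity)).mul_left _)
    fun r => norm_gauss_add_le hκ hκw hR r

lemma continuous_tsum_gauss {w : (F →+* ℝ) → ℂ} (hw : w ∈ upperHalf F) :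
    Continuous fun x : (F →+* ℝ) → ℝ => ∑' r : 𝓞 F, gauss w fun σ => x σ + σ (r : F) := by
  obtain ⟨κ, hκ, hκw⟩ := exists_im_lower_bound hw
  rw [continuous_iff_continuousAt]
  intro x₀
  obtain ⟨R, hR⟩ := exists_abs_upper_bound x₀
  have hon : ContinuousOn (fun x : (F →+* ℝ) → ℝ => ∑' r : 𝓞 F, gauss w fun σ => x σ + σ (r : F))
      {x | ∀ σ, |x σ| < R + 1} := by
    refine continuousOn_tsum (fun r => ((continuous_gauss w).comp (by fun_prop)).continuousOn)
      ((summable_exp_neg_absSum (F := F) (c := Real.pi * κ) (by positivity)).mul_left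
        (Real.exp (Real.pi * κ * ∑ _σ : F →+* ℝ, ((R + 1) + 1)))) fun r x hx => ?_
    exact norm_gauss_add_le hκ hκw (fun σ => (hx σ).le) r
  refine hon.continuousAt (IsOpen.mem_nhds ?_ fun σ => by linarith [hR σ])
  rw [show {x : (F →+* ℝ) → ℝ | ∀ σ, |x σ| < R + 1} = ⋂ σ, {x | |x σ| < R + 1} by ext; simp]
  exact isOpen_iInter_of_finite fun σ => isOpen_lt (by fun_prop) continuous_const

variable {δ : 𝓞 F} (hδ : Ideal.span {δ} = differentIdeal ℤ (𝓞 F))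
include hδ

lemma summable_gauss_dual {w : (F →+* ℝ) → ℂ} (hw : w ∈ upperHalf F) :
    Summable fun ζ : 𝓞 F => gauss w fun σ => σ (ζ : F) / σ (δ : F) := by
  have hδ0 : (δ : F) ≠ 0 := by exact_mod_cast delta_ne_zero hδ
  have hw' : (fun σ => w σ * (((σ (δ : F) ^ 2)⁻¹ : ℝ) : ℂ)) ∈ upperHalf F := by
    intro σ
    simp only
    rw [Complex.im_mul_ofReal]
    have h1 := hw σ
    have := emb_ne_zero σ hδ0
    positivity
  have := summable_gauss_add hw' (fun _ => 0)
  convert! this using 1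
  funext ζ
  rw [gauss, gauss]
  congr 1
  funext σ
  have := emb_ne_zero σ hδ0
  push_cast
  field_simp
  ring

/-- Poisson summation for Gaussians. -/
theorem exists_poisson_gauss : ∃ K : ℝ, 0 < K ∧ ∀ w ∈ upperHalf F, ∀ x : (F →+* ℝ) → ℝ,
    HasSum (fun ζ : 𝓞 F => K * rootFactor w * (gauss (fun σ => -1 / w σ)
        (fun σ => σ (ζ : F) / σ (δ : F)) * e fun σ => ((σ (ζ : F) / σ (δ : F) * x σ : ℝ) : ℂ)))
      (∑' r : 𝓞 F, gauss w fun σ => x σ + σ (r : F)) := by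
  obtain ⟨K, hK, hKint, hKi⟩ := exists_integral_comp_equiv (latEquiv F)
  obtain ⟨D, hD⟩ := exists_dualCoord hδ
  refine ⟨K, hK, fun w hw x => ?_⟩
  -- The periodization of the Gaussian in lattice coordinates; its Fourier coefficients are computed
  -- by unfolding.
  let φ : (BIdx F → ℝ) → ℂ := fun s => ∑' r : 𝓞 F, gauss w fun σ => latEquiv F s σ + σ (r : F)
  have hφc : Continuous φ := (continuous_tsum_gauss hw).comp (latEquiv F).continuous
  have hshift : ∀ (s : BIdx F → ℝ) (k : BIdx F → ℤ) (σ : F →+* ℝ),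
      latEquiv F (s + fun i => (k i : ℝ)) σ =
        latEquiv F s σ + σ (((intCoord F).symm k : 𝓞 F) : F) := by
    intro s k σ
    rw [map_add, Pi.add_apply]
    have := latEquiv_intCoord ((intCoord F).symm k) σ
    rw [Equiv.apply_symm_apply] at this
    rw [this]
  have hφp : ∀ (s : BIdx F → ℝ) (k : BIdx F → ℤ), φ (fun i => s i + k i) = φ s := by
    intro s k
    simp only [φ]
    rw [← (Equiv.addLeft ((intCoord F).symm k)).tsum_eq
      (fun r : 𝓞 F => gauss w fun σ => latEquiv F s σ + σ (r : F))]
    refine tsum_congr fun r => ?_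
    congr 1
    funext σ
    rw [show (fun i => s i + (k i : ℝ)) = s + fun i => (k i : ℝ) from rfl, hshift]
    simp only [Equiv.coe_addLeft, map_add]
    ring
  have hcoef : ∀ ζ : 𝓞 F, torusCoeff φ (D ζ) =
      K * rootFactor w * gauss (fun σ => -1 / w σ) (fun σ => σ (ζ : F) / σ (δ : F)) := by
    intro ζ
    let g : (BIdx F → ℝ) → ℂ := fun s => torusChar (-(D ζ)) s * gauss w (latEquiv F s)
    have hchar : ∀ s, torusChar (-(D ζ)) s =
        e (fun σ => -((σ (ζ : F) / σ (δ : F) * latEquiv F s σ : ℝ) : ℂ)) := by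
      intro s
      have h1 := hD ζ s
      have h2 : ∑ i, (((-(D ζ)) i : ℤ) : ℝ) * s i =
          -∑ σ : F →+* ℝ, σ (ζ : F) / σ (δ : F) * latEquiv F s σ := by
        rw [← h1, ← Finset.sum_neg_distrib]
        refine Finset.sum_congr rfl fun i _ => ?_
        simp
      rw [torusChar, h2, e]
      push_cast
      rw [Finset.sum_neg_distrib]
    have hgint : MeasureTheory.Integrable g := by
      have := hKi _ (integrable_gauss hw fun σ => σ (ζ : F) / σ (δ : F))
      convert! this using 1
      funext s
      simp only [g, hchar]
      ring
    have htile := hasSum_integral_unitCube hgint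
    rw [← (intCoord F).hasSum_iff] at htile
    have hg : ∀ (r : 𝓞 F) (s : BIdx F → ℝ), g (s + fun i => (intCoord F r i : ℝ)) =
        torusChar (-(D ζ)) s * gauss w fun σ => latEquiv F s σ + σ (r : F) := by
      intro r s
      simp only [g]
      congr 1
      · have : (∑ i, ((-(D ζ)) i : ℝ) * (s + fun i => (intCoord F r i : ℝ)) i) =
          (∑ i, ((-(D ζ)) i : ℝ) * s i) + ((∑ i, (-(D ζ)) i * intCoord F r i : ℤ) : ℝ) := by
          push_cast
          rw [← Finset.sum_add_distrib]
          refine Finset.sum_congr rfl fun i _ => ?_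
          simp only [Pi.add_apply]
          ring
        rw [torusChar, this, Complex.ofReal_add, mul_add, Complex.exp_add, torusChar]
        have h1 : Complex.exp (2 * Real.pi * Complex.I *
            (((∑ i, (-(D ζ)) i * intCoord F r i : ℤ) : ℝ) : ℂ)) = 1 := by
          rw [← Complex.exp_int_mul_two_pi_mul_I (∑ i, (-(D ζ)) i * intCoord F r i)]
          congr 1
          push_cast
          ring
        rw [h1, mul_one]
      · congr 1
        funext σ
        rw [hshift, Equiv.symm_apply_apply]
    obtain ⟨κ, hκ, hκw⟩ := exists_im_lower_bound hw
    obtain ⟨R, hR⟩ : ∃ R : ℝ, ∀ s ∈ unitCube (BIdx F), ∀ σ, |latEquiv F s σ| ≤ R := by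
      obtain ⟨R, hR⟩ := (isCompact_Icc (a := (0 : BIdx F → ℝ)) (b := 1)).exists_bound_of_continuousOn
        (latEquiv F).continuous.continuousOn
      exact ⟨R, fun s hs σ => (norm_le_pi_norm (latEquiv F s) σ).trans (hR s (unitCube_subset hs))⟩
    have hcr : ∀ r : 𝓞 F, Continuous fun s => torusChar (-(D ζ)) s *
        gauss w fun σ => latEquiv F s σ + σ (r : F) := by
      intro r
      refine (continuous_torusChar _).mul ((continuous_gauss w).comp ?_)
      exact (latEquiv F).continuous.add (continuous_const (y := fun σ : F →+* ℝ => σ (r : F)))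
    have : Countable (𝓞 F) := (intCoord F).injective.countable
    have hswap := MeasureTheory.hasSum_integral_of_summable_integral_norm
      (μ := MeasureTheory.volume.restrict (unitCube (BIdx F)))
      (F := fun (r : 𝓞 F) s => torusChar (-(D ζ)) s *
        gauss w fun σ => latEquiv F s σ + σ (r : F))
      (fun r => integrableOn_unitCube (hcr r).continuousOn)
      (by
        refine Summable.of_norm_bounded ((summable_exp_neg_absSum (F := F)
          (c := Real.pi * κ) (by positivity)).mul_left
          (Real.exp (Real.pi * κ * ∑ _σ : F →+* ℝ, (R + 1)))) fun r => ?_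
        refine norm_setIntegral_unitCube_le fun s hs => ?_
        rw [norm_norm, norm_mul, norm_torusChar, one_mul]
        exact norm_gauss_add_le hκ hκw (hR s hs) r)
    -- The sum over `r` is evaluated twice: by exchanging it with the integral over the cube, and by
    -- tiling the whole space with translates of the cube.
    have hun : torusCoeff φ (D ζ) = ∫ s, g s := by
      have h1 : (fun r : 𝓞 F => ∫ s in unitCube (BIdx F), torusChar (-(D ζ)) s *
          gauss w fun σ => latEquiv F s σ + σ (r : F)) =
          (fun k : BIdx F → ℤ => ∫ s in unitCube (BIdx F), g (s + fun i => (k i : ℝ))) ∘ intCoord F := by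
        funext r
        simp only [Function.comp_apply, hg]
      rw [h1] at hswap
      rw [← hswap.unique htile, torusCoeff]
      congr 1
      funext s
      rw [tsum_mul_left]
    rw [hun, mul_assoc, ← integral_gauss hw, ← hKint]
    congr 1
    funext s
    simp only [g, hchar]
    ring
  have hsum : Summable (torusCoeff φ) := by
    rw [← D.summable_iff]
    have := (summable_gauss_dual hδ (neg_inv_mem hw)).mul_left (K * rootFactor w)
    convert! this using 1
    funext ζ
    simp only [Function.comp_apply, hcoef]
  have key := hasSum_torusCoeff hφc hφp hsum ((latEquiv F).symm x)
  rw [← D.hasSum_iff] at key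
  have hφx : φ ((latEquiv F).symm x) = ∑' r : 𝓞 F, gauss w fun σ => x σ + σ (r : F) := by
    simp only [φ, ContinuousLinearEquiv.apply_symm_apply]
  rw [hφx] at key
  convert! key using 1
  funext ζ
  simp only [Function.comp_apply]
  rw [hcoef, torusChar, hD, ContinuousLinearEquiv.apply_symm_apply, e]
  push_cast
  ring

end Gauss

/-! ### The zeros of the theta series have empty interior. -/

section ThetaDense

variable {F : Type*} [Field F] [NumberField F] [NumberField.IsTotallyReal F]

lemma eHalf_sq (x : 𝓞 F) (z : (F →+* ℝ) → ℂ) :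
    eHalf (x ^ 2) z = gauss z fun σ => 0 + σ (x : F) := by
  rw [eHalf, gauss]
  congr 1
  funext σ
  simp

lemma theta_eq (z : (F →+* ℝ) → ℂ) : theta z = ∑' r : 𝓞 F, gauss z fun σ => 0 + σ (r : F) := by
  simp only [theta, eHalf_sq]

/-- At the point (i, …, i) all terms are positive reals. -/
lemma theta_I_ne_zero : theta (fun _ : F →+* ℝ => Complex.I) ≠ 0 := by
  have hmem : (fun _ : F →+* ℝ => Complex.I) ∈ upperHalf F := fun σ => by simp
  have h1 : ∀ r : 𝓞 F, (gauss (fun _ : F →+* ℝ => Complex.I) fun σ => 0 + σ (r : F)) =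
      ((Real.exp (-(Real.pi * ∑ σ : F →+* ℝ, σ (r : F) ^ 2)) : ℝ) : ℂ) := by
    intro r
    rw [gauss, e, Complex.ofReal_exp]
    congr 1
    push_cast
    rw [Finset.mul_sum, Finset.mul_sum, ← Finset.sum_neg_distrib]
    refine Finset.sum_congr rfl fun σ _ => ?_
    linear_combination (Real.pi * (σ (r : F) : ℂ) ^ 2) * Complex.I_mul_I
  have hs := summable_gauss_add hmem (fun _ => 0)
  simp only [h1] at hs
  rw [theta_eq]
  simp only [h1]
  rw [← Complex.ofReal_tsum]
  rw [Complex.ofReal_ne_zero]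
  have hs' := Complex.summable_ofReal.mp hs
  exact (hs'.tsum_pos (fun r => (Real.exp_pos _).le) 0 (Real.exp_pos _)).ne'

/-- The zeros of `θ` have empty interior. -/
lemma upperHalf_subset_closure : upperHalf F ⊆ closure {z | z ∈ upperHalf F ∧ theta z ≠ 0} := by
  intro z₀ hz₀
  by_contra hcl
  rw [mem_closure_iff_nhds] at hcl
  push Not at hcl
  obtain ⟨N, hN, hempty⟩ := hcl
  obtain ⟨κ₀, hκ₀, hκz⟩ := exists_im_lower_bound hz₀
  -- `κ` lies below 1 and below all imaginary parts of `z₀`. The region where the imaginary parts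
  -- exceed it therefore contains `z₀` and (i, …, i), and the theta series has a uniform majorant
  -- there.
  set κ := min κ₀ 1 / 2 with hκdef
  have hκ : 0 < κ := by positivity
  have hκ1 : κ < κ₀ := by
    have := min_le_left κ₀ 1
    have := lt_min hκ₀ one_pos
    rw [hκdef]; linarith
  have hκ2 : κ < 1 := by
    have := min_le_right κ₀ 1
    have := lt_min hκ₀ one_pos
    rw [hκdef]; linarith
  -- Vanishing near `z₀` would propagate, by the identity theorem in one variable, along the complex
  -- line through `z₀` (w = 0) and (i, …, i) (w = 1).
  let pt : ℂ → (F →+* ℝ) → ℂ := fun w σ => z₀ σ + w * (Complex.I - z₀ σ)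
  let U : Set ℂ := {w | ∀ σ, κ < (pt w σ).im}
  have hUeq : U = ⋂ σ, {w : ℂ | κ < (pt w σ).im} := by ext; simp [U]
  have hU : IsOpen U := by
    rw [hUeq]
    exact isOpen_iInter_of_finite fun σ => isOpen_lt continuous_const (by simp only [pt]; fun_prop)
  have hconv : Convex ℝ U := by
    rw [hUeq]
    refine convex_iInter fun σ => ?_
    have : {w : ℂ | κ < (pt w σ).im} = (fun w : ℂ => w * (Complex.I - z₀ σ)) ⁻¹'
        {u : ℂ | κ - (z₀ σ).im < u.im} := by
      ext w
      simp only [pt, Set.mem_ofPred_eq, Set.mem_preimage, Complex.add_im]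
      constructor <;> intro h <;> linarith
    rw [this]
    have hlin : (fun w : ℂ => w * (Complex.I - z₀ σ)) =
        (LinearMap.mulRight ℝ (Complex.I - z₀ σ) : ℂ →ₗ[ℝ] ℂ) := rfl
    rw [hlin]
    exact (convex_halfSpace_gt (f := Complex.im) ⟨Complex.add_im, fun c z => by simp⟩ _).linear_preimage _
  have hdiff : DifferentiableOn ℂ (fun w => theta (pt w)) U := by
    simp only [theta_eq]
    refine Complex.differentiableOn_tsum_of_summable_norm ((summable_exp_neg_absSum (F := F)
      (c := Real.pi * κ) (by positivity)).mul_left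
      (Real.exp (Real.pi * κ * ∑ _σ : F →+* ℝ, ((0 : ℝ) + 1)))) (fun r => ?_) hU fun r w hw => ?_
    · simp only [gauss, e, pt]
      fun_prop
    · exact norm_gauss_add_le hκ (fun σ => (hw σ).le) (fun σ => by simp) r
  have h0 : (0 : ℂ) ∈ U := fun σ => by
    simp only [pt, zero_mul, add_zero]
    exact hκ1.trans_le (hκz σ)
  have h1 : (1 : ℂ) ∈ U := fun σ => by
    simp only [pt, one_mul, add_sub_cancel, Complex.I_im]
    exact hκ2
  have hev : ∀ᶠ w in nhds (0 : ℂ), theta (pt w) = 0 := by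
    have hpc : Continuous pt := by simp only [pt]; fun_prop
    have hp0 : pt 0 = z₀ := by funext σ; simp [pt]
    have hN' : ∀ᶠ w in nhds (0 : ℂ), pt w ∈ N :=
      hpc.continuousAt.eventually (by rw [hp0]; exact hN)
    filter_upwards [hN', hU.mem_nhds h0] with w hw hwU
    by_contra hne
    have : pt w ∈ N ∩ {z | z ∈ upperHalf F ∧ theta z ≠ 0} :=
      ⟨hw, fun σ => hκ.trans (hwU σ), hne⟩
    rw [hempty] at this
    exact this
  have hz := (hdiff.analyticOnNhd hU).eqOn_zero_of_preconnected_of_eventuallyEq_zero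
    hconv.isPreconnected h0 hev h1
  apply theta_I_ne_zero (F := F)
  have hp1 : pt 1 = fun _ => Complex.I := by funext σ; simp [pt]
  simpa [hp1] using hz

/-- Two continuous functions agree if they agree off the zeros of `θ`. -/
lemma eqOn_of_theta_ne_zero {E : Type*} [TopologicalSpace E] [T2Space E]
    {f g : ((F →+* ℝ) → ℂ) → E} (hf : ContinuousOn f (upperHalf F))
    (hg : ContinuousOn g (upperHalf F))
    (h : ∀ z ∈ upperHalf F, theta z ≠ 0 → f z = g z) : ∀ z ∈ upperHalf F, f z = g z := by
  have := Set.EqOn.of_subset_closure (s := {z | z ∈ upperHalf F ∧ theta z ≠ 0})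
    (t := upperHalf F) (f := f) (g := g) (fun z hz => h z hz.1 hz.2) hf hg (fun z hz => hz.1)
    upperHalf_subset_closure
  exact fun z hz => this hz

end ThetaDense

/-! ### The additive character of F and its triviality on the inverse different. -/

section RatChar

variable {F : Type*} [Field F]

variable (F) in
/-- The ring of integers as a subring of the field. -/
def intSub : Subring F := (algebraMap (𝓞 F) F).range

lemma coe_mem_intSub (x : 𝓞 F) : (x : F) ∈ intSub F := ⟨x, rfl⟩

variable [NumberField F]

/-- The character `x ↦ e(x)` of the field. -/
def eF (x : F) : ℂ := e fun σ => (σ x : ℂ)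

lemma eF_add (x y : F) : eF (x + y) = eF x * eF y := by
  rw [eF, eF, eF, ← e_add]
  congr 1
  funext σ
  simp

lemma eF_neg (x : F) : eF (-x) = (starRingEnd ℂ) (eF x) := by
  rw [eF, eF, e, e, ← Complex.exp_conj]
  congr 1
  simp only [Complex.ofReal_neg, map_neg, Finset.sum_neg_distrib, map_mul, map_sum, Complex.conj_ofReal,
    Complex.conj_I, map_ofNat]
  ring

variable [NumberField.IsTotallyReal F]
variable {δ : 𝓞 F} (hδ : Ideal.span {δ} = differentIdeal ℤ (𝓞 F))
include hδ

lemma eF_eq_one {x : F} (hx : (δ : F) * x ∈ intSub F) : eF x = 1 := by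
  obtain ⟨ζ, hζ⟩ := hx
  obtain ⟨m, hm⟩ := exists_int_sum_div hδ ζ
  have hδ0 : (δ : F) ≠ 0 := by exact_mod_cast delta_ne_zero hδ
  rw [eF]
  refine e_ofReal_eq_one_of_int (m := m) ?_
  rw [← hm]
  refine Finset.sum_congr rfl fun σ _ => ?_
  have h := congr_arg σ hζ
  rw [map_mul] at h
  rw [eq_div_iff (emb_ne_zero σ hδ0), mul_comm, ← h]

lemma eF_congr {x y : F} (hx : (δ : F) * (x - y) ∈ intSub F) : eF x = eF y := by
  rw [show x = (x - y) + y by ring, eF_add, eF_eq_one hδ hx, one_mul]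

end RatChar

/-! ### Transformation of theta under SL₂(F). -/

section ThetaTransform

variable {F : Type*} [Field F]

/-- The point `-1 / (c (c z + d))`. -/
def shiftPoint (α : Matrix.SpecialLinearGroup (Fin 2) F) (z : (F →+* ℝ) → ℂ) : (F →+* ℝ) → ℂ :=
  fun σ => -1 / ((σ (α 1 0) : ℂ) * den α z σ)

/-- A consequence of ad - bc = 1. The rational summand a/c produces the Gauss sums, while the other
summand is what Poisson summation inverts. -/
lemma moebius_eq_add_shiftPoint {α : Matrix.SpecialLinearGroup (Fin 2) F} (hc : α 1 0 ≠ 0)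
    {z : (F →+* ℝ) → ℂ} (hz : z ∈ upperHalf F) (σ : F →+* ℝ) :
    moebius α z σ = (σ (α 0 0 / α 1 0) : ℂ) + shiftPoint α z σ := by
  have h1 := den_ne_zero α hz σ
  have h2 : (σ (α 1 0) : ℂ) ≠ 0 := by exact_mod_cast emb_ne_zero σ hc
  have h3 : (σ (α 0 0) : ℂ) * σ (α 1 1) - σ (α 0 1) * σ (α 1 0) = 1 := by exact_mod_cast emb_det α σ
  rw [moebius_apply, shiftPoint, map_div₀, Complex.ofReal_div]
  field_simp
  rw [den]
  linear_combination (-1 : ℂ) * h3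

lemma shiftPoint_mem {α : Matrix.SpecialLinearGroup (Fin 2) F} (hc : α 1 0 ≠ 0)
    {z : (F →+* ℝ) → ℂ} (hz : z ∈ upperHalf F) : shiftPoint α z ∈ upperHalf F := by
  intro σ
  have h := moebius_mem α hz σ
  rw [moebius_eq_add_shiftPoint hc hz] at h
  simpa using h

variable [NumberField F]

/-- The automorphy factor attached to `α`, up to a constant. -/
def jFactor (M : F) (α : Matrix.SpecialLinearGroup (Fin 2) F) (z : (F →+* ℝ) → ℂ) : ℂ :=
  rootFactor fun σ => ((σ M ^ 2 : ℝ) : ℂ) * shiftPoint α z σ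

lemma smul_mem_upperHalf {r : (F →+* ℝ) → ℝ} (hr : ∀ σ, 0 < r σ) {z : (F →+* ℝ) → ℂ}
    (hz : z ∈ upperHalf F) : (fun σ => (r σ : ℂ) * z σ) ∈ upperHalf F := by
  intro σ
  simp only [Complex.im_ofReal_mul]
  exact mul_pos (hr σ) (hz σ)

lemma sq_smul_mem_upperHalf {M : F} (hM : M ≠ 0) {z : (F →+* ℝ) → ℂ}
    (hz : z ∈ upperHalf F) : (fun σ => ((σ M ^ 2 : ℝ) : ℂ) * z σ) ∈ upperHalf F := by
  refine smul_mem_upperHalf (r := fun σ => σ M ^ 2) (fun σ => ?_) hz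
  have := emb_ne_zero σ hM
  positivity

lemma jFactor_ne_zero {M : F} (hM : M ≠ 0) {α : Matrix.SpecialLinearGroup (Fin 2) F}
    (hc : α 1 0 ≠ 0) {z : (F →+* ℝ) → ℂ} (hz : z ∈ upperHalf F) : jFactor M α z ≠ 0 :=
  rootFactor_ne_zero (sq_smul_mem_upperHalf hM (shiftPoint_mem hc hz))

lemma differentiableOn_jFactor {M : F} (hM : M ≠ 0) {α : Matrix.SpecialLinearGroup (Fin 2) F}
    (hc : α 1 0 ≠ 0) : DifferentiableOn ℂ (jFactor M α) (upperHalf F) := by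
  have h : DifferentiableOn ℂ (fun z : (F →+* ℝ) → ℂ => fun σ =>
      ((σ M ^ 2 : ℝ) : ℂ) * shiftPoint α z σ) (upperHalf F) := by
    refine differentiableOn_pi.mpr fun σ => ?_
    unfold shiftPoint den
    have hd : Differentiable ℂ fun z : (F →+* ℝ) → ℂ =>
        (σ (α 1 0) : ℂ) * ((σ (α 1 0) : ℂ) * z σ + (σ (α 1 1) : ℂ)) := by fun_prop
    have h2 : (σ (α 1 0) : ℂ) ≠ 0 := by exact_mod_cast emb_ne_zero σ hc
    simp only [div_eq_mul_inv]
    intro z hz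
    exact (((hd z).differentiableWithinAt.fun_inv
      (mul_ne_zero h2 (den_ne_zero α hz σ))).const_mul _).const_mul _
  exact differentiableOn_rootFactor.comp h fun z hz =>
    sq_smul_mem_upperHalf hM (shiftPoint_mem hc hz)

/-- The absolute value of the automorphy factor. -/
lemma norm_jFactor {M : F} {α : Matrix.SpecialLinearGroup (Fin 2) F} (z : (F →+* ℝ) → ℂ) :
    ‖jFactor M α z‖ =
      (∏ σ : F →+* ℝ, |σ M| ^ 2)⁻¹ ^ (1 / 2 : ℝ) * (∏ σ : F →+* ℝ, |σ (α 1 0)|) ^ (1 / 2 : ℝ) *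
        absFactor α z := by
  rw [jFactor, norm_rootFactor, absFactor_eq, ← Real.mul_rpow (by positivity) (by positivity),
    ← Real.mul_rpow (by positivity) (by positivity), Real.rpow_neg (by positivity),
    ← Real.inv_rpow (by positivity)]
  congr 1
  simp only [shiftPoint, norm_mul, norm_div, norm_neg, norm_one, Complex.norm_real, Real.norm_eq_abs,
    Finset.prod_mul_distrib, Finset.prod_div_distrib, Finset.prod_const_one, abs_pow]
  field_simp

/-- The coefficients of the transformed theta series. -/
def thetaCoeff (δ M : 𝓞 F) (α : Matrix.SpecialLinearGroup (Fin 2) F) (ζ : 𝓞 F) : ℂ :=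
  ∑' q : 𝓞 F ⧸ Ideal.span {M}, eF ((q.out : F) ^ 2 * α 0 0 / (2 * α 1 0)) *
    eF ((ζ : F) * (q.out : F) / ((δ : F) * (M : F)))

/-- The transformed theta series, up to a constant. -/
def thetaTransform (δ M : 𝓞 F) (α : Matrix.SpecialLinearGroup (Fin 2) F) (z : (F →+* ℝ) → ℂ) : ℂ :=
  ∑' ζ : 𝓞 F, thetaCoeff δ M α ζ * (eF ((ζ : F) ^ 2 * (α 1 0 * α 1 1) / (2 * (M : F) ^ 2 * (δ : F) ^ 2)) *
    gauss (fun σ => ((σ (α 1 0) ^ 2 / σ (M : F) ^ 2 : ℝ) : ℂ) * z σ) fun σ => σ (ζ : F) / σ (δ : F))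

lemma finite_quotient_span {M : 𝓞 F} (hM : M ≠ 0) : Finite (𝓞 F ⧸ Ideal.span {M}) :=
  Ideal.finiteQuotientOfFreeOfNeBot _ (by simpa using hM)

/-- Decomposition of the integers into residue classes. -/
def residueEquiv {M : 𝓞 F} (hM : M ≠ 0) : (𝓞 F ⧸ Ideal.span {M}) × 𝓞 F ≃ 𝓞 F :=
  Equiv.ofBijective (fun p => p.1.out + M * p.2) ⟨by
    rintro ⟨q, r⟩ ⟨q', r'⟩ h
    simp only at h
    have h1 : q = q' := by
      have := congr_arg (Ideal.Quotient.mk (Ideal.span {M})) h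
      have hM0 : Ideal.Quotient.mk (Ideal.span {M}) M = 0 :=
        Ideal.Quotient.eq_zero_iff_mem.mpr (Ideal.mem_span_singleton_self M)
      simp only [map_add, map_mul, hM0, zero_mul, add_zero] at this
      have e1 : ∀ q : 𝓞 F ⧸ Ideal.span {M}, Ideal.Quotient.mk (Ideal.span {M}) q.out = q :=
        fun q => Quotient.out_eq' q
      rwa [e1, e1] at this
    subst h1
    have h2 := add_left_cancel h
    rw [mul_right_inj' hM] at h2
    rw [h2], by
    intro x
    have hx : x - (Ideal.Quotient.mk (Ideal.span {M}) x).out ∈ Ideal.span {M} := by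
      rw [← Ideal.Quotient.eq]
      exact (Quotient.out_eq' _).symm
    obtain ⟨r, hr⟩ := Ideal.mem_span_singleton.mp hx
    exact ⟨(Ideal.Quotient.mk (Ideal.span {M}) x, r), by simp only; rw [← hr]; ring⟩⟩

lemma residueEquiv_apply {M : 𝓞 F} (hM : M ≠ 0) (q : 𝓞 F ⧸ Ideal.span {M}) (r : 𝓞 F) :
    residueEquiv hM (q, r) = q.out + M * r := rfl

variable [NumberField.IsTotallyReal F]

lemma gauss_moebius {α : Matrix.SpecialLinearGroup (Fin 2) F} (hc : α 1 0 ≠ 0)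
    {z : (F →+* ℝ) → ℂ} (hz : z ∈ upperHalf F) (x : F) :
    (gauss (moebius α z) fun σ => 0 + σ x) =
      eF (x ^ 2 * α 0 0 / (2 * α 1 0)) * gauss (shiftPoint α z) fun σ => σ x := by
  rw [gauss, eF, gauss, ← e_add]
  congr 1
  funext σ
  have h2 : (σ (α 1 0) : ℂ) ≠ 0 := by exact_mod_cast emb_ne_zero σ hc
  rw [moebius_eq_add_shiftPoint hc hz, Pi.add_apply]
  simp only [map_div₀, map_mul, map_pow, map_ofNat, zero_add]
  push_cast
  field_simp

variable {δ : 𝓞 F} (hδ : Ideal.span {δ} = differentIdeal ℤ (𝓞 F))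
include hδ

/-- The transformation of `θ` under an element of `SL₂(F)`. -/
theorem exists_theta_moebius : ∃ K : ℝ, 0 < K ∧
    ∀ (α : Matrix.SpecialLinearGroup (Fin 2) F) (M : 𝓞 F), α 1 0 ≠ 0 → M ≠ 0 →
      (δ : F) * (M * α 0 0 / α 1 0) ∈ intSub F →
      (δ : F) * ((M : F) ^ 2 * α 0 0 / (2 * α 1 0)) ∈ intSub F →
      ∀ z ∈ upperHalf F,
        theta (moebius α z) = jFactor (M : F) α z * (K * thetaTransform δ M α z) := by
  obtain ⟨K, hK, hP⟩ := exists_poisson_gauss hδ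
  refine ⟨K, hK, fun α M hc hM h1 h2 z hz => ?_⟩
  have hδ0 : (δ : F) ≠ 0 := by exact_mod_cast delta_ne_zero hδ
  have hM0 : (M : F) ≠ 0 := by exact_mod_cast hM
  have := finite_quotient_span hM
  have := Fintype.ofFinite (𝓞 F ⧸ Ideal.span {M})
  set w := shiftPoint α z with hw
  have hwm : w ∈ upperHalf F := shiftPoint_mem hc hz
  have hMw := sq_smul_mem_upperHalf hM0 hwm
  have hper : ∀ x r : 𝓞 F, eF ((((x + M * r : 𝓞 F)) : F) ^ 2 * α 0 0 / (2 * α 1 0)) =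
      eF ((x : F) ^ 2 * α 0 0 / (2 * α 1 0)) := by
    intro x r
    apply eF_congr hδ
    have hx := coe_mem_intSub x
    have hr := coe_mem_intSub r
    have : (δ : F) * ((((x + M * r : 𝓞 F)) : F) ^ 2 * α 0 0 / (2 * α 1 0) -
        (x : F) ^ 2 * α 0 0 / (2 * α 1 0)) =
        ((δ : F) * (M * α 0 0 / α 1 0)) * (x * r) +
          ((δ : F) * ((M : F) ^ 2 * α 0 0 / (2 * α 1 0))) * (r : F) ^ 2 := by
      simp only [map_add, map_mul]
      field_simp
      ring
    rw [this]
    exact add_mem (mul_mem h1 (mul_mem hx hr)) (mul_mem h2 (pow_mem hr 2))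
  have hsum : Summable fun x : 𝓞 F => eF ((x : F) ^ 2 * α 0 0 / (2 * α 1 0)) *
      gauss w fun σ => σ (x : F) := by
    have h := summable_gauss_add (moebius_mem α hz) (fun _ => 0)
    convert! h using 1
    funext x
    rw [gauss_moebius hc hz]
  have hgs : ∀ x r : 𝓞 F, (gauss w fun σ => σ ((x + M * r : 𝓞 F) : F)) =
      gauss (fun σ => ((σ (M : F) ^ 2 : ℝ) : ℂ) * w σ) fun σ => σ (x : F) / σ (M : F) + σ (r : F) := by
    intro x r
    rw [gauss, gauss]
    congr 1
    funext σ
    have hMσ : (σ (M : F) : ℂ) ≠ 0 := by exact_mod_cast emb_ne_zero σ hM0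
    simp only [map_add, map_mul]
    push_cast
    field_simp
  -- Write x = q + Mr with q running over the residues modulo M. The phase e(x²a/2c) depends only on
  -- q, and the sum over r is a shifted Gaussian sum at the point M²w.
  have step1 : theta (moebius α z) = ∑ q : 𝓞 F ⧸ Ideal.span {M},
      eF ((q.out : F) ^ 2 * α 0 0 / (2 * α 1 0)) *
      ∑' r : 𝓞 F, gauss (fun σ => ((σ (M : F) ^ 2 : ℝ) : ℂ) * w σ)
        fun σ => σ (q.out : F) / σ (M : F) + σ (r : F) := by
    rw [theta_eq]
    simp only [gauss_moebius hc hz]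
    rw [← (residueEquiv hM).tsum_eq]
    refine (Summable.tsum_prod ((residueEquiv hM).summable_iff.mpr hsum)).trans ?_
    rw [tsum_fintype]
    refine Finset.sum_congr rfl fun q _ => ?_
    rw [← tsum_mul_left]
    refine tsum_congr fun r => ?_
    rw [Function.comp_apply, residueEquiv_apply, hper, hgs]
  have step2 : ∀ q : 𝓞 F ⧸ Ideal.span {M}, HasSum (fun ζ : 𝓞 F =>
      eF ((q.out : F) ^ 2 * α 0 0 / (2 * α 1 0)) * (K * jFactor (M : F) α z *
        ((eF ((ζ : F) ^ 2 * (α 1 0 * α 1 1) / (2 * (M : F) ^ 2 * (δ : F) ^ 2)) *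
          gauss (fun σ => ((σ (α 1 0) ^ 2 / σ (M : F) ^ 2 : ℝ) : ℂ) * z σ)
            fun σ => σ (ζ : F) / σ (δ : F)) *
          eF ((ζ : F) * (q.out : F) / ((δ : F) * (M : F))))))
      (eF ((q.out : F) ^ 2 * α 0 0 / (2 * α 1 0)) *
      ∑' r : 𝓞 F, gauss (fun σ => ((σ (M : F) ^ 2 : ℝ) : ℂ) * w σ)
        fun σ => σ (q.out : F) / σ (M : F) + σ (r : F)) := by
    intro q
    refine HasSum.mul_left _ ?_
    have h := hP _ hMw fun σ => σ (q.out : F) / σ (M : F)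
    convert! h using 1
    funext ζ
    congr 2
    · rw [eF, gauss, gauss, ← e_add]
      congr 1
      funext σ
      have hMσ : (σ (M : F) : ℂ) ≠ 0 := by exact_mod_cast emb_ne_zero σ hM0
      have hδσ : (σ (δ : F) : ℂ) ≠ 0 := by exact_mod_cast emb_ne_zero σ hδ0
      have hcσ : (σ (α 1 0) : ℂ) ≠ 0 := by exact_mod_cast emb_ne_zero σ hc
      have hd := den_ne_zero α hz σ
      -- The inverted point is (c²z + cd)/M²: the term in z gives the new Gaussian, and cd/M² gives
      -- the phase quadratic in ζ.
      have hv : -1 / (((σ (M : F) ^ 2 : ℝ) : ℂ) * w σ) =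
          (σ (α 1 0) : ℂ) * den α z σ / (σ (M : F) : ℂ) ^ 2 := by
        rw [hw, shiftPoint]
        push_cast
        field_simp
      rw [hv, den]
      simp only [Pi.add_apply, map_div₀, map_mul, map_pow, map_ofNat]
      push_cast
      field_simp
      ring
    · rw [eF]
      congr 1
      funext σ
      have hMσ : (σ (M : F) : ℂ) ≠ 0 := by exact_mod_cast emb_ne_zero σ hM0
      have hδσ : (σ (δ : F) : ℂ) ≠ 0 := by exact_mod_cast emb_ne_zero σ hδ0
      simp only [map_div₀, map_mul]
      push_cast
      field_simp
  have step3 := hasSum_sum (s := Finset.univ) fun q _ => step2 q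
  rw [← step1] at step3
  rw [← step3.tsum_eq, thetaTransform, ← tsum_mul_left, ← tsum_mul_left]
  refine tsum_congr fun ζ => ?_
  rw [thetaCoeff, tsum_fintype, Finset.sum_mul, Finset.mul_sum, Finset.mul_sum]
  refine Finset.sum_congr rfl fun q _ => ?_
  ring

/-- Invariance of the transformed theta series under translations. -/
lemma thetaTransform_add {M : 𝓞 F} (hM : M ≠ 0) {α : Matrix.SpecialLinearGroup (Fin 2) F} {B : F}
    (hB : α 1 0 ^ 2 * B / (2 * (M : F) ^ 2 * (δ : F)) ∈ intSub F) (z : (F →+* ℝ) → ℂ) :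
    thetaTransform δ M α (fun σ => z σ + (σ B : ℂ)) = thetaTransform δ M α z := by
  have hδ0 : (δ : F) ≠ 0 := by exact_mod_cast delta_ne_zero hδ
  have hM0 : (M : F) ≠ 0 := by exact_mod_cast hM
  rw [thetaTransform, thetaTransform]
  refine tsum_congr fun ζ => ?_
  congr 2
  have h1 : eF ((ζ : F) ^ 2 * (α 1 0 ^ 2 * B / (2 * (M : F) ^ 2 * (δ : F) ^ 2))) = 1 := by
    apply eF_eq_one hδ
    have : (δ : F) * ((ζ : F) ^ 2 * (α 1 0 ^ 2 * B / (2 * (M : F) ^ 2 * (δ : F) ^ 2))) =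
      (ζ : F) ^ 2 * (α 1 0 ^ 2 * B / (2 * (M : F) ^ 2 * (δ : F))) := by
      field_simp
    rw [this]
    exact mul_mem (pow_mem (coe_mem_intSub ζ) 2) hB
  refine Eq.trans ?_ (mul_one _)
  rw [← h1, gauss, gauss, eF, ← e_add]
  congr 1
  funext σ
  have hMσ : (σ (M : F) : ℂ) ≠ 0 := by exact_mod_cast emb_ne_zero σ hM0
  have hδσ : (σ (δ : F) : ℂ) ≠ 0 := by exact_mod_cast emb_ne_zero σ hδ0
  simp only [Pi.add_apply, map_div₀, map_mul, map_pow, map_ofNat]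
  push_cast
  field_simp

/-- Invariance of the transformed theta series under squares of units. -/
lemma thetaTransform_unit {M : 𝓞 F} (hM : M ≠ 0) {α : Matrix.SpecialLinearGroup (Fin 2) F}
    {N : 𝓞 F} (hMN : M ∣ N) (hN : N * (α 1 0 * α 1 1) / (2 * (M : F) ^ 2 * (δ : F)) ∈ intSub F)
    {u : (𝓞 F)ˣ} (hu : N ∣ (u : 𝓞 F) - 1) (z : (F →+* ℝ) → ℂ) :
    thetaTransform δ M α (fun σ => ((σ ((u : 𝓞 F) : F) ^ 2 : ℝ) : ℂ) * z σ) =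
      thetaTransform δ M α z := by
  have hδ0 : (δ : F) ≠ 0 := by exact_mod_cast delta_ne_zero hδ
  have hM0 : (M : F) ≠ 0 := by exact_mod_cast hM
  obtain ⟨N', hN'⟩ := hMN
  obtain ⟨k, hk⟩ := hu
  have hu' : ((u : 𝓞 F) : F) = 1 + N * k := by
    have : (u : 𝓞 F) = 1 + N * k := by rw [← hk]; ring
    rw [this]; simp
  have hNM : (N : F) = M * N' := by rw [hN']; simp
  let E : 𝓞 F ≃ 𝓞 F := u.mulLeft
  rw [thetaTransform, thetaTransform]
  -- The substitution ζ ↦ uζ absorbs u² in the Gaussian, and the coefficients and phases do not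
  -- change because u ≡ 1 modulo N.
  conv_rhs => rw [← E.tsum_eq]
  refine tsum_congr fun ζ => ?_
  have hE : ((E ζ : 𝓞 F) : F) = (1 + N * k) * ζ := by
    simp only [E, Units.mulLeft_apply, map_mul]
    exact congr_arg (· * (ζ : F)) hu'
  congr 1
  · rw [thetaCoeff, thetaCoeff]
    refine tsum_congr fun q => ?_
    congr 1
    symm
    apply eF_congr hδ
    have : (δ : F) * (((E ζ : 𝓞 F) : F) * (q.out : F) / ((δ : F) * (M : F)) -
        (ζ : F) * (q.out : F) / ((δ : F) * (M : F))) = ((N' * k * ζ * q.out : 𝓞 F) : F) := by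
      rw [hE, hNM]
      simp only [map_mul]
      field_simp
      ring
    rw [this]
    exact coe_mem_intSub _
  · congr 1
    · symm
      apply eF_congr hδ
      have : (δ : F) * (((E ζ : 𝓞 F) : F) ^ 2 * (α 1 0 * α 1 1) / (2 * (M : F) ^ 2 * (δ : F) ^ 2) -
          (ζ : F) ^ 2 * (α 1 0 * α 1 1) / (2 * (M : F) ^ 2 * (δ : F) ^ 2)) =
          (N * (α 1 0 * α 1 1) / (2 * (M : F) ^ 2 * (δ : F))) *
            ((k * (2 + N * k) * ζ ^ 2 : 𝓞 F) : F) := by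
        rw [hE]
        simp only [map_mul, map_add, map_pow, map_ofNat]
        field_simp
        ring
      rw [this]
      exact mul_mem hN (coe_mem_intSub _)
    · rw [gauss, gauss]
      congr 1
      funext σ
      simp only [E, Units.mulLeft_apply, map_mul]
      push_cast
      ring

end ThetaTransform

/-! ### The absolute value of the theta multiplier. -/

section ThetaGroup

variable {F : Type*} [Field F]

lemma intCoe_add (x y : 𝓞 F) : ((x + y : 𝓞 F) : F) = (x : F) + (y : F) := rfl
lemma intCoe_sub (x y : 𝓞 F) : ((x - y : 𝓞 F) : F) = (x : F) - (y : F) := rfl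
lemma intCoe_mul (x y : 𝓞 F) : ((x * y : 𝓞 F) : F) = (x : F) * (y : F) := rfl
lemma intCoe_neg (x : 𝓞 F) : ((-x : 𝓞 F) : F) = -(x : F) := rfl
lemma intCoe_pow (x : 𝓞 F) (k : ℕ) : ((x ^ k : 𝓞 F) : F) = (x : F) ^ k := rfl
lemma intCoe_one : ((1 : 𝓞 F) : F) = 1 := rfl
lemma intCoe_zero : ((0 : 𝓞 F) : F) = 0 := rfl
lemma intCoe_two : ((2 : 𝓞 F) : F) = 2 := map_ofNat (algebraMap (𝓞 F) F) 2

/-- The group `Γ[2 δ⁻¹, 2 δ]`, under which `θ` transforms. -/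
def thetaGroup (δ : 𝓞 F) : Set (Matrix.SpecialLinearGroup (Fin 2) F) :=
  {γ | γ 0 0 ∈ intSub F ∧ γ 1 1 ∈ intSub F ∧ (δ : F) * γ 0 1 / 2 ∈ intSub F ∧
    γ 1 0 / (2 * (δ : F)) ∈ intSub F}

lemma inv_mem_thetaGroup {δ : 𝓞 F} {γ : Matrix.SpecialLinearGroup (Fin 2) F}
    (hγ : γ ∈ thetaGroup δ) : γ⁻¹ ∈ thetaGroup δ := by
  obtain ⟨h1, h2, h3, h4⟩ := hγ
  obtain ⟨e1, e2, e3, e4⟩ := entry_inv γ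
  refine ⟨by rwa [e1], by rwa [e4], ?_, ?_⟩
  · rw [e2, mul_neg, neg_div]
    exact neg_mem h3
  · rw [e3, neg_div]
    exact neg_mem h4

/-- Change of variable in a residue sum written with chosen representatives: `T` lifts the
permutation `E` to integers. -/
lemma tsum_residue_comp {I : Ideal (𝓞 F)} {φ : 𝓞 F → ℂ} (hφ : ∀ x y, x - y ∈ I → φ x = φ y)
    (E : 𝓞 F ⧸ I ≃ 𝓞 F ⧸ I) (T : 𝓞 F → 𝓞 F)
    (hT : ∀ x : 𝓞 F, Ideal.Quotient.mk I (T x) = E (Ideal.Quotient.mk I x)) :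
    ∑' q : 𝓞 F ⧸ I, φ (T q.out) = ∑' q : 𝓞 F ⧸ I, φ q.out := by
  have e1 : ∀ q : 𝓞 F ⧸ I, Ideal.Quotient.mk I q.out = q := fun q => Quotient.out_eq' q
  rw [← E.tsum_eq (fun q => φ q.out)]
  refine tsum_congr fun q => hφ _ _ ?_
  rw [← Ideal.Quotient.eq, hT, e1, e1]

variable [NumberField F]

/-- The Gauss sum of `a / c`. -/
def gaussSum (I : Ideal (𝓞 F)) (γ : Matrix.SpecialLinearGroup (Fin 2) F) : ℂ :=
  ∑' q : 𝓞 F ⧸ I, eF ((q.out : F) ^ 2 * γ 0 0 / (2 * γ 1 0))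

variable [NumberField.IsTotallyReal F]
variable {δ : 𝓞 F} (hδ : Ideal.span {δ} = differentIdeal ℤ (𝓞 F))
include hδ

/-- Replacing y by y + Mr adds a(yr + (M/2)r²)/δ to the argument, and M/2 = c/(2δ) is integral by
the condition on the lower left entry. -/
lemma gaussSum_term_congr {M : 𝓞 F} {γ : Matrix.SpecialLinearGroup (Fin 2) F}
    (hγ : γ ∈ thetaGroup δ) (hc : γ 1 0 ≠ 0) (hM : (δ : F) * M = γ 1 0) (x y : 𝓞 F)
    (hxy : x - y ∈ Ideal.span {M}) :
    eF ((x : F) ^ 2 * γ 0 0 / (2 * γ 1 0)) = eF ((y : F) ^ 2 * γ 0 0 / (2 * γ 1 0)) := by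
  obtain ⟨r, hr⟩ := Ideal.mem_span_singleton.mp hxy
  have hδ0 : (δ : F) ≠ 0 := by exact_mod_cast delta_ne_zero hδ
  have hM0 : (M : F) ≠ 0 := fun h => hc (by rw [← hM, h, mul_zero])
  obtain ⟨⟨a, ha⟩, -, -, ⟨c', hc'⟩⟩ := hγ
  have hx : (x : F) = y + M * r := by
    rw [← sub_eq_iff_eq_add']
    have := congr_arg (algebraMap (𝓞 F) F) hr
    simpa using this
  apply eF_congr hδ
  have hc2 : γ 1 0 = 2 * δ * (c' : F) := by
    rw [show ((c' : 𝓞 F) : F) = γ 1 0 / (2 * (δ : F)) from hc']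
    field_simp
  have : (δ : F) * ((x : F) ^ 2 * γ 0 0 / (2 * γ 1 0) - (y : F) ^ 2 * γ 0 0 / (2 * γ 1 0)) =
      γ 0 0 * (y * r) + γ 0 0 * ((γ 1 0 / (2 * (δ : F))) * r ^ 2) := by
    rw [hx, ← hM]
    field_simp
    ring
  rw [this]
  have h1 := coe_mem_intSub y
  have h2 := coe_mem_intSub r
  have h3 : γ 0 0 ∈ intSub F := ⟨a, ha⟩
  have h4 : γ 1 0 / (2 * (δ : F)) ∈ intSub F := ⟨c', hc'⟩
  exact add_mem (mul_mem h3 (mul_mem h1 h2)) (mul_mem h3 (mul_mem h4 (pow_mem h2 2)))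

/-- Completing the square: as ad = 1 + bc with δb/2 integral, the shift q ↦ q + dζ absorbs the
phases linear and quadratic in ζ. All coefficients become the same Gauss sum, and c²/M² = δ²
restores the Gaussian of θ. -/
lemma thetaTransform_eq {M : 𝓞 F} {γ : Matrix.SpecialLinearGroup (Fin 2) F}
    (hγ : γ ∈ thetaGroup δ) (hc : γ 1 0 ≠ 0) (hM : (δ : F) * M = γ 1 0) (z : (F →+* ℝ) → ℂ) :
    thetaTransform δ M γ z = gaussSum (Ideal.span {M}) γ * theta z := by
  have hδ0 : (δ : F) ≠ 0 := by exact_mod_cast delta_ne_zero hδ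
  have hM0 : (M : F) ≠ 0 := fun h => hc (by rw [← hM, h, mul_zero])
  obtain ⟨h1, h2, h3, h4⟩ := hγ
  obtain ⟨d, hd⟩ := h2
  have hd' : (d : F) = γ 1 1 := hd
  have hdet : γ 0 0 * γ 1 1 = 1 + γ 0 1 * γ 1 0 := by linear_combination det_eq γ
  rw [theta_eq, thetaTransform, ← tsum_mul_left]
  refine tsum_congr fun ζ => ?_
  have key : thetaCoeff δ M γ ζ * eF ((ζ : F) ^ 2 * (γ 1 0 * γ 1 1) / (2 * (M : F) ^ 2 * (δ : F) ^ 2)) =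
      gaussSum (Ideal.span {M}) γ := by
    rw [thetaCoeff, ← tsum_mul_right, gaussSum]
    let E : 𝓞 F ⧸ Ideal.span {M} ≃ 𝓞 F ⧸ Ideal.span {M} :=
      Equiv.addRight (Ideal.Quotient.mk (Ideal.span {M}) (d * ζ))
    rw [← tsum_residue_comp (φ := fun x : 𝓞 F => eF ((x : F) ^ 2 * γ 0 0 / (2 * γ 1 0)))
      (gaussSum_term_congr hδ ⟨h1, ⟨d, hd⟩, h3, h4⟩ hc hM) E (fun x => x + d * ζ)
      (fun x => by simp [E])]
    refine tsum_congr fun q => ?_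
    rw [← eF_add, ← eF_add]
    symm
    apply eF_congr hδ
    have hq := coe_mem_intSub q.out
    have hζ := coe_mem_intSub ζ
    have : (δ : F) * (((q.out + d * ζ : 𝓞 F) : F) ^ 2 * γ 0 0 / (2 * γ 1 0) -
        ((q.out : F) ^ 2 * γ 0 0 / (2 * γ 1 0) + (ζ : F) * (q.out : F) / ((δ : F) * (M : F)) +
          (ζ : F) ^ 2 * (γ 1 0 * γ 1 1) / (2 * (M : F) ^ 2 * (δ : F) ^ 2))) =
        ((δ : F) * γ 0 1 / 2) * (2 * (ζ * q.out) + γ 1 1 * ζ ^ 2) := by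
      simp only [intCoe_add, intCoe_mul]
      rw [hd', show (2 : F) * (M : F) ^ 2 * (δ : F) ^ 2 = 2 * γ 1 0 ^ 2 by rw [← hM]; ring, hM]
      field_simp
      linear_combination (ζ * (2 * q.out + γ 1 1 * ζ) : F) * hdet
    rw [this]
    exact mul_mem h3 (add_mem (mul_mem (by simpa only [intCoe_two] using coe_mem_intSub (2 : 𝓞 F)) (mul_mem hζ hq))
      (mul_mem ⟨d, hd⟩ (pow_mem hζ 2)))
  rw [← mul_assoc, key]
  congr 1
  rw [gauss, gauss]
  congr 1
  funext σ
  have hMσ : (σ (M : F) : ℂ) ≠ 0 := by exact_mod_cast emb_ne_zero σ hM0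
  have hδσ : (σ (δ : F) : ℂ) ≠ 0 := by exact_mod_cast emb_ne_zero σ hδ0
  rw [← hM, map_mul]
  push_cast
  field_simp
  ring

/-- Modulo M the entry a is invertible with inverse d. Substituting q ↦ aq in the Gauss sum of γ⁻¹,
which belongs to the fraction -d/c, gives the complex conjugate of the Gauss sum of γ. -/
lemma norm_gaussSum_inv {M : 𝓞 F} {γ : Matrix.SpecialLinearGroup (Fin 2) F}
    (hγ : γ ∈ thetaGroup δ) (hc : γ 1 0 ≠ 0) (hM : (δ : F) * M = γ 1 0) :
    ‖gaussSum (Ideal.span {-M}) γ⁻¹‖ = ‖gaussSum (Ideal.span {M}) γ‖ := by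
  obtain ⟨e1, e2, e3, e4⟩ := entry_inv γ
  have hδ0 : (δ : F) ≠ 0 := by exact_mod_cast delta_ne_zero hδ
  have hγ' := inv_mem_thetaGroup hγ
  obtain ⟨h1, h2, h3, h4⟩ := hγ
  obtain ⟨a, ha⟩ := h1
  obtain ⟨d, hd⟩ := h2
  obtain ⟨b, hb⟩ := h3
  have hd' : (d : F) = γ 1 1 := hd
  have ha' : (a : F) = γ 0 0 := ha
  have hb' : (b : F) = (δ : F) * γ 0 1 / 2 := hb
  have hdet : γ 0 0 * γ 1 1 = 1 + γ 0 1 * γ 1 0 := by linear_combination det_eq γ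
  have hdM : a * d = 1 + 2 * b * M := by
    have : ((a * d : 𝓞 F) : F) = ((1 + 2 * b * M : 𝓞 F) : F) := by
      simp only [intCoe_mul, intCoe_add, intCoe_one, intCoe_two]
      rw [ha', hd', hb', hdet, ← hM]
      ring
    exact_mod_cast this
  rw [Ideal.span_singleton_neg]
  have hunit : Ideal.Quotient.mk (Ideal.span {M}) a * Ideal.Quotient.mk (Ideal.span {M}) d = 1 := by
    have hM0 : Ideal.Quotient.mk (Ideal.span {M}) M = 0 :=
      Ideal.Quotient.eq_zero_iff_mem.mpr (Ideal.mem_span_singleton_self M)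
    rw [← map_mul, hdM]
    simp [hM0]
  let U : (𝓞 F ⧸ Ideal.span {M})ˣ := ⟨_, _, hunit, by rw [mul_comm]; exact hunit⟩
  have hcong := gaussSum_term_congr hδ (M := -M) hγ' (by rw [e3]; exact neg_ne_zero.mpr hc)
    (by rw [e3, ← hM]; simp)
  rw [Ideal.span_singleton_neg] at hcong
  rw [gaussSum, ← tsum_residue_comp (φ := fun x : 𝓞 F => eF ((x : F) ^ 2 * γ⁻¹ 0 0 / (2 * γ⁻¹ 1 0)))
    hcong U.mulLeft (fun x => a * x) (fun x => by simp [U])]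
  have : (∑' q : 𝓞 F ⧸ Ideal.span {M}, eF (((a * q.out : 𝓞 F) : F) ^ 2 * γ⁻¹ 0 0 / (2 * γ⁻¹ 1 0))) =
      (starRingEnd ℂ) (gaussSum (Ideal.span {M}) γ) := by
    rw [gaussSum, Complex.conj_tsum]
    refine tsum_congr fun q => ?_
    rw [← eF_neg]
    apply eF_congr hδ
    have : (δ : F) * (((a * q.out : 𝓞 F) : F) ^ 2 * γ⁻¹ 0 0 / (2 * γ⁻¹ 1 0) -
        -((q.out : F) ^ 2 * γ 0 0 / (2 * γ 1 0))) = ((-(b * a * q.out ^ 2) : 𝓞 F) : F) := by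
      simp only [intCoe_mul, intCoe_neg, intCoe_pow]
      rw [e1, e3, ha', hb']
      field_simp
      linear_combination (-(γ 0 0 * (q.out : F) ^ 2)) * hdet
    rw [this]
    exact coe_mem_intSub _
  rw [this, RCLike.norm_conj]

/-- `|h(γ, z)| = |N(c z + d)|^{1/2}` for `γ ∈ Γ[2 δ⁻¹, 2 δ]`. -/
theorem norm_theta_moebius {γ : Matrix.SpecialLinearGroup (Fin 2) F} (hγ : γ ∈ thetaGroup δ)
    {z : (F →+* ℝ) → ℂ} (hz : z ∈ upperHalf F) :
    ‖theta (moebius γ z)‖ = absFactor γ z * ‖theta z‖ := by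
  have hδ0 : (δ : F) ≠ 0 := by exact_mod_cast delta_ne_zero hδ
  -- If c = 0 then a is a unit with inverse d; reindexing the theta series by a leaves a phase that
  -- is trivial because δb/2 is integral.
  by_cases hc : γ 1 0 = 0
  · obtain ⟨⟨a, ha⟩, ⟨d, hd⟩, h3, -⟩ := hγ
    have hd' : (d : F) = γ 1 1 := hd
    have ha' : (a : F) = γ 0 0 := ha
    have hdet : γ 0 0 * γ 1 1 = 1 := by linear_combination det_eq γ + γ 0 1 * hc
    have had : a * d = 1 := by
      have : ((a * d : 𝓞 F) : F) = ((1 : 𝓞 F) : F) := by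
        simp only [intCoe_mul, intCoe_one]
        rw [ha', hd', hdet]
      exact_mod_cast this
    let U : (𝓞 F)ˣ := ⟨a, d, had, by rw [mul_comm, had]⟩
    have habs : absFactor γ z = 1 := by
      rw [absFactor_eq]
      have : ∀ σ : F →+* ℝ, ‖den γ z σ‖ = |σ (((U⁻¹ : (𝓞 F)ˣ) : 𝓞 F) : F)| := by
        intro σ
        rw [den, hc, map_zero]
        simp only [Complex.ofReal_zero, zero_mul, zero_add, Complex.norm_real, Real.norm_eq_abs]
        rw [← hd']
        rfl
      simp only [this, unit_prod_abs, Real.one_rpow]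
    rw [habs, one_mul]
    congr 1
    rw [theta_eq, theta_eq, ← (U.mulLeft).tsum_eq (fun r : 𝓞 F => gauss z fun σ => 0 + σ (r : F))]
    refine tsum_congr fun r => ?_
    have h1 : eF ((r : F) ^ 2 * (γ 0 0 * γ 0 1 / 2)) = 1 := by
      apply eF_eq_one hδ
      have : (δ : F) * ((r : F) ^ 2 * (γ 0 0 * γ 0 1 / 2)) =
        (r : F) ^ 2 * (γ 0 0 * ((δ : F) * γ 0 1 / 2)) := by ring
      rw [this]
      exact mul_mem (pow_mem (coe_mem_intSub r) 2) (mul_mem ⟨a, ha⟩ h3)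
    rw [← one_mul (gauss z _), ← h1, eF, gauss, gauss, ← e_add]
    congr 1
    funext σ
    have hdetσ : (σ (γ 0 0) : ℂ) * σ (γ 1 1) = 1 := by
      have := congr_arg σ hdet
      rw [map_mul, map_one] at this
      exact_mod_cast this
    have hdσ : (σ (γ 1 1) : ℂ) ≠ 0 := right_ne_zero_of_mul_eq_one hdetσ
    have hU : (((U.mulLeft r : 𝓞 F)) : F) = γ 0 0 * r := by
      rw [← ha']
      simp [U]
    rw [moebius_apply, den, hc, map_zero, Pi.add_apply, hU]
    simp only [map_mul, map_pow, map_div₀, map_ofNat]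
    push_cast
    have hinv : (σ (γ 1 1) : ℂ)⁻¹ = (σ (γ 0 0) : ℂ) := by
      rw [inv_eq_iff_eq_inv]
      exact eq_inv_of_mul_eq_one_right hdetσ
    rw [zero_mul, zero_add, zero_add, zero_add, div_eq_mul_inv _ (σ (γ 1 1) : ℂ), hinv]
    ring
  · have hγ0 := hγ
    obtain ⟨⟨a, ha⟩, ⟨d, hd⟩, h3, ⟨c', hc'⟩⟩ := hγ0
    have hc2 : (c' : F) = γ 1 0 / (2 * (δ : F)) := hc'
    set M : 𝓞 F := 2 * c' with hMdef
    have hM : (δ : F) * M = γ 1 0 := by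
      rw [hMdef]
      simp only [intCoe_mul, intCoe_two]
      rw [hc2]
      field_simp
    have hM0 : (M : F) ≠ 0 := fun h => hc (by rw [← hM, h, mul_zero])
    have hM00 : M ≠ 0 := fun h => hM0 (by rw [h]; simp)
    obtain ⟨e1, e2, e3, e4⟩ := entry_inv γ
    obtain ⟨K, hK, hθ⟩ := exists_theta_moebius hδ
    have aux : ∀ (α : Matrix.SpecialLinearGroup (Fin 2) F) (M : 𝓞 F), α ∈ thetaGroup δ →
        α 1 0 ≠ 0 → (δ : F) * M = α 1 0 → ∀ z ∈ upperHalf F, ‖theta (moebius α z)‖ =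
        ((∏ σ : F →+* ℝ, |σ (M : F)| ^ 2)⁻¹ ^ (1 / 2 : ℝ) * (∏ σ : F →+* ℝ, |σ (α 1 0)|) ^ (1 / 2 : ℝ) *
          K * ‖gaussSum (Ideal.span {M}) α‖) * absFactor α z * ‖theta z‖ := by
      intro α M hα hc hM z hz
      have hM0 : (M : F) ≠ 0 := fun h => hc (by rw [← hM, h, mul_zero])
      have hM00 : M ≠ 0 := fun h => hM0 (by rw [h]; simp)
      rw [hθ α M hc hM00 ?_ ?_ z hz, thetaTransform_eq hδ hα hc hM, norm_mul, norm_mul, norm_mul,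
        norm_jFactor, Complex.norm_real, Real.norm_of_nonneg hK.le]
      · ring
      · have : (δ : F) * (M * α 0 0 / α 1 0) = α 0 0 := by
          rw [← hM]; field_simp
        rw [this]
        exact hα.1
      · have : (δ : F) * ((M : F) ^ 2 * α 0 0 / (2 * α 1 0)) = α 0 0 * (α 1 0 / (2 * δ)) := by
          rw [← hM]; field_simp
        rw [this]
        exact mul_mem hα.1 hα.2.2.2
    have a1 := aux γ M hγ hc hM
    have a2 := aux γ⁻¹ (-M) (inv_mem_thetaGroup hγ) (by rw [e3]; exact neg_ne_zero.mpr hc)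
      (by rw [e3, ← hM]; simp)
    rw [norm_gaussSum_inv hδ hγ hc hM, e3] at a2
    simp only [map_neg, abs_neg] at a2
    set κ := (∏ σ : F →+* ℝ, |σ (M : F)| ^ 2)⁻¹ ^ (1 / 2 : ℝ) *
      (∏ σ : F →+* ℝ, |σ (γ 1 0)|) ^ (1 / 2 : ℝ) * K * ‖gaussSum (Ideal.span {M}) γ‖ with hκ
    have hκ0 : 0 ≤ κ := by positivity
    have hi : (fun _ : F →+* ℝ => Complex.I) ∈ upperHalf F := fun σ => by simp
    have b1 := a1 _ hi
    have b2 := a2 _ (moebius_mem γ hi)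
    rw [moebius_cancel_inv γ hi, b1] at b2
    have b3 := absFactor_mul γ⁻¹ γ hi
    rw [inv_mul_cancel, absFactor_one] at b3
    have hθ0 : 0 < ‖theta fun _ : F →+* ℝ => Complex.I‖ := norm_pos_iff.mpr theta_I_ne_zero
    -- γ and γ⁻¹ have the same constant κ. Going from (i, …, i) to its image and back gives κ² = 1,
    -- so neither the Gauss sum nor the Poisson constant has to be evaluated.
    have hκ1 : κ = 1 := by
      have : κ ^ 2 = 1 := by
        have h : ‖theta fun _ : F →+* ℝ => Complex.I‖ * 1 =
          ‖theta fun _ : F →+* ℝ => Complex.I‖ * κ ^ 2 := by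
          linear_combination b2 - (κ ^ 2 * ‖theta fun _ : F →+* ℝ => Complex.I‖) * b3
        exact (mul_left_cancel₀ hθ0.ne' h).symm
      exact (pow_eq_one_iff_of_nonneg hκ0 two_ne_zero).mp this
    rw [a1 z hz, hκ1, one_mul]

end ThetaGroup

/-! ### Values of ψ_𝔠 on units and on integers congruent to 1. -/

section FinitePart

variable {F : Type*} [Field F] [NumberField F]

namespace HeckeCharacter

lemma norm_finitePart (ψ : HeckeCharacter F) (𝔠 : Ideal (𝓞 F)) {a : F} (ha : a ≠ 0) :
    ‖ψ.finitePart 𝔠 a‖ = 1 := by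
  rw [finitePart, dif_pos ha]
  exact Circle.norm_coe _

/-- `ψ_𝔠(a) = 1` if `a ≡ 1` modulo `𝔠`. -/
lemma finitePart_eq_one_of_sub_one_mem {ψ : HeckeCharacter F} {𝔠 : Ideal (𝓞 F)}
    (hψ : ψ.ConductorDvd 𝔠) {a : 𝓞 F} (ha0 : a ≠ 0) (ha : a - 1 ∈ 𝔠) :
    ψ.finitePart 𝔠 (a : F) = 1 := by
  have ha0' : (a : F) ≠ 0 := by exact_mod_cast ha0
  rw [finitePart, dif_pos ha0', hψ _ rfl fun v => ?_]
  · rfl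
  · have hval : ((partIdele 𝔠 (Units.mk0 (a : F) ha0') : (AdeleRing (𝓞 F) F)ˣ) :
      AdeleRing (𝓞 F) F).2 v = partFiniteAdele 𝔠 (a : F) v := rfl
    rw [hval, partFiniteAdele_apply]
    split_ifs with hv
    · have hle : 𝔠 ≤ v.asIdeal := Ideal.le_of_dvd hv
      have hav : a ∉ v.asIdeal := by
        intro h
        apply v.isPrime.ne_top
        rw [Ideal.eq_top_iff_one]
        have := v.asIdeal.sub_mem h (hle ha)
        simpa using this
      refine ⟨?_, a - 1, ha, ?_⟩
      · rw [HeightOneSpectrum.valuedAdicCompletion_eq_valuation']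
        exact (HeightOneSpectrum.valuation_eq_one_iff_notMem (K := F) (v := v)).mpr hav
      · rw [← HeightOneSpectrum.valuedAdicCompletion_eq_valuation' (K := F) v]
        have hcoe : (((a - 1 : 𝓞 F) : F) : v.adicCompletion F) =
            ((a : F) : v.adicCompletion F) - 1 := by
          rw [eq_sub_iff_add_eq, ← HeightOneSpectrum.adicCompletion.coe_one,
            ← HeightOneSpectrum.adicCompletion.coe_add, intCoe_sub, intCoe_one, sub_add_cancel]
        exact le_of_eq (congr_arg _ hcoe.symm)
    · refine ⟨map_one _, 0, 𝔠.zero_mem, ?_⟩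
      rw [sub_self, map_zero, map_zero, map_zero]

/-- `ψ_𝔠(u) = 1` for units `u`. -/
lemma finitePart_unit {ψ : HeckeCharacter F} {𝔠 : Ideal (𝓞 F)}
    (hψ : ψ.ConductorDvd 𝔠) (hψ' : ψ.TrivialAtInfinity) (u : (𝓞 F)ˣ) :
    ψ.finitePart 𝔠 ((u : 𝓞 F) : F) = 1 := by
  have hu0 : ((u : 𝓞 F) : F) ≠ 0 := by exact_mod_cast u.ne_zero
  rw [finitePart, dif_pos hu0]
  set x : Fˣ := Units.mk0 ((u : 𝓞 F) : F) hu0 with hx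
  set P := Units.map (algebraMap F (AdeleRing (𝓞 F) F) : F →* AdeleRing (𝓞 F) F) x with hP
  set Q := partIdele 𝔠 x with hQ
  have hPinv : (P : AdeleRing (𝓞 F) F) * (P⁻¹ : (AdeleRing (𝓞 F) F)ˣ) = 1 := P.mul_inv
  have h1 : (P : AdeleRing (𝓞 F) F).1 * ((P⁻¹ : (AdeleRing (𝓞 F) F)ˣ) : AdeleRing (𝓞 F) F).1 = 1 :=
    congr_arg Prod.fst hPinv
  let W : (AdeleRing (𝓞 F) F)ˣ :=
    { val := ((P : AdeleRing (𝓞 F) F).1, (1 : FiniteAdeleRing (𝓞 F) F))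
      inv := (((P⁻¹ : (AdeleRing (𝓞 F) F)ˣ) : AdeleRing (𝓞 F) F).1, (1 : FiniteAdeleRing (𝓞 F) F))
      val_inv := Prod.ext h1 (one_mul (1 : FiniteAdeleRing (𝓞 F) F))
      inv_val := Prod.ext ((mul_comm _ _).trans h1) (one_mul (1 : FiniteAdeleRing (𝓞 F) F)) }
  have hW : ψ.toHom W = 1 := hψ' W rfl
  have hPrin : ψ.toHom P = 1 := ψ.map_principal x
  -- This idele is 1 at infinity and at the primes dividing 𝔠, and u at the others, so the conductor
  -- condition applies to it. Since ψ is trivial on the principal idele `P` and on its infinite part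
  -- `W`, it is trivial on `Q`.
  have hV : ψ.toHom (P * Q⁻¹ * W⁻¹) = 1 := by
    refine hψ _ ?_ fun v => ?_
    · change (P : AdeleRing (𝓞 F) F).1 * (1 : InfiniteAdeleRing F) *
        ((P⁻¹ : (AdeleRing (𝓞 F) F)ˣ) : AdeleRing (𝓞 F) F).1 = 1
      rw [mul_one, h1]
    · have hval : ((P * Q⁻¹ * W⁻¹ : (AdeleRing (𝓞 F) F)ˣ) : AdeleRing (𝓞 F) F).2 v =
          ((x : F) : v.adicCompletion F) * partFiniteAdele 𝔠 ((x⁻¹ : Fˣ) : F) v * 1 := rfl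
      rw [hval, partFiniteAdele_apply, mul_one]
      have hu1 : Valued.v ((((u : 𝓞 F) : F)) : v.adicCompletion F) = 1 := by
        rw [HeightOneSpectrum.valuedAdicCompletion_eq_valuation']
        exact (HeightOneSpectrum.valuation_eq_one_iff_notMem (K := F) (v := v)).mpr fun h =>
          v.isPrime.ne_top (Ideal.eq_top_of_isUnit_mem _ h u.isUnit)
      split_ifs with hv
      · have : ((x : F) : v.adicCompletion F) * (((x⁻¹ : Fˣ) : F) : v.adicCompletion F) = 1 := by
          rw [← HeightOneSpectrum.adicCompletion.coe_mul, Units.mul_inv,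
            HeightOneSpectrum.adicCompletion.coe_one]
        rw [this]
        refine ⟨map_one _, 0, 𝔠.zero_mem, ?_⟩
        rw [sub_self, map_zero, map_zero, map_zero]
      · rw [mul_one]
        refine ⟨hu1, ?_⟩
        -- At a prime not dividing 𝔠 some element of 𝔠 is a unit, so the congruence modulo 𝔠 is no
        -- restriction.
        have hnot : ¬ 𝔠 ≤ v.asIdeal := fun h => hv (Ideal.dvd_iff_le.mpr h)
        obtain ⟨a, ha, hav⟩ := Set.not_subset.mp hnot
        refine ⟨a, ha, ?_⟩
        rw [(HeightOneSpectrum.valuation_eq_one_iff_notMem (K := F) (v := v)).mpr hav]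
        refine (Valuation.map_sub _ _ _).trans ?_
        rw [map_one]
        exact max_le hu1.le le_rfl
  rw [map_mul, map_mul, map_inv, map_inv, hW, hPrin, one_mul, inv_one, mul_one, inv_eq_one] at hV
  rw [hV]
  rfl

end HeckeCharacter

end FinitePart

/-! ### Units: signatures, squares, logarithms and balancing. -/

section Units

variable {F : Type*} [Field F] [NumberField F]

lemma exists_totallyPositive_generator (hF : NarrowClassNumberOne F) {I : Ideal (𝓞 F)} (hI : I ≠ ⊥) :
    ∃ ξ : 𝓞 F, TotallyPositive (ξ : F) ∧ Ideal.span {ξ} = I := by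
  obtain ⟨x, hx, hIx⟩ := hF (Units.mk0 (I : FractionalIdeal (𝓞 F)⁰ F)
    (FractionalIdeal.coeIdeal_ne_zero.mpr hI))
  rw [Units.val_mk0] at hIx
  have hmem : x ∈ (I : FractionalIdeal (𝓞 F)⁰ F) := by
    rw [hIx]
    exact FractionalIdeal.mem_spanSingleton_self _ _
  obtain ⟨ξ, -, rfl⟩ := (FractionalIdeal.mem_coeIdeal _).mp hmem
  refine ⟨ξ, hx, ?_⟩
  rw [← FractionalIdeal.coeIdeal_span_singleton] at hIx
  exact (FractionalIdeal.coeIdeal_injective hIx).symm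

lemma TotallyPositive.ne_zero' [Nonempty (F →+* ℝ)] {x : F} (hx : TotallyPositive x) : x ≠ 0 := by
  rintro rfl
  have := hx (Classical.arbitrary _)
  simp at this

variable [NumberField.IsTotallyReal F]

variable (F) in
/-- Every real vector is close to an integer. -/
lemma exists_int_close : ∃ C : ℝ, ∀ v : (F →+* ℝ) → ℝ, ∃ x : 𝓞 F, ∀ σ, |σ (x : F) - v σ| ≤ C := by
  refine ⟨‖(latEquiv F : (BIdx F → ℝ) →L[ℝ] ((F →+* ℝ) → ℝ))‖, fun v => ?_⟩
  set s := (latEquiv F).symm v with hs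
  set x : 𝓞 F := (intCoord F).symm fun i => ⌊s i⌋ with hx
  refine ⟨x, fun σ => ?_⟩
  have h1 : ∀ σ, σ (x : F) = latEquiv F (fun i => (⌊s i⌋ : ℝ)) σ := by
    intro σ
    have := latEquiv_intCoord x σ
    rw [hx, Equiv.apply_symm_apply] at this
    exact this.symm
  have h2 : v = latEquiv F s := by rw [hs, ContinuousLinearEquiv.apply_symm_apply]
  rw [h1, h2, ← Pi.sub_apply, ← map_sub, ← Real.norm_eq_abs]
  refine (norm_le_pi_norm _ σ).trans ?_
  refine ((latEquiv F : (BIdx F → ℝ) →L[ℝ] ((F →+* ℝ) → ℝ)).le_opNorm _).trans ?_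
  refine mul_le_of_le_one_right (norm_nonneg _) ?_
  refine (pi_norm_le_iff_of_nonneg zero_le_one).mpr fun i => ?_
  rw [Pi.sub_apply, Real.norm_eq_abs, abs_sub_comm, Int.self_sub_floor, abs_of_nonneg (Int.fract_nonneg _)]
  exact (Int.fract_lt_one _).le

/-- Integers of every signature exist. -/
lemma exists_int_sign (p : (F →+* ℝ) → Bool) :
    ∃ x : 𝓞 F, ∀ σ, if p σ then 0 < σ (x : F) else σ (x : F) < 0 := by
  obtain ⟨C, hC⟩ := exists_int_close F
  -- A target of absolute value |C| + 1 exceeds the approximation error, so its sign is kept.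
  obtain ⟨x, hx⟩ := hC fun σ => if p σ then |C| + 1 else -(|C| + 1)
  refine ⟨x, fun σ => ?_⟩
  have h := abs_le.mp (hx σ)
  have h2 := le_abs_self C
  split_ifs with hp
  · simp only [hp, if_true] at h
    linarith [h.1]
  · simp only [hp] at h
    simp only [Bool.false_eq_true, if_false] at h
    linarith [h.2]

variable (F) in
lemma card_infinitePlace : Fintype.card (InfinitePlace F) = Module.finrank ℚ F := by
  rw [InfinitePlace.card_eq_nrRealPlaces_add_nrComplexPlaces, IsTotallyReal.nrComplexPlaces_eq_zero,
    add_zero, IsTotallyReal.finrank]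

variable (F) in
lemma rank_add_one : NumberField.Units.rank F + 1 = Module.finrank ℚ F := by
  rw [NumberField.Units.rank, card_infinitePlace]
  have : 0 < Module.finrank ℚ F := Module.finrank_pos
  omega

lemma exists_emb_of_place (w : InfinitePlace F) : ∃ σ : F →+* ℝ, ∀ x : F, w x = |σ x| := by
  refine ⟨(complexEmbEquiv F).symm w.embedding, fun x => ?_⟩
  have h : complexEmbEquiv F ((complexEmbEquiv F).symm w.embedding) x = w.embedding x := by
    rw [Equiv.apply_symm_apply]
  rw [complexEmbEquiv_apply] at h
  rw [← InfinitePlace.norm_embedding_eq, ← h, Complex.norm_real, Real.norm_eq_abs]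

lemma exists_place_of_emb (σ : F →+* ℝ) : ∃ w : InfinitePlace F, ∀ x : F, w x = |σ x| := by
  refine ⟨InfinitePlace.mk (complexEmbEquiv F σ), fun x => ?_⟩
  rw [InfinitePlace.apply, complexEmbEquiv_apply, Complex.norm_real, Real.norm_eq_abs]

lemma torsion_eq {u : (𝓞 F)ˣ} (hu : u ∈ NumberField.Units.torsion F) : u = 1 ∨ u = -1 := by
  obtain ⟨σ⟩ := nonempty_realEmb (F := F)
  obtain ⟨w, hw⟩ := exists_place_of_emb σ
  have h := (NumberField.Units.mem_torsion F).mp hu w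
  rw [hw] at h
  rcases abs_eq (zero_le_one) |>.mp h with h | h
  · left
    ext
    apply σ.injective
    rw [h]
    simp
  · right
    ext
    apply σ.injective
    rw [h]
    simp

/-- The signature of a unit. -/
def unitSign (u : (𝓞 F)ˣ) : (F →+* ℝ) → Bool := fun σ => decide (0 < σ ((u : 𝓞 F) : F))

lemma unitSign_mul_sq (u v : (𝓞 F)ˣ) : unitSign (u * v ^ 2) = unitSign u := by
  funext σ
  have hv : 0 < σ ((v : 𝓞 F) : F) ^ 2 := by
    have : ((v : 𝓞 F) : F) ≠ 0 := by exact_mod_cast v.ne_zero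
    have := emb_ne_zero σ this
    positivity
  simp only [unitSign, Units.val_mul, Units.val_pow_eq_pow_val, decide_eq_decide]
  rw [intCoe_mul, intCoe_pow, map_mul, map_pow]
  exact mul_pos_iff_of_pos_right hv

/-- Representatives of the units modulo squares. -/
def unitRep (b : Bool × (Fin (NumberField.Units.rank F) → Bool)) : (𝓞 F)ˣ :=
  (if b.1 then -1 else 1) * ∏ i, NumberField.Units.fundSystem F i ^ (if b.2 i then (1 : ℤ) else 0)

/-- Dirichlet's unit theorem with the exponents reduced modulo 2; the torsion is ±1 because F has a
real embedding. -/
lemma exists_unitRep (u : (𝓞 F)ˣ) : ∃ b v, u = unitRep b * v ^ 2 := by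
  obtain ⟨⟨ζ, f⟩, h, -⟩ := NumberField.Units.exist_unique_eq_mul_prod F u
  have hprod : ∏ i, NumberField.Units.fundSystem F i ^ (f i) =
      (∏ i, NumberField.Units.fundSystem F i ^ (if decide (f i % 2 = 1) then (1 : ℤ) else 0)) *
        (∏ i, NumberField.Units.fundSystem F i ^ (f i / 2)) ^ 2 := by
    rw [← Finset.prod_pow, ← Finset.prod_mul_distrib]
    refine Finset.prod_congr rfl fun i _ => ?_
    rw [← zpow_natCast, ← zpow_mul, ← zpow_add]
    congr 1
    push_cast
    by_cases h : f i % 2 = 1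
    · simp only [h, decide_true, if_true]
      omega
    · simp only [h, decide_false, Bool.false_eq_true, if_false]
      omega
  simp only at h
  rcases torsion_eq ζ.2 with hζ | hζ
  · refine ⟨(false, fun i => decide (f i % 2 = 1)),
      ∏ i, NumberField.Units.fundSystem F i ^ (f i / 2), ?_⟩
    rw [h, hζ, hprod, unitRep, ← mul_assoc]
    rfl
  · refine ⟨(true, fun i => decide (f i % 2 = 1)),
      ∏ i, NumberField.Units.fundSystem F i ^ (f i / 2), ?_⟩
    rw [h, hζ, hprod, unitRep, ← mul_assoc]
    rfl

/-- If x has the required signature and ξ is a totally positive generator of (x), then the unit x/ξ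
has it too. -/
lemma unitSign_surjective (hF : NarrowClassNumberOne F) :
    Function.Surjective (unitSign (F := F)) := by
  intro p
  obtain ⟨x, hx⟩ := exists_int_sign p
  have hx0 : x ≠ 0 := by
    rintro rfl
    obtain ⟨σ⟩ := nonempty_realEmb (F := F)
    have := hx σ
    simp at this
  obtain ⟨ξ, hξ, hspan⟩ := exists_totallyPositive_generator hF (I := Ideal.span {x}) (by simpa using hx0)
  obtain ⟨u, hu⟩ := Ideal.span_singleton_eq_span_singleton.mp hspan
  refine ⟨u, ?_⟩
  funext σ
  have h1 := hx σ
  rw [← hu, intCoe_mul, map_mul] at h1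
  have h2 := hξ σ
  rw [unitSign]
  cases hp : p σ
  · rw [hp] at h1
    simp only [Bool.false_eq_true, if_false] at h1
    rw [decide_eq_false_iff_not, not_lt]
    by_contra! h
    exact absurd (mul_pos h2 h) h1.not_gt
  · rw [hp] at h1
    simp only [if_true] at h1
    rw [decide_eq_true_eq]
    exact (pos_iff_pos_of_mul_pos h1).mp h2

/-- Totally positive units are squares. -/
theorem exists_sq_of_totallyPositive_unit (hF : NarrowClassNumberOne F) {u : (𝓞 F)ˣ}
    (hu : TotallyPositive ((u : 𝓞 F) : F)) : ∃ v : (𝓞 F)ˣ, u = v ^ 2 := by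
  classical
  have hsurj : Function.Surjective fun b => unitSign (unitRep (F := F) b) := by
    intro p
    obtain ⟨u, hu⟩ := unitSign_surjective hF p
    obtain ⟨b, v, hb⟩ := exists_unitRep u
    exact ⟨b, by rw [← hu, hb, unitSign_mul_sq]⟩
  -- There are 2^(rank + 1) = 2ⁿ representatives and 2ⁿ signatures, so the surjection is injective
  -- and only the trivial class modulo squares is totally positive.
  have hinj := ((Fintype.bijective_iff_surjective_and_card _).mpr ⟨hsurj, by
    rw [Fintype.card_prod, Fintype.card_fun, Fintype.card_fun, Fintype.card_bool, Fintype.card_fin,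
      card_realEmb, ← rank_add_one, pow_succ, mul_comm]⟩).injective
  obtain ⟨b, v, hb⟩ := exists_unitRep u
  have h0 : unitRep (F := F) (false, fun _ => false) = 1 := by simp [unitRep]
  have : b = (false, fun _ => false) := by
    apply hinj
    simp only
    rw [h0, ← unitSign_mul_sq (unitRep b) v, ← hb]
    funext σ
    simp [unitSign, hu σ]
  exact ⟨v, by rw [hb, this, h0, one_mul]⟩

lemma log_abs_unit_sum (u : (𝓞 F)ˣ) : ∑ σ : F →+* ℝ, Real.log |σ ((u : 𝓞 F) : F)| = 0 := by
  rw [← Real.log_prod, unit_prod_abs, Real.log_one]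
  intro σ _
  have : ((u : 𝓞 F) : F) ≠ 0 := by exact_mod_cast u.ne_zero
  exact abs_ne_zero.mpr (emb_ne_zero σ this)

variable (F) in
/-- The logarithmic vectors of the squares of the fundamental units. -/
def logVec : (Fin (NumberField.Units.rank F) → ℝ) →ₗ[ℝ] ((F →+* ℝ) → ℝ) where
  toFun s σ := ∑ k, s k * (2 * Real.log |σ ((NumberField.Units.fundSystem F k : 𝓞 F) : F)|)
  map_add' s t := by
    funext σ
    simp only [Pi.add_apply, add_mul, Finset.sum_add_distrib]
  map_smul' c s := by
    funext σ
    simp only [Pi.smul_apply, smul_eq_mul, RingHom.id_apply, Finset.mul_sum, mul_assoc]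

lemma logVec_apply (s : Fin (NumberField.Units.rank F) → ℝ) (σ : F →+* ℝ) :
    logVec F s σ = ∑ k, s k * (2 * Real.log |σ ((NumberField.Units.fundSystem F k : 𝓞 F) : F)|) := rfl

lemma sum_logVec (s : Fin (NumberField.Units.rank F) → ℝ) : ∑ σ, logVec F s σ = 0 := by
  simp only [logVec_apply]
  rw [Finset.sum_comm]
  refine Finset.sum_eq_zero fun k _ => ?_
  rw [← Finset.mul_sum, ← Finset.mul_sum, log_abs_unit_sum, mul_zero, mul_zero]

/-- The logarithmic embeddings of the fundamental units are a real basis of the logarithmic space.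
That space omits one place, which does no harm: a relation at all places restricts to one at the
remaining places. -/
lemma logVec_injective : Function.Injective (logVec F) := by
  rw [← LinearMap.ker_eq_bot, LinearMap.ker_eq_bot']
  intro s hs
  classical
  let B := (NumberField.Units.basisUnitLattice F).ofZLatticeBasis ℝ (NumberField.Units.unitLattice F)
  have hB : ∑ k, s k • B k = 0 := by
    funext w
    obtain ⟨σ, hσ⟩ := exists_emb_of_place w.1
    have h := congr_fun hs σ
    rw [logVec_apply] at h
    rw [Finset.sum_apply]
    have : ∀ k, (s k • B k) w = (s k * (2 * Real.log |σ ((NumberField.Units.fundSystem F k : 𝓞 F) : F)|)) / 2 := by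
      intro k
      rw [Pi.smul_apply, Module.Basis.ofZLatticeBasis_apply,
        ← NumberField.Units.logEmbedding_fundSystem,
        NumberField.Units.dirichletUnitTheorem.logEmbedding_component, IsTotallyReal.mult_eq, hσ,
        smul_eq_mul]
      push_cast
      ring
    simp only [this]
    rw [← Finset.sum_div, h]
    simp
  funext k
  exact Fintype.linearIndependent_iff.mp B.linearIndependent s hB k

variable (F) in
/-- Logarithmic coordinates adapted to the squares of the units. -/
def logEquiv : (ℝ × (Fin (NumberField.Units.rank F) → ℝ)) ≃L[ℝ] ((F →+* ℝ) → ℝ) :=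
  (LinearEquiv.ofInjectiveOfFinrankEq
    ((LinearMap.pi fun _ : F →+* ℝ => ((Module.finrank ℚ F : ℝ)⁻¹) • (LinearMap.id : ℝ →ₗ[ℝ] ℝ)).coprod
      (logVec F)) (by
    rw [← LinearMap.ker_eq_bot, LinearMap.ker_eq_bot']
    rintro ⟨τ, s⟩ h
    have hn : (0 : ℝ) < Module.finrank ℚ F := by exact_mod_cast Module.finrank_pos
    have h1 : ∀ σ, (Module.finrank ℚ F : ℝ)⁻¹ * τ + logVec F s σ = 0 := fun σ => by
      simpa using congr_fun h σ
    have h2 : τ = 0 := by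
      have := Finset.sum_congr (s₁ := Finset.univ) rfl fun (σ : F →+* ℝ) _ => h1 σ
      rw [Finset.sum_add_distrib, sum_logVec, Finset.sum_const, Finset.card_univ, card_realEmb] at this
      simpa [hn.ne'] using this
    have h3 : s = 0 := by
      apply logVec_injective
      rw [map_zero]
      funext σ
      simpa [h2] using h1 σ
    rw [h2, h3]
    rfl) (by
    rw [Module.finrank_prod, Module.finrank_self, Module.finrank_fintype_fun_eq_card,
      Module.finrank_fintype_fun_eq_card, Fintype.card_fin, card_realEmb, ← rank_add_one,
      add_comm])).toContinuousLinearEquiv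

lemma logEquiv_apply (τ : ℝ) (s : Fin (NumberField.Units.rank F) → ℝ) (σ : F →+* ℝ) :
    logEquiv F (τ, s) σ = τ / Module.finrank ℚ F + logVec F s σ := by
  rw [div_eq_inv_mul]
  rfl

/-- The unit with exponents `k`. -/
def unitPow (k : Fin (NumberField.Units.rank F) → ℤ) : (𝓞 F)ˣ :=
  ∏ i, NumberField.Units.fundSystem F i ^ k i

lemma coe_zpow_unit (u : (𝓞 F)ˣ) (k : ℤ) :
    (((u ^ k : (𝓞 F)ˣ) : 𝓞 F) : F) = ((u : 𝓞 F) : F) ^ k := by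
  have := map_zpow (Units.map (algebraMap (𝓞 F) F : 𝓞 F →* F)) u k
  have h2 := congr_arg Units.val this
  rw [Units.val_zpow_eq_zpow_val] at h2
  exact h2

lemma log_unitPow (k : Fin (NumberField.Units.rank F) → ℤ) (σ : F →+* ℝ) :
    2 * Real.log |σ ((unitPow k : 𝓞 F) : F)| = logVec F (fun i => (k i : ℝ)) σ := by
  have h : ((unitPow k : 𝓞 F) : F) =
      ∏ i, ((NumberField.Units.fundSystem F i : 𝓞 F) : F) ^ k i := by
    rw [unitPow, Units.coe_prod]
    refine (map_prod (algebraMap (𝓞 F) F) _ _).trans ?_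
    exact Finset.prod_congr rfl fun i _ => coe_zpow_unit _ _
  rw [h, map_prod, Finset.abs_prod, Real.log_prod, Finset.mul_sum, logVec_apply]
  · refine Finset.sum_congr rfl fun i _ => ?_
    rw [map_zpow₀, abs_zpow, Real.log_zpow]
    ring
  · intro i _
    have : ((NumberField.Units.fundSystem F i : 𝓞 F) : F) ≠ 0 := by
      exact_mod_cast Units.ne_zero _
    exact abs_ne_zero.mpr (by rw [map_zpow₀]; exact zpow_ne_zero _ (emb_ne_zero σ this))

variable (F) in
/-- A real vector can be balanced by (the square of) a unit. -/
theorem exists_unit_balance_sq : ∃ C : ℝ, 0 ≤ C ∧ ∀ v : (F →+* ℝ) → ℝ, ∃ u : (𝓞 F)ˣ, ∀ σ,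
    |v σ + 2 * Real.log |σ ((u : 𝓞 F) : F)| - (∑ τ, v τ) / Module.finrank ℚ F| ≤ C := by
  let L : (Fin (NumberField.Units.rank F) → ℝ) →L[ℝ] ((F →+* ℝ) → ℝ) :=
    (logVec F).toContinuousLinearMap
  refine ⟨‖L‖, L.opNorm_nonneg, fun v => ?_⟩
  obtain ⟨⟨τ, s⟩, hp⟩ := (logEquiv F).surjective v
  have hv : ∀ σ, v σ = τ / Module.finrank ℚ F + logVec F s σ := fun σ => by
    rw [← hp, logEquiv_apply]
  have hn : (0 : ℝ) < Module.finrank ℚ F := by exact_mod_cast Module.finrank_pos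
  have hτ : ∑ σ, v σ = τ := by
    simp only [hv]
    rw [Finset.sum_add_distrib, sum_logVec, Finset.sum_const, Finset.card_univ, card_realEmb,
      nsmul_eq_mul]
    field_simp
    ring
  -- Removing integer parts leaves coordinates in [0, 1), so the deviation from the mean is at most
  -- the norm of `L`.
  refine ⟨unitPow fun i => -⌊s i⌋, fun σ => ?_⟩
  rw [hτ, log_unitPow, hv]
  have : τ / (Module.finrank ℚ F : ℝ) + logVec F s σ + logVec F (fun i => ((-⌊s i⌋ : ℤ) : ℝ)) σ -
      τ / Module.finrank ℚ F = L (fun i => Int.fract (s i)) σ := by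
    have : (fun i => Int.fract (s i)) = s + fun i => ((-⌊s i⌋ : ℤ) : ℝ) := by
      funext i
      simp [Int.fract, sub_eq_add_neg]
    rw [this, map_add]
    simp only [L, LinearMap.coe_toContinuousLinearMap', Pi.add_apply]
    ring
  rw [this, ← Real.norm_eq_abs]
  refine (norm_le_pi_norm _ σ).trans ((L.le_opNorm _).trans ?_)
  refine mul_le_of_le_one_right (norm_nonneg _) ?_
  refine (pi_norm_le_iff_of_nonneg zero_le_one).mpr fun i => ?_
  rw [Real.norm_eq_abs, abs_of_nonneg (Int.fract_nonneg _)]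
  exact (Int.fract_lt_one _).le

variable (F) in
-- Apply the version with squares to 2v and halve.
theorem exists_unit_balance : ∃ C : ℝ, 0 ≤ C ∧ ∀ v : (F →+* ℝ) → ℝ, ∃ u : (𝓞 F)ˣ, ∀ σ,
    |v σ + Real.log |σ ((u : 𝓞 F) : F)| - (∑ τ, v τ) / Module.finrank ℚ F| ≤ C := by
  obtain ⟨C, hC0, hC⟩ := exists_unit_balance_sq F
  refine ⟨C, hC0, fun v => ?_⟩
  obtain ⟨u, hu⟩ := hC fun σ => 2 * v σ
  refine ⟨u, fun σ => ?_⟩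
  have h := hu σ
  rw [← Finset.mul_sum] at h
  have : v σ + Real.log |σ ((u : 𝓞 F) : F)| - (∑ τ, v τ) / Module.finrank ℚ F =
    (2 * v σ + 2 * Real.log |σ ((u : 𝓞 F) : F)| - 2 * (∑ τ, v τ) / Module.finrank ℚ F) / 2 := by ring
  rw [this, abs_div, abs_two]
  linarith [abs_nonneg (2 * v σ + 2 * Real.log |σ ((u : 𝓞 F) : F)| - 2 * (∑ τ, v τ) / Module.finrank ℚ F)]

/-- Some power of a unit is congruent to `1`. -/
lemma exists_unit_pow_sub_one_dvd {N : 𝓞 F} (hN : N ≠ 0) :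
    ∃ k : ℕ, 0 < k ∧ ∀ u : (𝓞 F)ˣ, N ∣ ((u ^ k : (𝓞 F)ˣ) : 𝓞 F) - 1 := by
  have := finite_quotient_span hN
  have := Fintype.ofFinite (𝓞 F ⧸ Ideal.span {N})
  classical
  refine ⟨Fintype.card (𝓞 F ⧸ Ideal.span {N})ˣ, Fintype.card_pos, fun u => ?_⟩
  rw [← Ideal.mem_span_singleton, ← Ideal.Quotient.eq_zero_iff_mem, map_sub, map_one, sub_eq_zero]
  have h := pow_card_eq_one (x := Units.map (Ideal.Quotient.mk (Ideal.span {N})).toMonoidHom u)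
  have h2 := congr_arg Units.val h
  rw [← map_pow] at h2
  exact h2

end Units

/-! ### The Koecher principle. -/

section Koecher

variable {F : Type*} [Field F] [NumberField F] [NumberField.IsTotallyReal F]

lemma not_totallyPositive_iff {ζ : F} (h0 : ζ ≠ 0) :
    ¬ TotallyPositive ζ ↔ ∃ σ : F →+* ℝ, σ ζ < 0 := by
  simp only [TotallyPositive, not_forall, not_lt]
  exact exists_congr fun σ => ⟨fun h => h.lt_of_ne (emb_ne_zero σ h0), le_of_lt⟩

lemma norm_eDual (δ ζ : 𝓞 F) (z : (F →+* ℝ) → ℂ) :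
    ‖eDual δ ζ z‖ = Real.exp (-(2 * Real.pi * ∑ σ : F →+* ℝ, σ (ζ : F) / σ (δ : F) * (z σ).im)) := by
  rw [eDual, norm_e]
  simp only [Complex.im_ofReal_mul]

lemma coe_unit_ne_zero (u : (𝓞 F)ˣ) : ((u : 𝓞 F) : F) ≠ 0 := by exact_mod_cast u.ne_zero

lemma unit_sq_smul_mem (u : (𝓞 F)ˣ) {z : (F →+* ℝ) → ℂ} (hz : z ∈ upperHalf F) :
    (fun σ => ((σ ((u : 𝓞 F) : F) ^ 2 : ℝ) : ℂ) * z σ) ∈ upperHalf F :=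
  sq_smul_mem_upperHalf (coe_unit_ne_zero u) hz

variable {δ : 𝓞 F} (hδ : Ideal.span {δ} = differentIdeal ℤ (𝓞 F))
include hδ

/-- Invariance under the square of a unit is inherited by the coefficients. -/
lemma coeff_unit_sq {f : ((F →+* ℝ) → ℂ) → ℂ} {a : 𝓞 F → ℂ}
    (h : ∀ z ∈ upperHalf F, HasSum (fun ζ => a ζ * eDual δ ζ z) (f z)) {u : (𝓞 F)ˣ}
    (hu : ∀ z ∈ upperHalf F, f (fun σ => ((σ ((u : 𝓞 F) : F) ^ 2 : ℝ) : ℂ) * z σ) = f z)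
    (ζ : 𝓞 F) : a ((u : 𝓞 F) ^ 2 * ζ) = a ζ := by
  let E : 𝓞 F ≃ 𝓞 F := (u ^ 2).mulLeft
  have h2 : ∀ z ∈ upperHalf F, HasSum (fun ζ => a (E.symm ζ) * eDual δ ζ z) (f z) := by
    intro z hz
    rw [← E.hasSum_iff, ← hu z hz]
    convert! h _ (unit_sq_smul_mem u hz) using 1
    funext ζ
    rw [Function.comp_apply, E.symm_apply_apply, eDual, eDual]
    congr 2
    funext σ
    have : ((E ζ : 𝓞 F) : F) = ((u : 𝓞 F) : F) ^ 2 * ζ := rfl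
    rw [this, map_mul, map_pow]
    push_cast
    ring
  have h3 := congr_fun (coeff_unique hδ h h2) (E ζ)
  rw [E.symm_apply_apply] at h3
  exact h3

omit hδ in
/-- There is a unit, congruent to `1` modulo `N`, which is large at one place and small at the
others. -/
lemma exists_contracting_unit (h1 : Module.finrank ℚ F ≠ 1) {N : 𝓞 F} (hN : N ≠ 0) (σ₁ : F →+* ℝ) :
    ∃ u : (𝓞 F)ˣ, N ∣ (u : 𝓞 F) - 1 ∧ 1 < σ₁ ((u : 𝓞 F) : F) ^ 2 ∧
      ∀ σ, σ ≠ σ₁ → σ ((u : 𝓞 F) : F) ^ 2 < 1 := by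
  classical
  obtain ⟨C, hC0, hC⟩ := exists_unit_balance F
  obtain ⟨k, hk, hkN⟩ := exists_unit_pow_sub_one_dvd hN
  have hn : (0 : ℝ) < Module.finrank ℚ F := by exact_mod_cast Module.finrank_pos
  have hn2 : (2 : ℝ) ≤ Module.finrank ℚ F := by
    have : 0 < Module.finrank ℚ F := Module.finrank_pos
    exact_mod_cast (by omega : 2 ≤ Module.finrank ℚ F)
  -- The target has sum zero, so log|u| is within C of its negative: at least (n - 1)(C + 1) - C > 0
  -- at σ₁, where n ≥ 2 is used, and at most -1 elsewhere. The k-th power supplies the congruence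
  -- modulo N.
  obtain ⟨u, hu⟩ := hC fun σ => if σ = σ₁ then -(Module.finrank ℚ F - 1) * (C + 1) else C + 1
  have hsum : ∑ σ : F →+* ℝ, (if σ = σ₁ then -((Module.finrank ℚ F : ℝ) - 1) * (C + 1) else C + 1) = 0 := by
    have : ∀ σ : F →+* ℝ, (if σ = σ₁ then -((Module.finrank ℚ F : ℝ) - 1) * (C + 1) else C + 1) =
        (C + 1) - if σ = σ₁ then (Module.finrank ℚ F : ℝ) * (C + 1) else 0 := by
      intro σ
      split_ifs <;> ring
    simp only [this]
    rw [Finset.sum_sub_distrib, Finset.sum_ite_eq' Finset.univ σ₁, Finset.sum_const, Finset.card_univ,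
      card_realEmb, if_pos (Finset.mem_univ _), nsmul_eq_mul, sub_self]
  simp only [hsum, zero_div, sub_zero] at hu
  have hpow : ∀ σ : F →+* ℝ, σ (((u ^ k : (𝓞 F)ˣ) : 𝓞 F) : F) ^ 2 = (|σ ((u : 𝓞 F) : F)| ^ k) ^ 2 := by
    intro σ
    have : (((u ^ k : (𝓞 F)ˣ) : 𝓞 F) : F) = ((u : 𝓞 F) : F) ^ k := by
      rw [Units.val_pow_eq_pow_val]; rfl
    rw [this, map_pow, ← abs_pow, sq_abs]
  have hpos : ∀ σ : F →+* ℝ, 0 < |σ ((u : 𝓞 F) : F)| := fun σ =>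
    abs_pos.mpr (emb_ne_zero σ (coe_unit_ne_zero u))
  refine ⟨u ^ k, hkN u, ?_, fun σ hσ => ?_⟩
  · rw [hpow]
    have h := (abs_le.mp (hu σ₁)).1
    simp only [if_true] at h
    have : 0 < Real.log |σ₁ ((u : 𝓞 F) : F)| := by nlinarith
    have h2 := (Real.log_pos_iff (hpos σ₁).le).mp this
    exact one_lt_pow₀ (one_lt_pow₀ h2 hk.ne') two_ne_zero
  · rw [hpow]
    have h := (abs_le.mp (hu σ)).2
    simp only [hσ, if_false] at h
    have : Real.log |σ ((u : 𝓞 F) : F)| < 0 := by linarith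
    have h2 := (Real.log_neg_iff (hpos σ)).mp this
    exact pow_lt_one₀ (by positivity) (pow_lt_one₀ (by positivity) h2 hk.ne') two_ne_zero

omit hδ in
lemma exists_bound_latPoint {f : ((F →+* ℝ) → ℂ) → ℂ} (hf : ContinuousOn f (upperHalf F))
    {y : (F →+* ℝ) → ℝ} (hy : ∀ σ, 0 < y σ) :
    ∃ C, ∀ s ∈ unitCube (BIdx F), ‖f (latPoint s y)‖ ≤ C := by
  have hc : ContinuousOn (fun s : BIdx F → ℝ => f (latPoint s y)) (Set.Icc 0 1) := by
    refine hf.comp (Continuous.continuousOn ?_) fun s _ => latPoint_mem hy s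
    exact continuous_latPoint.comp (by fun_prop : Continuous fun s : BIdx F → ℝ => (s, y))
  obtain ⟨C, hC⟩ := isCompact_Icc.exists_bound_of_continuousOn hc
  exact ⟨C, fun s hs => hC s (unitCube_subset hs)⟩

/-- The Koecher principle. -/
theorem coeff_eq_zero_of_not_totallyPositive (hδ_pos : TotallyPositive (δ : F))
    {f : ((F →+* ℝ) → ℂ) → ℂ} (hf : DifferentiableOn ℂ f (upperHalf F)) {a : 𝓞 F → ℂ}
    (h : ∀ z ∈ upperHalf F, HasSum (fun ζ => a ζ * eDual δ ζ z) (f z)) {N : 𝓞 F} (hN : N ≠ 0)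
    (hu : ∀ u : (𝓞 F)ˣ, N ∣ (u : 𝓞 F) - 1 → ∀ z ∈ upperHalf F,
      f (fun σ => ((σ ((u : 𝓞 F) : F) ^ 2 : ℝ) : ℂ) * z σ) = f z)
    (h1 : Module.finrank ℚ F = 1 → ∃ B C : ℝ, ∀ z ∈ upperHalf F, (∀ σ, B ≤ (z σ).im) → ‖f z‖ ≤ C)
    {ζ : 𝓞 F} (hζ0 : ζ ≠ 0) (hζ : ¬ TotallyPositive (ζ : F)) : a ζ = 0 := by
  have hζ0' : (ζ : F) ≠ 0 := by exact_mod_cast hζ0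
  obtain ⟨σ₁, hσ₁⟩ := (not_totallyPositive_iff hζ0').mp hζ
  rw [← norm_le_zero_iff]
  by_cases hfin : Module.finrank ℚ F = 1
  -- In degree one there is no contracting unit; boundedness at infinity and y → ∞ in Cauchy's
  -- estimate take its place.
  · obtain ⟨B, C, hBC⟩ := h1 hfin
    have hcard : ∀ σ : F →+* ℝ, σ = σ₁ := by
      have : Fintype.card (F →+* ℝ) = 1 := by rw [card_realEmb, hfin]
      exact fun σ => (Fintype.card_le_one_iff.mp this.le) σ σ₁
    have hneg : σ₁ (ζ : F) / σ₁ (δ : F) < 0 := div_neg_of_neg_of_pos hσ₁ (hδ_pos σ₁)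
    have hlim : Filter.Tendsto (fun y : ℝ => C * Real.exp (2 * Real.pi * (σ₁ (ζ : F) / σ₁ (δ : F)) * y))
        Filter.atTop (nhds (C * 0)) := by
      refine Filter.Tendsto.const_mul _ (Real.tendsto_exp_atBot.comp ?_)
      exact Filter.tendsto_id.const_mul_atTop_of_neg (by nlinarith [Real.pi_pos])
    rw [mul_zero] at hlim
    refine ge_of_tendsto hlim ?_
    filter_upwards [Filter.eventually_ge_atTop (max B 1)] with y hy
    have hy0 : ∀ σ : F →+* ℝ, 0 < (fun _ => y : (F →+* ℝ) → ℝ) σ := fun σ =>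
      zero_lt_one.trans_le ((le_max_right B 1).trans hy)
    have := norm_coeff_le hδ h hy0 (C := C) (fun s _ => hBC _ (latPoint_mem hy0 s) fun σ => by
      rw [latPoint_im]; exact (le_max_left B 1).trans hy) ζ
    refine this.trans (le_of_eq ?_)
    have huniv : (Finset.univ : Finset (F →+* ℝ)) = {σ₁} := by
      ext σ; simp [hcard σ]
    rw [huniv, Finset.sum_singleton, ← mul_assoc]
  -- The coefficients at u^(2j)ζ and ζ agree. In Cauchy's estimate at height 1 for u^(2j)ζ, the
  -- negative term at σ₁ tends to -∞ with j and the other terms tend to 0, so the bound tends to 0.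
  · obtain ⟨u, huN, hu1, hu2⟩ := exists_contracting_unit hfin hN σ₁
    have hinv : ∀ (j : ℕ), a ((u : 𝓞 F) ^ (2 * j) * ζ) = a ζ := by
      intro j
      induction j with
      | zero => simp
      | succ j ih =>
        rw [← ih, ← coeff_unit_sq hδ h (hu u huN) ((u : 𝓞 F) ^ (2 * j) * ζ)]
        congr 1
        ring
    have hy : ∀ σ : F →+* ℝ, 0 < (1 : (F →+* ℝ) → ℝ) σ := fun σ => zero_lt_one
    obtain ⟨C, hC⟩ := exists_bound_latPoint hf.continuousOn hy
    have hbound : ∀ j : ℕ, ‖a ζ‖ ≤ C * Real.exp (2 * Real.pi * ∑ σ : F →+* ℝ,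
        (σ ((u : 𝓞 F) : F) ^ 2) ^ j * (σ (ζ : F) / σ (δ : F))) := by
      intro j
      rw [← hinv j]
      refine (norm_coeff_le hδ h hy hC _).trans (le_of_eq ?_)
      congr 3
      refine Finset.sum_congr rfl fun σ _ => ?_
      rw [intCoe_mul, intCoe_pow, map_mul, map_pow, Pi.one_apply, pow_mul]
      ring
    have hneg : σ₁ (ζ : F) / σ₁ (δ : F) < 0 := div_neg_of_neg_of_pos hσ₁ (hδ_pos σ₁)
    have hlim : Filter.Tendsto (fun j : ℕ => C * Real.exp (2 * Real.pi * ∑ σ : F →+* ℝ,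
        (σ ((u : 𝓞 F) : F) ^ 2) ^ j * (σ (ζ : F) / σ (δ : F)))) Filter.atTop (nhds (C * 0)) := by
      classical
      refine Filter.Tendsto.const_mul _ (Real.tendsto_exp_atBot.comp ?_)
      refine Filter.Tendsto.const_mul_atBot (by positivity) ?_
      simp only [← Finset.add_sum_erase _ _ (Finset.mem_univ σ₁)]
      refine Filter.Tendsto.atBot_add (C := ∑ σ ∈ Finset.univ.erase σ₁, 0 * (σ (ζ : F) / σ (δ : F)))
        ((tendsto_pow_atTop_atTop_of_one_lt hu1).atTop_mul_const_of_neg hneg) ?_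
      refine tendsto_finsetSum _ fun σ hσ => Filter.Tendsto.mul_const _ ?_
      exact tendsto_pow_atTop_nhds_zero_of_lt_one (sq_nonneg _) (hu2 σ (Finset.ne_of_mem_erase hσ))
    rw [mul_zero] at hlim
    exact ge_of_tendsto' hlim hbound

/-- A function with a regular Fourier expansion is bounded away from the real boundary. -/
lemma exists_bound_of_expansion (hδ_pos : TotallyPositive (δ : F))
    {f : ((F →+* ℝ) → ℂ) → ℂ} {a : 𝓞 F → ℂ}
    (h : ∀ z ∈ upperHalf F, HasSum (fun ζ => a ζ * eDual δ ζ z) (f z))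
    (ha : ∀ ζ : 𝓞 F, ζ ≠ 0 → ¬ TotallyPositive (ζ : F) → a ζ = 0)
    {y : (F →+* ℝ) → ℝ} (hy : ∀ σ, 0 < y σ) :
    ∃ C : ℝ, ∀ z ∈ upperHalf F, (∀ σ, y σ ≤ (z σ).im) → ‖f z‖ ≤ C := by
  have h0 := (h _ (latPoint_mem hy 0)).summable.norm
  refine ⟨∑' ζ, ‖a ζ * eDual δ ζ (latPoint 0 y)‖, fun z hz hyz => ?_⟩
  -- Only nonnegative exponents occur, so every term decreases in absolute value as the imaginary
  -- parts grow, and the series at height `y` is a uniform majorant.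
  have hle : ∀ ζ, ‖a ζ * eDual δ ζ z‖ ≤ ‖a ζ * eDual δ ζ (latPoint 0 y)‖ := by
    intro ζ
    rw [norm_mul, norm_mul]
    by_cases hζ : ζ ≠ 0 ∧ ¬ TotallyPositive (ζ : F)
    · rw [ha ζ hζ.1 hζ.2]; simp
    · refine mul_le_mul_of_nonneg_left ?_ (norm_nonneg _)
      rw [norm_eDual, norm_eDual, Real.exp_le_exp, neg_le_neg_iff]
      refine mul_le_mul_of_nonneg_left (Finset.sum_le_sum fun σ _ => ?_) (by positivity)
      rw [latPoint_im]
      refine mul_le_mul_of_nonneg_left (hyz σ) (div_nonneg ?_ (hδ_pos σ).le)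
      by_cases hζ0 : ζ = 0
      · rw [hζ0]; simp
      · exact ((not_not.mp fun h => hζ ⟨hζ0, h⟩) σ).le
  rw [← (h z hz).tsum_eq]
  have hs := Summable.of_nonneg_of_le (fun _ => norm_nonneg _) hle h0
  exact (norm_tsum_le_tsum_norm hs).trans (hs.tsum_le_tsum hle h0)

end Koecher

/-! ### Translations, diagonal matrices and their conjugates. -/

section Elementary

variable {F : Type*} [Field F]

/-- The translation by `B`. -/
def transSL (B : F) : Matrix.SpecialLinearGroup (Fin 2) F := ⟨!![1, B; 0, 1], by simp⟩

/-- The diagonal matrix with entries `u` and `u⁻¹`. -/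
def diagSL (u : (𝓞 F)ˣ) : Matrix.SpecialLinearGroup (Fin 2) F :=
  ⟨!![((u : 𝓞 F) : F), 0; 0, (((u⁻¹ : (𝓞 F)ˣ) : 𝓞 F) : F)], by
    rw [Matrix.det_fin_two_of, mul_zero, sub_zero, ← intCoe_mul, ← Units.val_mul, mul_inv_cancel]
    rfl⟩

lemma transSL_entry (B : F) : transSL B 0 0 = 1 ∧ transSL B 0 1 = B ∧ transSL B 1 0 = 0 ∧
    transSL B 1 1 = 1 := ⟨rfl, rfl, rfl, rfl⟩

lemma diagSL_entry (u : (𝓞 F)ˣ) : diagSL u 0 0 = ((u : 𝓞 F) : F) ∧ diagSL u 0 1 = 0 ∧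
    diagSL u 1 0 = 0 ∧ diagSL u 1 1 = (((u⁻¹ : (𝓞 F)ˣ) : 𝓞 F) : F) := ⟨rfl, rfl, rfl, rfl⟩

lemma unit_mul_inv_coe (u : (𝓞 F)ˣ) : ((u : 𝓞 F) : F) * (((u⁻¹ : (𝓞 F)ˣ) : 𝓞 F) : F) = 1 := by
  rw [← intCoe_mul, ← Units.val_mul, mul_inv_cancel]
  rfl

lemma moebius_transSL (B : F) (z : (F →+* ℝ) → ℂ) :
    moebius (transSL B) z = fun σ => z σ + (σ B : ℂ) := by
  obtain ⟨h1, h2, h3, h4⟩ := transSL_entry B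
  funext σ
  rw [moebius_apply, den, h1, h2, h3, h4]
  simp

lemma moebius_diagSL (u : (𝓞 F)ˣ) (z : (F →+* ℝ) → ℂ) :
    moebius (diagSL u) z = fun σ => ((σ ((u : 𝓞 F) : F) ^ 2 : ℝ) : ℂ) * z σ := by
  obtain ⟨h1, h2, h3, h4⟩ := diagSL_entry u
  funext σ
  have h := congr_arg (fun x => ((σ x : ℝ) : ℂ)) (unit_mul_inv_coe u)
  simp only [map_mul, map_one, Complex.ofReal_mul, Complex.ofReal_one] at h
  rw [moebius_apply, den, h1, h2, h3, h4, map_zero, Complex.ofReal_zero, zero_mul, zero_add, add_zero,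
    div_eq_iff (right_ne_zero_of_mul_eq_one h)]
  push_cast
  linear_combination (-((σ ((u : 𝓞 F) : F) : ℂ) * z σ)) * h

lemma conj_transSL (α : Matrix.SpecialLinearGroup (Fin 2) F) (B : F) :
    (α * transSL B * α⁻¹) 0 0 = 1 - α 0 0 * α 1 0 * B ∧
    (α * transSL B * α⁻¹) 0 1 = α 0 0 ^ 2 * B ∧
    (α * transSL B * α⁻¹) 1 0 = -(α 1 0 ^ 2 * B) ∧
    (α * transSL B * α⁻¹) 1 1 = 1 + α 0 0 * α 1 0 * B := by
  obtain ⟨h1, h2, h3, h4⟩ := transSL_entry B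
  obtain ⟨e1, e2, e3, e4⟩ := entry_inv α
  have hd := det_eq α
  simp only [mul_entry, h1, h2, h3, h4, e1, e2, e3, e4]
  refine ⟨?_, ?_, ?_, ?_⟩
  · linear_combination hd
  · ring
  · ring
  · linear_combination hd

lemma conj_diagSL (α : Matrix.SpecialLinearGroup (Fin 2) F) (u : (𝓞 F)ˣ) :
    (α * diagSL u * α⁻¹) 0 0 = α 0 0 * α 1 1 * ((u : 𝓞 F) : F) -
      α 0 1 * α 1 0 * (((u⁻¹ : (𝓞 F)ˣ) : 𝓞 F) : F) ∧
    (α * diagSL u * α⁻¹) 0 1 = α 0 0 * α 0 1 *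
      ((((u⁻¹ : (𝓞 F)ˣ) : 𝓞 F) : F) - ((u : 𝓞 F) : F)) ∧
    (α * diagSL u * α⁻¹) 1 0 = α 1 0 * α 1 1 *
      (((u : 𝓞 F) : F) - (((u⁻¹ : (𝓞 F)ˣ) : 𝓞 F) : F)) ∧
    (α * diagSL u * α⁻¹) 1 1 = α 0 0 * α 1 1 * (((u⁻¹ : (𝓞 F)ˣ) : 𝓞 F) : F) -
      α 0 1 * α 1 0 * ((u : 𝓞 F) : F) := by
  obtain ⟨h1, h2, h3, h4⟩ := diagSL_entry u
  obtain ⟨e1, e2, e3, e4⟩ := entry_inv α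
  simp only [mul_entry, h1, h2, h3, h4, e1, e2, e3, e4]
  refine ⟨?_, ?_, ?_, ?_⟩ <;> ring

/-- Common denominators. -/
lemma exists_common_denominator [NumberField F] (s : Finset F) :
    ∃ N : 𝓞 F, N ≠ 0 ∧ ∀ x ∈ s, (N : F) * x ∈ intSub F := by
  obtain ⟨b, hb⟩ := IsLocalization.exist_integer_multiples_of_finset (𝓞 F)⁰ s
  refine ⟨b, nonZeroDivisors.ne_zero b.2, fun x hx => ?_⟩
  obtain ⟨y, hy⟩ := hb x hx
  refine ⟨y, ?_⟩
  rw [hy, Algebra.smul_def]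

end Elementary

/-! ### The level group, and how forms inherit invariance from theta. -/

section Level

variable {F : Type*} [Field F] [NumberField F] [NumberField.IsTotallyReal F]
variable {δ c : 𝓞 F} {𝔠 : Ideal (𝓞 F)}
variable (hδ : Ideal.span {δ} = differentIdeal ℤ (𝓞 F)) (hc : Ideal.span {c} = 𝔠)
include hδ hc

lemma mem_GamLevel_iff (hc0 : c ≠ 0) (γ : Matrix.SpecialLinearGroup (Fin 2) F) :
    γ ∈ GamLevel 𝔠 ↔ γ 0 0 ∈ intSub F ∧ γ 1 1 ∈ intSub F ∧ (δ : F) * γ 0 1 / 2 ∈ intSub F ∧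
      2 * γ 1 0 / ((δ : F) * (c : F)) ∈ intSub F := by
  have hδ0 : (δ : F) ≠ 0 := by exact_mod_cast delta_ne_zero hδ
  have hc0' : (c : F) ≠ 0 := by exact_mod_cast hc0
  have h1 : ∀ x : F, x ∈ (1 : FractionalIdeal (𝓞 F)⁰ F) ↔ x ∈ intSub F := fun x => by
    rw [FractionalIdeal.mem_one_iff]; exact Iff.rfl
  rw [GamLevel, Gam, Set.mem_ofPred_eq, h1, h1]
  refine and_congr_right fun _ => and_congr_right fun _ => and_congr ?_ ?_
  · rw [FractionalIdeal.mem_singleton_mul]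
    constructor
    · rintro ⟨y, hy, hxy⟩
      obtain ⟨ζ, rfl⟩ := (mem_diff_inv_iff hδ y).mp hy
      rw [hxy]
      refine ⟨ζ, ?_⟩
      field_simp
    · rintro ⟨ζ, hζ⟩
      refine ⟨(ζ : F) / δ, (mem_diff_inv_iff hδ _).mpr ⟨ζ, rfl⟩, ?_⟩
      have hζ' : (ζ : F) = (δ : F) * γ 0 1 / 2 := hζ
      rw [hζ']
      field_simp
  · have hprod : FractionalIdeal.spanSingleton (𝓞 F)⁰ ((2 : F)⁻¹) * diff F *
        (𝔠 : FractionalIdeal (𝓞 F)⁰ F) =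
        FractionalIdeal.spanSingleton (𝓞 F)⁰ ((2 : F)⁻¹ * (δ : F) * (c : F)) := by
      rw [diff, ← hδ, ← hc, FractionalIdeal.coeIdeal_span_singleton,
        FractionalIdeal.coeIdeal_span_singleton, FractionalIdeal.spanSingleton_mul_spanSingleton,
        FractionalIdeal.spanSingleton_mul_spanSingleton]
    rw [hprod, FractionalIdeal.mem_spanSingleton]
    constructor
    · rintro ⟨ζ, hζ⟩
      refine ⟨ζ, ?_⟩
      rw [← hζ, Algebra.smul_def]
      field_simp
    · rintro ⟨ζ, hζ⟩
      refine ⟨ζ, ?_⟩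
      rw [Algebra.smul_def, hζ]
      field_simp

/-- As 4 divides c, a lower left entry in 2⁻¹δ𝔠 lies in 2δR. -/
lemma GamLevel_subset_thetaGroup (hc0 : c ≠ 0) (h4 : (4 : 𝓞 F) ∣ c) :
    GamLevel 𝔠 ⊆ thetaGroup δ := by
  intro γ hγ
  have hδ0 : (δ : F) ≠ 0 := by exact_mod_cast delta_ne_zero hδ
  have hc0' : (c : F) ≠ 0 := by exact_mod_cast hc0
  obtain ⟨h1, h2, h3, h5⟩ := (mem_GamLevel_iff hδ hc hc0 γ).mp hγ
  refine ⟨h1, h2, h3, ?_⟩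
  obtain ⟨m, rfl⟩ := h4
  have : γ 1 0 / (2 * (δ : F)) = (m : F) * (2 * γ 1 0 / ((δ : F) * ((4 * m : 𝓞 F) : F))) := by
    rw [intCoe_mul] at hc0' ⊢
    have : ((4 : 𝓞 F) : F) = 4 := map_ofNat (algebraMap (𝓞 F) F) 4
    rw [this] at hc0' ⊢
    have hm : (m : F) ≠ 0 := right_ne_zero_of_mul hc0'
    field_simp
    norm_num
  rw [this]
  exact mul_mem (coe_mem_intSub m) h5

omit hδ hc in
lemma not_isUnit_of_four_dvd (h4 : (4 : 𝓞 F) ∣ c) : ¬ IsUnit c := by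
  intro hcu
  obtain ⟨u, hu⟩ := isUnit_of_dvd_unit h4 hcu
  have h := unit_prod_abs u
  have hval : ∀ σ : F →+* ℝ, |σ ((u : 𝓞 F) : F)| = 4 := by
    intro σ
    have : ((4 : 𝓞 F) : F) = 4 := map_ofNat (algebraMap (𝓞 F) F) 4
    rw [hu, this, map_ofNat]
    norm_num
  simp only [hval, Finset.prod_const, Finset.card_univ] at h
  exact (one_lt_pow₀ (by norm_num : (1 : ℝ) < 4) Fintype.card_ne_zero).ne' h

/-- With a vanishing upper left entry the determinant would make c a unit, against 4 ∣ c. This keeps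
the default value 0 of `finitePart` out of the transformation law. -/
lemma GamLevel_entry_ne_zero (hc0 : c ≠ 0) (h4 : (4 : 𝓞 F) ∣ c)
    {γ : Matrix.SpecialLinearGroup (Fin 2) F} (hγ : γ ∈ GamLevel 𝔠) : γ 0 0 ≠ 0 := by
  intro h0
  have hδ0 : (δ : F) ≠ 0 := by exact_mod_cast delta_ne_zero hδ
  have hc0' : (c : F) ≠ 0 := by exact_mod_cast hc0
  obtain ⟨-, -, ⟨x, hx⟩, ⟨y, hy⟩⟩ := (mem_GamLevel_iff hδ hc hc0 γ).mp hγ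
  have hx' : (x : F) = (δ : F) * γ 0 1 / 2 := hx
  have hy' : (y : F) = 2 * γ 1 0 / ((δ : F) * (c : F)) := hy
  have hd := det_eq γ
  rw [h0] at hd
  apply not_isUnit_of_four_dvd h4
  refine IsUnit.of_mul_eq_one (-(x * y)) ?_
  have : ((c * -(x * y) : 𝓞 F) : F) = ((1 : 𝓞 F) : F) := by
    rw [intCoe_mul, intCoe_neg, intCoe_mul, intCoe_one, hx', hy']
    field_simp
    linear_combination hd
  exact_mod_cast this

variable {ψ : HeckeCharacter F} {f : ((F →+* ℝ) → ℂ) → ℂ}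

omit hδ hc in
lemma continuousOn_absFactor (γ : Matrix.SpecialLinearGroup (Fin 2) F) :
    ContinuousOn (absFactor γ) (upperHalf F) := by
  unfold absFactor
  refine Continuous.continuousOn (Continuous.rpow_const ?_ fun _ => Or.inr (by norm_num))
  fun_prop

/-- ψ_𝔠 has absolute value 1 and |h| is known from `norm_theta_moebius`. The transformation law is
available only where θ ≠ 0; the identity of absolute values extends by density. -/
lemma IsModularForm.norm_moebius (hc0 : c ≠ 0) (h4 : (4 : 𝓞 F) ∣ c) (hf : IsModularForm 𝔠 ψ f)
    {γ : Matrix.SpecialLinearGroup (Fin 2) F} (hγ : γ ∈ GamLevel 𝔠) {z : (F →+* ℝ) → ℂ}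
    (hz : z ∈ upperHalf F) : ‖f (moebius γ z)‖ = absFactor γ z * ‖f z‖ := by
  refine eqOn_of_theta_ne_zero (f := fun z => ‖f (moebius γ z)‖)
    (g := fun z => absFactor γ z * ‖f z‖) ?_ ?_ (fun z hz hθ => ?_) z hz
  · exact (hf.holomorphic.continuousOn.comp (continuousOn_moebius γ) fun z hz => moebius_mem γ hz).norm
  · exact (continuousOn_absFactor γ).mul hf.holomorphic.continuousOn.norm
  · rw [hf.transform γ hγ z hz hθ, norm_mul, norm_mul,
      ψ.norm_finitePart 𝔠 (GamLevel_entry_ne_zero hδ hc hc0 h4 hγ), one_mul, autFactor, norm_div,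
      norm_theta_moebius hδ (GamLevel_subset_thetaGroup hδ hc hc0 h4 hγ) hz,
      mul_div_cancel_right₀ _ (norm_ne_zero_iff.mpr hθ)]

omit hδ hc in
/-- A modular form inherits the invariance of a transformed theta series. -/
lemma IsModularForm.div_moebius_eq (hf : IsModularForm 𝔠 ψ f)
    {α τ : Matrix.SpecialLinearGroup (Fin 2) F} {J ϑ : ((F →+* ℝ) → ℂ) → ℂ}
    (hJ : ContinuousOn J (upperHalf F)) (hJ0 : ∀ z ∈ upperHalf F, J z ≠ 0)
    (hθ : ∀ z ∈ upperHalf F, theta (moebius α z) = J z * ϑ z)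
    (hϑ : ∀ z ∈ upperHalf F, ϑ (moebius τ z) = ϑ z)
    (hγ : α * τ * α⁻¹ ∈ GamLevel 𝔠) (hψ1 : ψ.finitePart 𝔠 ((α * τ * α⁻¹) 0 0) = 1)
    {z : (F →+* ℝ) → ℂ} (hz : z ∈ upperHalf F) :
    f (moebius α (moebius τ z)) / J (moebius τ z) = f (moebius α z) / J z := by
  set γ := α * τ * α⁻¹ with hγdef
  have hγα : ∀ w ∈ upperHalf F, moebius γ w = moebius α (moebius τ (moebius α⁻¹ w)) := by
    intro w hw
    rw [hγdef, moebius_mul _ _ hw, moebius_mul _ _ (moebius_mem _ hw)]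
  -- Cross-multiplied, so that both sides are continuous. Where θ(w) ≠ 0 the factor θ(γw)/θ(w) is a
  -- quotient of two values of J, since the invariance of ϑ under τ cancels the other factor.
  have key : ∀ w ∈ upperHalf F, f (moebius γ w) * J (moebius α⁻¹ w) =
      f w * J (moebius τ (moebius α⁻¹ w)) := by
    have c1 : ContinuousOn (fun w => moebius α⁻¹ w) (upperHalf F) := continuousOn_moebius _
    refine eqOn_of_theta_ne_zero ?_ ?_ fun w hw hw0 => ?_
    · exact (hf.holomorphic.continuousOn.comp (continuousOn_moebius γ) fun z hz => moebius_mem γ hz).mul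
        (hJ.comp c1 fun z hz => moebius_mem _ hz)
    · exact hf.holomorphic.continuousOn.mul (hJ.comp ((continuousOn_moebius τ).comp c1 fun z hz =>
        moebius_mem _ hz) fun z hz => moebius_mem _ (moebius_mem _ hz))
    · have hv := moebius_mem α⁻¹ hw
      have hτv := moebius_mem τ hv
      rw [hf.transform γ hγ w hw hw0, hψ1, one_mul, autFactor, hγα w hw, hθ _ hτv, hϑ _ hv]
      have h1 := hθ _ hv
      rw [moebius_inv_cancel α hw] at h1
      have hϑ0 : ϑ (moebius α⁻¹ w) ≠ 0 := fun h => hw0 (by rw [h1, h, mul_zero])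
      rw [h1]
      have := hJ0 _ hv
      field_simp
  have h := key _ (moebius_mem α hz)
  rw [hγα _ (moebius_mem α hz), moebius_cancel_inv α hz] at h
  rw [div_eq_div_iff (hJ0 _ (moebius_mem τ hz)) (hJ0 _ hz), h]

end Level

/-! ### Boundedness at an arbitrary cusp. -/

section Cusps

variable {F : Type*} [Field F] [NumberField F] [NumberField.IsTotallyReal F]

/-- Scaling by an element of the field. -/
def scale (m : F) (z : (F →+* ℝ) → ℂ) : (F →+* ℝ) → ℂ := fun σ => (σ m : ℂ) * z σ

lemma scale_mem {m : F} (hm : TotallyPositive m) {z : (F →+* ℝ) → ℂ} (hz : z ∈ upperHalf F) :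
    scale m z ∈ upperHalf F := smul_mem_upperHalf (r := fun σ => σ m) hm hz

lemma TotallyPositive.inv {m : F} (hm : TotallyPositive m) : TotallyPositive m⁻¹ := fun σ => by
  rw [map_inv₀]; exact inv_pos.mpr (hm σ)

lemma TotallyPositive.mul {m m' : F} (hm : TotallyPositive m) (hm' : TotallyPositive m') :
    TotallyPositive (m * m') := fun σ => by
  rw [map_mul]; exact mul_pos (hm σ) (hm' σ)

lemma TotallyPositive.div {m m' : F} (hm : TotallyPositive m) (hm' : TotallyPositive m') :
    TotallyPositive (m / m') := by
  rw [div_eq_mul_inv]; exact hm.mul hm'.inv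

lemma totallyPositive_two : TotallyPositive (2 : F) := fun σ => by rw [map_ofNat]; norm_num

lemma totallyPositive_sq {m : F} (hm : m ≠ 0) : TotallyPositive (m ^ 2) := fun σ => by
  rw [map_pow]
  have := emb_ne_zero σ hm
  positivity

lemma scale_scale (m m' : F) (z : (F →+* ℝ) → ℂ) : scale m (scale m' z) = scale (m * m') z := by
  funext σ
  simp only [scale, map_mul, Complex.ofReal_mul, mul_assoc]

lemma scale_one (z : (F →+* ℝ) → ℂ) : scale (1 : F) z = z := by
  funext σ
  simp [scale]

lemma differentiable_scale (m : F) : Differentiable ℂ (scale m) := by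
  unfold scale; fun_prop

variable {δ : 𝓞 F} (hδ : Ideal.span {δ} = differentIdeal ℤ (𝓞 F)) (hδ_pos : TotallyPositive (δ : F))
include hδ hδ_pos

/-- Fourier expansion of a function invariant under translations and squares of units. -/
theorem exists_regular_expansion {m : F} (hm : TotallyPositive m) {h : ((F →+* ℝ) → ℂ) → ℂ}
    (hh : DifferentiableOn ℂ h (upperHalf F))
    (hper : ∀ z ∈ upperHalf F, ∀ r : 𝓞 F, h (moebius (transSL (m * r)) z) = h z)
    {N : 𝓞 F} (hN : N ≠ 0)
    (hu : ∀ u : (𝓞 F)ˣ, N ∣ (u : 𝓞 F) - 1 → ∀ z ∈ upperHalf F, h (moebius (diagSL u) z) = h z)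
    (h1 : Module.finrank ℚ F = 1 → ∃ B C : ℝ, ∀ z ∈ upperHalf F, (∀ σ, B ≤ (z σ).im) → ‖h z‖ ≤ C) :
    ∃ a : 𝓞 F → ℂ, (∀ z ∈ upperHalf F, HasSum (fun ζ => a ζ * eDual δ ζ z) (h (scale m z))) ∧
      (∀ ζ : 𝓞 F, ζ ≠ 0 → ¬ TotallyPositive (ζ : F) → a ζ = 0) ∧
      ∀ u : (𝓞 F)ˣ, N ∣ (u : 𝓞 F) - 1 → ∀ ζ, a ((u : 𝓞 F) ^ 2 * ζ) = a ζ := by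
  have hd : DifferentiableOn ℂ (fun z => h (scale m z)) (upperHalf F) :=
    hh.comp (differentiable_scale m).differentiableOn fun z hz => scale_mem hm hz
  have hp : IntPeriodic fun z => h (scale m z) := by
    intro z hz r
    simp only
    rw [← hper (scale m z) (scale_mem hm hz) r, moebius_transSL]
    congr 1
    funext σ
    simp only [scale, map_mul]
    push_cast
    ring
  have hus : ∀ u : (𝓞 F)ˣ, N ∣ (u : 𝓞 F) - 1 → ∀ z ∈ upperHalf F,
      h (scale m (fun σ => ((σ ((u : 𝓞 F) : F) ^ 2 : ℝ) : ℂ) * z σ)) = h (scale m z) := by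
    intro u huN z hz
    rw [← hu u huN (scale m z) (scale_mem hm hz), moebius_diagSL]
    congr 1
    funext σ
    simp only [scale]
    ring
  have h1' : Module.finrank ℚ F = 1 →
      ∃ B C : ℝ, ∀ z ∈ upperHalf F, (∀ σ, B ≤ (z σ).im) → ‖h (scale m z)‖ ≤ C := by
    intro hfin
    obtain ⟨B, C, hBC⟩ := h1 hfin
    refine ⟨∑ σ : F →+* ℝ, |B| / σ m, C, fun z hz hzB => hBC _ (scale_mem hm hz) fun σ => ?_⟩
    simp only [scale, Complex.im_ofReal_mul]
    have hle : |B| / σ m ≤ (z σ).im := by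
      refine le_trans ?_ (hzB σ)
      exact Finset.single_le_sum (f := fun σ : F →+* ℝ => |B| / σ m)
        (fun τ _ => div_nonneg (abs_nonneg B) (hm τ).le) (Finset.mem_univ σ)
    rw [div_le_iff₀ (hm σ)] at hle
    linarith [le_abs_self B]
  obtain ⟨a, ha⟩ := exists_expansion hδ hd hp
  exact ⟨a, ha, fun ζ hζ0 hζ => coeff_eq_zero_of_not_totallyPositive hδ hδ_pos hd ha hN hus h1' hζ0 hζ,
    fun u huN ζ => coeff_unit_sq hδ ha (hus u huN) ζ⟩

/-- By the Koecher principle, invariance under a lattice of translations and a congruence group of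
units gives an expansion without negative exponents, which is bounded above every positive height.
For F = ℚ this improves a bound known only at large height. -/
theorem exists_bound_im {m : F} (hm : TotallyPositive m) {h : ((F →+* ℝ) → ℂ) → ℂ}
    (hh : DifferentiableOn ℂ h (upperHalf F))
    (hper : ∀ z ∈ upperHalf F, ∀ r : 𝓞 F, h (moebius (transSL (m * r)) z) = h z)
    {N : 𝓞 F} (hN : N ≠ 0)
    (hu : ∀ u : (𝓞 F)ˣ, N ∣ (u : 𝓞 F) - 1 → ∀ z ∈ upperHalf F, h (moebius (diagSL u) z) = h z)
    (h1 : Module.finrank ℚ F = 1 → ∃ B C : ℝ, ∀ z ∈ upperHalf F, (∀ σ, B ≤ (z σ).im) → ‖h z‖ ≤ C)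
    {y : ℝ} (hy : 0 < y) :
    ∃ C : ℝ, ∀ z ∈ upperHalf F, (∀ σ, y ≤ (z σ).im) → ‖h z‖ ≤ C := by
  obtain ⟨a, ha, ha0, -⟩ := exists_regular_expansion hδ hδ_pos hm hh hper hN hu h1
  obtain ⟨C, hC⟩ := exists_bound_of_expansion hδ hδ_pos ha ha0 (y := fun σ => y / σ m)
    fun σ => div_pos hy (hm σ)
  refine ⟨C, fun z hz hyz => ?_⟩
  have h2 := hC (scale m⁻¹ z) (scale_mem hm.inv hz) fun σ => by
    simp only [scale, Complex.im_ofReal_mul, map_inv₀]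
    rw [div_eq_inv_mul]
    exact mul_le_mul_of_nonneg_left (hyz σ) (inv_pos.mpr (hm σ)).le
  rwa [scale_scale, mul_inv_cancel₀ hm.ne_zero', scale_one] at h2

omit hδ hδ_pos in
lemma finitePart_one_add {c : 𝓞 F} {𝔠 : Ideal (𝓞 F)} (hc : Ideal.span {c} = 𝔠) (h4 : (4 : 𝓞 F) ∣ c)
    {ψ : HeckeCharacter F} (hψ : ψ.ConductorDvd 𝔠) {x : F} (hx : (x - 1) / (c : F) ∈ intSub F)
    (hc0 : c ≠ 0) : ψ.finitePart 𝔠 x = 1 := by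
  obtain ⟨y, hy⟩ := hx
  have hc0' : (c : F) ≠ 0 := by exact_mod_cast hc0
  have hy' : (y : F) = (x - 1) / (c : F) := hy
  have hx : x = ((1 + c * y : 𝓞 F) : F) := by
    rw [intCoe_add, intCoe_mul, hy', intCoe_one]
    field_simp
    ring
  rw [hx]
  refine HeckeCharacter.finitePart_eq_one_of_sub_one_mem hψ ?_ ?_
  · intro h0
    refine not_isUnit_of_four_dvd h4 (IsUnit.of_mul_eq_one (-y) ?_)
    linear_combination -h0
  · rw [← hc, add_sub_cancel_left]
    exact Ideal.mem_span_singleton.mpr (dvd_mul_right _ _)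

variable {c : 𝓞 F} {𝔠 : Ideal (𝓞 F)} {ψ : HeckeCharacter F} {f : ((F →+* ℝ) → ℂ) → ℂ}

set_option maxHeartbeats 1000000 in
/-- Modular forms are bounded near every cusp other than infinity. -/
theorem IsModularForm.exists_cusp_bound (hf : IsModularForm 𝔠 ψ f) (hc : Ideal.span {c} = 𝔠)
    (hc0 : c ≠ 0) (h4 : (4 : 𝓞 F) ∣ c) (hψ : ψ.ConductorDvd 𝔠)
    {α : Matrix.SpecialLinearGroup (Fin 2) F} (hα : α 1 0 ≠ 0) {y : ℝ} (hy : 0 < y) :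
    ∃ C : ℝ, ∀ z ∈ upperHalf F, (∀ σ, y ≤ (z σ).im) → ‖f (moebius α z)‖ ≤ C * absFactor α z := by
  have hδ0 : (δ : F) ≠ 0 := by exact_mod_cast delta_ne_zero hδ
  have hc0' : (c : F) ≠ 0 := by exact_mod_cast hc0
  obtain ⟨K, hK, hθ⟩ := exists_theta_moebius hδ
  classical
  obtain ⟨M, hM, hMx⟩ := exists_common_denominator
    ({(δ : F) * α 0 0 / α 1 0, (δ : F) * α 0 0 / (2 * α 1 0)} : Finset F)
  have hM0 : (M : F) ≠ 0 := by exact_mod_cast hM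
  have hθα := hθ α M hα hM
    (by
      have := hMx ((δ : F) * α 0 0 / α 1 0) (by simp)
      convert! this using 1
      ring)
    (by
      have := mul_mem (coe_mem_intSub M) (hMx ((δ : F) * α 0 0 / (2 * α 1 0)) (by simp))
      convert! this using 1
      ring)
  -- The numbers whose denominators N must clear: those in the translation and unit invariance of
  -- the transformed theta series, in the entries of ατα⁻¹ for membership in Γ_𝔠, and in the
  -- congruence of its upper left entry to 1 modulo c.
  let X : Fin 10 → F := ![α 1 0 ^ 2 / ((M : F) ^ 2 * (δ : F) ^ 2), 2 * α 0 0 * α 1 0 / ((δ : F) * c),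
    α 0 0 ^ 2, 4 * α 1 0 ^ 2 / ((δ : F) ^ 2 * c), α 1 0 * α 1 1 / (2 * (M : F) ^ 2 * (δ : F)),
    1 / (M : F), α 0 0 * α 1 1 / c, α 0 1 * α 1 0 / c, (δ : F) * α 0 0 * α 0 1 / 2,
    2 * (α 1 0 * α 1 1) / ((δ : F) * c)]
  obtain ⟨N₁, hN₁, hN₁x⟩ := exists_common_denominator (Finset.univ.image X)
  -- A square, so that the translation lattice (2N/δ)R has a totally positive multiplier.
  set N : 𝓞 F := N₁ ^ 2 with hNdef
  have hN : N ≠ 0 := pow_ne_zero 2 hN₁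
  have hNpos : TotallyPositive (N : F) := by
    rw [hNdef, intCoe_pow]
    exact totallyPositive_sq (by exact_mod_cast hN₁)
  have hNx : ∀ i, (N : F) * X i ∈ intSub F := by
    intro i
    have : (N : F) * X i = (N₁ : F) * (N₁ * X i) := by rw [hNdef, intCoe_pow]; ring
    rw [this]
    exact mul_mem (coe_mem_intSub _) (hN₁x _ (Finset.mem_image_of_mem X (Finset.mem_univ i)))
  have hX : ∀ i, ∀ r : 𝓞 F, (N : F) * X i * r ∈ intSub F := fun i r =>
    mul_mem (hNx i) (coe_mem_intSub r)
  have x0 : ∀ r : 𝓞 F, (N : F) * (α 1 0 ^ 2 / ((M : F) ^ 2 * (δ : F) ^ 2)) * r ∈ intSub F := hX 0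
  have x1 : ∀ r : 𝓞 F, (N : F) * (2 * α 0 0 * α 1 0 / ((δ : F) * c)) * r ∈ intSub F := hX 1
  have x2 : ∀ r : 𝓞 F, (N : F) * (α 0 0 ^ 2) * r ∈ intSub F := hX 2
  have x3 : ∀ r : 𝓞 F, (N : F) * (4 * α 1 0 ^ 2 / ((δ : F) ^ 2 * c)) * r ∈ intSub F := hX 3
  have x6 : ∀ r : 𝓞 F, (N : F) * (α 0 0 * α 1 1 / c) * r ∈ intSub F := hX 6
  have x7 : ∀ r : 𝓞 F, (N : F) * (α 0 1 * α 1 0 / c) * r ∈ intSub F := hX 7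
  have x8 : ∀ r : 𝓞 F, (N : F) * ((δ : F) * α 0 0 * α 0 1 / 2) * r ∈ intSub F := hX 8
  have x9 : ∀ r : 𝓞 F, (N : F) * (2 * (α 1 0 * α 1 1) / ((δ : F) * c)) * r ∈ intSub F := hX 9
  have x4 : (N : F) * (α 1 0 * α 1 1 / (2 * (M : F) ^ 2 * (δ : F))) ∈ intSub F := hNx 4
  have x5 : (N : F) * (1 / (M : F)) ∈ intSub F := hNx 5
  have hJc : ContinuousOn (jFactor (M : F) α) (upperHalf F) :=
    (differentiableOn_jFactor hM0 hα).continuousOn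
  have hJ0 : ∀ z ∈ upperHalf F, jFactor (M : F) α z ≠ 0 := fun z hz => jFactor_ne_zero hM0 hα hz
  -- Dividing by J, which has no zeros, gives a weight one half translate of f by α without choosing
  -- a multiplier; |J| is a constant times `absFactor`.
  set h : ((F →+* ℝ) → ℂ) → ℂ := fun z => f (moebius α z) / jFactor (M : F) α z with hh
  set κ : ℝ := (∏ σ : F →+* ℝ, |σ (M : F)| ^ 2)⁻¹ ^ (1 / 2 : ℝ) *
    (∏ σ : F →+* ℝ, |σ (α 1 0)|) ^ (1 / 2 : ℝ) with hκ
  have hκ0 : 0 < κ := by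
    have h1 : ∀ σ : F →+* ℝ, 0 < |σ (M : F)| := fun σ => abs_pos.mpr (emb_ne_zero σ hM0)
    have h2 : ∀ σ : F →+* ℝ, 0 < |σ (α 1 0)| := fun σ => abs_pos.mpr (emb_ne_zero σ hα)
    have h3 : 0 < ∏ σ : F →+* ℝ, |σ (M : F)| ^ 2 := Finset.prod_pos fun σ _ => pow_pos (h1 σ) 2
    have h4 : 0 < ∏ σ : F →+* ℝ, |σ (α 1 0)| := Finset.prod_pos fun σ _ => h2 σ
    positivity
  have hnorm : ∀ z ∈ upperHalf F, ‖f (moebius α z)‖ = ‖h z‖ * (κ * absFactor α z) := by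
    intro z hz
    rw [hh, hκ, ← norm_jFactor, ← norm_mul, div_mul_cancel₀ _ (hJ0 z hz)]
  have hd : DifferentiableOn ℂ h (upperHalf F) := by
    have h1 : DifferentiableOn ℂ (fun z => f (moebius α z)) (upperHalf F) := by
      refine hf.holomorphic.comp (differentiableOn_pi.mpr fun σ => ?_) fun z hz => moebius_mem α hz
      unfold moebius
      simp only [div_eq_mul_inv]
      intro z hz
      refine DifferentiableWithinAt.mul (by fun_prop) (DifferentiableWithinAt.fun_inv (by fun_prop) ?_)
      exact den_ne_zero α hz σ
    intro z hz
    rw [hh]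
    simp only [div_eq_mul_inv]
    exact (h1 z hz).mul ((differentiableOn_jFactor hM0 hα z hz).fun_inv (hJ0 z hz))
  have hper : ∀ z ∈ upperHalf F, ∀ r : 𝓞 F, h (moebius (transSL (2 * (N : F) / δ * r)) z) = h z := by
    intro z hz r
    obtain ⟨e1, e2, e3, e4⟩ := conj_transSL α (2 * (N : F) / δ * r)
    refine hf.div_moebius_eq hJc hJ0 hθα (fun z hz => ?_) ?_ ?_ hz
    · congr 1
      rw [moebius_transSL]
      refine thetaTransform_add hδ hM ?_ z
      have := x0 r
      convert! this using 1
      field_simp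
    · rw [mem_GamLevel_iff hδ hc hc0, e1, e2, e3, e4]
      have k2 := mul_mem (coe_mem_intSub c) (x1 r)
      have k2' : α 0 0 * α 1 0 * (2 * (N : F) / δ * r) ∈ intSub F := by
        convert! k2 using 1
        field_simp
      refine ⟨sub_mem (one_mem _) k2', add_mem (one_mem _) k2', ?_, ?_⟩
      · have := x2 r
        convert! this using 1
        field_simp
      · have := neg_mem (x3 r)
        convert! this using 1
        field_simp
        ring
    · refine finitePart_one_add hc h4 hψ ?_ hc0
      rw [e1]
      have := neg_mem (x1 r)
      convert! this using 1
      field_simp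
      ring
  have hunit : ∀ u : (𝓞 F)ˣ, N ∣ (u : 𝓞 F) - 1 → ∀ z ∈ upperHalf F, h (moebius (diagSL u) z) = h z := by
    intro u hu z hz
    obtain ⟨e1, e2, e3, e4⟩ := conj_diagSL α u
    obtain ⟨k, hk⟩ := hu
    have hu' : ((u : 𝓞 F) : F) = 1 + N * k := by
      have := congr_arg (algebraMap (𝓞 F) F) hk
      rw [map_sub, map_mul, map_one, sub_eq_iff_eq_add'] at this
      exact this
    have hui : (((u⁻¹ : (𝓞 F)ˣ) : 𝓞 F) : F) = 1 - N * k * (((u⁻¹ : (𝓞 F)ˣ) : 𝓞 F) : F) := by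
      have := unit_mul_inv_coe u
      rw [hu'] at this
      linear_combination this
    set v : 𝓞 F := ((u⁻¹ : (𝓞 F)ˣ) : 𝓞 F) with hv
    have hdet := det_eq α
    have k7 := x6
    have k8 := x7
    have k7' : ∀ r : 𝓞 F, (N : F) * (α 0 0 * α 1 1) * r ∈ intSub F := fun r => by
      convert! mul_mem (coe_mem_intSub c) (k7 r) using 1
      field_simp
    have k8' : ∀ r : 𝓞 F, (N : F) * (α 0 1 * α 1 0) * r ∈ intSub F := fun r => by
      convert! mul_mem (coe_mem_intSub c) (k8 r) using 1
      field_simp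
    refine hf.div_moebius_eq hJc hJ0 hθα (fun z hz => ?_) ?_ ?_ hz
    · congr 1
      rw [moebius_diagSL]
      refine thetaTransform_unit hδ hM (N := N) ?_ ?_ ⟨k, hk⟩ z
      · obtain ⟨q, hq⟩ := x5
        refine ⟨q, ?_⟩
        have hq' : (q : F) = (N : F) * (1 / (M : F)) := hq
        have : ((N : 𝓞 F) : F) = ((M * q : 𝓞 F) : F) := by
          rw [intCoe_mul, hq']
          field_simp
        exact_mod_cast this
      · have := x4
        convert! this using 1
        ring
    · rw [mem_GamLevel_iff hδ hc hc0, e1, e2, e3, e4]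
      refine ⟨?_, ?_, ?_, ?_⟩
      · have := add_mem (one_mem _) (add_mem (k7' k) (k8' (k * v)))
        convert! this using 1
        rw [intCoe_mul, hu']
        linear_combination (-(α 0 1 * α 1 0)) * hui + hdet
      · have := sub_mem (sub_mem (one_mem _) (k7' (k * v))) (k8' k)
        convert! this using 1
        rw [intCoe_mul, hu']
        linear_combination (α 0 0 * α 1 1) * hui + hdet
      · have := neg_mem (x8 (k * v + k))
        convert! this using 1
        rw [intCoe_add, intCoe_mul, hu']
        linear_combination ((δ : F) * α 0 0 * α 0 1 / 2) * hui
      · have := x9 (k * v + k)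
        convert! this using 1
        rw [intCoe_add, intCoe_mul, hu']
        linear_combination (-(2 * (α 1 0 * α 1 1) / ((δ : F) * c))) * hui
    · refine finitePart_one_add hc h4 hψ ?_ hc0
      rw [e1]
      have := add_mem (k7 k) (k8 (k * v))
      convert! this using 1
      rw [intCoe_mul, hu']
      field_simp
      linear_combination (-(α 0 1 * α 1 0)) * hui + hdet
  have hreg : Module.finrank ℚ F = 1 →
      ∃ B C : ℝ, ∀ z ∈ upperHalf F, (∀ σ, B ≤ (z σ).im) → ‖h z‖ ≤ C := by
    intro hfin
    obtain ⟨B, C, hBC⟩ := hf.regular hfin α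
    refine ⟨B, C / κ, fun z hz hzB => ?_⟩
    have h1 := hBC z hz hzB
    rw [hnorm z hz, ← mul_assoc] at h1
    rw [le_div_iff₀ hκ0]
    exact le_of_mul_le_mul_right h1 (absFactor_pos α hz)
  obtain ⟨C, hC⟩ := exists_bound_im hδ hδ_pos (m := 2 * (N : F) / δ)
    ((totallyPositive_two.mul hNpos).div hδ_pos) hd hper hN hunit hreg hy
  refine ⟨C * κ, fun z hz hyz => ?_⟩
  rw [hnorm z hz, ← mul_assoc]
  have := absFactor_pos α hz
  gcongr
  exact hC z hz hyz

end Cusps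

/-! ### Invariance of theta under squares of units and translations by 2δ⁻¹R. -/

section ThetaInvariance

variable {F : Type*} [Field F] [NumberField F] [NumberField.IsTotallyReal F]
variable {δ : 𝓞 F}

lemma theta_moebius_diagSL (u : (𝓞 F)ˣ) (z : (F →+* ℝ) → ℂ) : theta (moebius (diagSL u) z) = theta z := by
  rw [theta_eq, theta_eq, moebius_diagSL,
    ← u.mulLeft.tsum_eq (fun r : 𝓞 F => gauss z fun σ => 0 + σ (r : F))]
  refine tsum_congr fun r => ?_
  rw [gauss, gauss]
  congr 1
  funext σ
  have : ((u.mulLeft r : 𝓞 F) : F) = ((u : 𝓞 F) : F) * r := rfl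
  rw [this, map_mul]
  push_cast
  ring

lemma theta_moebius_transSL (hδ : Ideal.span {δ} = differentIdeal ℤ (𝓞 F)) (r : 𝓞 F)
    (z : (F →+* ℝ) → ℂ) : theta (moebius (transSL (2 / (δ : F) * r)) z) = theta z := by
  have hδ0 : (δ : F) ≠ 0 := by exact_mod_cast delta_ne_zero hδ
  rw [theta_eq, theta_eq, moebius_transSL]
  refine tsum_congr fun x => ?_
  have h1 : eF ((x : F) ^ 2 * (r / δ)) = 1 := by
    apply eF_eq_one hδ
    refine ⟨x ^ 2 * r, ?_⟩
    refine (intCoe_mul _ _).trans ?_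
    rw [intCoe_pow]
    field_simp
  rw [← one_mul (gauss z _), ← h1, eF, gauss, gauss, ← e_add]
  congr 1
  funext σ
  simp only [Pi.add_apply, map_mul, map_pow, map_div₀, map_ofNat, zero_add]
  push_cast
  ring

lemma scale_moebius_diagSL (m : F) (u : (𝓞 F)ˣ) (z : (F →+* ℝ) → ℂ) :
    scale m (moebius (diagSL u) z) = moebius (diagSL u) (scale m z) := by
  rw [moebius_diagSL, moebius_diagSL]
  funext σ
  simp only [scale]
  ring

lemma scale_moebius_transSL (m B : F) (z : (F →+* ℝ) → ℂ) :
    scale m (moebius (transSL B) z) = moebius (transSL (m * B)) (scale m z) := by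
  rw [moebius_transSL, moebius_transSL]
  funext σ
  simp only [scale, map_mul]
  push_cast
  ring

end ThetaInvariance

/-! ### The matrix of the involution z ↦ -1/(m²z). -/

section Involution

variable {F : Type*} [Field F]

/-- The matrix of `z ↦ -1 / (m² z)`. -/
def invSL (m : F) (hm : m ≠ 0) : Matrix.SpecialLinearGroup (Fin 2) F :=
  ⟨!![0, -m⁻¹; m, 0], by rw [Matrix.det_fin_two_of]; field_simp; ring⟩

lemma invSL_entry {m : F} (hm : m ≠ 0) : invSL m hm 0 0 = 0 ∧ invSL m hm 0 1 = -m⁻¹ ∧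
    invSL m hm 1 0 = m ∧ invSL m hm 1 1 = 0 := ⟨rfl, rfl, rfl, rfl⟩

lemma moebius_invSL {m : F} (hm : m ≠ 0) (z : (F →+* ℝ) → ℂ) :
    moebius (invSL m hm) z = fun σ => -1 / ((σ m : ℂ) ^ 2 * z σ) := by
  obtain ⟨h1, h2, h3, h4⟩ := invSL_entry hm
  funext σ
  have hmσ : (σ m : ℂ) ≠ 0 := by exact_mod_cast emb_ne_zero σ hm
  rw [moebius_apply, den, h1, h2, h3, h4, map_zero, map_neg, map_inv₀]
  push_cast
  rw [zero_mul, zero_add, add_zero, neg_div, neg_div, neg_inj, inv_eq_one_div, div_div]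
  congr 1
  ring

variable [NumberField F]

lemma absFactor_invSL {m : F} (hm : m ≠ 0) (z : (F →+* ℝ) → ℂ) :
    absFactor (invSL m hm) z = (∏ σ : F →+* ℝ, |σ m|) ^ (1 / 2 : ℝ) * (∏ σ, ‖z σ‖) ^ (1 / 2 : ℝ) := by
  obtain ⟨h1, h2, h3, h4⟩ := invSL_entry hm
  rw [absFactor_eq, ← Real.mul_rpow (by positivity) (by positivity), ← Finset.prod_mul_distrib]
  congr 1
  refine Finset.prod_congr rfl fun σ _ => ?_
  rw [den, h3, h4, map_zero]
  simp

/-- In each coordinate the two bases are x = -iz and 1/(m²x). As Re x > 0 the principal logarithms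
of x cancel, and only log|m| remains. -/
lemma rootFactor_neg_inv {m : F} (hm : m ≠ 0) {z : (F →+* ℝ) → ℂ} (hz : z ∈ upperHalf F) :
    rootFactor z * rootFactor (moebius (invSL m hm) z) = ((∏ σ : F →+* ℝ, |σ m| : ℝ) : ℂ) := by
  rw [rootFactor, rootFactor, ← Finset.prod_mul_distrib, Complex.ofReal_prod]
  refine Finset.prod_congr rfl fun σ => fun _ => ?_
  have hmσ : σ m ≠ 0 := emb_ne_zero σ hm
  have hmσ' : (σ m : ℂ) ≠ 0 := by exact_mod_cast hmσ
  have hre := neg_I_mul_re_pos hz σ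
  have h0 := neg_I_mul_ne_zero hz σ
  have hz0 : z σ ≠ 0 := right_ne_zero_of_mul h0
  have hw : -Complex.I * moebius (invSL m hm) z σ =
      (((σ m ^ 2)⁻¹ : ℝ) : ℂ) * (-Complex.I * z σ)⁻¹ := by
    rw [moebius_invSL]
    push_cast
    rw [mul_inv, inv_neg, Complex.inv_I]
    field_simp
  have harg : (-Complex.I * z σ).arg ≠ Real.pi := by
    intro h
    have := (Complex.arg_eq_pi_iff.mp h).1
    linarith
  have hpos : 0 < (σ m ^ 2)⁻¹ := by positivity
  rw [hw, Complex.cpow_def_of_ne_zero h0, Complex.cpow_def_of_ne_zero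
    (mul_ne_zero (by exact_mod_cast hpos.ne') (inv_ne_zero h0)),
    Complex.log_ofReal_mul hpos (inv_ne_zero h0), Complex.log_inv _ harg, ← Complex.exp_add]
  have : Complex.log (-Complex.I * z σ) * (-(1 / 2)) +
      ((Real.log (σ m ^ 2)⁻¹ : ℝ) + -Complex.log (-Complex.I * z σ)) * (-(1 / 2)) =
      ((Real.log |σ m| : ℝ) : ℂ) := by
    rw [Real.log_inv, ← sq_abs, Real.log_pow]
    push_cast
    ring
  rw [this, ← Complex.ofReal_exp, Real.exp_log (abs_pos.mpr hmσ)]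

end Involution

/-! ### Invariance and expansions of f and of f|W(c). -/

section FormInvariance

variable {F : Type*} [Field F] [NumberField F] [NumberField.IsTotallyReal F]

/-- The function `f` is invariant under the translations `z ↦ z + 2 r / δ` and under squares of
units, and it is regular at infinity. -/
structure IsUnitPeriodic (δ : 𝓞 F) (f : ((F →+* ℝ) → ℂ) → ℂ) : Prop where
  holo : DifferentiableOn ℂ f (upperHalf F)
  trans : ∀ z ∈ upperHalf F, ∀ r : 𝓞 F, f (moebius (transSL (2 / (δ : F) * r)) z) = f z
  unit : ∀ u : (𝓞 F)ˣ, ∀ z ∈ upperHalf F, f (moebius (diagSL u) z) = f z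
  reg : Module.finrank ℚ F = 1 → ∃ B C : ℝ, ∀ z ∈ upperHalf F, (∀ σ, B ≤ (z σ).im) → ‖f z‖ ≤ C

/-- The expansion of `f`, with its elementary properties. -/
structure IsRegularExpansion (δ : 𝓞 F) (f : ((F →+* ℝ) → ℂ) → ℂ) (a : 𝓞 F → ℂ) : Prop where
  hasSum : ∀ z ∈ upperHalf F, HasSum (fun ζ => a ζ * eDual δ ζ z) (f (scale (2 / (δ : F)) z))
  vanish : ∀ ζ : 𝓞 F, ζ ≠ 0 → ¬ TotallyPositive (ζ : F) → a ζ = 0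
  unit : ∀ (u : (𝓞 F)ˣ) (ζ : 𝓞 F), a ((u : 𝓞 F) ^ 2 * ζ) = a ζ

variable {δ c : 𝓞 F} {𝔠 : Ideal (𝓞 F)} {ψ : HeckeCharacter F} {f : ((F →+* ℝ) → ℂ) → ℂ}
variable (hδ : Ideal.span {δ} = differentIdeal ℤ (𝓞 F)) (hδ_pos : TotallyPositive (δ : F))
include hδ hδ_pos

lemma IsUnitPeriodic.exists_expansion (hf : IsUnitPeriodic δ f) :
    ∃ a, IsRegularExpansion δ f a := by
  obtain ⟨a, h1, h2, h3⟩ := exists_regular_expansion hδ hδ_pos (totallyPositive_two.div hδ_pos)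
    hf.holo hf.trans one_ne_zero (fun u _ => hf.unit u) hf.reg
  exact ⟨a, h1, h2, fun u ζ => h3 u (one_dvd _) ζ⟩

lemma IsUnitPeriodic.exists_bound (hf : IsUnitPeriodic δ f) {y : ℝ} (hy : 0 < y) :
    ∃ C : ℝ, ∀ z ∈ upperHalf F, (∀ σ, y ≤ (z σ).im) → ‖f z‖ ≤ C :=
  exists_bound_im hδ hδ_pos (totallyPositive_two.div hδ_pos)
    hf.holo hf.trans one_ne_zero (fun u _ => hf.unit u) hf.reg hy

omit hδ in
-- Scaling the variable by δ/2 turns e(ζz/δ) into e(ζz/2).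
lemma IsRegularExpansion.hasFourierExpansion {a : 𝓞 F → ℂ} (ha : IsRegularExpansion δ f a) :
    HasFourierExpansion f a := by
  intro z hz
  have hδ0 : (δ : F) ≠ 0 := hδ_pos.ne_zero'
  have h := ha.hasSum (scale ((δ : F) / 2) z) (scale_mem (hδ_pos.div totallyPositive_two) hz)
  rw [scale_scale, show (2 / (δ : F)) * (δ / 2) = 1 by field_simp, scale_one] at h
  convert! h using 1
  funext ζ
  congr 1
  rw [eHalf, eDual]
  congr 1
  funext σ
  have hδσ : (σ (δ : F) : ℂ) ≠ 0 := by exact_mod_cast emb_ne_zero σ hδ0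
  simp only [scale, map_div₀, map_ofNat]
  push_cast
  field_simp

/-- `fourierCoeff` picks some expansion by choice; uniqueness shows that it is this one. -/
lemma IsRegularExpansion.eq_fourierCoeff {a : 𝓞 F → ℂ} (ha : IsRegularExpansion δ f a) :
    fourierCoeff f = a := by
  have h : ∃ a, HasFourierExpansion f a := ⟨a, ha.hasFourierExpansion hδ_pos⟩
  rw [fourierCoeff, dif_pos h]
  refine coeff_unique hδ (f := fun z => f (scale (2 / (δ : F)) z)) (fun z hz => ?_) ha.hasSum
  have hδ0 : (δ : F) ≠ 0 := hδ_pos.ne_zero'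
  convert! h.choose_spec _ (scale_mem (totallyPositive_two.div hδ_pos) hz) using 1
  funext ζ
  congr 1
  rw [eHalf, eDual]
  congr 1
  funext σ
  have hδσ : (σ (δ : F) : ℂ) ≠ 0 := by exact_mod_cast emb_ne_zero σ hδ0
  simp only [scale, map_div₀, map_ofNat]
  push_cast
  field_simp

/-- At infinity `IsModularForm.div_moebius_eq` applies with α = 1, J = 1 and ϑ = θ, so no level is
lost. Invariance under all units needs ψ_𝔠(u) = 1, where triviality of ψ at infinity enters. -/
theorem IsModularForm.isUnitPeriodic (hf : IsModularForm 𝔠 ψ f) (hc : Ideal.span {c} = 𝔠)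
    (hc0 : c ≠ 0) (hψ : ψ.ConductorDvd 𝔠) (hψ' : ψ.TrivialAtInfinity) : IsUnitPeriodic δ f := by
  have hδ0 : (δ : F) ≠ 0 := hδ_pos.ne_zero'
  have hJ : ContinuousOn (fun _ : (F →+* ℝ) → ℂ => (1 : ℂ)) (upperHalf F) := continuousOn_const
  refine ⟨hf.holomorphic, fun z hz r => ?_, fun u z hz => ?_, fun hfin => ?_⟩
  · obtain ⟨h1, h2, h3, h4⟩ := transSL_entry (2 / (δ : F) * r)
    have hconj : (1 : Matrix.SpecialLinearGroup (Fin 2) F) * transSL (2 / (δ : F) * r) * 1⁻¹ =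
      transSL (2 / (δ : F) * r) := by rw [one_mul, inv_one, mul_one]
    have h := hf.div_moebius_eq (α := 1) (τ := transSL (2 / (δ : F) * r)) (ϑ := theta) hJ
      (fun _ _ => one_ne_zero) (fun z _ => by rw [moebius_one, one_mul])
      (fun z _ => theta_moebius_transSL hδ r z) ?_ ?_ hz
    · rwa [moebius_one, moebius_one, div_one, div_one] at h
    · rw [hconj, mem_GamLevel_iff hδ hc hc0, h1, h2, h3, h4]
      refine ⟨one_mem _, one_mem _, ⟨r, ?_⟩, ?_⟩
      · field_simp
      · rw [mul_zero, zero_div]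
        exact zero_mem _
    · rw [hconj, h1]
      exact HeckeCharacter.finitePart_unit hψ hψ' 1
  · obtain ⟨h1, h2, h3, h4⟩ := diagSL_entry u
    have hconj : (1 : Matrix.SpecialLinearGroup (Fin 2) F) * diagSL u * 1⁻¹ = diagSL u := by
      rw [one_mul, inv_one, mul_one]
    have h := hf.div_moebius_eq (α := 1) (τ := diagSL u) (ϑ := theta) hJ
      (fun _ _ => one_ne_zero) (fun z _ => by rw [moebius_one, one_mul])
      (fun z _ => theta_moebius_diagSL u z) ?_ ?_ hz
    · rwa [moebius_one, moebius_one, div_one, div_one] at h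
    · rw [hconj, mem_GamLevel_iff hδ hc hc0, h1, h2, h3, h4]
      refine ⟨coe_mem_intSub _, coe_mem_intSub _, ?_, ?_⟩
      · rw [mul_zero, zero_div]
        exact zero_mem _
      · rw [mul_zero, zero_div]
        exact zero_mem _
    · rw [hconj, h1]
      exact HeckeCharacter.finitePart_unit hψ hψ' u
  · obtain ⟨B, C, hBC⟩ := hf.regular hfin 1
    refine ⟨B, C, fun z hz hzB => ?_⟩
    have := hBC z hz hzB
    rwa [moebius_one, absFactor_one, mul_one] at this

omit hδ_pos in
-- Here a = 0, so Poisson summation applies directly, without residue classes. The series on the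
-- right keeps the translation and unit invariance of θ when (m/δ)² is integral.
lemma exists_theta_invSL : ∃ K : ℝ, ∀ (m : F) (hm : m ≠ 0), ∀ z ∈ upperHalf F,
    theta (moebius (invSL m hm) z) = rootFactor (moebius (invSL m hm) z) *
      (K * theta (scale (m ^ 2 / (δ : F) ^ 2) z)) := by
  obtain ⟨K, hK, hP⟩ := exists_poisson_gauss hδ
  have hδ0 : (δ : F) ≠ 0 := by exact_mod_cast delta_ne_zero hδ
  refine ⟨K, fun m hm z hz => ?_⟩
  have h := hP _ (moebius_mem (invSL m hm) hz) 0
  rw [theta_eq]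
  rw [theta_eq]
  refine h.tsum_eq.symm.trans ?_
  rw [tsum_mul_left, ← mul_assoc, mul_comm (K : ℂ)]
  congr 1
  refine tsum_congr fun ζ => ?_
  have he : e (fun σ : F →+* ℝ => ((σ (ζ : F) / σ (δ : F) * (0 : (F →+* ℝ) → ℝ) σ : ℝ) : ℂ)) = 1 := by
    rw [← e_zero (F := F)]
    congr 1
    funext σ
    simp
  rw [he, mul_one, gauss, gauss]
  congr 1
  funext σ
  have hδσ : (σ (δ : F) : ℂ) ≠ 0 := by exact_mod_cast emb_ne_zero σ hδ0
  have hmσ : (σ m : ℂ) ≠ 0 := by exact_mod_cast emb_ne_zero σ hm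
  have hz0 : z σ ≠ 0 := by
    intro h0
    have := hz σ
    rw [h0] at this
    simp at this
  rw [moebius_invSL]
  simp only [scale, map_div₀, map_pow, zero_add]
  push_cast
  field_simp

omit hδ in
/-- The symmetry operator in terms of the involution. -/
lemma symmetryW_eq {t : 𝓞 F} (ht : (t : F) * δ / 2 ≠ 0) (hct : c = t ^ 2) (z : (F →+* ℝ) → ℂ) :
    symmetryW δ c f z = rootFactor z * ((∏ σ : F →+* ℝ, |σ ((t : F) * δ / 2)|) ^ (-(1 / 2) : ℝ) : ℝ) *
      f (moebius (invSL ((t : F) * δ / 2) ht) z) := by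
  rw [symmetryW, moebius_invSL, rootFactor]
  congr 2
  · refine congr_arg Complex.ofReal ?_
    have h1 : ((2 : F)⁻¹ ^ 2 * (δ : F) ^ 2 * (c : F)) = ((t : F) * δ / 2) ^ 2 := by
      rw [hct, intCoe_pow]
      ring
    rw [h1, norm_eq_prod]
    have h2 : ∏ σ : F →+* ℝ, σ (((t : F) * δ / 2) ^ 2) = (∏ σ : F →+* ℝ, |σ ((t : F) * δ / 2)|) ^ (2 : ℝ) := by
      rw [Real.rpow_two, ← Finset.prod_pow]
      exact Finset.prod_congr rfl fun σ _ => by rw [map_pow, sq_abs]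
    rw [h2, ← Real.rpow_mul (Finset.prod_nonneg fun _ _ => abs_nonneg _)]
    congr 2
    norm_num
  · funext σ
    rw [hct, intCoe_pow, map_pow, map_div₀, map_mul, map_ofNat]
    push_cast
    by_cases h0 : (σ (t : F) : ℂ) ^ 2 * (σ (δ : F) : ℂ) ^ 2 * z σ = 0
    · rw [h0, show ((σ (t : F) : ℂ) * σ (δ : F) / 2) ^ 2 * z σ =
        ((σ (t : F) : ℂ) ^ 2 * (σ (δ : F) : ℂ) ^ 2 * z σ) / 4 by ring, h0]
      simp
    · rw [show ((σ (t : F) : ℂ) * σ (δ : F) / 2) ^ 2 * z σ =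
        ((σ (t : F) : ℂ) ^ 2 * (σ (δ : F) : ℂ) ^ 2 * z σ) / 4 by ring]
      field_simp

omit hδ in
-- W(c) is the weight one half translate by the involution up to a factor of absolute value 1, so
-- cusp conditions on f at that matrix become conditions on f|W(c) at infinity.
lemma norm_symmetryW_mul {t : 𝓞 F} (ht : (t : F) * δ / 2 ≠ 0) (hct : c = t ^ 2)
    {z : (F →+* ℝ) → ℂ} (hz : z ∈ upperHalf F) :
    ‖symmetryW δ c f z‖ * absFactor (invSL ((t : F) * δ / 2) ht) z =
      ‖f (moebius (invSL ((t : F) * δ / 2) ht) z)‖ := by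
  have h1 : 0 < ∏ σ : F →+* ℝ, |σ ((t : F) * δ / 2)| :=
    Finset.prod_pos fun σ _ => abs_pos.mpr (emb_ne_zero σ ht)
  have h2 : 0 < ∏ σ, ‖z σ‖ := Finset.prod_pos fun σ _ => norm_pos_iff.mpr
    (right_ne_zero_of_mul (neg_I_mul_ne_zero hz σ))
  rw [symmetryW_eq hδ_pos ht hct, norm_mul, norm_mul, norm_rootFactor, absFactor_invSL,
    Complex.norm_real, Real.norm_of_nonneg (by positivity), Real.rpow_neg h2.le, Real.rpow_neg h1.le]
  have h3 : 0 < (∏ σ : F →+* ℝ, |σ ((t : F) * δ / 2)|) ^ (1 / 2 : ℝ) := by positivity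
  have h4 : 0 < (∏ σ, ‖z σ‖) ^ (1 / 2 : ℝ) := by positivity
  field_simp

set_option maxHeartbeats 400000 in
-- Up to a constant f|W(c) is f(αz)/J(z) for the involution α. Conjugation by α takes the
-- translation by 2r/δ to a lower triangular matrix with entry -(cδ/2)r, and a diagonal matrix to
-- its inverse. Both stay in Γ_𝔠, so the full invariance survives.
theorem IsModularForm.isUnitPeriodic_symmetryW (hf : IsModularForm 𝔠 ψ f) (hc : Ideal.span {c} = 𝔠)
    (hc0 : c ≠ 0) (h4 : (4 : 𝓞 F) ∣ c) {t : 𝓞 F} (hct : c = t ^ 2)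
    (hψ : ψ.ConductorDvd 𝔠) (hψ' : ψ.TrivialAtInfinity) :
    IsUnitPeriodic δ (symmetryW δ c f) := by
  have hδ0 : (δ : F) ≠ 0 := hδ_pos.ne_zero'
  have hc0' : (c : F) ≠ 0 := by exact_mod_cast hc0
  have hct' : (c : F) = (t : F) ^ 2 := by rw [hct, intCoe_pow]
  have ht0 : (t : F) ≠ 0 := fun h => hc0' (by rw [hct', h]; simp)
  have ht : (t : F) * δ / 2 ≠ 0 := div_ne_zero (mul_ne_zero ht0 hδ0) two_ne_zero
  set m : F := (t : F) * δ / 2 with hm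
  obtain ⟨K, hK⟩ := exists_theta_invSL hδ
  set α := invSL m ht with hα
  obtain ⟨a1, a2, a3, a4⟩ := invSL_entry ht
  set J : ((F →+* ℝ) → ℂ) → ℂ := fun z => rootFactor (moebius α z) with hJdef
  have hmoeb : DifferentiableOn ℂ (moebius α) (upperHalf F) := by
    refine differentiableOn_pi.mpr fun σ => ?_
    unfold moebius
    simp only [div_eq_mul_inv]
    intro z hz
    refine DifferentiableWithinAt.mul (by fun_prop) (DifferentiableWithinAt.fun_inv (by fun_prop) ?_)
    exact den_ne_zero α hz σ
  have hJ : ContinuousOn J (upperHalf F) :=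
    ContinuousOn.comp (g := rootFactor (F := F)) (t := upperHalf F)
      differentiableOn_rootFactor.continuousOn hmoeb.continuousOn fun z hz => moebius_mem α hz
  have hJ0 : ∀ z ∈ upperHalf F, J z ≠ 0 := fun z hz => rootFactor_ne_zero (moebius_mem α hz)
  obtain ⟨k, hk⟩ := h4
  have hkc : (c : F) = 4 * k := by
    rw [hk, intCoe_mul]
    exact congr_arg (· * (k : F)) (map_ofNat (algebraMap (𝓞 F) F) 4)
  -- m²/δ² = c/4 is integral because 4 ∣ c, so θ(kz) is still invariant under translations by 2δ⁻¹R.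
  have hmk : m ^ 2 / (δ : F) ^ 2 = k := by
    rw [hm, div_pow, mul_pow, ← hct', hkc]
    field_simp
    ring
  have hθ : ∀ z ∈ upperHalf F, theta (moebius α z) = J z * (K * theta (scale (k : F) z)) := by
    intro z hz
    rw [← hmk]
    exact hK m ht z hz
  have hsym : ∀ z, symmetryW δ c f z = rootFactor z *
      ((∏ σ : F →+* ℝ, |σ m|) ^ (-(1 / 2) : ℝ) : ℝ) * f (moebius α z) := symmetryW_eq hδ_pos ht hct
  have hg : ∀ z ∈ upperHalf F, symmetryW δ c f z =
      (((∏ σ : F →+* ℝ, |σ m|) ^ (-(1 / 2) : ℝ) : ℝ) * ((∏ σ : F →+* ℝ, |σ m| : ℝ) : ℂ)) *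
        (f (moebius α z) / J z) := by
    intro z hz
    have h1 : rootFactor z * J z = ((∏ σ : F →+* ℝ, |σ m| : ℝ) : ℂ) := rootFactor_neg_inv ht hz
    have := hJ0 z hz
    rw [hsym, ← h1]
    field_simp
  refine ⟨?_, fun z hz r => ?_, fun u z hz => ?_, fun hfin => ?_⟩
  · have h1 : DifferentiableOn ℂ (fun z => rootFactor z *
        ((∏ σ : F →+* ℝ, |σ m|) ^ (-(1 / 2) : ℝ) : ℝ) * f (moebius α z)) (upperHalf F) := by
      intro z hz
      exact ((differentiableOn_rootFactor z hz).mul_const _).mul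
        ((hf.holomorphic.comp hmoeb fun z hz => moebius_mem α hz) z hz)
    exact h1.congr fun z _ => symmetryW_eq hδ_pos ht hct z
  · have hτz := moebius_mem (transSL (2 / (δ : F) * r)) hz
    obtain ⟨e1, e2, e3, e4⟩ := conj_transSL α (2 / (δ : F) * r)
    rw [hg _ hτz, hg _ hz]
    congr 1
    refine hf.div_moebius_eq hJ hJ0 hθ (fun z hz => ?_) ?_ ?_ hz
    · rw [scale_moebius_transSL]
      congr 1
      have : (k : F) * (2 / (δ : F) * r) = 2 / (δ : F) * ((k * r : 𝓞 F) : F) := by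
        rw [intCoe_mul]; ring
      rw [this, theta_moebius_transSL hδ]
    · rw [mem_GamLevel_iff hδ hc hc0, e1, e2, e3, e4, a1, a3]
      refine ⟨by simp, by simp, by simp, ⟨-r, ?_⟩⟩
      rw [map_neg, hct', hm]
      field_simp
    · rw [e1, a1]
      simp only [zero_mul, sub_zero]
      exact HeckeCharacter.finitePart_unit hψ hψ' 1
  · have hτz := moebius_mem (diagSL u) hz
    obtain ⟨e1, e2, e3, e4⟩ := conj_diagSL α u
    rw [hg _ hτz, hg _ hz]
    congr 1
    have e1' : (α * diagSL u * α⁻¹) 0 0 = (((u⁻¹ : (𝓞 F)ˣ) : 𝓞 F) : F) := by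
      rw [e1, a1, a2, a3]
      field_simp
      ring
    have e4' : (α * diagSL u * α⁻¹) 1 1 = ((u : 𝓞 F) : F) := by
      rw [e4, a1, a2, a3]
      field_simp
      ring
    refine hf.div_moebius_eq hJ hJ0 hθ (fun z hz => ?_) ?_ ?_ hz
    · rw [scale_moebius_diagSL, theta_moebius_diagSL]
    · rw [mem_GamLevel_iff hδ hc hc0, e1', e2, e3, e4', a1, a4]
      exact ⟨coe_mem_intSub _, coe_mem_intSub _, by simp, by simp⟩
    · rw [e1']
      exact HeckeCharacter.finitePart_unit hψ hψ' u⁻¹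
  · obtain ⟨B, C, hBC⟩ := hf.regular hfin α
    refine ⟨B, C, fun z hz hzB => ?_⟩
    have h1 := hBC z hz hzB
    rw [← norm_symmetryW_mul hδ_pos ht hct hz] at h1
    exact le_of_mul_le_mul_right h1 (absFactor_pos α hz)

end FormInvariance

/-! ### Simultaneous Diophantine approximation. -/

section Approximation

variable {F : Type*} [Field F] [NumberField F] [NumberField.IsTotallyReal F]

variable (F) in
/-- Simultaneous approximation. -/
theorem exists_dirichlet_approx : ∃ C : ℝ, 0 < C ∧ ∀ (x : (F →+* ℝ) → ℝ) (m : ℕ), 0 < m →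
    ∃ q d : 𝓞 F, q ≠ 0 ∧ (∀ σ : F →+* ℝ, |σ (q : F)| ≤ C * m) ∧
      ∀ σ : F →+* ℝ, |σ (q : F) * x σ + σ (d : F)| ≤ C / m := by
  let L : (BIdx F → ℝ) →L[ℝ] ((F →+* ℝ) → ℝ) := (latEquiv F : (BIdx F → ℝ) →L[ℝ] ((F →+* ℝ) → ℝ))
  have hL0 : 0 ≤ ‖L‖ := L.opNorm_nonneg
  refine ⟨‖L‖ + 1, by positivity, fun x m hm => ?_⟩
  have hm' : (0 : ℝ) < m := by exact_mod_cast hm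
  have hLle : ∀ (s : BIdx F → ℝ) (B : ℝ), 0 ≤ B → (∀ i, |s i| ≤ B) → ∀ σ, |latEquiv F s σ| ≤ (‖L‖ + 1) * B := by
    intro s B hB hs σ
    have h1 : ‖s‖ ≤ B := (pi_norm_le_iff_of_nonneg hB).mpr fun i => by
      rw [Real.norm_eq_abs]; exact hs i
    calc |latEquiv F s σ| = ‖L s σ‖ := (Real.norm_eq_abs _).symm
      _ ≤ ‖L s‖ := norm_le_pi_norm _ σ
      _ ≤ ‖L‖ * ‖s‖ := L.le_opNorm s
      _ ≤ (‖L‖ + 1) * B := by nlinarith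
  -- Pigeonhole: (m + 1)ⁿ integers with coordinates from 0 to m, against mⁿ boxes of side 1/m for
  -- the fractional parts of the coordinates of qx.
  let Q : (BIdx F → Fin (m + 1)) → 𝓞 F := fun k => (intCoord F).symm fun i => ((k i : ℕ) : ℤ)
  obtain ⟨S, hS⟩ : ∃ S : (BIdx F → Fin (m + 1)) → BIdx F → ℝ,
      ∀ k σ, σ ((Q k : 𝓞 F) : F) * x σ = latEquiv F (S k) σ :=
    ⟨fun k => (latEquiv F).symm fun σ => σ ((Q k : 𝓞 F) : F) * x σ, fun k σ => by
      rw [ContinuousLinearEquiv.apply_symm_apply]⟩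
  have hbox : ∀ k i, ⌊(m : ℝ) * Int.fract (S k i)⌋₊ < m := by
    intro k i
    rw [Nat.floor_lt (mul_nonneg hm'.le (Int.fract_nonneg _))]
    have := Int.fract_lt_one (S k i)
    nlinarith
  let box : (BIdx F → Fin (m + 1)) → BIdx F → Fin m := fun k i => ⟨_, hbox k i⟩
  have hne : Nonempty (BIdx F) := by
    rw [← Fintype.card_pos_iff, card_BIdx]
    exact Fintype.card_pos
  obtain ⟨k, k', hkk, hbk⟩ := Fintype.exists_ne_map_eq_of_card_lt box (by
    classical
    rw [Fintype.card_fun, Fintype.card_fun, Fintype.card_fin, Fintype.card_fin]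
    exact Nat.pow_lt_pow_left (Nat.lt_succ_self m) Fintype.card_ne_zero)
  have hcoord : ∀ k : BIdx F → ℤ, ∀ σ, σ (((intCoord F).symm k : 𝓞 F) : F) =
      latEquiv F (fun i => (k i : ℝ)) σ := by
    intro k σ
    have := latEquiv_intCoord ((intCoord F).symm k) σ
    rw [Equiv.apply_symm_apply] at this
    exact this.symm
  let D : (BIdx F → Fin (m + 1)) → 𝓞 F := fun k => (intCoord F).symm fun i => ⌊S k i⌋
  refine ⟨Q k - Q k', D k' - D k, ?_, fun σ => ?_, fun σ => ?_⟩
  · intro h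
    apply hkk
    have h1 := (intCoord F).symm.injective (sub_eq_zero.mp h)
    funext i
    have h2 := congr_fun h1 i
    exact Fin.ext (by exact_mod_cast h2)
  · rw [intCoe_sub, map_sub, hcoord, hcoord, ← Pi.sub_apply, ← map_sub]
    refine hLle _ _ hm'.le (fun i => ?_) σ
    rw [Pi.sub_apply, abs_le]
    have h1 : ((k i : ℕ) : ℝ) ≤ m := by exact_mod_cast Nat.lt_succ_iff.mp (k i).2
    have h2 : ((k' i : ℕ) : ℝ) ≤ m := by exact_mod_cast Nat.lt_succ_iff.mp (k' i).2
    have h3 : (0 : ℝ) ≤ ((k i : ℕ) : ℝ) := Nat.cast_nonneg _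
    have h4 : (0 : ℝ) ≤ ((k' i : ℕ) : ℝ) := Nat.cast_nonneg _
    push_cast
    constructor <;> linarith
  · have h1 : σ ((Q k - Q k' : 𝓞 F) : F) * x σ + σ ((D k' - D k : 𝓞 F) : F) =
        latEquiv F (fun i => Int.fract (S k i) - Int.fract (S k' i)) σ := by
      have hsplit : (fun i => Int.fract (S k i) - Int.fract (S k' i)) =
          (S k - S k') + ((fun i => (⌊S k' i⌋ : ℝ)) - fun i => (⌊S k i⌋ : ℝ)) := by
        funext i
        simp only [Pi.add_apply, Pi.sub_apply, Int.fract]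
        ring
      rw [intCoe_sub, intCoe_sub, map_sub, map_sub, sub_mul, hS, hS, hcoord, hcoord, hsplit, map_add,
        map_sub, map_sub]
      rfl
    rw [h1, div_eq_mul_inv]
    refine hLle _ _ (by positivity) (fun i => ?_) σ
    have hb : ⌊(m : ℝ) * Int.fract (S k i)⌋₊ = ⌊(m : ℝ) * Int.fract (S k' i)⌋₊ := by
      have := congr_arg Fin.val (congr_fun hbk i)
      exact this
    have a1 := Nat.floor_le (mul_nonneg hm'.le (Int.fract_nonneg (S k i)))
    have a2 := Nat.lt_floor_add_one ((m : ℝ) * Int.fract (S k i))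
    have a3 := Nat.floor_le (mul_nonneg hm'.le (Int.fract_nonneg (S k' i)))
    have a4 := Nat.lt_floor_add_one ((m : ℝ) * Int.fract (S k' i))
    rw [hb] at a1 a2
    have h3 : |(m : ℝ) * (Int.fract (S k i) - Int.fract (S k' i))| ≤ 1 := by
      rw [abs_le]; constructor <;> linarith
    rw [abs_mul, abs_of_pos hm'] at h3
    rw [← one_div, le_div_iff₀ hm']
    linarith

/-- Simultaneous approximation with coprime numerator and denominator. -/
theorem exists_coprime_approx (hF : NarrowClassNumberOne F) : ∃ C : ℝ, 0 < C ∧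
    ∀ (x : (F →+* ℝ) → ℝ) (m : ℕ), 0 < m → ∃ q d p b : 𝓞 F, p * d - b * q = 1 ∧ q ≠ 0 ∧
      (∀ σ : F →+* ℝ, |σ (q : F)| ≤ C * m) ∧
      ∀ σ : F →+* ℝ, |σ (q : F) * x σ + σ (d : F)| ≤ C / m := by
  obtain ⟨C, hC, hD⟩ := exists_dirichlet_approx F
  obtain ⟨C₀, hC₀, hB⟩ := exists_unit_balance F
  refine ⟨Real.exp C₀ * C, by positivity, fun x m hm => ?_⟩
  obtain ⟨q, d, hq, h1, h2⟩ := hD x m hm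
  have hI : Ideal.span {q, d} ≠ ⊥ := by
    rw [Ne, Ideal.span_eq_bot]
    intro h
    exact hq (h q (by simp))
  obtain ⟨ξ, hξ, hspan⟩ := exists_totallyPositive_generator hF hI
  have hξ0 : (ξ : F) ≠ 0 := hξ.ne_zero'
  have hξ00 : ξ ≠ 0 := fun h => hξ0 (by rw [h]; rfl)
  -- The common divisor ξ of q and d is divided out. A suitable unit multiple of ξ has all
  -- conjugates bounded below, since |N(ξ)| ≥ 1, so the division costs only the factor exp C₀.
  obtain ⟨u, hu⟩ := hB fun σ => Real.log |σ (ξ : F)|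
  obtain ⟨q', hq'⟩ := Ideal.mem_span_singleton.mp (hspan ▸ Ideal.subset_span (by simp) : q ∈ Ideal.span {ξ})
  obtain ⟨d', hd'⟩ := Ideal.mem_span_singleton.mp (hspan ▸ Ideal.subset_span (by simp) : d ∈ Ideal.span {ξ})
  obtain ⟨s, r, hsr⟩ := Ideal.mem_span_pair.mp (hspan ▸ Ideal.mem_span_singleton_self ξ : ξ ∈ Ideal.span {q, d})
  have hone : s * q' + r * d' = 1 := by
    apply mul_left_cancel₀ hξ00
    linear_combination hsr - s * hq' - r * hd'
  set v : 𝓞 F := ((u⁻¹ : (𝓞 F)ˣ) : 𝓞 F) with hv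
  have huv : (u : 𝓞 F) * v = 1 := by rw [hv, ← Units.val_mul, mul_inv_cancel]; rfl
  have hlow : ∀ σ : F →+* ℝ, Real.exp (-C₀) ≤ |σ (ξ : F)| * |σ ((u : 𝓞 F) : F)| := by
    intro σ
    have p1 : 0 < |σ (ξ : F)| := abs_pos.mpr (emb_ne_zero σ hξ0)
    have p2 : 0 < |σ ((u : 𝓞 F) : F)| := abs_pos.mpr (emb_ne_zero σ (coe_unit_ne_zero u))
    rw [← Real.le_log_iff_exp_le (by positivity), Real.log_mul p1.ne' p2.ne']
    have h := (abs_le.mp (hu σ)).1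
    have hmean : 0 ≤ (∑ τ : F →+* ℝ, Real.log |τ (ξ : F)|) / Module.finrank ℚ F := by
      refine div_nonneg ?_ (Nat.cast_nonneg _)
      rw [← Real.log_prod fun τ _ => abs_ne_zero.mpr (emb_ne_zero τ hξ0)]
      exact Real.log_nonneg (one_le_abs_prod hξ00)
    linarith
  have hdiv : ∀ (σ : F →+* ℝ) (y X : ℝ), |σ (ξ : F) * y| ≤ X → |σ (v : F) * y| ≤ Real.exp C₀ * X := by
    intro σ y X hX
    have h3 : σ ((u : 𝓞 F) : F) * σ (v : F) = 1 := by
      rw [← map_mul, ← intCoe_mul, huv, intCoe_one, map_one]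
    have h4 : |σ ((u : 𝓞 F) : F)| * |σ (v : F)| = 1 := by rw [← abs_mul, h3, abs_one]
    have p3 : 0 < |σ (v : F)| := by
      refine abs_pos.mpr (right_ne_zero_of_mul (a := σ ((u : 𝓞 F) : F)) ?_)
      rw [h3]; exact one_ne_zero
    have h5 : |σ (v : F)| ≤ Real.exp C₀ * |σ (ξ : F)| := by
      have := mul_le_mul_of_nonneg_right (hlow σ) p3.le
      rw [mul_assoc, h4, mul_one, Real.exp_neg, inv_mul_le_iff₀ (Real.exp_pos _)] at this
      exact this
    rw [abs_mul] at hX ⊢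
    calc |σ (v : F)| * |y| ≤ (Real.exp C₀ * |σ (ξ : F)|) * |y| :=
          mul_le_mul_of_nonneg_right h5 (abs_nonneg _)
      _ = Real.exp C₀ * (|σ (ξ : F)| * |y|) := by ring
      _ ≤ Real.exp C₀ * X := mul_le_mul_of_nonneg_left hX (Real.exp_pos _).le
  refine ⟨v * q', v * d', u * r, -(u * s), ?_, ?_, fun σ => ?_, fun σ => ?_⟩
  · linear_combination (r * d' + s * q') * huv + hone
  · intro h
    rcases mul_eq_zero.mp h with h | h
    · rw [h, mul_zero] at huv
      exact zero_ne_one huv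
    · exact hq (by rw [hq', h, mul_zero])
  · rw [intCoe_mul, map_mul, mul_assoc]
    refine hdiv σ _ _ ?_
    rw [← map_mul, ← intCoe_mul, ← hq']
    exact h1 σ
  · have h3 := h2 σ
    rw [hq', hd', intCoe_mul, intCoe_mul, map_mul, map_mul, mul_assoc, ← mul_add] at h3
    rw [intCoe_mul, intCoe_mul, map_mul, map_mul, mul_assoc, ← mul_add, mul_div_assoc]
    exact hdiv σ _ _ h3

end Approximation

/-! ### Uniform bounds over all cusps of Γ[2δ⁻¹, 2⁻¹δ] equivalent to infinity. -/

section Growth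

variable {F : Type*} [Field F] [NumberField F] [NumberField.IsTotallyReal F]
variable {δ c : 𝓞 F} {𝔠 : Ideal (𝓞 F)} {ψ : HeckeCharacter F} {f : ((F →+* ℝ) → ℂ) → ℂ}
variable (hδ : Ideal.span {δ} = differentIdeal ℤ (𝓞 F)) (hδ_pos : TotallyPositive (δ : F))
include hδ hδ_pos

/-- Uniform boundedness at the cusps equivalent to infinity under `Γ[2 δ⁻¹, 2⁻¹ δ]`. -/
theorem IsModularForm.exists_uniform_cusp_bound (hf : IsModularForm 𝔠 ψ f) (hc : Ideal.span {c} = 𝔠)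
    (hc0 : c ≠ 0) (h4 : (4 : 𝓞 F) ∣ c) (hψ : ψ.ConductorDvd 𝔠) {y : ℝ} (hy : 0 < y) :
    ∃ C : ℝ, 0 ≤ C ∧ ∀ (α : Matrix.SpecialLinearGroup (Fin 2) F) (q d : 𝓞 F), α 0 0 ∈ intSub F →
      (δ : F) * α 0 1 / 2 ∈ intSub F → α 1 0 = (δ : F) / 2 * q → α 1 1 = d → q ≠ 0 →
      ∀ z ∈ upperHalf F, (∀ σ, y ≤ (z σ).im) → ‖f (moebius α z)‖ ≤ C * absFactor α z := by
  have hδ0 : (δ : F) ≠ 0 := hδ_pos.ne_zero'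
  have hc0' : (c : F) ≠ 0 := by exact_mod_cast hc0
  have := finite_quotient_span hc0
  have := Fintype.ofFinite (𝓞 F ⧸ Ideal.span {c})
  have key : ∀ k : (𝓞 F ⧸ Ideal.span {c}) × (𝓞 F ⧸ Ideal.span {c}), ∃ C : ℝ, 0 ≤ C ∧
      ∀ (α : Matrix.SpecialLinearGroup (Fin 2) F) (q d : 𝓞 F), α 0 0 ∈ intSub F →
      (δ : F) * α 0 1 / 2 ∈ intSub F → α 1 0 = (δ : F) / 2 * q → α 1 1 = d → q ≠ 0 →
      Ideal.Quotient.mk (Ideal.span {c}) q = k.1 → Ideal.Quotient.mk (Ideal.span {c}) d = k.2 →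
      ∀ z ∈ upperHalf F, (∀ σ, y ≤ (z σ).im) → ‖f (moebius α z)‖ ≤ C * absFactor α z := by
    intro k
    by_cases hex : ∃ (α : Matrix.SpecialLinearGroup (Fin 2) F) (q d : 𝓞 F), α 0 0 ∈ intSub F ∧
      (δ : F) * α 0 1 / 2 ∈ intSub F ∧ α 1 0 = (δ : F) / 2 * q ∧ α 1 1 = d ∧ q ≠ 0 ∧
      Ideal.Quotient.mk (Ideal.span {c}) q = k.1 ∧ Ideal.Quotient.mk (Ideal.span {c}) d = k.2
    · obtain ⟨β, q', d', b1, b2, b3, b4, b5, b6, b7⟩ := hex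
      have hβ : β 1 0 ≠ 0 := by
        rw [b3]
        exact mul_ne_zero (div_ne_zero hδ0 two_ne_zero) (by exact_mod_cast b5)
      obtain ⟨C, hC⟩ := hf.exists_cusp_bound hδ hδ_pos hc hc0 h4 hψ hβ hy
      refine ⟨|C|, abs_nonneg C, fun α q d a1 a2 a3 a4 a5 a6 a7 z hz hyz => ?_⟩
      -- Matrices with bottom rows congruent modulo c differ by an element of Γ_𝔠, so the bound at
      -- one representative β serves its whole class, and there are finitely many classes.
      have hγ : α * β⁻¹ ∈ GamLevel 𝔠 := by
        obtain ⟨e1, e2, e3, e4⟩ := entry_inv β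
        have hδ2 : ∀ x : F, (δ : F) * x / 2 ∈ intSub F → ∀ r : 𝓞 F, x * ((δ : F) / 2 * r) ∈ intSub F := by
          intro x hx r
          convert! mul_mem hx (coe_mem_intSub r) using 1
          ring
        rw [mem_GamLevel_iff hδ hc hc0]
        simp only [mul_entry, e1, e2, e3, e4, a3, a4, b3, b4]
        refine ⟨?_, ?_, ?_, ?_⟩
        · convert! sub_mem (mul_mem a1 (coe_mem_intSub d')) (hδ2 _ a2 q') using 1
          ring
        · convert! sub_mem (mul_mem (coe_mem_intSub d) b1) (hδ2 _ b2 q) using 1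
          ring
        · convert! sub_mem (mul_mem a2 b1) (mul_mem a1 b2) using 1
          ring
        · have h : q * d' - d * q' ∈ Ideal.span {c} := by
            rw [← Ideal.Quotient.eq_zero_iff_mem, map_sub, map_mul, map_mul, a6, a7, b6, b7]
            ring
          obtain ⟨r, hr⟩ := Ideal.mem_span_singleton.mp h
          refine ⟨r, ?_⟩
          have hr' : (q : F) * d' - d * q' = c * r := by
            rw [← intCoe_mul, ← intCoe_mul, ← intCoe_mul, ← hr, intCoe_sub]
          field_simp
          linear_combination -hr'
      have hmul : α = (α * β⁻¹) * β := by rw [inv_mul_cancel_right]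
      have e := hf.norm_moebius hδ hc hc0 h4 hγ (moebius_mem β hz)
      rw [← moebius_mul _ _ hz, ← hmul] at e
      have e' := absFactor_mul (α * β⁻¹) β hz
      rw [← hmul] at e'
      rw [e, e']
      have p1 := absFactor_pos (α * β⁻¹) (moebius_mem β hz)
      have p2 := absFactor_pos β hz
      have h2 := hC z hz hyz
      calc _ ≤ absFactor (α * β⁻¹) (moebius β z) * (|C| * absFactor β z) := by
            refine mul_le_mul_of_nonneg_left (h2.trans ?_) p1.le
            exact mul_le_mul_of_nonneg_right (le_abs_self C) p2.le
        _ = _ := by ring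
    · refine ⟨0, le_rfl, fun α q d a1 a2 a3 a4 a5 a6 a7 => absurd ⟨α, q, d, a1, a2, a3, a4, a5, a6, a7⟩ hex⟩
  choose C hC0 hC using key
  refine ⟨∑ k, C k, Finset.sum_nonneg fun k _ => hC0 k, fun α q d a1 a2 a3 a4 a5 z hz hyz => ?_⟩
  refine (hC (_, _) α q d a1 a2 a3 a4 a5 rfl rfl z hz hyz).trans ?_
  refine mul_le_mul_of_nonneg_right ?_ (absFactor_pos α hz).le
  exact Finset.single_le_sum (f := C) (fun k _ => hC0 k) (Finset.mem_univ _)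

end Growth

/-! ### Growth of forms toward the real boundary, and of their coefficients. -/

section Growth

variable {F : Type*} [Field F] [NumberField F] [NumberField.IsTotallyReal F]
variable {δ c : 𝓞 F} {𝔠 : Ideal (𝓞 F)} {ψ : HeckeCharacter F} {f : ((F →+* ℝ) → ℂ) → ℂ}

lemma norm_den_ge (β : Matrix.SpecialLinearGroup (Fin 2) F) (z : (F →+* ℝ) → ℂ) (σ : F →+* ℝ) :
    |σ (β 1 0)| * |(z σ).im| ≤ ‖den β z σ‖ := by
  have : (den β z σ).im = σ (β 1 0) * (z σ).im := by simp [den]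
  rw [← abs_mul, ← this]
  exact Complex.abs_im_le_norm _

variable (hδ : Ideal.span {δ} = differentIdeal ℤ (𝓞 F)) (hδ_pos : TotallyPositive (δ : F))
include hδ hδ_pos

/-- Growth of a modular form near the real boundary. -/
theorem IsModularForm.exists_growth (hF : NarrowClassNumberOne F) (hf : IsModularForm 𝔠 ψ f)
    (hc : Ideal.span {c} = 𝔠) (hc0 : c ≠ 0) (h4 : (4 : 𝓞 F) ∣ c) (hψ : ψ.ConductorDvd 𝔠)
    (hψ' : ψ.TrivialAtInfinity) :
    ∃ C : ℝ, 0 ≤ C ∧ ∀ z ∈ upperHalf F, ‖f z‖ ≤ C * (1 + (∏ σ, (z σ).im) ^ (-(1 / 2) : ℝ)) := by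
  have hδ0 : (δ : F) ≠ 0 := hδ_pos.ne_zero'
  have hU := hf.isUnitPeriodic hδ hδ_pos hc hc0 hψ hψ'
  obtain ⟨C₀, hC₀, hbal⟩ := exists_unit_balance_sq F
  obtain ⟨A, hA, happ⟩ := exists_coprime_approx hF
  set D : ℝ := ∑ σ : F →+* ℝ, |σ ((δ : F) / 2)| with hD
  have hD0 : 0 ≤ D := Finset.sum_nonneg fun _ _ => abs_nonneg _
  have hDle : ∀ σ : F →+* ℝ, |σ ((δ : F) / 2)| ≤ D := fun σ =>
    Finset.single_le_sum (f := fun σ : F →+* ℝ => |σ ((δ : F) / 2)|) (fun _ _ => abs_nonneg _)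
      (Finset.mem_univ σ)
  set A' : ℝ := A + D * (A * 2) * Real.exp C₀ with hA'
  have hA'0 : 0 < A' := by positivity
  obtain ⟨C₁, hC₁⟩ := hU.exists_bound hδ hδ_pos (Real.exp_pos (-C₀))
  obtain ⟨C₂, hC₂0, hC₂⟩ := hf.exists_uniform_cusp_bound hδ hδ_pos hc hc0 h4 hψ
    (y := Real.exp (-C₀) / A' ^ 2) (by positivity)
  set P : ℝ := ∏ σ : F →+* ℝ, |σ ((δ : F) / 2)| with hP
  have hP0 : 0 < P := Finset.prod_pos fun σ _ =>
    abs_pos.mpr (emb_ne_zero σ (div_ne_zero hδ0 two_ne_zero))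
  refine ⟨|C₁| + C₂ * P ^ (-(1 / 2) : ℝ), by positivity, fun z' hz' => ?_⟩
  -- The square of a unit makes all imaginary parts comparable to their geometric mean `T`; neither
  -- f nor the product of the imaginary parts changes.
  obtain ⟨u, hu⟩ := hbal fun σ => Real.log (z' σ).im
  have hn : (0 : ℝ) < Module.finrank ℚ F := by exact_mod_cast Module.finrank_pos
  rw [← Real.log_prod fun σ _ => (hz' σ).ne'] at hu
  have hprod0 : 0 < ∏ σ, (z' σ).im := Finset.prod_pos fun σ _ => hz' σ
  set T : ℝ := Real.exp (Real.log (∏ σ, (z' σ).im) / Module.finrank ℚ F) with hT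
  have hT0 : 0 < T := Real.exp_pos _
  set z : (F →+* ℝ) → ℂ := moebius (diagSL u) z' with hzdef
  have hz : z ∈ upperHalf F := moebius_mem _ hz'
  have hzim : ∀ σ, (z σ).im = σ ((u : 𝓞 F) : F) ^ 2 * (z' σ).im := by
    intro σ
    rw [hzdef, moebius_diagSL]
    simp only [Complex.im_ofReal_mul]
  have hzb : ∀ σ, Real.exp (-C₀) * T ≤ (z σ).im ∧ (z σ).im ≤ Real.exp C₀ * T := by
    intro σ
    have hup : 0 < |σ ((u : 𝓞 F) : F)| := abs_pos.mpr (emb_ne_zero σ (coe_unit_ne_zero u))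
    have hlog : Real.log (z σ).im = Real.log (z' σ).im + 2 * Real.log |σ ((u : 𝓞 F) : F)| := by
      rw [hzim, ← sq_abs, Real.log_mul (by positivity) (hz' σ).ne', Real.log_pow]
      push_cast
      ring
    have h := abs_le.mp (hu σ)
    rw [← hlog] at h
    rw [hT, ← Real.exp_add, ← Real.exp_add, ← Real.le_log_iff_exp_le (hz σ),
      ← Real.log_le_iff_le_exp (hz σ)]
    constructor <;> linarith [h.1, h.2]
  have hzprod : ∏ σ, (z σ).im = ∏ σ, (z' σ).im := by
    simp only [hzim, Finset.prod_mul_distrib]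
    have := unit_prod_abs u
    have h2 : ∏ σ : F →+* ℝ, σ ((u : 𝓞 F) : F) ^ 2 = 1 := by
      have : ∏ σ : F →+* ℝ, σ ((u : 𝓞 F) : F) ^ 2 = (∏ σ : F →+* ℝ, |σ ((u : 𝓞 F) : F)|) ^ 2 := by
        rw [← Finset.prod_pow]
        exact Finset.prod_congr rfl fun σ _ => (sq_abs _).symm
      rw [this, unit_prod_abs, one_pow]
    rw [h2, one_mul]
  rw [← hU.unit u z' hz', ← hzprod]
  rw [← hzprod] at hprod0
  have hroot : 0 < (∏ σ, (z σ).im) ^ (-(1 / 2) : ℝ) := Real.rpow_pos_of_pos hprod0 _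
  by_cases hT1 : 1 ≤ T
  · have h1 := hC₁ z hz fun σ => by
      refine le_trans ?_ (hzb σ).1
      nlinarith [Real.exp_pos (-C₀)]
    have h2 : 0 ≤ C₂ * P ^ (-(1 / 2) : ℝ) := by positivity
    calc ‖f z‖ ≤ |C₁| * 1 := by rw [mul_one]; exact h1.trans (le_abs_self _)
      _ ≤ _ := mul_le_mul (by linarith) (by linarith) zero_le_one (by positivity)
  · push Not at hT1
    set R : ℝ := Real.sqrt T with hR
    have hR0 : 0 < R := Real.sqrt_pos.mpr hT0
    have hRR : R * R = T := Real.mul_self_sqrt hT0.le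
    have hR1 : R < 1 := by
      by_contra! h
      nlinarith
    -- The quality of the approximation is matched to the height: with m of order T^{-1/2}, the real
    -- and imaginary parts of cz + d are both O(T^{1/2}).
    set m : ℕ := ⌈R⁻¹⌉₊ with hm
    have hRi : 1 < R⁻¹ := one_lt_inv_iff₀.mpr ⟨hR0, hR1⟩
    have hm0 : 0 < m := Nat.ceil_pos.mpr (by linarith)
    have hm1 : R⁻¹ ≤ m := Nat.le_ceil _
    have hm2 : (m : ℝ) ≤ 2 * R⁻¹ := by
      have := Nat.ceil_lt_add_one (a := R⁻¹) (by linarith)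
      rw [← hm] at this
      linarith
    have hm' : (0 : ℝ) < m := by exact_mod_cast hm0
    obtain ⟨q, d, p, b, hdet, hq, hq1, hq2⟩ := happ (fun σ => σ ((δ : F) / 2) * (z σ).re) m hm0
    have hdet' : (p : F) * d - b * q = 1 := by
      rw [← intCoe_mul, ← intCoe_mul, ← intCoe_sub, hdet, intCoe_one]
    let β : Matrix.SpecialLinearGroup (Fin 2) F :=
      ⟨!![(p : F), 2 * (b : F) / δ; (δ : F) / 2 * q, (d : F)], by
        rw [Matrix.det_fin_two_of]
        field_simp
        exact hdet'⟩
    have b1 : β 0 0 = (p : F) := rfl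
    have b2 : β 0 1 = 2 * (b : F) / δ := rfl
    have b3 : β 1 0 = (δ : F) / 2 * q := rfl
    have b4 : β 1 1 = (d : F) := rfl
    have hden : ∀ σ, ‖den β z σ‖ ≤ A' * R := by
      intro σ
      have hsplit : den β z σ = ((σ (q : F) * (σ ((δ : F) / 2) * (z σ).re) + σ (d : F) : ℝ) : ℂ) +
          ((σ ((δ : F) / 2) * σ (q : F) * (z σ).im : ℝ) : ℂ) * Complex.I := by
        rw [den, b3, b4, map_mul]
        nth_rewrite 1 [← Complex.re_add_im (z σ)]
        push_cast
        ring
      rw [hsplit]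
      refine (norm_add_le _ _).trans ?_
      rw [norm_mul, Complex.norm_I, mul_one, Complex.norm_real, Complex.norm_real, Real.norm_eq_abs,
        Real.norm_eq_abs, abs_mul, abs_mul, abs_of_pos (hz σ)]
      have e1 : A / m ≤ A * R := by
        rw [div_le_iff₀ hm']
        have : 1 ≤ R * m := by
          have := mul_le_mul_of_nonneg_left hm1 hR0.le
          rwa [mul_inv_cancel₀ hR0.ne'] at this
        nlinarith
      have e2 : |σ (q : F)| ≤ A * (2 * R⁻¹) := (hq1 σ).trans (mul_le_mul_of_nonneg_left hm2 hA.le)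
      have e3 : (z σ).im ≤ Real.exp C₀ * (R * R) := by rw [hRR]; exact (hzb σ).2
      calc _ ≤ A * R + D * (A * (2 * R⁻¹)) * (Real.exp C₀ * (R * R)) := by
            refine add_le_add ((hq2 σ).trans e1) ?_
            refine mul_le_mul (mul_le_mul (hDle σ) e2 (abs_nonneg _) hD0) e3 (hz σ).le ?_
            positivity
        _ = A' * R := by
            rw [hA']
            field_simp
    have hdpos : ∀ σ, 0 < ‖den β z σ‖ := fun σ => norm_pos_iff.mpr (den_ne_zero β hz σ)
    have hw := moebius_mem β hz
    obtain ⟨e1, e2, e3, e4⟩ := entry_inv β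
    -- The imaginary parts of βz are bounded below, so the uniform cusp bound applies to β⁻¹ at βz,
    -- which is f at z.
    have hbound := hC₂ β⁻¹ (-q) p (by rw [e1, b4]; exact coe_mem_intSub d)
      (by
        rw [e2, b2]
        refine ⟨-b, ?_⟩
        rw [map_neg]
        field_simp)
      (by rw [e3, b3, intCoe_neg]; ring) (by rw [e4, b1]) (neg_ne_zero.mpr hq) (moebius β z) hw
      (fun σ => by
        rw [moebius_im, le_div_iff₀ (by have := hdpos σ; positivity)]
        calc Real.exp (-C₀) / A' ^ 2 * ‖den β z σ‖ ^ 2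
            ≤ Real.exp (-C₀) / A' ^ 2 * (A' * R) ^ 2 := by
              refine mul_le_mul_of_nonneg_left ?_ (by positivity)
              exact pow_le_pow_left₀ (hdpos σ).le (hden σ) 2
          _ = Real.exp (-C₀) * (R * R) := by field_simp
          _ ≤ (z σ).im := by rw [hRR]; exact (hzb σ).1)
    rw [moebius_cancel_inv β hz] at hbound
    have habs := absFactor_mul β⁻¹ β hz
    rw [inv_mul_cancel, absFactor_one] at habs
    have hβpos := absFactor_pos β hz
    -- From |cz + d| ≥ |c|y in each coordinate and |N(q)| ≥ 1. This is the source of the exponent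
    -- -1/2 of N(y).
    have hβlow : P ^ (1 / 2 : ℝ) * (∏ σ, (z σ).im) ^ (1 / 2 : ℝ) ≤ absFactor β z := by
      rw [absFactor_eq, ← Real.mul_rpow hP0.le hprod0.le]
      refine Real.rpow_le_rpow (by positivity) ?_ (by norm_num)
      rw [hP, ← Finset.prod_mul_distrib]
      calc ∏ σ : F →+* ℝ, |σ ((δ : F) / 2)| * (z σ).im
          ≤ (∏ σ : F →+* ℝ, |σ ((δ : F) / 2)| * (z σ).im) * ∏ σ : F →+* ℝ, |σ (q : F)| := by
            refine le_mul_of_one_le_right ?_ (one_le_abs_prod hq)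
            exact Finset.prod_nonneg fun σ _ => mul_nonneg (abs_nonneg _) (hz σ).le
        _ = ∏ σ : F →+* ℝ, |σ (β 1 0)| * |(z σ).im| := by
            rw [← Finset.prod_mul_distrib]
            refine Finset.prod_congr rfl fun σ _ => ?_
            rw [b3, map_mul, abs_mul, abs_of_pos (hz σ)]
            ring
        _ ≤ ∏ σ, ‖den β z σ‖ := Finset.prod_le_prod (fun σ _ => by positivity)
            fun σ _ => norm_den_ge β z σ
    have hinv : absFactor β⁻¹ (moebius β z) = (absFactor β z)⁻¹ := eq_inv_of_mul_eq_one_left habs.symm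
    rw [hinv] at hbound
    have hfin : (absFactor β z)⁻¹ ≤ P ^ (-(1 / 2) : ℝ) * (∏ σ, (z σ).im) ^ (-(1 / 2) : ℝ) := by
      rw [Real.rpow_neg hP0.le, Real.rpow_neg hprod0.le, ← mul_inv]
      exact inv_anti₀ (by positivity) hβlow
    calc ‖f z‖ ≤ C₂ * (P ^ (-(1 / 2) : ℝ) * (∏ σ, (z σ).im) ^ (-(1 / 2) : ℝ)) :=
          hbound.trans (mul_le_mul_of_nonneg_left hfin hC₂0)
      _ = (C₂ * P ^ (-(1 / 2) : ℝ)) * (∏ σ, (z σ).im) ^ (-(1 / 2) : ℝ) := by ring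
      _ ≤ _ := mul_le_mul (by linarith [abs_nonneg C₁]) (by linarith) hroot.le (by positivity)

/-- Polynomial growth near the boundary in bounded regions. -/
def HasModerateGrowth (f : ((F →+* ℝ) → ℂ) → ℂ) : Prop :=
  ∀ X : ℝ, ∃ C : ℝ, 0 ≤ C ∧ ∀ z ∈ upperHalf F, (∀ σ, ‖z σ‖ ≤ X) →
    ‖f z‖ ≤ C * (∏ σ, (z σ).im) ^ (-(1 / 2) : ℝ)

omit hδ hδ_pos in
lemma prod_im_pos {z : (F →+* ℝ) → ℂ} (hz : z ∈ upperHalf F) : 0 < ∏ σ, (z σ).im :=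
  Finset.prod_pos fun σ _ => hz σ

/-- In a bounded region N(y)^{-1/2} is bounded below and absorbs the constant 1. -/
theorem IsModularForm.hasModerateGrowth (hF : NarrowClassNumberOne F) (hf : IsModularForm 𝔠 ψ f)
    (hc : Ideal.span {c} = 𝔠) (hc0 : c ≠ 0) (h4 : (4 : 𝓞 F) ∣ c) (hψ : ψ.ConductorDvd 𝔠)
    (hψ' : ψ.TrivialAtInfinity) : HasModerateGrowth f := by
  obtain ⟨C, hC0, hC⟩ := hf.exists_growth hδ hδ_pos hF hc hc0 h4 hψ hψ'
  intro X
  set Y : ℝ := ∏ _σ : F →+* ℝ, |X| with hY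
  have hY0 : 0 ≤ Y := Finset.prod_nonneg fun _ _ => abs_nonneg _
  refine ⟨C * (Y ^ (1 / 2 : ℝ) + 1), by positivity, fun z hz hzX => ?_⟩
  have hp := prod_im_pos hz
  have h1 : ∏ σ, (z σ).im ≤ Y := Finset.prod_le_prod (fun σ _ => (hz σ).le) fun σ _ =>
    (Complex.im_le_norm _).trans ((hzX σ).trans (le_abs_self X))
  have h2 : 1 ≤ Y ^ (1 / 2 : ℝ) * (∏ σ, (z σ).im) ^ (-(1 / 2) : ℝ) := by
    rw [Real.rpow_neg hp.le, ← div_eq_mul_inv, le_div_iff₀ (by positivity), one_mul]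
    exact Real.rpow_le_rpow hp.le h1 (by norm_num)
  refine (hC z hz).trans ?_
  rw [mul_assoc]
  refine mul_le_mul_of_nonneg_left ?_ hC0
  rw [add_mul, one_mul]
  linarith

/-- The bound for f is carried through the involution. With A its `absFactor`, N(Im αz) = N(y)/A⁴,
so the translate is at most C(A⁻¹ + N(y)^{-1/2}A). The first term is controlled by |N(z)| ≥ N(y),
the second by the boundedness of z. -/
theorem IsModularForm.hasModerateGrowth_symmetryW (hF : NarrowClassNumberOne F)
    (hf : IsModularForm 𝔠 ψ f)
    (hc : Ideal.span {c} = 𝔠) (hc0 : c ≠ 0) (h4 : (4 : 𝓞 F) ∣ c) {t : 𝓞 F} (hct : c = t ^ 2)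
    (hψ : ψ.ConductorDvd 𝔠) (hψ' : ψ.TrivialAtInfinity) : HasModerateGrowth (symmetryW δ c f) := by
  obtain ⟨C, hC0, hC⟩ := hf.exists_growth hδ hδ_pos hF hc hc0 h4 hψ hψ'
  have hδ0 : (δ : F) ≠ 0 := hδ_pos.ne_zero'
  have ht00 : t ≠ 0 := fun h => hc0 (by rw [hct, h]; ring)
  have ht0 : (t : F) ≠ 0 := by exact_mod_cast ht00
  have ht : (t : F) * δ / 2 ≠ 0 := div_ne_zero (mul_ne_zero ht0 hδ0) two_ne_zero
  set α := invSL ((t : F) * δ / 2) ht with hα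
  obtain ⟨a1, a2, a3, a4⟩ := invSL_entry ht
  set P : ℝ := ∏ σ : F →+* ℝ, |σ ((t : F) * δ / 2)| with hP
  have hP0 : 0 < P := Finset.prod_pos fun σ _ => abs_pos.mpr (emb_ne_zero σ ht)
  intro X
  set Y : ℝ := ∏ _σ : F →+* ℝ, |X| with hY
  have hY0 : 0 ≤ Y := Finset.prod_nonneg fun _ _ => abs_nonneg _
  refine ⟨C * (P ^ (-(1 / 2) : ℝ) + P ^ (1 / 2 : ℝ) * Y ^ (1 / 2 : ℝ)), by positivity,
    fun z hz hzX => ?_⟩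
  have hp := prod_im_pos hz
  have hpos := absFactor_pos α hz
  have hnorm := norm_symmetryW_mul (f := f) hδ_pos ht hct hz
  rw [← hα] at hnorm
  set N : ℝ := ∏ σ, ‖z σ‖ with hN
  have hN0 : 0 < N := Finset.prod_pos fun σ _ => norm_pos_iff.mpr
    (right_ne_zero_of_mul (neg_I_mul_ne_zero hz σ))
  have habs : absFactor α z = P ^ (1 / 2 : ℝ) * N ^ (1 / 2 : ℝ) := absFactor_invSL ht z
  have him : ∏ σ, (moebius α z σ).im = (∏ σ, (z σ).im) / (absFactor α z) ^ (4 : ℝ) := by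
    rw [absFactor_eq, ← Real.rpow_mul (by positivity)]
    norm_num
    rw [← Finset.prod_pow, ← Finset.prod_div_distrib]
    exact Finset.prod_congr rfl fun σ _ => moebius_im α z σ
  have h1 : (∏ σ, (moebius α z σ).im) ^ (-(1 / 2) : ℝ) =
      (∏ σ, (z σ).im) ^ (-(1 / 2) : ℝ) * absFactor α z * absFactor α z := by
    rw [him, Real.div_rpow hp.le (by positivity), ← Real.rpow_mul hpos.le, div_eq_mul_inv,
      ← Real.rpow_neg hpos.le]
    norm_num
    ring
  have h2 := hC _ (moebius_mem α hz)
  rw [h1, ← hnorm] at h2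
  have hNle : N ≤ Y := Finset.prod_le_prod (fun σ _ => norm_nonneg _) fun σ _ =>
    (hzX σ).trans (le_abs_self X)
  have hleN : ∏ σ, (z σ).im ≤ N := Finset.prod_le_prod (fun σ _ => (hz σ).le) fun σ _ =>
    Complex.im_le_norm _
  set I : ℝ := (∏ σ, (z σ).im) ^ (-(1 / 2) : ℝ) with hI
  have hI0 : 0 < I := Real.rpow_pos_of_pos hp _
  have h3 : (absFactor α z)⁻¹ ≤ P ^ (-(1 / 2) : ℝ) * I := by
    rw [habs, hI, Real.rpow_neg hP0.le, Real.rpow_neg hp.le, ← mul_inv]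
    refine inv_anti₀ (by positivity) ?_
    exact mul_le_mul_of_nonneg_left (Real.rpow_le_rpow hp.le hleN (by norm_num)) (by positivity)
  have h4 : absFactor α z ≤ P ^ (1 / 2 : ℝ) * Y ^ (1 / 2 : ℝ) := by
    rw [habs]
    exact mul_le_mul_of_nonneg_left (Real.rpow_le_rpow hN0.le hNle (by norm_num)) (by positivity)
  have h5 : ‖symmetryW δ c f z‖ ≤ C * ((absFactor α z)⁻¹ + I * absFactor α z) := by
    rw [← mul_le_mul_iff_left₀ hpos]
    refine h2.trans (le_of_eq ?_)
    field_simp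
  refine h5.trans ?_
  rw [mul_assoc]
  refine mul_le_mul_of_nonneg_left ?_ hC0
  rw [add_mul]
  refine add_le_add h3 ?_
  rw [mul_comm]
  exact mul_le_mul_of_nonneg_right h4 hI0.le

omit hδ_pos in
/-- Polynomial growth of the coefficients. -/
theorem IsRegularExpansion.exists_coeff_bound (hδ_pos : TotallyPositive (δ : F)) {a : 𝓞 F → ℂ}
    (ha : IsRegularExpansion δ f a) (hf : HasModerateGrowth f) :
    ∃ C : ℝ, 0 ≤ C ∧ ∀ ζ : 𝓞 F, ζ ≠ 0 → ‖a ζ‖ ≤ C * (∏ σ : F →+* ℝ, |σ (ζ : F)|) ^ (1 / 2 : ℝ) := by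
  have hδ0 : (δ : F) ≠ 0 := hδ_pos.ne_zero'
  obtain ⟨C₀, hC₀, hbal⟩ := exists_unit_balance_sq F
  let L : (BIdx F → ℝ) →L[ℝ] ((F →+* ℝ) → ℝ) := (latEquiv F : (BIdx F → ℝ) →L[ℝ] ((F →+* ℝ) → ℝ))
  have hL0 : 0 ≤ ‖L‖ := L.opNorm_nonneg
  set X : ℝ := ∑ σ : F →+* ℝ, (2 / σ (δ : F)) * (‖L‖ + σ (δ : F) * Real.exp C₀) with hX
  obtain ⟨C, hC0, hC⟩ := hf X
  set K : ℝ := ∏ _σ : F →+* ℝ, (2 : ℝ) with hK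
  have hK0 : 0 < K := Finset.prod_pos fun _ _ => two_pos
  set E : ℝ := Real.exp (2 * Real.pi * Module.finrank ℚ F) with hE
  refine ⟨C * K ^ (-(1 / 2) : ℝ) * E, by positivity, fun ζ hζ0 => ?_⟩
  by_cases hζ : TotallyPositive (ζ : F)
  swap
  · rw [ha.vanish ζ hζ0 hζ, norm_zero]
    have : 0 ≤ ∏ σ : F →+* ℝ, |σ (ζ : F)| := Finset.prod_nonneg fun _ _ => abs_nonneg _
    positivity
  -- Multiplying ζ by the square of a unit does not change its coefficient, and makes all conjugates
  -- bounded below because N(ζ) ≥ 1.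
  obtain ⟨u, hu⟩ := hbal fun σ => Real.log (σ (ζ : F))
  rw [← ha.unit u ζ]
  set ξ : 𝓞 F := (u : 𝓞 F) ^ 2 * ζ with hξ
  have hξσ : ∀ σ : F →+* ℝ, σ (ξ : F) = σ ((u : 𝓞 F) : F) ^ 2 * σ (ζ : F) := by
    intro σ
    rw [hξ, intCoe_mul, intCoe_pow, map_mul, map_pow]
  have hξpos : ∀ σ : F →+* ℝ, 0 < σ (ξ : F) := by
    intro σ
    rw [hξσ]
    have := emb_ne_zero σ (coe_unit_ne_zero u)
    have := hζ σ
    positivity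
  have hprod : ∏ σ : F →+* ℝ, |σ (ζ : F)| = ∏ σ : F →+* ℝ, σ (ξ : F) := by
    simp only [hξσ, Finset.prod_mul_distrib]
    have h2 : ∏ σ : F →+* ℝ, σ ((u : 𝓞 F) : F) ^ 2 = 1 := by
      have : ∏ σ : F →+* ℝ, σ ((u : 𝓞 F) : F) ^ 2 = (∏ σ : F →+* ℝ, |σ ((u : 𝓞 F) : F)|) ^ 2 := by
        rw [← Finset.prod_pow]
        exact Finset.prod_congr rfl fun σ _ => (sq_abs _).symm
      rw [this, unit_prod_abs, one_pow]
    rw [h2, one_mul]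
    exact Finset.prod_congr rfl fun σ _ => abs_of_pos (hζ σ)
  have hlow : ∀ σ : F →+* ℝ, Real.exp (-C₀) ≤ σ (ξ : F) := by
    intro σ
    rw [← Real.le_log_iff_exp_le (hξpos σ)]
    have hup : 0 < |σ ((u : 𝓞 F) : F)| := abs_pos.mpr (emb_ne_zero σ (coe_unit_ne_zero u))
    have hlog : Real.log (σ (ξ : F)) = Real.log (σ (ζ : F)) + 2 * Real.log |σ ((u : 𝓞 F) : F)| := by
      rw [hξσ, ← sq_abs, Real.log_mul (by positivity) (hζ σ).ne', Real.log_pow]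
      push_cast
      ring
    have h := (abs_le.mp (hu σ)).1
    have hmean : 0 ≤ (∑ τ : F →+* ℝ, Real.log (τ (ζ : F))) / Module.finrank ℚ F := by
      refine div_nonneg ?_ (Nat.cast_nonneg _)
      rw [← Real.log_prod fun τ _ => (hζ τ).ne']
      refine Real.log_nonneg ?_
      have := one_le_abs_prod hζ0
      rwa [Finset.prod_congr rfl fun σ _ => abs_of_pos (hζ σ)] at this
    linarith
  -- At this height the exponential in Cauchy's estimate is exp(2πn), and by the balancing the
  -- points stay in a bounded region.
  let y : (F →+* ℝ) → ℝ := fun σ => σ (δ : F) / σ (ξ : F)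
  have hy : ∀ σ, 0 < y σ := fun σ => div_pos (hδ_pos σ) (hξpos σ)
  have hyle : ∀ σ, y σ ≤ σ (δ : F) * Real.exp C₀ := by
    intro σ
    have h := hlow σ
    rw [Real.exp_neg, inv_le_iff_one_le_mul₀ (Real.exp_pos _)] at h
    simp only [y]
    rw [div_le_iff₀ (hξpos σ)]
    nlinarith [hδ_pos σ]
  have hbd : ∀ s ∈ unitCube (BIdx F), ‖f (scale (2 / (δ : F)) (latPoint s y))‖ ≤
      C * (K ^ (-(1 / 2) : ℝ) * (∏ σ : F →+* ℝ, σ (ξ : F)) ^ (1 / 2 : ℝ)) := by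
    intro s hs
    have h1 := hC _ (scale_mem (totallyPositive_two.div hδ_pos) (latPoint_mem hy s)) fun σ => by
      have hsn : ‖s‖ ≤ 1 := by
        refine (pi_norm_le_iff_of_nonneg zero_le_one).mpr fun i => ?_
        have := unitCube_subset hs
        rw [Real.norm_eq_abs, abs_of_nonneg (this.1 i)]
        exact this.2 i
      have h2δ : 0 < 2 / σ (δ : F) := div_pos two_pos (hδ_pos σ)
      refine le_trans ?_ (Finset.single_le_sum (f := fun σ : F →+* ℝ =>
        (2 / σ (δ : F)) * (‖L‖ + σ (δ : F) * Real.exp C₀)) (fun τ _ => by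
          have := hδ_pos τ
          positivity) (Finset.mem_univ σ))
      simp only [scale, norm_mul, Complex.norm_real, map_div₀, map_ofNat]
      rw [Real.norm_of_nonneg h2δ.le]
      refine mul_le_mul_of_nonneg_left ?_ h2δ.le
      refine (norm_add_le _ _).trans (add_le_add ?_ ?_)
      · rw [Complex.norm_real]
        calc ‖latEquiv F s σ‖ ≤ ‖L s‖ := norm_le_pi_norm _ σ
          _ ≤ ‖L‖ * ‖s‖ := L.le_opNorm s
          _ ≤ ‖L‖ := mul_le_of_le_one_right hL0 hsn
      · rw [norm_mul, Complex.norm_I, one_mul, Complex.norm_real, Real.norm_of_nonneg (hy σ).le]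
        exact hyle σ
    refine h1.trans (le_of_eq ?_)
    congr 1
    have him : ∏ σ, (scale (2 / (δ : F)) (latPoint s y) σ).im = K * (∏ σ : F →+* ℝ, σ (ξ : F))⁻¹ := by
      rw [hK, ← Finset.prod_inv_distrib, ← Finset.prod_mul_distrib]
      refine Finset.prod_congr rfl fun σ _ => ?_
      have := (hδ_pos σ).ne'
      have := (hξpos σ).ne'
      simp only [scale, Complex.im_ofReal_mul, latPoint_im, map_div₀, map_ofNat, y]
      field_simp
    have hξp : 0 < ∏ σ : F →+* ℝ, σ (ξ : F) := Finset.prod_pos fun σ _ => hξpos σ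
    rw [him, Real.mul_rpow hK0.le (by positivity), Real.inv_rpow hξp.le, Real.rpow_neg hξp.le, inv_inv]
  have h := norm_coeff_le hδ ha.hasSum hy hbd ξ
  rw [hprod]
  refine h.trans (le_of_eq ?_)
  have hexp : 2 * Real.pi * ∑ σ : F →+* ℝ, σ (ξ : F) / σ (δ : F) * y σ =
      2 * Real.pi * Module.finrank ℚ F := by
    congr 1
    have : ∀ σ : F →+* ℝ, σ (ξ : F) / σ (δ : F) * y σ = 1 := by
      intro σ
      have := (hδ_pos σ).ne'
      have := (hξpos σ).ne'
      simp only [y]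
      field_simp
    simp only [this, Finset.sum_const, Finset.card_univ, card_realEmb, nsmul_eq_mul, mul_one]
  rw [hexp, ← hE]
  ring

end Growth

/-! ### Totally positive generators of ideals. -/

section Generators

variable {F : Type*} [Field F] [NumberField F] [NumberField.IsTotallyReal F]

/-- Squaring kills the torsion ±1, so only the exponents of the fundamental units remain. -/
lemma exists_unitPow_sq (v : (𝓞 F)ˣ) : ∃ k, v ^ 2 = unitPow k ^ 2 := by
  obtain ⟨⟨ζ, k⟩, h, -⟩ := NumberField.Units.exist_unique_eq_mul_prod F v
  refine ⟨k, ?_⟩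
  have hζ : (ζ : (𝓞 F)ˣ) ^ 2 = 1 := by
    rcases torsion_eq ζ.2 with h | h <;> rw [h]
    · exact one_pow 2
    · exact neg_one_sq
  rw [h, mul_pow, hζ, one_mul, unitPow]

lemma unitPow_sq_injective : Function.Injective fun k => (unitPow (F := F) k) ^ 2 := by
  intro k l h
  have h1 : logVec F (fun i => (k i : ℝ)) = logVec F (fun i => (l i : ℝ)) := by
    funext σ
    have h2 : |σ ((unitPow k : 𝓞 F) : F)| = |σ ((unitPow l : 𝓞 F) : F)| := by
      have h3 : σ ((unitPow k : 𝓞 F) : F) ^ 2 = σ ((unitPow l : 𝓞 F) : F) ^ 2 := by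
        have h4 : ((unitPow k : 𝓞 F) : F) ^ 2 = ((unitPow l : 𝓞 F) : F) ^ 2 := by
          rw [← intCoe_pow, ← intCoe_pow]
          exact congr_arg (fun u : (𝓞 F)ˣ => ((u : 𝓞 F) : F)) h
        rw [← map_pow, h4, map_pow]
      exact sq_eq_sq_iff_abs_eq_abs _ _ |>.mp h3
    rw [← log_unitPow, ← log_unitPow, h2]
  have h2 := logVec_injective h1
  funext i
  exact_mod_cast congr_fun h2 i

lemma totallyPositive_unit_sq_mul (u : (𝓞 F)ˣ) {ξ : 𝓞 F} (hξ : TotallyPositive (ξ : F)) :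
    TotallyPositive (((u : 𝓞 F) ^ 2 * ξ : 𝓞 F) : F) := by
  intro σ
  rw [intCoe_mul, intCoe_pow, map_mul, map_pow]
  have h1 := emb_ne_zero σ (coe_unit_ne_zero u)
  have h2 := hξ σ
  positivity

/-- The quotient of two totally positive generators is a totally positive unit, hence a square. With
invariance under squares of units this makes a(I) well defined. -/
lemma exists_unit_of_span_eq (hF : NarrowClassNumberOne F) {ξ η : 𝓞 F}
    (hξ : TotallyPositive (ξ : F)) (hη : TotallyPositive (η : F))
    (h : Ideal.span {ξ} = Ideal.span {η}) : ∃ v : (𝓞 F)ˣ, η = (v : 𝓞 F) ^ 2 * ξ := by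
  obtain ⟨u, hu⟩ := Ideal.span_singleton_eq_span_singleton.mp h
  have hupos : TotallyPositive ((u : 𝓞 F) : F) := by
    intro σ
    have h1 := hη σ
    rw [← hu, intCoe_mul, map_mul] at h1
    exact pos_of_mul_pos_right h1 (hξ σ).le
  obtain ⟨v, hv⟩ := exists_sq_of_totallyPositive_unit hF hupos
  refine ⟨v, ?_⟩
  rw [← hu, hv, mul_comm]
  rfl

lemma span_unit_sq_mul (u : (𝓞 F)ˣ) (ξ : 𝓞 F) :
    Ideal.span {(u : 𝓞 F) ^ 2 * ξ} = Ideal.span {ξ} :=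
  Ideal.span_singleton_mul_left_unit (u.isUnit.pow 2) ξ

/-- A totally positive generator of a non-zero ideal. -/
def idealGen (hF : NarrowClassNumberOne F) (I : {I : Ideal (𝓞 F) // I ≠ ⊥}) : 𝓞 F :=
  (exists_totallyPositive_generator hF I.2).choose

lemma idealGen_pos (hF : NarrowClassNumberOne F) (I : {I : Ideal (𝓞 F) // I ≠ ⊥}) :
    TotallyPositive (idealGen hF I : F) := (exists_totallyPositive_generator hF I.2).choose_spec.1

lemma span_idealGen (hF : NarrowClassNumberOne F) (I : {I : Ideal (𝓞 F) // I ≠ ⊥}) :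
    Ideal.span {idealGen hF I} = I := (exists_totallyPositive_generator hF I.2).choose_spec.2

lemma prod_idealGen (hF : NarrowClassNumberOne F) (I : {I : Ideal (𝓞 F) // I ≠ ⊥}) :
    ∏ σ : F →+* ℝ, σ (idealGen hF I : F) = Ideal.absNorm (I : Ideal (𝓞 F)) := by
  rw [← span_idealGen hF I, ← abs_prod_eq_absNorm, abs_of_pos]
  exact Finset.prod_pos fun σ _ => idealGen_pos hF I σ

lemma absNorm_pos (I : {I : Ideal (𝓞 F) // I ≠ ⊥}) : 1 ≤ Ideal.absNorm (I : Ideal (𝓞 F)) :=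
  Nat.one_le_iff_ne_zero.mpr fun h => I.2 (Ideal.absNorm_eq_zero_iff.mp h)

/-- The totally positive integers are the products of the chosen generators of the non-zero ideals
and the squares of the products of the fundamental units. -/
def genEquiv (hF : NarrowClassNumberOne F) :
    ({I : Ideal (𝓞 F) // I ≠ ⊥} × (Fin (NumberField.Units.rank F) → ℤ)) ≃
      {ξ : 𝓞 F // TotallyPositive (ξ : F)} :=
  Equiv.ofBijective
    (fun p => ⟨(unitPow p.2 : 𝓞 F) ^ 2 * idealGen hF p.1,
      totallyPositive_unit_sq_mul _ (idealGen_pos hF p.1)⟩) <| by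
    constructor
    · rintro ⟨I, k⟩ ⟨J, l⟩ h
      have h1 : (unitPow k : 𝓞 F) ^ 2 * idealGen hF I = (unitPow l : 𝓞 F) ^ 2 * idealGen hF J :=
        congr_arg Subtype.val h
      have h2 : I = J := by
        refine Subtype.ext ?_
        rw [← span_idealGen hF I, ← span_idealGen hF J, ← span_unit_sq_mul (unitPow k), h1,
          span_unit_sq_mul]
      subst h2
      have h3 : idealGen hF I ≠ 0 := by
        have := (idealGen_pos hF I).ne_zero'
        exact_mod_cast this
      have h4 := unitPow_sq_injective (Units.ext (mul_right_cancel₀ h3 h1))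
      rw [h4]
    · rintro ⟨ξ, hξ⟩
      have hξ0 : ξ ≠ 0 := by
        have := hξ.ne_zero'
        exact_mod_cast this
      let I : {I : Ideal (𝓞 F) // I ≠ ⊥} := ⟨Ideal.span {ξ}, by
        rwa [Ne, Ideal.span_singleton_eq_bot]⟩
      obtain ⟨v, hv⟩ := exists_unit_of_span_eq hF (idealGen_pos hF I) hξ (span_idealGen hF I)
      obtain ⟨k, hk⟩ := exists_unitPow_sq v
      refine ⟨(I, k), Subtype.ext ?_⟩
      have h2 : ((v : 𝓞 F)) ^ 2 = (unitPow k : 𝓞 F) ^ 2 := congr_arg Units.val hk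
      exact (hv.trans (by rw [h2])).symm

lemma genEquiv_apply (hF : NarrowClassNumberOne F) (I : {I : Ideal (𝓞 F) // I ≠ ⊥})
    (k : Fin (NumberField.Units.rank F) → ℤ) :
    (genEquiv hF (I, k) : 𝓞 F) = (unitPow k : 𝓞 F) ^ 2 * idealGen hF I := rfl

lemma idealCoeffWellDefined (hF : NarrowClassNumberOne F) {a : 𝓞 F → ℂ}
    (ha : ∀ (u : (𝓞 F)ˣ) (ζ : 𝓞 F), a ((u : 𝓞 F) ^ 2 * ζ) = a ζ) : IdealCoeffWellDefined a := by
  intro ξ hξ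
  have h : ∃ η : 𝓞 F, TotallyPositive (η : F) ∧ Ideal.span {η} = Ideal.span {ξ} := ⟨ξ, hξ, rfl⟩
  rw [idealCoeff, dif_pos h]
  obtain ⟨v, hv⟩ := exists_unit_of_span_eq hF hξ h.choose_spec.1 h.choose_spec.2.symm
  rw [hv, ha]

lemma idealCoeff_eq (hF : NarrowClassNumberOne F) {a : 𝓞 F → ℂ}
    (ha : ∀ (u : (𝓞 F)ˣ) (ζ : 𝓞 F), a ((u : 𝓞 F) ^ 2 * ζ) = a ζ)
    (I : {I : Ideal (𝓞 F) // I ≠ ⊥}) : idealCoeff a I = a (idealGen hF I) := by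
  rw [idealCoeffWellDefined hF ha _ (idealGen_pos hF I), span_idealGen]

/-- Balancing brings every conjugate below a constant times N(I)^{1/n} ≤ N(I); the weaker bound is
enough for counting ideals. -/
lemma exists_balanced_generator (hF : NarrowClassNumberOne F) :
    ∃ C : ℝ, 0 < C ∧ ∀ I : {I : Ideal (𝓞 F) // I ≠ ⊥}, ∃ ξ : 𝓞 F,
      Ideal.span {ξ} = I ∧ (ξ ≠ 0) ∧
        ∀ σ : F →+* ℝ, |σ (ξ : F)| ≤ C * Ideal.absNorm (I : Ideal (𝓞 F)) := by
  obtain ⟨C, hC, hbal⟩ := exists_unit_balance_sq F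
  refine ⟨Real.exp C, Real.exp_pos _, fun I => ?_⟩
  obtain ⟨u, hu⟩ := hbal fun σ => Real.log (σ (idealGen hF I : F))
  have hpos := totallyPositive_unit_sq_mul u (idealGen_pos hF I)
  have hN : (1 : ℝ) ≤ Ideal.absNorm (I : Ideal (𝓞 F)) := by exact_mod_cast absNorm_pos I
  refine ⟨(u : 𝓞 F) ^ 2 * idealGen hF I, by rw [span_unit_sq_mul, span_idealGen], ?_, fun σ => ?_⟩
  · have := hpos.ne_zero'
    exact_mod_cast this
  · have hup : 0 < |σ ((u : 𝓞 F) : F)| := abs_pos.mpr (emb_ne_zero σ (coe_unit_ne_zero u))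
    have hg := idealGen_pos hF I σ
    rw [abs_of_pos (hpos σ), ← Real.log_le_log_iff (hpos σ) (by positivity),
      Real.log_mul (Real.exp_pos _).ne' (by positivity), Real.log_exp, intCoe_mul, intCoe_pow, map_mul,
      map_pow, ← sq_abs, Real.log_mul (by positivity) hg.ne', Real.log_pow]
    have h := (abs_le.mp (hu σ)).2
    rw [← Real.log_prod fun τ _ => (idealGen_pos hF I τ).ne', prod_idealGen] at h
    have h2 : Real.log (Ideal.absNorm (I : Ideal (𝓞 F))) / (Module.finrank ℚ F : ℝ) ≤
        Real.log (Ideal.absNorm (I : Ideal (𝓞 F))) := by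
      refine div_le_self (Real.log_nonneg hN) ?_
      exact_mod_cast (Module.finrank_pos : 0 < Module.finrank ℚ F)
    push_cast
    linarith

/-- Distinct ideals have distinct balanced generators, so a convergent sum over lattice points
dominates. The exponent is not sharp, but only some half-plane of convergence is needed. -/
lemma exists_summable_absNorm (hF : NarrowClassNumberOne F) : ∃ N : ℕ,
    Summable fun I : {I : Ideal (𝓞 F) // I ≠ ⊥} => ((Ideal.absNorm (I : Ideal (𝓞 F)) : ℝ)⁻¹) ^ N := by
  obtain ⟨N, hN⟩ := exists_summable_inv_pow F
  obtain ⟨C, hC, hgen⟩ := exists_balanced_generator hF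
  choose ξ h1 h2 h3 using hgen
  have hinj : Function.Injective ξ := fun I J h => Subtype.ext (by rw [← h1 I, ← h1 J, h])
  set n : ℝ := (Module.finrank ℚ F : ℝ) with hn
  have hn0 : 0 < n := Nat.cast_pos.mpr Module.finrank_pos
  refine ⟨N, Summable.of_nonneg_of_le (fun I => by positivity) (fun I => ?_)
    ((hN.comp_injective hinj).mul_left ((n * C) ^ N))⟩
  have hNI : (1 : ℝ) ≤ Ideal.absNorm (I : Ideal (𝓞 F)) := by exact_mod_cast absNorm_pos I
  have hsum : ∑ σ : F →+* ℝ, |σ (ξ I : F)| ≤ n * C * Ideal.absNorm (I : Ideal (𝓞 F)) := by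
    refine (Finset.sum_le_sum fun σ _ => h3 I σ).trans (le_of_eq ?_)
    rw [Finset.sum_const, Finset.card_univ, card_realEmb, nsmul_eq_mul, mul_assoc]
  have hpos : 0 < ∑ σ : F →+* ℝ, |σ (ξ I : F)| := by
    obtain ⟨σ⟩ := nonempty_realEmb (F := F)
    have hξ : (ξ I : F) ≠ 0 := by exact_mod_cast h2 I
    exact Finset.sum_pos' (fun _ _ => abs_nonneg _)
      ⟨σ, Finset.mem_univ _, abs_pos.mpr (emb_ne_zero σ hξ)⟩
  rw [Function.comp_apply, ← mul_pow]
  refine pow_le_pow_left₀ (by positivity) ?_ N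
  rw [← div_eq_mul_inv, le_div_iff₀ hpos, inv_mul_le_iff₀ (by linarith)]
  linarith

/-- The coefficients of a Dirichlet series over the ideals. -/
lemma exists_summable_coeff (hF : NarrowClassNumberOne F) {a : 𝓞 F → ℂ}
    (hbd : ∃ C : ℝ, 0 ≤ C ∧ ∀ ζ : 𝓞 F, ζ ≠ 0 → ‖a ζ‖ ≤ C * (∏ σ : F →+* ℝ, |σ (ζ : F)|) ^ (1 / 2 : ℝ)) :
    ∃ x₀ : ℝ, ∀ x : ℝ, x₀ < x → Summable fun I : {I : Ideal (𝓞 F) // I ≠ ⊥} =>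
      ‖a (idealGen hF I)‖ * (Ideal.absNorm (I : Ideal (𝓞 F)) : ℝ) ^ (-x) := by
  obtain ⟨C, hC0, hC⟩ := hbd
  obtain ⟨N, hN⟩ := exists_summable_absNorm hF
  refine ⟨N + 1 / 2, fun x hx => Summable.of_nonneg_of_le (fun I => by positivity) (fun I => ?_)
    (hN.mul_left C)⟩
  have hNI : (1 : ℝ) ≤ Ideal.absNorm (I : Ideal (𝓞 F)) := by exact_mod_cast absNorm_pos I
  have h0 : idealGen hF I ≠ 0 := by
    have := (idealGen_pos hF I).ne_zero'
    exact_mod_cast this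
  have h := hC _ h0
  rw [Finset.prod_congr rfl fun σ _ => abs_of_pos (idealGen_pos hF I σ), prod_idealGen] at h
  refine (mul_le_mul_of_nonneg_right h (by positivity)).trans ?_
  rw [mul_assoc, ← Real.rpow_add (by linarith), inv_pow, ← Real.rpow_natCast, ← Real.rpow_neg (by linarith)]
  exact mul_le_mul_of_nonneg_left (Real.rpow_le_rpow_of_exponent_le hNI (by linarith)) hC0

end Generators

/-! ### Mellin transforms and gamma integrals in logarithmic coordinates. -/

section MellinExp

lemma abs_exp_smul_cpow (s w : ℂ) (v : ℝ) :
    |Real.exp v| • (((Real.exp v : ℝ) : ℂ) ^ (s - 1) • w) = Complex.exp (s * v) * w := by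
  rw [abs_of_pos (Real.exp_pos _), Complex.real_smul, smul_eq_mul, ← mul_assoc,
    Complex.cpow_def_of_ne_zero (by exact_mod_cast (Real.exp_pos v).ne'), ← Complex.ofReal_log (Real.exp_pos v).le,
    Real.log_exp, Complex.ofReal_exp, ← Complex.exp_add]
  ring_nf

lemma mellin_eq_integral_exp (g : ℝ → ℂ) (s : ℂ) :
    mellin g s = ∫ v : ℝ, Complex.exp (s * v) * g (Real.exp v) := by
  have h := MeasureTheory.integral_image_eq_integral_abs_deriv_smul (s := Set.univ) MeasurableSet.univ
    (fun v _ => (Real.hasDerivAt_exp v).hasDerivWithinAt) Real.exp_injective.injOn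
    (fun t : ℝ => (t : ℂ) ^ (s - 1) • g t)
  rw [Set.image_univ, Real.range_exp, MeasureTheory.setIntegral_univ] at h
  rw [mellin, h]
  exact MeasureTheory.integral_congr_ae (Filter.Eventually.of_forall fun v => abs_exp_smul_cpow s _ v)

lemma integral_exp_mul_exp_neg_exp {s : ℂ} (hs : 0 < s.re) {κ : ℝ} (hκ : 0 < κ) :
    ∫ v : ℝ, Complex.exp (s * v) * ((Real.exp (-(κ * Real.exp v)) : ℝ) : ℂ) =
      (1 / (κ : ℂ)) ^ s * Complex.Gamma s := by
  have h := Complex.integral_cpow_mul_exp_neg_mul_Ioi hs hκ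
  rw [← h, ← mellin_eq_integral_exp (fun t => ((Real.exp (-(κ * t)) : ℝ) : ℂ)) s, mellin]
  simp only [smul_eq_mul]
  push_cast
  rfl

lemma integrable_exp_mul_exp_neg_exp {s : ℂ} (hs : 0 < s.re) {κ : ℝ} (hκ : 0 < κ) :
    MeasureTheory.Integrable
      fun v : ℝ => Complex.exp (s * v) * ((Real.exp (-(κ * Real.exp v)) : ℝ) : ℂ) := by
  -- A non-integrable function has integral 0 by convention, whereas the known value of this
  -- integral is nonzero.
  by_contra h
  have h1 := integral_exp_mul_exp_neg_exp hs hκ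
  rw [MeasureTheory.integral_undef h] at h1
  refine mul_ne_zero ?_ (Complex.Gamma_ne_zero_of_re_pos hs) h1.symm
  rw [Complex.cpow_def_of_ne_zero (by simpa using hκ.ne')]
  exact Complex.exp_ne_zero _

variable {ι : Type*} [Fintype ι]

/-- The integrand of the multidimensional Gamma integral in logarithmic coordinates. -/
def gammaKernel (s : ℂ) (κ : ι → ℝ) (v : ι → ℝ) : ℂ :=
  ∏ i, (Complex.exp (s * v i) * ((Real.exp (-(κ i * Real.exp (v i))) : ℝ) : ℂ))

lemma integrable_gammaKernel {s : ℂ} (hs : 0 < s.re) {κ : ι → ℝ} (hκ : ∀ i, 0 < κ i) :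
    MeasureTheory.Integrable (gammaKernel s κ) :=
  MeasureTheory.Integrable.fintype_prod
    (f := fun i (v : ℝ) => Complex.exp (s * v) * ((Real.exp (-(κ i * Real.exp v)) : ℝ) : ℂ))
    fun i => integrable_exp_mul_exp_neg_exp hs (hκ i)

lemma integral_gammaKernel {s : ℂ} (hs : 0 < s.re) {κ : ι → ℝ} (hκ : ∀ i, 0 < κ i) :
    ∫ v, gammaKernel s κ v = (((∏ i, κ i : ℝ)) : ℂ) ^ (-s) * Complex.Gamma s ^ Fintype.card ι := by
  unfold gammaKernel
  rw [MeasureTheory.integral_fintype_prod_volume_eq_prod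
    (f := fun i (v : ℝ) => Complex.exp (s * v) * ((Real.exp (-(κ i * Real.exp v)) : ℝ) : ℂ))]
  simp only [integral_exp_mul_exp_neg_exp hs (hκ _)]
  rw [Finset.prod_mul_distrib, Finset.prod_const, Finset.card_univ]
  congr 1
  have h1 : ∀ i, (1 / (κ i : ℂ)) ^ s = (((κ i)⁻¹ : ℝ) : ℂ) ^ s := fun i => by
    rw [one_div, Complex.ofReal_inv]
  simp only [h1]
  have h2 : ∀ t : Finset ι, ∏ i ∈ t, (((κ i)⁻¹ : ℝ) : ℂ) ^ s = ((∏ i ∈ t, (κ i)⁻¹ : ℝ) : ℂ) ^ s := by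
    classical
    intro t
    induction t using Finset.induction_on with
    | empty => simp
    | insert i t hi ih =>
      rw [Finset.prod_insert hi, Finset.prod_insert hi, ih, Complex.ofReal_mul,
        Complex.mul_cpow_ofReal_nonneg (inv_nonneg.mpr (hκ i).le)
          (Finset.prod_nonneg fun j _ => inv_nonneg.mpr (hκ j).le)]
  have hp : 0 < ∏ i, κ i := Finset.prod_pos fun i _ => hκ i
  rw [h2, Finset.prod_inv_distrib, Complex.cpow_neg, Complex.ofReal_inv, Complex.inv_cpow]
  rw [Complex.arg_ofReal_of_nonneg hp.le]
  exact Real.pi_pos.ne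

/-- Absolute values replace s by Re s, so the formula for the integral also computes L¹ norms. -/
lemma norm_gammaKernel (s : ℂ) (κ v : ι → ℝ) :
    ((‖gammaKernel s κ v‖ : ℝ) : ℂ) = gammaKernel (s.re : ℂ) κ v := by
  rw [gammaKernel, gammaKernel, norm_prod, Complex.ofReal_prod]
  refine Finset.prod_congr rfl fun i _ => ?_
  rw [norm_mul, Complex.norm_exp, Complex.norm_real, Real.norm_of_nonneg (Real.exp_pos _).le,
    Complex.ofReal_mul, Complex.ofReal_exp, Complex.re_mul_ofReal, Complex.ofReal_mul]

lemma gammaKernel_eq (s : ℂ) (κ v : ι → ℝ) : gammaKernel s κ v =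
    Complex.exp (s * (∑ i, v i : ℝ)) * ((Real.exp (-∑ i, κ i * Real.exp (v i)) : ℝ) : ℂ) := by
  rw [gammaKernel, Finset.prod_mul_distrib, ← Complex.exp_sum, ← Complex.ofReal_prod, ← Real.exp_sum,
    Finset.sum_neg_distrib, Complex.ofReal_sum, Finset.mul_sum]

end MellinExp

/-! ### Tiling of ℝ × ℝᵈ and termwise integration. -/

section ProductTiling

variable {d : Type*} [Fintype d] {E : Type*} [NormedAddCommGroup E] [NormedSpace ℝ E]

instance isAddHaarMeasure_volume_prod :
    (MeasureTheory.volume : MeasureTheory.Measure (ℝ × (d → ℝ))).IsAddHaarMeasure :=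
  inferInstanceAs ((MeasureTheory.volume : MeasureTheory.Measure ℝ).prod
    (MeasureTheory.volume : MeasureTheory.Measure (d → ℝ))).IsAddHaarMeasure

/-- The product of the real line and the unit cube. -/
def cubeTube (d : Type*) : Set (ℝ × (d → ℝ)) := Prod.snd ⁻¹' unitCube d

/-- The unfolding step: the integer translates will be the squares of units, with the tube as their
fundamental domain. -/
lemma hasSum_integral_cubeTube {g : ℝ × (d → ℝ) → E} (hg : MeasureTheory.Integrable g) :
    HasSum (fun k : d → ℤ => ∫ p in cubeTube d, g (p + (0, fun i => (k i : ℝ)))) (∫ p, g p) := by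
  let S : (d → ℤ) → Set (ℝ × (d → ℝ)) := fun k =>
    Prod.snd ⁻¹' ((fun s : d → ℝ => s + fun i => -(k i : ℝ)) ⁻¹' unitCube d)
  have hU : (⋃ k, S k) = Set.univ := by
    simp only [S]
    rw [← Set.preimage_iUnion, iUnion_cube_translates, Set.preimage_univ]
  have h := MeasureTheory.hasSum_integral_iUnion (μ := MeasureTheory.volume) (f := g) (s := S)
    (fun k => measurable_snd (measurableSet_cube_translate k))
    (fun k l hkl => (pairwise_disjoint_cube_translates hkl).preimage Prod.snd)
    hg.integrableOn
  rw [hU, MeasureTheory.setIntegral_univ] at h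
  convert! h using 1
  funext k
  have h3 := (MeasureTheory.measurePreserving_add_right
    (MeasureTheory.volume : MeasureTheory.Measure (ℝ × (d → ℝ)))
    ((0 : ℝ), fun i => -(k i : ℝ))).setIntegral_preimage_emb
    (measurableEmbedding_addRight _) (fun p => g (p + (0, fun i => (k i : ℝ)))) (cubeTube d)
  rw [← h3]
  congr 1
  funext p
  congr 1
  refine Prod.ext ?_ ?_
  · simp
  · funext i
    simp

lemma integrable_tsum_of_summable {α ι : Type*} [MeasurableSpace α] {μ : MeasureTheory.Measure α}
    [Countable ι] {G : ι → α → ℂ} (hint : ∀ i, MeasureTheory.Integrable (G i) μ)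
    (hsum : Summable fun i => ∫ x, ‖G i x‖ ∂μ) {g : α → ℂ} (hg : MeasureTheory.AEStronglyMeasurable g μ)
    (h : ∀ x, HasSum (fun i => G i x) (g x)) : MeasureTheory.Integrable g μ := by
  refine ⟨hg, ?_⟩
  calc ∫⁻ x, ‖g x‖ₑ ∂μ ≤ ∫⁻ x, ∑' i, ‖G i x‖ₑ ∂μ := by
        refine MeasureTheory.lintegral_mono fun x => ?_
        rw [← (h x).tsum_eq]
        exact enorm_tsum_le_tsum_enorm
    _ = ∑' i, ∫⁻ x, ‖G i x‖ₑ ∂μ :=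
        MeasureTheory.lintegral_tsum fun i => (hint i).1.enorm
    _ = ∑' i, ENNReal.ofReal (∫ x, ‖G i x‖ ∂μ) := by
        refine tsum_congr fun i => ?_
        rw [MeasureTheory.ofReal_integral_norm_eq_lintegral_enorm (hint i)]
    _ < ⊤ := hsum.tsum_ofReal_lt_top

/-- The half-open cube agrees up to a null set with the closed one, which the reflection preserves.
-/
lemma integral_unitCube_one_sub (g : (d → ℝ) → E) :
    ∫ s in unitCube d, g (1 - s) = ∫ s in unitCube d, g s := by
  have h1 : unitCube d =ᵐ[MeasureTheory.volume] Set.Icc (0 : d → ℝ) 1 := by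
    rw [unitCube_eq_pi]
    exact MeasureTheory.Measure.univ_pi_Ioc_ae_eq_Icc
  rw [MeasureTheory.setIntegral_congr_set h1, MeasureTheory.setIntegral_congr_set h1]
  have h2 := (MeasureTheory.Measure.measurePreserving_sub_left
    (MeasureTheory.volume : MeasureTheory.Measure (d → ℝ)) 1).setIntegral_preimage_emb
    (measurableEmbedding_subLeft _) g (Set.Icc 0 1)
  rw [← h2]
  congr 1
  congr 1
  ext s
  simp only [Set.mem_preimage, Set.mem_Icc, Pi.le_def, Pi.sub_apply, Pi.one_apply, Pi.zero_apply]
  constructor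
  · rintro ⟨h, h'⟩
    exact ⟨fun i => by linarith [h' i], fun i => by linarith [h i]⟩
  · rintro ⟨h, h'⟩
    exact ⟨fun i => by linarith [h' i], fun i => by linarith [h i]⟩

end ProductTiling

/-! ### Expansions on the imaginary axes and the torus of units. -/

section LogExpansion

variable {F : Type*} [Field F] [NumberField F] [NumberField.IsTotallyReal F]

/-- The expansion of the restriction of a form to the imaginary axes, in logarithmic coordinates. -/
structure IsLogExpansion (κ : (F →+* ℝ) → ℝ) (a : 𝓞 F → ℂ) (φ : ((F →+* ℝ) → ℝ) → ℂ) : Prop where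
  cont : Continuous φ
  hasSum : ∀ v, HasSum (fun ζ : 𝓞 F =>
    a ζ * ((Real.exp (-∑ σ, κ σ * σ (ζ : F) * Real.exp (v σ)) : ℝ) : ℂ)) (φ v)
  vanish : ∀ ζ : 𝓞 F, ζ ≠ 0 → ¬ TotallyPositive (ζ : F) → a ζ = 0
  unit : ∀ (u : (𝓞 F)ˣ) (ζ : 𝓞 F), a ((u : 𝓞 F) ^ 2 * ζ) = a ζ
  bound : ∃ C : ℝ, 0 ≤ C ∧ ∀ ζ : 𝓞 F, ζ ≠ 0 → ‖a ζ‖ ≤ C * (∏ σ : F →+* ℝ, |σ (ζ : F)|) ^ (1 / 2 : ℝ)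

variable (F) in
/-- The scaling factor of the Haar measures under the logarithmic coordinates. -/
def logScale : ℝ := (exists_integral_comp_equiv (logEquiv F)).choose

lemma logScale_pos : 0 < logScale F := (exists_integral_comp_equiv (logEquiv F)).choose_spec.1

lemma integral_comp_logEquiv (g : ((F →+* ℝ) → ℝ) → ℂ) :
    ∫ p, g (logEquiv F p) = logScale F * ∫ v, g v :=
  (exists_integral_comp_equiv (logEquiv F)).choose_spec.2.1 g

lemma integrable_comp_logEquiv {g : ((F →+* ℝ) → ℝ) → ℂ} (hg : MeasureTheory.Integrable g) :
    MeasureTheory.Integrable fun p => g (logEquiv F p) :=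
  (exists_integral_comp_equiv (logEquiv F)).choose_spec.2.2 g hg

/-- The average of a function over the torus of units. -/
def unitAverage (φ : ((F →+* ℝ) → ℝ) → ℂ) (τ : ℝ) : ℂ :=
  ∫ s in unitCube (Fin (NumberField.Units.rank F)), φ (logEquiv F (τ, s))

lemma sum_logEquiv (p : ℝ × (Fin (NumberField.Units.rank F) → ℝ)) : ∑ σ, logEquiv F p σ = p.1 := by
  obtain ⟨τ, s⟩ := p
  have hn : (Module.finrank ℚ F : ℝ) ≠ 0 := Nat.cast_ne_zero.mpr Module.finrank_pos.ne'
  simp only [logEquiv_apply]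
  rw [Finset.sum_add_distrib, sum_logVec, add_zero, Finset.sum_const, Finset.card_univ, card_realEmb,
    nsmul_eq_mul]
  field_simp

/-- `logVec` is built from logarithms of squares of units, so integer shifts of the coordinates
multiply by such squares. -/
lemma logEquiv_add_int (p : ℝ × (Fin (NumberField.Units.rank F) → ℝ))
    (k : Fin (NumberField.Units.rank F) → ℤ) (σ : F →+* ℝ) :
    Real.exp (logEquiv F (p + (0, fun i => (k i : ℝ))) σ) =
      σ ((unitPow k : 𝓞 F) : F) ^ 2 * Real.exp (logEquiv F p σ) := by
  obtain ⟨τ, s⟩ := p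
  have h : 0 < |σ ((unitPow k : 𝓞 F) : F)| := abs_pos.mpr (emb_ne_zero σ (coe_unit_ne_zero _))
  rw [Prod.mk_add_mk, add_zero, logEquiv_apply, logEquiv_apply, map_add, Pi.add_apply, ← log_unitPow,
    ← add_assoc, Real.exp_add, mul_comm]
  congr 1
  rw [two_mul, Real.exp_add, Real.exp_log h, ← sq, sq_abs]

variable {κ : (F →+* ℝ) → ℝ} {a : 𝓞 F → ℂ} {φ : ((F →+* ℝ) → ℝ) → ℂ}

/-- The square of a unit passes from exp(v) to ξ, and the sum of the coordinates does not change. -/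
lemma gammaKernel_unit_shift (s : ℂ) (ξ : 𝓞 F) (p : ℝ × (Fin (NumberField.Units.rank F) → ℝ))
    (k : Fin (NumberField.Units.rank F) → ℤ) :
    gammaKernel s (fun σ => κ σ * σ (((unitPow k : 𝓞 F) ^ 2 * ξ : 𝓞 F) : F)) (logEquiv F p) =
      gammaKernel s (fun σ => κ σ * σ (ξ : F)) (logEquiv F (p + (0, fun i => (k i : ℝ)))) := by
  rw [gammaKernel_eq, gammaKernel_eq, sum_logEquiv, sum_logEquiv, Prod.fst_add, add_zero]
  congr 4
  refine Finset.sum_congr rfl fun σ _ => ?_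
  rw [logEquiv_add_int, intCoe_mul, intCoe_pow, map_mul, map_pow]
  ring

lemma IsLogExpansion.periodic (hφ : IsLogExpansion κ a φ)
    (p : ℝ × (Fin (NumberField.Units.rank F) → ℝ)) (k : Fin (NumberField.Units.rank F) → ℤ) :
    φ (logEquiv F (p + (0, fun i => (k i : ℝ)))) = φ (logEquiv F p) := by
  refine (hφ.hasSum _).unique ?_
  have h := hφ.hasSum (logEquiv F p)
  rw [← (unitPow k ^ 2).mulLeft.hasSum_iff] at h
  convert! h using 1
  funext ζ
  have hco : ((unitPow k ^ 2).mulLeft ζ : 𝓞 F) = (unitPow k : 𝓞 F) ^ 2 * ζ := rfl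
  rw [Function.comp_apply, hco, hφ.unit]
  congr 4
  refine Finset.sum_congr rfl fun σ _ => ?_
  rw [logEquiv_add_int, intCoe_mul, intCoe_pow, map_mul, map_pow]
  ring

lemma IsLogExpansion.hasSum_pos (hφ : IsLogExpansion κ a φ) (v : (F →+* ℝ) → ℝ) :
    HasSum (fun ζ : {ζ : 𝓞 F // TotallyPositive (ζ : F)} =>
      a ζ * ((Real.exp (-∑ σ, κ σ * σ ((ζ : 𝓞 F) : F) * Real.exp (v σ)) : ℝ) : ℂ)) (φ v - a 0) := by
  classical
  have h := hasSum_ite_sub_hasSum (hφ.hasSum v) 0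
  have h0 : a 0 * ((Real.exp (-∑ σ, κ σ * σ ((0 : 𝓞 F) : F) * Real.exp (v σ)) : ℝ) : ℂ) = a 0 := by
    rw [intCoe_zero]
    simp
  rw [h0, ← hasSum_subtype_iff_of_support_subset (s := {ζ : 𝓞 F | TotallyPositive (ζ : F)})] at h
  · convert! h using 1
    funext ζ
    have hζ : (ζ : 𝓞 F) ≠ 0 := by
      have := TotallyPositive.ne_zero' ζ.2
      exact_mod_cast this
    exact (if_neg hζ).symm
  · intro ζ hζ
    rw [Function.mem_support] at hζ
    by_contra hζ'
    apply hζ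
    by_cases h0 : ζ = 0
    · rw [if_pos h0]
    · rw [if_neg h0, hφ.vanish ζ h0 hζ', zero_mul]

variable (hκ : ∀ σ, 0 < κ σ)
include hκ

omit [NumberField.IsTotallyReal F] in
lemma prod_mul_emb_cpow {ξ : 𝓞 F} (hξ : TotallyPositive (ξ : F)) (s : ℂ) :
    ((∏ σ, κ σ * σ (ξ : F) : ℝ) : ℂ) ^ (-s) =
      ((∏ σ, κ σ : ℝ) : ℂ) ^ (-s) * ((∏ σ : F →+* ℝ, σ (ξ : F) : ℝ) : ℂ) ^ (-s) := by
  rw [Finset.prod_mul_distrib, Complex.ofReal_mul, Complex.mul_cpow_ofReal_nonneg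
    (Finset.prod_nonneg fun σ _ => (hκ σ).le) (Finset.prod_nonneg fun σ _ => (hξ σ).le)]

lemma integrable_gammaKernel_logEquiv {s : ℂ} (hs : 0 < s.re) {ξ : 𝓞 F}
    (hξ : TotallyPositive (ξ : F)) :
    MeasureTheory.Integrable fun p => gammaKernel s (fun σ => κ σ * σ (ξ : F)) (logEquiv F p) :=
  integrable_comp_logEquiv (integrable_gammaKernel hs fun σ => mul_pos (hκ σ) (hξ σ))

lemma integral_gammaKernel_logEquiv {s : ℂ} (hs : 0 < s.re) {ξ : 𝓞 F}
    (hξ : TotallyPositive (ξ : F)) :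
    ∫ p, gammaKernel s (fun σ => κ σ * σ (ξ : F)) (logEquiv F p) =
      (logScale F * (((∏ σ, κ σ : ℝ) : ℂ) ^ (-s) * Complex.Gamma s ^ Module.finrank ℚ F)) *
        ((∏ σ : F →+* ℝ, σ (ξ : F) : ℝ) : ℂ) ^ (-s) := by
  rw [integral_comp_logEquiv, integral_gammaKernel hs fun σ => mul_pos (hκ σ) (hξ σ),
    prod_mul_emb_cpow hκ hξ, card_realEmb]
  ring

lemma integral_norm_gammaKernel_logEquiv {s : ℂ} (hs : 0 < s.re) {ξ : 𝓞 F}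
    (hξ : TotallyPositive (ξ : F)) :
    ∫ p, ‖gammaKernel s (fun σ => κ σ * σ (ξ : F)) (logEquiv F p)‖ =
      ‖(logScale F * (((∏ σ, κ σ : ℝ) : ℂ) ^ (-(s.re : ℂ)) *
        Complex.Gamma (s.re : ℂ) ^ Module.finrank ℚ F))‖ * (∏ σ : F →+* ℝ, σ (ξ : F)) ^ (-s.re) := by
  have h := integral_gammaKernel_logEquiv hκ (s := (s.re : ℂ)) (by simpa using hs) hξ
  simp only [← norm_gammaKernel] at h
  have hp : 0 < ∏ σ : F →+* ℝ, σ (ξ : F) := Finset.prod_pos fun σ _ => hξ σ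
  have h2 := congr_arg norm (integral_ofReal.symm.trans h)
  rw [norm_mul, Complex.norm_cpow_eq_rpow_re_of_pos hp] at h2
  refine (Eq.trans ?_ h2).trans (by simp)
  refine (Eq.trans ?_ (Complex.norm_real _).symm)
  refine (Real.norm_of_nonneg ?_).symm
  apply MeasureTheory.integral_nonneg
  exact fun p => norm_nonneg _

end LogExpansion

/-! ### Unfolding the Mellin transform into the L-series. -/

section MellinLSeries

variable {F : Type*} [Field F] [NumberField F] [NumberField.IsTotallyReal F]
variable {κ : (F →+* ℝ) → ℝ} {a : 𝓞 F → ℂ} {φ : ((F →+* ℝ) → ℝ) → ℂ}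

lemma idealGen_unit (hF : NarrowClassNumberOne F)
    (hunit : ∀ (u : (𝓞 F)ˣ) (ζ : 𝓞 F), a ((u : 𝓞 F) ^ 2 * ζ) = a ζ)
    (I : {I : Ideal (𝓞 F) // I ≠ ⊥}) (k : Fin (NumberField.Units.rank F) → ℤ) :
    a (genEquiv hF (I, k)) = a (idealGen hF I) := by
  rw [genEquiv_apply, hunit]

lemma continuous_cast_logEquiv : Continuous fun p => logEquiv F p := (logEquiv F).continuous

lemma lTerm_eq (hF : NarrowClassNumberOne F)
    (hunit : ∀ (u : (𝓞 F)ˣ) (ζ : 𝓞 F), a ((u : 𝓞 F) ^ 2 * ζ) = a ζ) (s : ℂ)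
    (I : {I : Ideal (𝓞 F) // I ≠ ⊥}) :
    lTerm a s I = a (idealGen hF I) * ((∏ σ : F →+* ℝ, σ (idealGen hF I : F) : ℝ) : ℂ) ^ (-s) := by
  rw [lTerm, idealCoeff_eq hF hunit, prod_idealGen, Complex.ofReal_natCast]

lemma summable_lTerm (hF : NarrowClassNumberOne F)
    (hunit : ∀ (u : (𝓞 F)ˣ) (ζ : 𝓞 F), a ((u : 𝓞 F) ^ 2 * ζ) = a ζ) {s : ℂ}
    (h : Summable fun I : {I : Ideal (𝓞 F) // I ≠ ⊥} =>
      ‖a (idealGen hF I)‖ * (Ideal.absNorm (I : Ideal (𝓞 F)) : ℝ) ^ (-s.re)) :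
    Summable (lTerm a s) := by
  refine Summable.of_norm ?_
  convert! h using 1
  funext I
  have hp : 0 < ∏ σ : F →+* ℝ, σ (idealGen hF I : F) := Finset.prod_pos fun σ _ => idealGen_pos hF I σ
  rw [lTerm_eq hF hunit, norm_mul, Complex.norm_cpow_eq_rpow_re_of_pos hp, prod_idealGen]
  simp

variable (hκ : ∀ σ, 0 < κ σ)
include hκ

/-- The integrated terms of the expansion are summable. -/
lemma IsLogExpansion.summable_integral_norm (hF : NarrowClassNumberOne F)
    (hφ : IsLogExpansion κ a φ) {s : ℂ} (hs : 0 < s.re)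
    (h : Summable fun I : {I : Ideal (𝓞 F) // I ≠ ⊥} =>
      ‖a (idealGen hF I)‖ * (Ideal.absNorm (I : Ideal (𝓞 F)) : ℝ) ^ (-s.re)) :
    Summable fun ζ : {ζ : 𝓞 F // TotallyPositive (ζ : F)} =>
      ∫ p in cubeTube (Fin (NumberField.Units.rank F)),
        ‖a ζ * gammaKernel s (fun σ => κ σ * σ ((ζ : 𝓞 F) : F)) (logEquiv F p)‖ := by
  rw [← (genEquiv hF).summable_iff]
  -- For a fixed ideal, the integrals over the tube summed over all unit exponents make up the
  -- integral over the whole space.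
  have hfib : ∀ I : {I : Ideal (𝓞 F) // I ≠ ⊥}, HasSum (fun k => ∫ p in cubeTube (Fin (NumberField.Units.rank F)),
      ‖a (genEquiv hF (I, k)) * gammaKernel s (fun σ => κ σ * σ (((genEquiv hF (I, k) : 𝓞 F)) : F))
        (logEquiv F p)‖) (‖a (idealGen hF I)‖ *
          ∫ p, ‖gammaKernel s (fun σ => κ σ * σ (idealGen hF I : F)) (logEquiv F p)‖) := by
    intro I
    have h1 := (hasSum_integral_cubeTube
      (integrable_gammaKernel_logEquiv hκ hs (idealGen_pos hF I)).norm).mul_left ‖a (idealGen hF I)‖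
    convert! h1 using 1
    funext k
    rw [← MeasureTheory.integral_const_mul]
    refine MeasureTheory.integral_congr_ae (Filter.Eventually.of_forall fun p => ?_)
    simp only
    rw [norm_mul, idealGen_unit hF hφ.unit, genEquiv_apply, gammaKernel_unit_shift]
  have hnn : 0 ≤ (fun ζ : {ζ : 𝓞 F // TotallyPositive (ζ : F)} =>
      ∫ p in cubeTube (Fin (NumberField.Units.rank F)),
        ‖a ζ * gammaKernel s (fun σ => κ σ * σ ((ζ : 𝓞 F) : F)) (logEquiv F p)‖) ∘ genEquiv hF := by
    intro q
    apply MeasureTheory.integral_nonneg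
    exact fun p => norm_nonneg _
  rw [summable_prod_of_nonneg hnn]
  refine ⟨fun I => (hfib I).summable, ?_⟩
  have h2 := h.mul_left ‖(logScale F * (((∏ σ, κ σ : ℝ) : ℂ) ^ (-(s.re : ℂ)) *
        Complex.Gamma (s.re : ℂ) ^ Module.finrank ℚ F))‖
  convert! h2 using 1
  funext I
  rw [show ∑' k, ((fun ζ : {ζ : 𝓞 F // TotallyPositive (ζ : F)} =>
      ∫ p in cubeTube (Fin (NumberField.Units.rank F)),
        ‖a ζ * gammaKernel s (fun σ => κ σ * σ ((ζ : 𝓞 F) : F)) (logEquiv F p)‖) ∘ genEquiv hF) (I, k) = _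
    from (hfib I).tsum_eq, integral_norm_gammaKernel_logEquiv hκ hs (idealGen_pos hF I), prod_idealGen]
  ring

/-- The Mellin transform of the average over the torus of units is the Dirichlet series. -/
theorem IsLogExpansion.mellin_eq (hF : NarrowClassNumberOne F)
    (hφ : IsLogExpansion κ a φ) {s : ℂ} (hs : 0 < s.re)
    (h : Summable fun I : {I : Ideal (𝓞 F) // I ≠ ⊥} =>
      ‖a (idealGen hF I)‖ * (Ideal.absNorm (I : Ideal (𝓞 F)) : ℝ) ^ (-s.re)) :
    mellin (fun t => unitAverage φ (Real.log t) - a 0) s =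
      (logScale F * (((∏ σ, κ σ : ℝ) : ℂ) ^ (-s) * Complex.Gamma s ^ Module.finrank ℚ F)) *
        ∑' I, lTerm a s I := by
  set T := cubeTube (Fin (NumberField.Units.rank F)) with hT
  set G : {ζ : 𝓞 F // TotallyPositive (ζ : F)} → (ℝ × (Fin (NumberField.Units.rank F) → ℝ)) → ℂ :=
    fun ζ p => a ζ * gammaKernel s (fun σ => κ σ * σ ((ζ : 𝓞 F) : F)) (logEquiv F p) with hG
  have hint : ∀ ζ, MeasureTheory.Integrable (G ζ) (MeasureTheory.volume.restrict T) := fun ζ =>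
    ((integrable_gammaKernel_logEquiv hκ hs ζ.2).const_mul _).integrableOn
  have hsum := hφ.summable_integral_norm hκ hF hs h
  have hpt : ∀ p, HasSum (fun ζ => G ζ p)
      (Complex.exp (s * p.1) * (φ (logEquiv F p) - a 0)) := by
    intro p
    have h1 := (hφ.hasSum_pos (logEquiv F p)).mul_left (Complex.exp (s * p.1))
    convert! h1 using 1
    funext ζ
    simp only [hG]
    rw [gammaKernel_eq, sum_logEquiv]
    ring
  have hcont : Continuous fun p : ℝ × (Fin (NumberField.Units.rank F) → ℝ) =>
      Complex.exp (s * p.1) * (φ (logEquiv F p) - a 0) := by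
    have := hφ.cont.comp (continuous_cast_logEquiv (F := F))
    exact (Continuous.cexp (by fun_prop)).mul (this.sub continuous_const)
  have hcount : Countable {ζ : 𝓞 F // TotallyPositive (ζ : F)} := by
    have : Countable (𝓞 F) := (intCoord F).injective.countable
    infer_instance
  have hI := integrable_tsum_of_summable hint hsum hcont.aestronglyMeasurable.restrict hpt
  have hmain := MeasureTheory.hasSum_integral_of_summable_integral_norm hint hsum
  simp only [(hpt _).tsum_eq] at hmain
  rw [← (genEquiv hF).hasSum_iff] at hmain
  have hL := (summable_lTerm hF hφ.unit h).hasSum.mul_left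
    (logScale F * (((∏ σ, κ σ : ℝ) : ℂ) ^ (-s) * Complex.Gamma s ^ Module.finrank ℚ F))
  have hfib : ∀ I : {I : Ideal (𝓞 F) // I ≠ ⊥}, HasSum (fun k =>
      ((fun ζ => ∫ p in T, G ζ p) ∘ genEquiv hF) (I, k))
      ((logScale F * (((∏ σ, κ σ : ℝ) : ℂ) ^ (-s) * Complex.Gamma s ^ Module.finrank ℚ F)) *
        lTerm a s I) := by
    intro I
    have h1 := (hasSum_integral_cubeTube
      (integrable_gammaKernel_logEquiv hκ hs (idealGen_pos hF I))).mul_left (a (idealGen hF I))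
    rw [integral_gammaKernel_logEquiv hκ hs (idealGen_pos hF I)] at h1
    convert! h1 using 1
    · funext k
      rw [← MeasureTheory.integral_const_mul]
      refine MeasureTheory.integral_congr_ae (Filter.Eventually.of_forall fun p => ?_)
      simp only [hG]
      rw [idealGen_unit hF hφ.unit, genEquiv_apply, gammaKernel_unit_shift]
    · rw [lTerm_eq hF hφ.unit]
      ring
  -- The sum over totally positive integers is taken first over units, then over ideals. Fubini then
  -- separates τ from the unit coordinates and recognizes the Mellin transform of the average.
  have heq := (hmain.prod_fiberwise hfib).unique hL
  rw [← heq, mellin_eq_integral_exp]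
  have hTprod : T = Set.univ ×ˢ unitCube (Fin (NumberField.Units.rank F)) := by
    ext p
    simp [hT, cubeTube]
  have hFub := MeasureTheory.setIntegral_prod
    (μ := (MeasureTheory.volume : MeasureTheory.Measure ℝ))
    (ν := (MeasureTheory.volume : MeasureTheory.Measure (Fin (NumberField.Units.rank F) → ℝ)))
    (s := Set.univ) (t := unitCube (Fin (NumberField.Units.rank F)))
    (fun p => Complex.exp (s * p.1) * (φ (logEquiv F p) - a 0)) (by
      rw [← hTprod]
      exact hI)
  rw [hTprod]
  refine Eq.trans ?_ hFub.symm
  rw [MeasureTheory.setIntegral_univ]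
  refine MeasureTheory.integral_congr_ae (Filter.Eventually.of_forall fun τ => ?_)
  simp only
  rw [MeasureTheory.integral_const_mul, Real.log_exp]
  congr 1
  have h3 : Continuous fun s => φ (logEquiv F (τ, s)) :=
    hφ.cont.comp (continuous_cast_logEquiv.comp (by fun_prop))
  rw [MeasureTheory.integral_sub (integrableOn_unitCube h3.continuousOn)
    (integrableOn_unitCube continuousOn_const), unitAverage]
  congr 1
  rw [MeasureTheory.setIntegral_const, MeasureTheory.Measure.real, volume_unitCube]
  simp

end MellinLSeries

/-! ### The averages form a pair with functional equation. -/

section FunctionalEquation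

variable {F : Type*} [Field F] [NumberField F] [NumberField.IsTotallyReal F]
variable {κ : (F →+* ℝ) → ℝ} {a b : 𝓞 F → ℂ} {φ γ : ((F →+* ℝ) → ℝ) → ℂ}

lemma IsLogExpansion.continuous_logEquiv (hφ : IsLogExpansion κ a φ) (τ : ℝ) :
    Continuous fun s => φ (logEquiv F (τ, s)) :=
  hφ.cont.comp (continuous_cast_logEquiv.comp (by fun_prop))

lemma IsLogExpansion.continuous_unitAverage (hφ : IsLogExpansion κ a φ) :
    Continuous (unitAverage φ) := by
  have h1 : unitCube (Fin (NumberField.Units.rank F)) =ᵐ[MeasureTheory.volume]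
      Set.Icc (0 : Fin (NumberField.Units.rank F) → ℝ) 1 := by
    rw [unitCube_eq_pi]
    exact MeasureTheory.Measure.univ_pi_Ioc_ae_eq_Icc
  have h2 : unitAverage φ = fun τ => ∫ s in Set.Icc (0 : Fin (NumberField.Units.rank F) → ℝ) 1,
      φ (logEquiv F (τ, s)) := funext fun τ => MeasureTheory.setIntegral_congr_set h1
  rw [h2]
  exact continuous_parametric_integral_of_continuous
    (f := fun τ s => φ (logEquiv F (τ, s))) (hφ.cont.comp (continuous_cast_logEquiv (F := F)))
    isCompact_Icc

/-- v ↦ -v is (τ, s) ↦ (-τ, -s). The cube is preserved, up to a null set, by s ↦ 1 - s instead; the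
two differ by an integer shift, harmless by periodicity. -/
lemma unitAverage_neg (hγ : IsLogExpansion κ b γ)
    (h : ∀ v, φ (-v) = Real.exp ((∑ σ, v σ) / 2) * γ v) (τ : ℝ) :
    unitAverage φ (-τ) = Real.exp (τ / 2) * unitAverage γ τ := by
  rw [unitAverage, ← integral_unitCube_one_sub, unitAverage, ← MeasureTheory.integral_const_mul]
  refine MeasureTheory.integral_congr_ae (Filter.Eventually.of_forall fun s => ?_)
  simp only
  have h1 : logEquiv F (-τ, 1 - s) =
      -logEquiv F ((τ, s) + (0, fun i => (((-1 : Fin (NumberField.Units.rank F) → ℤ) i : ℤ) : ℝ))) := by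
    rw [← map_neg]
    congr 1
    refine Prod.ext ?_ ?_
    · simp
    · funext i
      simp
      ring
  rw [h1, h, sum_logEquiv, hγ.periodic, Prod.fst_add, add_zero]

/-- Otherwise all conjugates would be less than 1, and so would the norm, a positive integer. -/
lemma one_le_sum_emb {ζ : 𝓞 F} (hζ : TotallyPositive (ζ : F)) : 1 ≤ ∑ σ : F →+* ℝ, σ (ζ : F) := by
  by_contra! hlt
  have hζ0 : ζ ≠ 0 := by
    have := hζ.ne_zero'
    exact_mod_cast this
  have h1 := one_le_abs_prod hζ0
  obtain ⟨σ₀⟩ := nonempty_realEmb (F := F)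
  have hle : ∀ σ : F →+* ℝ, σ (ζ : F) < 1 := fun σ =>
    (Finset.single_le_sum (f := fun σ : F →+* ℝ => σ (ζ : F)) (fun τ _ => (hζ τ).le)
      (Finset.mem_univ σ)).trans_lt hlt
  rw [Finset.prod_congr rfl fun σ _ => abs_of_pos (hζ σ)] at h1
  have h2 : ∏ σ : F →+* ℝ, σ (ζ : F) < ∏ _σ : F →+* ℝ, (1 : ℝ) :=
    Finset.prod_lt_prod (fun σ _ => hζ σ) (fun σ _ => (hle σ).le) ⟨σ₀, Finset.mem_univ _, hle σ₀⟩
  rw [Finset.prod_const_one] at h2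
  linarith

/-- With T = exp(τ/n), the exponent of ζ is at least cT·tr(ζ) on the whole cube. As T ≥ 2 and tr(ζ)
≥ 1, T·tr(ζ) ≥ T/2 + tr(ζ); the first part is the decay, and the second leaves a convergent series
independent of τ. -/
lemma IsLogExpansion.exists_decay (hκ : ∀ σ, 0 < κ σ) (hφ : IsLogExpansion κ a φ) :
    ∃ c M : ℝ, 0 < c ∧ ∀ τ : ℝ, 2 ≤ Real.exp (τ / Module.finrank ℚ F) →
      ‖unitAverage φ τ - a 0‖ ≤ M * Real.exp (-(c * Real.exp (τ / Module.finrank ℚ F))) := by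
  let L : (Fin (NumberField.Units.rank F) → ℝ) →L[ℝ] ((F →+* ℝ) → ℝ) :=
    (logVec F).toContinuousLinearMap
  have hL0 : 0 ≤ ‖L‖ := L.opNorm_nonneg
  obtain ⟨c₀, hc₀, hc₀le⟩ : ∃ c₀ : ℝ, 0 < c₀ ∧ ∀ σ, c₀ ≤ κ σ := by
    obtain ⟨σ₀, hσ₀⟩ := Finite.exists_min κ
    exact ⟨κ σ₀, hκ σ₀, hσ₀⟩
  set c : ℝ := c₀ * Real.exp (-‖L‖) with hc
  have hcpos : 0 < c := by positivity
  -- The point at which the exponent of every ζ is exactly c·tr(ζ); convergence of the remaining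
  -- series is read off from the expansion there.
  set v₀ : (F →+* ℝ) → ℝ := fun σ => Real.log (c / κ σ) with hv₀
  have hsum := (hφ.hasSum_pos v₀).summable.norm
  have hv₀' : ∀ ζ : 𝓞 F, ∑ σ, κ σ * σ (ζ : F) * Real.exp (v₀ σ) = c * ∑ σ : F →+* ℝ, σ (ζ : F) := by
    intro ζ
    rw [Finset.mul_sum]
    refine Finset.sum_congr rfl fun σ _ => ?_
    have := hκ σ
    simp only [hv₀]
    rw [Real.exp_log (by positivity)]
    field_simp
  simp only [hv₀', norm_mul, Complex.norm_real, Real.norm_of_nonneg (Real.exp_pos _).le] at hsum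
  set M := ∑' ζ : {ζ : 𝓞 F // TotallyPositive (ζ : F)},
    ‖a ζ‖ * Real.exp (-(c * ∑ σ : F →+* ℝ, σ ((ζ : 𝓞 F) : F))) with hM
  refine ⟨c / 2, M, by positivity, fun τ hτ => ?_⟩
  set T := Real.exp (τ / Module.finrank ℚ F) with hT
  have hsub : unitAverage φ τ - a 0 =
      ∫ s in unitCube (Fin (NumberField.Units.rank F)), (φ (logEquiv F (τ, s)) - a 0) := by
    rw [MeasureTheory.integral_sub (integrableOn_unitCube (hφ.continuous_logEquiv τ).continuousOn)
      (integrableOn_unitCube continuousOn_const), unitAverage]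
    congr 1
    rw [MeasureTheory.setIntegral_const, MeasureTheory.Measure.real, volume_unitCube]
    simp
  rw [hsub]
  refine norm_setIntegral_unitCube_le fun s hs => ?_
  have hs1 : ‖s‖ ≤ 1 := by
    refine (pi_norm_le_iff_of_nonneg zero_le_one).mpr fun i => ?_
    have := unitCube_subset hs
    rw [Real.norm_eq_abs, abs_of_nonneg (this.1 i)]
    exact this.2 i
  have hlow : ∀ σ, c * T ≤ κ σ * Real.exp (logEquiv F (τ, s) σ) := by
    intro σ
    have h1 : |logVec F s σ| ≤ ‖L‖ := by
      calc |logVec F s σ| = ‖L s σ‖ := rfl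
        _ ≤ ‖L s‖ := norm_le_pi_norm _ σ
        _ ≤ ‖L‖ * ‖s‖ := L.le_opNorm s
        _ ≤ ‖L‖ := mul_le_of_le_one_right hL0 hs1
    rw [logEquiv_apply, Real.exp_add, ← hT, hc]
    have h2 : Real.exp (-‖L‖) ≤ Real.exp (logVec F s σ) := Real.exp_le_exp.mpr (abs_le.mp h1).1
    have h3 := mul_le_mul (hc₀le σ) h2 (Real.exp_pos _).le (hκ σ).le
    have h4 : 0 < T := Real.exp_pos _
    nlinarith
  have hbd : ∀ ζ : {ζ : 𝓞 F // TotallyPositive (ζ : F)},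
      ‖a ζ * ((Real.exp (-∑ σ, κ σ * σ ((ζ : 𝓞 F) : F) * Real.exp (logEquiv F (τ, s) σ)) : ℝ) : ℂ)‖ ≤
        Real.exp (-(c / 2 * T)) * (‖a ζ‖ * Real.exp (-(c * ∑ σ : F →+* ℝ, σ ((ζ : 𝓞 F) : F)))) := by
    intro ζ
    have hx := one_le_sum_emb ζ.2
    rw [norm_mul, Complex.norm_real, Real.norm_of_nonneg (Real.exp_pos _).le, mul_left_comm,
      ← Real.exp_add]
    refine mul_le_mul_of_nonneg_left (Real.exp_le_exp.mpr ?_) (norm_nonneg _)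
    have h1 : c * T * ∑ σ : F →+* ℝ, σ ((ζ : 𝓞 F) : F) ≤
        ∑ σ, κ σ * σ ((ζ : 𝓞 F) : F) * Real.exp (logEquiv F (τ, s) σ) := by
      rw [Finset.mul_sum]
      refine Finset.sum_le_sum fun σ _ => ?_
      have := mul_le_mul_of_nonneg_right (hlow σ) (ζ.2 σ).le
      linarith
    set x := ∑ σ : F →+* ℝ, σ ((ζ : 𝓞 F) : F)
    have h2 : T / 2 + x ≤ T * x := by nlinarith
    nlinarith
  have h := tsum_of_norm_bounded (hsum.hasSum.mul_left (Real.exp (-(c / 2 * T)))) hbd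
  rw [(hφ.hasSum_pos _).tsum_eq, mul_comm] at h
  exact h

lemma IsLogExpansion.isBigO (hκ : ∀ σ, 0 < κ σ) (hφ : IsLogExpansion κ a φ) (r : ℝ) :
    (fun t : ℝ => unitAverage φ (Real.log t) - a 0) =O[Filter.atTop] fun t => t ^ r := by
  obtain ⟨c, M, hc, hM⟩ := hφ.exists_decay hκ
  have hn : (0 : ℝ) < Module.finrank ℚ F := Nat.cast_pos.mpr Module.finrank_pos
  -- exp(τ/n) is t^{1/n}, so a power of it of order at least -rn is needed to reach t^r.
  obtain ⟨N, hN⟩ := exists_nat_ge (-r * Module.finrank ℚ F)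
  refine Asymptotics.IsBigO.of_bound (|M| * (N.factorial / c ^ N)) ?_
  filter_upwards [Filter.eventually_ge_atTop (Real.exp (Real.log 2 * Module.finrank ℚ F))] with t ht
  have ht0 : 0 < t := (Real.exp_pos _).trans_le ht
  have hlog := (Real.le_log_iff_exp_le ht0).mpr ht
  have hT : 2 ≤ Real.exp (Real.log t / Module.finrank ℚ F) := by
    rw [← Real.log_le_iff_le_exp two_pos, le_div_iff₀ hn]
    exact hlog
  have hlog0 : 0 ≤ Real.log t := le_trans (by have := Real.log_nonneg one_le_two; positivity) hlog
  rw [Real.norm_of_nonneg (by positivity), mul_assoc]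
  refine (hM _ hT).trans ((mul_le_mul_of_nonneg_right (le_abs_self M) (Real.exp_pos _).le).trans ?_)
  refine mul_le_mul_of_nonneg_left ((exp_neg_le_inv_pow hc (Real.exp_pos _) N).trans ?_) (abs_nonneg _)
  refine mul_le_mul_of_nonneg_left ?_ (by positivity)
  rw [← Real.exp_neg, ← Real.exp_nat_mul, Real.rpow_def_of_pos ht0]
  refine Real.exp_le_exp.mpr ?_
  rw [mul_neg, neg_le_iff_add_nonneg, ← mul_div_assoc, add_comm]
  have : N * Real.log t / Module.finrank ℚ F + Real.log t * r =
      Real.log t * ((N + r * Module.finrank ℚ F) / Module.finrank ℚ F) := by field_simp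
  rw [this]
  refine mul_nonneg hlog0 (div_nonneg ?_ hn.le)
  linarith

/-- The pair of averages, with its functional equation. -/
def averagePair (hκ : ∀ σ, 0 < κ σ) (hφ : IsLogExpansion κ a φ) (hγ : IsLogExpansion κ b γ)
    (h : ∀ v, φ (-v) = Real.exp ((∑ σ, v σ) / 2) * γ v) : WeakFEPair ℂ where
  f t := unitAverage φ (Real.log t)
  g t := unitAverage γ (Real.log t)
  k := 1 / 2
  ε := 1
  f₀ := a 0
  g₀ := b 0
  hf_int := ContinuousOn.locallyIntegrableOn (hφ.continuous_unitAverage.comp_continuousOn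
    (Real.continuousOn_log.mono fun t ht => ne_of_gt ht)) measurableSet_Ioi
  hg_int := ContinuousOn.locallyIntegrableOn (hγ.continuous_unitAverage.comp_continuousOn
    (Real.continuousOn_log.mono fun t ht => ne_of_gt ht)) measurableSet_Ioi
  hk := by norm_num
  hε := one_ne_zero
  h_feq t ht := by
    have ht' : 0 < t := ht
    rw [one_div, Real.log_inv, unitAverage_neg hγ h, one_mul, smul_eq_mul,
      Real.rpow_def_of_pos ht']
    congr 3
    ring
  hf_top r := hφ.isBigO hκ r
  hg_top r := hγ.isBigO hκ r

end FunctionalEquation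

/-! ### Dividing the completed function by its gamma factors. -/

section Continuation

/-- The continuation of the Dirichlet series attached to a pair of functions with a functional
equation under `s ↦ 1/2 - s`. -/
def lFunction (P : WeakFEPair ℂ) (K X : ℝ) (n : ℕ) (s : ℂ) : ℂ :=
  (K : ℂ)⁻¹ * (X : ℂ) ^ s * ((Complex.Gamma s)⁻¹ ^ n * (P.Λ₀ s - P.g₀ / (1 / 2 - s)) -
    (Complex.Gamma s)⁻¹ ^ (n - 1) * (Complex.Gamma (s + 1))⁻¹ * P.f₀)

variable {P : WeakFEPair ℂ} {K X : ℝ} {n : ℕ}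

/-- The numerator of the continuation. -/
def lNumerator (P : WeakFEPair ℂ) (K X : ℝ) (n : ℕ) (s : ℂ) : ℂ :=
  (K : ℂ)⁻¹ * (X : ℂ) ^ s * ((Complex.Gamma s)⁻¹ ^ n * ((s - 1 / 2) * P.Λ₀ s + P.g₀) -
    (s - 1 / 2) * ((Complex.Gamma s)⁻¹ ^ (n - 1) * (Complex.Gamma (s + 1))⁻¹ * P.f₀))

lemma differentiable_one_div_Gamma_add_one : Differentiable ℂ fun s : ℂ => (Complex.Gamma (s + 1))⁻¹ :=
  Complex.differentiable_one_div_Gamma.comp (differentiable_id.add_const 1)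

lemma differentiable_cpow_const (hX : 0 < X) : Differentiable ℂ fun s : ℂ => (X : ℂ) ^ s :=
  fun s => (differentiableAt_id).const_cpow (Or.inl (by exact_mod_cast hX.ne'))

lemma differentiable_lNumerator (hX : 0 < X) : Differentiable ℂ (lNumerator P K X n) := by
  have h1 := Complex.differentiable_one_div_Gamma
  have h2 := differentiable_one_div_Gamma_add_one
  have h3 := differentiable_cpow_const hX
  have h4 := P.differentiable_Λ₀
  unfold lNumerator
  exact (h3.const_mul _).mul (((h1.pow n).mul (((differentiable_id.sub_const _).mul h4).add_const _)).sub
    ((differentiable_id.sub_const _).mul (((h1.pow (n - 1)).mul h2).mul_const _)))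

lemma lFunction_eq_div {s : ℂ} (hs : s ≠ 1 / 2) :
    lFunction P K X n s = (s - 1 / 2)⁻¹ * lNumerator P K X n s := by
  have h1 : s - 1 / 2 ≠ 0 := sub_ne_zero.mpr hs
  have h2 : (1 / 2 : ℂ) - s = -(s - 1 / 2) := by ring
  rw [lFunction, lNumerator, h2, div_neg, sub_neg_eq_add]
  generalize s - 1 / 2 = w at *
  field_simp

/-- 1/Γ is entire, and sΓ(s) = Γ(s + 1) turns f₀/(sΓ(s)ⁿ) into f₀/(Γ(s)ⁿ⁻¹Γ(s + 1)), so the pole at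
s = 0 disappears. Only the term with g₀ could be singular. -/
lemma differentiable_lFunction (hX : 0 < X) (h0 : P.g₀ = 0) :
    Differentiable ℂ (lFunction P K X n) := by
  have h1 := Complex.differentiable_one_div_Gamma
  have h2 := differentiable_one_div_Gamma_add_one
  have h3 := differentiable_cpow_const hX
  have h4 := P.differentiable_Λ₀
  unfold lFunction
  simp only [h0, zero_div, sub_zero]
  exact (h3.const_mul _).mul (((h1.pow n).mul h4).sub (((h1.pow (n - 1)).mul h2).mul_const _))

lemma differentiableOn_lFunction (hX : 0 < X) :
    DifferentiableOn ℂ (lFunction P K X n) {(1 / 2 : ℂ)}ᶜ := by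
  have h : DifferentiableOn ℂ (fun s => (s - 1 / 2)⁻¹ * lNumerator P K X n s) {(1 / 2 : ℂ)}ᶜ := by
    intro s hs
    have h1 : s - 1 / 2 ≠ 0 := sub_ne_zero.mpr hs
    have h2 : DifferentiableAt ℂ (fun s : ℂ => (s - 1 / 2)⁻¹) s :=
      (differentiableAt_id.sub_const _).fun_inv h1
    exact (h2.mul (differentiable_lNumerator hX s)).differentiableWithinAt
  exact h.congr fun s hs => lFunction_eq_div hs

lemma lFunction_eventuallyEq : lFunction P K X n =ᶠ[nhdsWithin (1 / 2) {(1 / 2 : ℂ)}ᶜ]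
    fun s => (s - 1 / 2) ^ (-1 : ℤ) • lNumerator P K X n s := by
  filter_upwards [self_mem_nhdsWithin] with s hs
  rw [lFunction_eq_div hs, zpow_neg_one, smul_eq_mul]

lemma analyticAt_lNumerator (hX : 0 < X) : AnalyticAt ℂ (lNumerator P K X n) (1 / 2) :=
  (differentiable_lNumerator hX).analyticAt _

lemma meromorphicAt_lFunction (hX : 0 < X) : MeromorphicAt (lFunction P K X n) (1 / 2) :=
  MeromorphicAt.congr (f := fun s => (s - 1 / 2) ^ (-1 : ℤ) • lNumerator P K X n s)
    ((((MeromorphicAt.id _).sub (MeromorphicAt.const _ _)).zpow _).smul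
      (analyticAt_lNumerator hX).meromorphicAt) lFunction_eventuallyEq.symm

/-- At s = 1/2 only a nonzero multiple of g₀/Γ(1/2)ⁿ survives. -/
lemma lNumerator_ne_zero (hX : 0 < X) (hK : K ≠ 0) (h0 : P.g₀ ≠ 0) :
    lNumerator P K X n (1 / 2) ≠ 0 := by
  rw [lNumerator, sub_self, zero_mul, zero_mul, zero_add, sub_zero]
  have h1 : Complex.Gamma (1 / 2) ≠ 0 := Complex.Gamma_ne_zero_of_re_pos (by norm_num)
  have h2 : (K : ℂ) ≠ 0 := by exact_mod_cast hK
  have h3 : (X : ℂ) ≠ 0 := by exact_mod_cast hX.ne'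
  exact mul_ne_zero (mul_ne_zero (inv_ne_zero h2) ((Complex.cpow_ne_zero_iff_of_exponent_ne_zero
    (by norm_num)).mpr h3)) (mul_ne_zero (pow_ne_zero _ (inv_ne_zero h1)) h0)

lemma order_lFunction (hX : 0 < X) (hK : K ≠ 0) (h0 : P.g₀ ≠ 0) :
    meromorphicOrderAt (lFunction P K X n) (1 / 2) = -1 := by
  have h := (meromorphicOrderAt_eq_int_iff (meromorphicAt_lFunction (P := P) (K := K) (n := n) hX)
    (n := -1)).mpr ⟨lNumerator P K X n, analyticAt_lNumerator hX, lNumerator_ne_zero hX hK h0,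
      lFunction_eventuallyEq⟩
  exact h

lemma neg_one_le_order_lFunction (hX : 0 < X) (hK : K ≠ 0) :
    -1 ≤ meromorphicOrderAt (lFunction P K X n) (1 / 2) := by
  by_cases h0 : P.g₀ = 0
  · have h1 : AnalyticAt ℂ (lFunction P K X n) (1 / 2) :=
      (differentiable_lFunction hX h0).analyticAt _
    refine le_trans ?_ h1.meromorphicOrderAt_nonneg
    exact WithTop.coe_le_coe.mpr (by norm_num : (-1 : ℤ) ≤ 0)
  · exact (order_lFunction hX hK h0).ge

/-- The completed function. -/
lemma Gamma_mul_lFunction (hX : 0 < X) (hn : 0 < n) (hk : P.k = 1 / 2) (hε : P.ε = 1) {s : ℂ}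
    (hs : ∀ m : ℕ, s ≠ -(m : ℂ)) :
    (X : ℂ) ^ (-s) * Complex.Gamma s ^ n * lFunction P K X n s = (K : ℂ)⁻¹ * P.Λ s := by
  have hΓ := Complex.Gamma_ne_zero hs
  have hs0 : s ≠ 0 := by simpa using hs 0
  have hXs : (X : ℂ) ^ s ≠ 0 := by
    rw [Complex.cpow_def_of_ne_zero (by exact_mod_cast hX.ne')]
    exact Complex.exp_ne_zero _
  obtain ⟨j, rfl⟩ : ∃ j, n = j + 1 := ⟨n - 1, by omega⟩
  rw [lFunction, WeakFEPair.Λ, hk, hε, Complex.Gamma_add_one s hs0, Complex.cpow_neg, smul_eq_mul,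
    smul_eq_mul, Nat.add_sub_cancel]
  push_cast
  rw [inv_pow, inv_pow]
  have h1 : 1 / (1 / 2 - s) * P.g₀ = P.g₀ / (1 / 2 - s) := by ring
  rw [h1]
  generalize P.g₀ / (1 / 2 - s) = w at *
  field_simp
  ring

/-- For Re s > 1/2 the completed function of the pair is the Mellin transform of f - f₀, and the
gamma factor can be cancelled because it is nonzero. -/
lemma lFunction_eq_of_mellin (hX : 0 < X) (hK : K ≠ 0) (hn : 0 < n) (hk : P.k = 1 / 2)
    (hε : P.ε = 1) {s Z : ℂ} (hs : 1 / 2 < s.re)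
    (h : mellin (fun t => P.f t - P.f₀) s = (K * ((X : ℂ) ^ (-s) * Complex.Gamma s ^ n)) * Z) :
    lFunction P K X n s = Z := by
  have hs' : ∀ m : ℕ, s ≠ -(m : ℂ) := by
    intro m hm
    rw [hm] at hs
    simp at hs
    have : (0 : ℝ) ≤ m := Nat.cast_nonneg m
    linarith
  have h1 := Gamma_mul_lFunction (K := K) hX hn hk hε hs'
  rw [← (P.hasMellin (s := s) (by rw [hk]; exact hs)).2, h] at h1
  have hΓ := Complex.Gamma_ne_zero hs'
  have hXs : (X : ℂ) ^ (-s) ≠ 0 := by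
    rw [Complex.cpow_def_of_ne_zero (by exact_mod_cast hX.ne')]
    exact Complex.exp_ne_zero _
  have hK' : (K : ℂ) ≠ 0 := by exact_mod_cast hK
  have h2 : (X : ℂ) ^ (-s) * Complex.Gamma s ^ n ≠ 0 := mul_ne_zero hXs (pow_ne_zero _ hΓ)
  refine mul_left_cancel₀ h2 (h1.trans ?_)
  field_simp

end Continuation

/-! ### The continuation of the L-series. -/

section LContinuation

variable {F : Type*} [Field F] [NumberField F] [NumberField.IsTotallyReal F]
variable {κ : (F →+* ℝ) → ℝ} {a b : 𝓞 F → ℂ} {φ : ((F →+* ℝ) → ℝ) → ℂ}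

lemma IsLogExpansion.isLContinuation (hκ : ∀ σ, 0 < κ σ) (hF : NarrowClassNumberOne F)
    (hφ : IsLogExpansion κ a φ) {P : WeakFEPair ℂ} (hk : P.k = 1 / 2) (hε : P.ε = 1)
    (hf : P.f = fun t => unitAverage φ (Real.log t)) (hf₀ : P.f₀ = a 0) :
    IsLContinuation a (lFunction P (logScale F) (∏ σ, κ σ) (Module.finrank ℚ F)) := by
  have hX : 0 < ∏ σ, κ σ := Finset.prod_pos fun σ _ => hκ σ
  have hK : logScale F ≠ 0 := logScale_pos.ne'
  refine ⟨?_, differentiableOn_lFunction hX, meromorphicAt_lFunction hX,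
    neg_one_le_order_lFunction hX hK⟩
  obtain ⟨x₀, hx₀⟩ := exists_summable_coeff hF hφ.bound
  refine ⟨max x₀ (1 / 2), fun s hs => ?_⟩
  have h1 : x₀ < s.re := (le_max_left _ _).trans_lt hs
  have h2 : 1 / 2 < s.re := (le_max_right _ _).trans_lt hs
  have hsum := hx₀ s.re h1
  have hm := hφ.mellin_eq hκ hF (by linarith) hsum
  rw [lFunction_eq_of_mellin hX hK Module.finrank_pos hk hε h2 (by rw [hf, hf₀]; exact hm)]
  exact (summable_lTerm hF hφ.unit hsum).hasSum

end LContinuation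

/-! ### Restriction to the imaginary axes, and the constants of the completed series. -/

section ImaginaryAxes

variable {F : Type*} [Field F]

/-- The point `i exp(v) / |m|` of the imaginary axes. -/
def axisPoint (m : F) (v : (F →+* ℝ) → ℝ) : (F →+* ℝ) → ℂ :=
  fun σ => Complex.I * ((Real.exp (v σ) / |σ m| : ℝ) : ℂ)

lemma axisPoint_mem {m : F} (hm : m ≠ 0) (v : (F →+* ℝ) → ℝ) : axisPoint m v ∈ upperHalf F := by
  intro σ
  have := abs_pos.mpr (emb_ne_zero σ hm)
  simp only [axisPoint, Complex.mul_im, Complex.I_re, Complex.I_im, Complex.ofReal_re, Complex.ofReal_im]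
  simp only [zero_mul, one_mul, zero_add]
  positivity

lemma continuous_axisPoint (m : F) : Continuous (axisPoint m) := by
  unfold axisPoint
  fun_prop

/-- The points i/|σ(m)| are fixed by the involution; the logarithmic coordinate is measured from
them. -/
lemma moebius_invSL_axisPoint {m : F} (hm : m ≠ 0) (v : (F →+* ℝ) → ℝ) :
    moebius (invSL m hm) (axisPoint m v) = axisPoint m (-v) := by
  rw [moebius_invSL]
  funext σ
  have h1 : |σ m| ≠ 0 := (abs_pos.mpr (emb_ne_zero σ hm)).ne'
  have h2 : Real.exp (v σ) ≠ 0 := (Real.exp_pos _).ne'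
  have h3 : (σ m : ℂ) ^ 2 = ((|σ m| : ℝ) : ℂ) ^ 2 := by
    rw [← Complex.ofReal_pow, ← Complex.ofReal_pow, sq_abs]
  have h1' : ((|σ m| : ℝ) : ℂ) ≠ 0 := by exact_mod_cast h1
  have h2' : ((Real.exp (v σ) : ℝ) : ℂ) ≠ 0 := by exact_mod_cast h2
  simp only [axisPoint, Pi.neg_apply, Real.exp_neg]
  rw [h3]
  push_cast
  rw [← Complex.ofReal_exp]
  have hI := Complex.I_mul_I
  field_simp
  rw [Complex.I_sq]

variable [NumberField F]

/-- The norm constant of W(c) is |N(m)|^{-1/2}, and it cancels the |m| in the axis coordinates,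
leaving a pure exponential. -/
lemma rootFactor_axisPoint {m : F} (hm : m ≠ 0) (v : (F →+* ℝ) → ℝ) :
    rootFactor (axisPoint m v) * (((∏ σ : F →+* ℝ, |σ m|) ^ (-(1 / 2) : ℝ) : ℝ) : ℂ) =
      ((Real.exp (-(∑ σ, v σ) / 2) : ℝ) : ℂ) := by
  have hpos : ∀ σ : F →+* ℝ, 0 < |σ m| := fun σ => abs_pos.mpr (emb_ne_zero σ hm)
  have h1 : rootFactor (axisPoint m v) =
      (((∏ σ : F →+* ℝ, Real.exp (v σ) / |σ m|) ^ (-(1 / 2) : ℝ) : ℝ) : ℂ) := by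
    rw [rootFactor, ← Real.finsetProd_rpow _ _ fun σ _ => (div_pos (Real.exp_pos _) (hpos σ)).le,
      Complex.ofReal_prod]
    refine Finset.prod_congr rfl fun σ _ => ?_
    rw [Complex.ofReal_cpow (div_pos (Real.exp_pos _) (hpos σ)).le]
    congr 1
    · rw [axisPoint, ← mul_assoc, neg_mul, Complex.I_mul_I, neg_neg, one_mul]
    · push_cast
      ring
  have hP : 0 < ∏ σ : F →+* ℝ, |σ m| := Finset.prod_pos fun σ _ => hpos σ
  rw [h1, ← Complex.ofReal_mul, ← Real.mul_rpow (Finset.prod_nonneg fun σ _ =>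
    (div_pos (Real.exp_pos _) (hpos σ)).le) hP.le, Finset.prod_div_distrib, div_mul_cancel₀ _ hP.ne',
    ← Real.exp_sum, ← Real.exp_mul]
  congr 2
  ring

variable [NumberField.IsTotallyReal F]
variable {δ c : 𝓞 F} {𝔠 : Ideal (𝓞 F)} {f : ((F →+* ℝ) → ℂ) → ℂ} {a : 𝓞 F → ℂ}

/-- At z = i exp(v)/|m| the exponential e(ζz/2) is exp(-π Σ ζ exp(v)/|m|), whence the scale π/|m|.
-/
lemma IsRegularExpansion.isLogExpansion (hδ : Ideal.span {δ} = differentIdeal ℤ (𝓞 F))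
    (hδ_pos : TotallyPositive (δ : F)) (hf : IsUnitPeriodic δ f) (hg : HasModerateGrowth f)
    (ha : IsRegularExpansion δ f a) {m : F} (hm : m ≠ 0) :
    IsLogExpansion (fun σ => Real.pi / |σ m|) a fun v => f (axisPoint m v) where
  cont := hf.holo.continuousOn.comp_continuous (continuous_axisPoint m) (axisPoint_mem hm)
  hasSum v := by
    convert! ha.hasFourierExpansion hδ_pos _ (axisPoint_mem hm v) using 1
    funext ζ
    congr 1
    rw [eHalf, e, Complex.ofReal_exp]
    congr 1
    push_cast
    rw [Finset.mul_sum, ← Finset.sum_neg_distrib]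
    refine Finset.sum_congr rfl fun σ _ => ?_
    rw [axisPoint]
    push_cast
    linear_combination (-(Real.pi : ℂ) * (σ (ζ : F) : ℂ) * Complex.exp (v σ) / ((|σ m| : ℝ) : ℂ)) *
      Complex.I_mul_I
  vanish := ha.vanish
  unit := ha.unit
  bound := ha.exists_coeff_bound hδ hδ_pos hg

/-- If t is a totally positive generator of the square root of 𝔠, then t² and c are totally positive
generators of 𝔠, so they differ by the square of a unit. -/
lemma exists_sq_generator (hF : NarrowClassNumberOne F) (hsq : ∃ 𝔟 : Ideal (𝓞 F), 𝔠 = 𝔟 ^ 2)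
    (hc_pos : TotallyPositive (c : F)) (hc : Ideal.span {c} = 𝔠) : ∃ t : 𝓞 F, c = t ^ 2 := by
  obtain ⟨𝔟, h𝔟⟩ := hsq
  have hc0 : c ≠ 0 := by
    have := hc_pos.ne_zero'
    exact_mod_cast this
  have hb : 𝔟 ≠ ⊥ := by
    rintro rfl
    rw [h𝔟, Ideal.bot_pow two_ne_zero, Ideal.span_singleton_eq_bot] at hc
    exact hc0 hc
  obtain ⟨t, ht, htb⟩ := exists_totallyPositive_generator hF hb
  have htt : TotallyPositive ((t * t : 𝓞 F) : F) := by
    intro σ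
    rw [intCoe_mul, map_mul]
    exact mul_pos (ht σ) (ht σ)
  obtain ⟨v, hv⟩ := exists_unit_of_span_eq hF htt hc_pos (by
    rw [hc, h𝔟, ← htb, ← Ideal.span_singleton_mul_span_singleton, sq])
  exact ⟨v * t, by rw [hv]; ring⟩

/-- The constants of the completed series. -/
lemma completedL_eq (hδ : Ideal.span {δ} = differentIdeal ℤ (𝓞 F)) (hδ0 : δ ≠ 0)
    (hc : Ideal.span {c} = 𝔠) {t : 𝓞 F} (hct : c = t ^ 2) (ht : t ≠ 0) (L : ℂ → ℂ) (s : ℂ) :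
    completedL 𝔠 L s = ((∏ σ : F →+* ℝ, Real.pi / |σ ((t : F) * δ / 2)| : ℝ) : ℂ) ^ (-s) *
      Complex.Gamma s ^ Module.finrank ℚ F * L s := by
  have hT0 : ∀ σ : F →+* ℝ, 0 < |σ (t : F)| := fun σ => abs_pos.mpr (emb_ne_zero σ (by exact_mod_cast ht))
  have hD0 : ∀ σ : F →+* ℝ, 0 < |σ (δ : F)| := fun σ => abs_pos.mpr (emb_ne_zero σ (by exact_mod_cast hδ0))
  set T : ℝ := ∏ σ : F →+* ℝ, |σ (t : F)| with hT
  set D : ℝ := ∏ σ : F →+* ℝ, |σ (δ : F)| with hD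
  have hTpos : 0 < T := Finset.prod_pos fun σ _ => hT0 σ
  have hDpos : 0 < D := Finset.prod_pos fun σ _ => hD0 σ
  have h1 : (Ideal.absNorm (differentIdeal ℤ (𝓞 F)) : ℂ) = ((D : ℝ) : ℂ) := by
    rw [← hδ, hD, ← Finset.abs_prod, abs_prod_eq_absNorm, Complex.ofReal_natCast]
  have h2 : (Ideal.absNorm 𝔠 : ℂ) = ((T ^ 2 : ℝ) : ℂ) := by
    rw [← hc, hct, ← Ideal.span_singleton_pow, map_pow, hT, ← Finset.abs_prod, abs_prod_eq_absNorm]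
    push_cast
    rfl
  -- π/|tδ/2| = 2π/|tδ|, so this single product carries the powers of 2π, N(δ) and N(𝔠)^{1/2} of the
  -- completed series.
  have h3 : ∏ σ : F →+* ℝ, Real.pi / |σ ((t : F) * δ / 2)| =
      (2 * Real.pi) ^ Module.finrank ℚ F / (T * D) := by
    rw [hT, hD, ← Finset.prod_mul_distrib, ← card_realEmb (F := F), ← Finset.card_univ,
      ← Finset.prod_const, ← Finset.prod_div_distrib]
    refine Finset.prod_congr rfl fun σ _ => ?_
    have := (hT0 σ).ne'
    have := (hD0 σ).ne'
    rw [map_div₀, map_mul, map_ofNat, abs_div, abs_mul, abs_two]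
    field_simp
  have hpi : (0 : ℝ) < 2 * Real.pi := by positivity
  have hX : 0 < (2 * Real.pi) ^ Module.finrank ℚ F / (T * D) := by positivity
  have hlog : Real.log ((2 * Real.pi) ^ Module.finrank ℚ F / (T * D)) =
      Module.finrank ℚ F * Real.log (2 * Real.pi) - (Real.log T + Real.log D) := by
    rw [Real.log_div (by positivity) (by positivity), Real.log_pow, Real.log_mul hTpos.ne' hDpos.ne']
  have hcpow : ∀ (x : ℝ) (w : ℂ), 0 < x → (x : ℂ) ^ w = Complex.exp ((Real.log x : ℝ) * w) := by
    intro x w hx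
    rw [Complex.cpow_def_of_ne_zero (by exact_mod_cast hx.ne'), ← Complex.ofReal_log hx.le]
  have h4 : (2 * Real.pi : ℂ) = ((2 * Real.pi : ℝ) : ℂ) := by push_cast; rfl
  rw [completedL, h1, h2, h3, h4, hcpow _ _ hpi, hcpow _ _ hDpos, hcpow _ _ (by positivity),
    hcpow _ _ hX, hlog, Real.log_pow]
  have h5 : Complex.exp (((Module.finrank ℚ F * Real.log (2 * Real.pi) -
      (Real.log T + Real.log D) : ℝ) : ℂ) * -s) =
      Complex.exp ((Real.log (2 * Real.pi) : ℝ) * -((Module.finrank ℚ F : ℂ) * s)) *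
        Complex.exp ((Real.log D : ℝ) * s) * Complex.exp (((2 : ℕ) * Real.log T : ℝ) * (s / 2)) := by
    rw [← Complex.exp_add, ← Complex.exp_add]
    congr 1
    push_cast
    ring
  rw [h5]
  ring

/-- For ζ = 0 the exponential in Cauchy's estimate is 1, so the constant term is bounded by f at
arbitrarily large height. -/
lemma coeff_zero_eq_zero (hδ : Ideal.span {δ} = differentIdeal ℤ (𝓞 F))
    (hδ_pos : TotallyPositive (δ : F)) (ha : IsRegularExpansion δ f a)
    (h : ∀ ε : ℝ, 0 < ε → ∃ B : ℝ, ∀ z ∈ upperHalf F, (∀ σ, B ≤ (z σ).im) → ‖f z‖ ≤ ε) : a 0 = 0 := by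
  rw [← norm_le_zero_iff]
  refine le_of_forall_pos_le_add fun ε hε => ?_
  rw [zero_add]
  obtain ⟨B, hB⟩ := h ε hε
  -- After scaling by 2/δ the height is |B| + 1 in every coordinate.
  let y : (F →+* ℝ) → ℝ := fun σ => σ (δ : F) / 2 * (|B| + 1)
  have hy : ∀ σ, 0 < y σ := fun σ => by
    have := hδ_pos σ
    simp only [y]
    positivity
  have h1 := norm_coeff_le hδ ha.hasSum hy (C := ε) (fun s _ => by
    refine hB _ (scale_mem (totallyPositive_two.div hδ_pos) (latPoint_mem hy s)) fun σ => ?_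
    have := (hδ_pos σ).ne'
    simp only [scale, Complex.im_ofReal_mul, latPoint_im, map_div₀, map_ofNat, y]
    have h2 : 2 / σ (δ : F) * (σ (δ : F) / 2 * (|B| + 1)) = |B| + 1 := by field_simp
    rw [h2]
    linarith [le_abs_self B]) 0
  refine h1.trans (le_of_eq ?_)
  rw [intCoe_zero]
  simp

end ImaginaryAxes

end HilbertHalf

end

/-! ### The theorem. -/

theorem theorem5p1 {F : Type*} [Field F] [NumberField F] [NumberField.IsTotallyReal F]
    (hF : HilbertHalf.NarrowClassNumberOne F)
    (𝔠 : Ideal (𝓞 F)) (h4 : Ideal.span {(4 : 𝓞 F)} ∣ 𝔠) (hsq : ∃ 𝔟 : Ideal (𝓞 F), 𝔠 = 𝔟 ^ 2)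
    (c : 𝓞 F) (hc_pos : HilbertHalf.TotallyPositive (c : F)) (hc : Ideal.span {c} = 𝔠)
    (δ : 𝓞 F) (hδ_pos : HilbertHalf.TotallyPositive (δ : F))
    (hδ : Ideal.span {δ} = differentIdeal ℤ (𝓞 F))
    (ψ : HilbertHalf.HeckeCharacter F) (hψ : ψ.ConductorDvd 𝔠) (hψ_inf : ψ.TrivialAtInfinity)
    (f g : ((F →+* ℝ) → ℂ) → ℂ) (hf : HilbertHalf.IsModularForm 𝔠 ψ f)
    (hg : g = HilbertHalf.symmetryW δ c f)
    (a b : 𝓞 F → ℂ) (ha : a = HilbertHalf.fourierCoeff f) (hb : b = HilbertHalf.fourierCoeff g) :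
    HilbertHalf.HasFourierExpansion f a ∧ HilbertHalf.HasFourierExpansion g b ∧
    HilbertHalf.IdealCoeffWellDefined a ∧ HilbertHalf.IdealCoeffWellDefined b ∧
    ∃ Lf Lg : ℂ → ℂ,
      HilbertHalf.IsLContinuation a Lf ∧ HilbertHalf.IsLContinuation b Lg ∧
      (HilbertHalf.VanishesAtCusps f → Differentiable ℂ Lf) ∧
      (b 0 = 0 → Differentiable ℂ Lf) ∧
      (b 0 ≠ 0 → meromorphicOrderAt Lf (1 / 2) = -1) ∧
      ∀ s : ℂ, (∀ m : ℕ, s ≠ -(m : ℂ)) → (∀ m : ℕ, 1 / 2 - s ≠ -(m : ℂ)) →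
        HilbertHalf.completedL 𝔠 Lf s = HilbertHalf.completedL 𝔠 Lg (1 / 2 - s) := by
  have hc0 : c ≠ 0 := by
    have := hc_pos.ne_zero'
    exact_mod_cast this
  have hδ0 : δ ≠ 0 := by
    have := hδ_pos.ne_zero'
    exact_mod_cast this
  have h4c : (4 : 𝓞 F) ∣ c := by
    rwa [← hc, Ideal.dvd_iff_le, Ideal.span_singleton_le_span_singleton] at h4
  obtain ⟨t, hct⟩ := HilbertHalf.exists_sq_generator hF hsq hc_pos hc
  have ht0 : t ≠ 0 := by
    rintro rfl
    exact hc0 (by rw [hct]; ring)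
  have hm : (t : F) * δ / 2 ≠ 0 := div_ne_zero
    (mul_ne_zero (by exact_mod_cast ht0) (by exact_mod_cast hδ0)) two_ne_zero
  set m : F := (t : F) * δ / 2 with hmdef
  subst hg
  have hfP := hf.isUnitPeriodic hδ hδ_pos hc hc0 hψ hψ_inf
  have hgP := hf.isUnitPeriodic_symmetryW hδ hδ_pos hc hc0 h4c hct hψ hψ_inf
  have hfG := hf.hasModerateGrowth hδ hδ_pos hF hc hc0 h4c hψ hψ_inf
  have hgG := hf.hasModerateGrowth_symmetryW hδ hδ_pos hF hc hc0 h4c hct hψ hψ_inf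
  obtain ⟨a', ha'⟩ := hfP.exists_expansion hδ hδ_pos
  obtain ⟨b', hb'⟩ := hgP.exists_expansion hδ hδ_pos
  obtain rfl : a = a' := ha.trans (ha'.eq_fourierCoeff hδ hδ_pos)
  obtain rfl : b = b' := hb.trans (hb'.eq_fourierCoeff hδ hδ_pos)
  have hφ := ha'.isLogExpansion hδ hδ_pos hfP hfG hm
  have hγ := hb'.isLogExpansion hδ hδ_pos hgP hgG hm
  have hκ : ∀ σ : F →+* ℝ, 0 < Real.pi / |σ m| := fun σ =>
    div_pos Real.pi_pos (abs_pos.mpr (HilbertHalf.emb_ne_zero σ hm))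
  have hX : 0 < ∏ σ : F →+* ℝ, Real.pi / |σ m| := Finset.prod_pos fun σ _ => hκ σ
  have hK : HilbertHalf.logScale F ≠ 0 := HilbertHalf.logScale_pos.ne'
  have hfe : ∀ v : (F →+* ℝ) → ℝ, f (HilbertHalf.axisPoint m (-v)) =
      Real.exp ((∑ σ, v σ) / 2) * HilbertHalf.symmetryW δ c f (HilbertHalf.axisPoint m v) := by
    intro v
    rw [HilbertHalf.symmetryW_eq hδ_pos hm hct, HilbertHalf.rootFactor_axisPoint hm,
      HilbertHalf.moebius_invSL_axisPoint hm, ← mul_assoc, ← Complex.ofReal_mul, ← Real.exp_add]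
    have h0 : (∑ σ, v σ) / 2 + -(∑ σ, v σ) / 2 = 0 := by ring
    rw [h0, Real.exp_zero, Complex.ofReal_one, one_mul]
  let P := HilbertHalf.averagePair hκ hφ hγ hfe
  -- b(0) is governed by g at infinity, that is, by f translated by the involution, whose cusp is 0.
  have hb0 : HilbertHalf.VanishesAtCusps f → b 0 = 0 := by
    intro hv
    refine HilbertHalf.coeff_zero_eq_zero hδ hδ_pos hb' fun ε hε => ?_
    obtain ⟨B, hB⟩ := hv (HilbertHalf.invSL m hm) ε hε
    refine ⟨B, fun z hz hzB => ?_⟩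
    have h1 := hB z hz hzB
    rw [← HilbertHalf.norm_symmetryW_mul hδ_pos hm hct hz] at h1
    exact le_of_mul_le_mul_right h1 (HilbertHalf.absFactor_pos _ hz)
  have hcont : b 0 = 0 → Differentiable ℂ (HilbertHalf.lFunction P (HilbertHalf.logScale F)
      (∏ σ : F →+* ℝ, Real.pi / |σ m|) (Module.finrank ℚ F)) := fun h0 =>
    HilbertHalf.differentiable_lFunction hX h0
  have hsymm : P.symm.ε = 1 := inv_one
  refine ⟨ha'.hasFourierExpansion hδ_pos, hb'.hasFourierExpansion hδ_pos,
    HilbertHalf.idealCoeffWellDefined hF ha'.unit, HilbertHalf.idealCoeffWellDefined hF hb'.unit,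
    HilbertHalf.lFunction P (HilbertHalf.logScale F) (∏ σ : F →+* ℝ, Real.pi / |σ m|)
      (Module.finrank ℚ F),
    HilbertHalf.lFunction P.symm (HilbertHalf.logScale F) (∏ σ : F →+* ℝ, Real.pi / |σ m|)
      (Module.finrank ℚ F),
    hφ.isLContinuation hκ hF rfl rfl rfl rfl, hγ.isLContinuation hκ hF rfl hsymm rfl rfl,
    fun hv => hcont (hb0 hv), hcont, fun h0 => HilbertHalf.order_lFunction hX hK h0,
    fun s hs hs' => ?_⟩
  -- Off the poles of the two gamma factors, where `Complex.Gamma` takes conventional values, both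
  -- completed series are the same constant times Λ of the pair and of the swapped pair.
  rw [HilbertHalf.completedL_eq hδ hδ0 hc hct ht0, HilbertHalf.completedL_eq hδ hδ0 hc hct ht0,
    HilbertHalf.Gamma_mul_lFunction hX Module.finrank_pos rfl rfl hs,
    HilbertHalf.Gamma_mul_lFunction hX Module.finrank_pos rfl hsymm hs']
  congr 1
  have h := P.functional_equation (1 / 2 - s)
  have hk : (P.k : ℂ) - (1 / 2 - s) = s := by
    have : P.k = 1 / 2 := rfl
    rw [this]
    push_cast
    ring
  rw [hk] at h
  exact h.trans (one_smul ℂ _)
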